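/- **Setting.** Let $n\ge 2$, let $\mathfrak a_n>0$ be the unique positive solution of $(1+\mathfrak a_n)^n=1+2n\mathfrak a_n$, and put $B(r)=\{t\in\mathbb C:|t|<r\}$, $U(r)=\{t:\operatorname{Re}t>0,\ |\operatorname{Im}t|<r\}\cup B(r)$. Let $\mathbf G$ be a Riemann surface spread over the complex plane, i.e. a Hausdorff space with a local homeomorphism to $\mathbb C$ that serves as the coordinate $\xi$ (for instance a domain of $\mathbb C$); $\frac{\mathrm d}{\mathrm d\xi}$, straight paths and discs on $\mathbf G$ refer to this coordinate. Consider $$\Big(-\frac{\mathrm d^n}{\mathrm d\xi^n}+\sum_{k=0}^{n-2}u^{n-k}\psi_k(u,\xi)\frac{\mathrm d^k}{\mathrm d\xi^k}\Big)W(u,\xi)=0,\tag{1}$$ where $\psi_k(u,\xi)\sim\delta_{0,k}+\sum_{m\ge1}\psi_{k,m}(\xi)u^{-m}$ as $u\to+\infty$, for $\xi\in\Delta$ and $0\le k\le n-2$, with $\Delta$ as follows. **Condition 1.1.** There are a non-empty domain (connected open set) $\Delta\subseteq\mathbf G$, constants $d'>0$, $c>0$, $\rho>0$, $\sigma'\ge0$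 and functions $\Psi_k(t,\xi)$, $0\le k\le n-2$, analytic on $U(\mathfrak a_nd')\times\Delta$, such that there $$|\Psi_k(t,\xi)|\le c\,\frac{e^{\sigma'\operatorname{Re}t}}{1+|\xi|^{1+\rho}},$$ and $\psi_k(u,\xi)=\delta_{0,k}+\int_0^{+\infty}e^{-ut}\Psi_k(t,\xi)\,\mathrm dt$ for $\operatorname{Re}u>\sigma'$, $\xi\in\Delta$. **Angles and domains.** Fix $0\le j\le n-1$. Let $\theta_{j,\ell}$ ($0\le \ell\le n-1$, $\ell\ne j$) be values of $-\arg(e^{2\pi i\ell/n}-e^{2\pi ij/n})$, chosen modulo $2\pi$ so that $\max_{\ell\ne j}\theta_{j,\ell}-\min_{\ell\ne j}\theta_{j,\ell}=\frac{n-2}n\pi$, and put $\theta_j=\frac12(\min_{\ell\ne j}\theta_{j,\ell}+\max_{\ell\ne j}\theta_{j,\ell})$. For $d>0$ let $\Gamma_j(d)$ be any non-empty subdomain of $\Delta$ such that (i) every point of $\Gamma_j(d)$ has distance at least $d$ from the boundary of $\Delta$, i.e. the open disc of radius $d$ about it lies in $\Delta$; (ii) for every $\xi\in\Gamma_j(d)$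 and $\ell\ne j$ the path $t\mapsto\xi+te^{i\theta_{j,\ell}}$, $t\ge0$, lies in $\Gamma_j(d)$. Let $\mathscr P_j(\xi)$ be the path $t\mapsto\xi+te^{i\theta_j}$, $t\ge0$. **Coefficients.** Let $$X_j(\xi)=-\frac1n\int_{\mathscr P_j(\xi)}\sum_{k=0}^{n-2}e^{2\pi ij(k+1)/n}\psi_{k,1}(t)\,\mathrm dt,\qquad \mathtt B_p=e^{-X_j}\frac{\mathrm d^p}{\mathrm d\xi^p}e^{X_j},$$ let $\mathsf A_{j,0}=1$ and, for $m\ge1$, $$\begin{aligned}\mathsf A_{j,m}(\xi)={}&\frac1n\sum_{p=2}^{\min(n,m+1)}\binom npe^{2\pi ij(n-p+1)/n}\sum_{r=0}^p\binom pr\int_{\mathscr P_j(\xi)}\mathtt B_{p-r}\,\mathsf A^{(r)}_{j,m-p+1}\,\mathrm dt\\&-\frac1n\sum_{k=0}^{n-2}\sum_{p=1}^{\min(m,k)}\binom kpe^{2\pi ij(k-p+1)/n}\sum_{r=0}^p\binom pr\int_{\mathscr P_j(\xi)}\mathtt B_{p-r}\,\psi_{k,1}\,\mathsf A^{(r)}_{j,m-p}\,\mathrm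 dt\\&-\frac1n\sum_{k=0}^{n-2}\sum_{q=0}^{m-1}\sum_{p=0}^{\min(k,q)}\binom kpe^{2\pi ij(k-p+1)/n}\sum_{r=0}^p\binom pr\int_{\mathscr P_j(\xi)}\mathtt B_{p-r}\,\psi_{k,m-q+1}\,\mathsf A^{(r)}_{j,q-p}\,\mathrm dt.\end{aligned}$$ For $\omega>0$ and $m\ge0$ let $\mathsf B_{j,m}(\omega,\xi)=\sum_{r=0}^m\omega^{m-r}|s(m,r)|\,\mathsf A_{j,r+1}(\xi)$, with $s(m,r)$ the Stirling numbers of the first kind. **The functions $\eta_j$.** $\eta_j(u,\xi)$ denotes a function analytic in $\{\operatorname{Re}u>\sigma'\}\times\Gamma_j(d)$ such that $$W_j(u,\xi)=\exp\big(e^{2\pi ij/n}u\xi+X_j(\xi)\big)\big(1+\eta_j(u,\xi)\big)$$ solves (1) for $\operatorname{Re}u>\sigma'$, $\xi\in\Gamma_j(d)$, and such that, for these $u,\xi$ and $0\le s\le n-2$, $\frac{\mathrm d^s\eta_j(u,\zeta)}{\mathrm d\zeta^s}\big|_{\zeta=\xi+te^{i\theta_j}}\to0$ as $t\to+\infty$.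 **Theorem 1.2.** Assume Condition 1.1, let $0<d<d'$ and $\omega>\frac{\pi}{2\mathfrak a_nd}$. Then, for every $0\le j\le n-1$, the function $\eta_j$ exists, is unique on $\{\operatorname{Re}u>\sigma'\}\times\Gamma_j(d)$, and $$\eta_j(u,\xi)=\sum_{m=0}^\infty\frac{\mathsf B_{j,m}(\omega,\xi)}{u(u+\omega)\cdots(u+m\omega)}$$ for $\operatorname{Re}u>\sigma'$ and $\xi\in\Gamma_j(d)$. The series converges absolutely, and for each $\sigma>\sigma'$ the series of absolute values converges uniformly for $\operatorname{Re}u\ge\sigma$ and $\xi\in\Gamma_j(d)$. -/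

import Mathlib

open Filter Topology Asymptotics

noncomputable section

namespace FactorialSeries

/-! ### Riemann domains over the `ξ`-plane

The independent variable `ξ` lives on a Riemann surface spread over the complex plane: a Hausdorff
space `S` with a local homeomorphism `pr : S → ℂ`, whose value `pr x` is the complex number `ξ` of
which `x` is an instance on some sheet. A domain of `ℂ` is the case `pr = Subtype.val`. -/

section RiemannDomain

variable {S : Type*} [TopologicalSpace S] {pr : S → ℂ}

/-- The local inverse of `pr` near `pr x` that sends `pr x` to `x` (meaningful near `pr x`). -/
def sec (hpr : IsLocalHomeomorph pr) (x : S) : ℂ → S := (Classical.choose (hpr x)).symm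

/-- The derivative `d^s f / dξ^s` at `x` of a function on the surface. -/
def dXi (hpr : IsLocalHomeomorph pr) (s : ℕ) (f : S → ℂ) (x : S) : ℂ :=
  iteratedDeriv s (fun z => f (sec hpr x z)) (pr x)

/-- `f (t, ξ)` is (jointly) analytic at every point of `V × D`. -/
def AnalyticOnProd (hpr : IsLocalHomeomorph pr) (f : ℂ → S → ℂ) (V : Set ℂ) (D : Set S) : Prop :=
  ∀ t ∈ V, ∀ x ∈ D, AnalyticAt ℂ (fun p : ℂ × ℂ => f p.1 (sec hpr x p.2)) (t, pr x)

/-- `γ` is the path `[0, ∞) ∋ t ↦ x + t e^{iφ}` on the surface. -/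
def IsRay (pr : S → ℂ) (x : S) (φ : ℝ) (γ : ℝ → S) : Prop :=
  ContinuousOn γ (Set.Ici 0) ∧ γ 0 = x ∧
    ∀ t : ℝ, 0 ≤ t → pr (γ t) = pr x + t * Complex.exp (φ * Complex.I)

open Classical in
/-- The path `t ↦ x + t e^{iφ}` on the surface (constant if the surface contains no such path). -/
def ray (pr : S → ℂ) (x : S) (φ : ℝ) : ℝ → S :=
  if h : ∃ γ, IsRay pr x φ γ then Classical.choose h else fun _ => x

/-- The integral of `g (t) dt` along the path `[0, ∞) ∋ s ↦ x + s e^{iφ}`. -/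
def rayIntegral (pr : S → ℂ) (x : S) (φ : ℝ) (g : S → ℂ) : ℂ :=
  ∫ s in Set.Ioi (0 : ℝ), g (ray pr x φ s) * Complex.exp (φ * Complex.I)

/-- The disc of radius `d` around `x` is contained in `D`, that is, the distance of the point
`x` of the open set `D` from the boundary of `D` is at least `d`. -/
def DiscIn (pr : S → ℂ) (D : Set S) (d : ℝ) (x : S) : Prop :=
  ∃ s : ℂ → S, ContinuousOn s (Metric.ball (pr x) d) ∧ s (pr x) = x ∧
    ∀ z ∈ Metric.ball (pr x) d, s z ∈ D ∧ pr (s z) = z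

end RiemannDomain

/-! ### The hypothesis on the potentials -/

/-- The points whose distance from the positive real axis is less than `r`. -/
def U (r : ℝ) : Set ℂ := {t : ℂ | 0 < t.re ∧ |t.im| < r} ∪ Metric.ball 0 r

/-- `e^{2πi j q / n}`. -/
def zeta (n j q : ℕ) : ℂ := Complex.exp (2 * Real.pi * Complex.I * (j * q) / n)

/-- The potentials `ψ_k`, `0 ≤ k ≤ n - 2`, are Borel summable on the domain `Δ`, with Borel
transforms `Ψ_k` that are analytic in `U (a d') × Δ` and grow at most exponentially there. -/
structure BorelCondition {S : Type*} [TopologicalSpace S] {pr : S → ℂ} (hpr : IsLocalHomeomorph pr)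
    (n : ℕ) (a d' c ρ σ' : ℝ) (Δ : Set S) (ψ Ψ : ℕ → ℂ → S → ℂ) : Prop where
  d'_pos : 0 < d'
  c_pos : 0 < c
  ρ_pos : 0 < ρ
  σ'_nonneg : 0 ≤ σ'
  isOpen : IsOpen Δ
  isConnected : IsConnected Δ
  analytic : ∀ k < n - 1, AnalyticOnProd hpr (Ψ k) (U (a * d')) Δ
  bound : ∀ k < n - 1, ∀ t ∈ U (a * d'), ∀ x ∈ Δ,
    ‖Ψ k t x‖ ≤ c * (Real.exp (σ' * t.re) / (1 + ‖pr x‖ ^ (1 + ρ)))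
  laplace : ∀ k < n - 1, ∀ u : ℂ, σ' < u.re → ∀ x ∈ Δ,
    ψ k u x = (if k = 0 then 1 else 0)
      + ∫ t in Set.Ioi (0 : ℝ), Complex.exp (-u * t) * Ψ k t x

/-- `ψ_k (u, ξ) ∼ δ_{0,k} + ∑_{m ≥ 1} ψ_{k,m} (ξ) / u^m` as `u → +∞`, for each `ξ ∈ Δ`; this
determines the coefficients `ψ_{k,m}` on `Δ`. -/
def HasExpansion {S : Type*} (n : ℕ) (Δ : Set S) (ψ : ℕ → ℂ → S → ℂ) (ψc : ℕ → ℕ → S → ℂ) : Prop :=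
  ∀ k < n - 1, ∀ x ∈ Δ, ∀ N : ℕ,
    (fun u : ℝ => ψ k u x - ((if k = 0 then 1 else 0)
      + ∑ m ∈ Finset.Icc 1 N, ψc k m x / (u : ℂ) ^ m)) =o[atTop] fun u : ℝ => 1 / u ^ N

/-! ### Angles and the domains `Γ_j (d)` -/

/-- `θ ℓ` is a value of `-arg (e^{2πiℓ/n} - e^{2πij/n})` for every `ℓ ≠ j`, and the values are
chosen so that their maximum and minimum differ by `(n - 2) π / n`. -/
def IsAngleChoice (n : ℕ) (j : Fin n) (θ : Fin n → ℝ) : Prop :=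
  (∀ ℓ, ℓ ≠ j → ∃ q : ℤ, θ ℓ = -Complex.arg (zeta n ℓ 1 - zeta n j 1) + 2 * Real.pi * q) ∧
    sSup (θ '' {ℓ | ℓ ≠ j}) - sInf (θ '' {ℓ | ℓ ≠ j}) = ((n : ℝ) - 2) / n * Real.pi

/-- The angle `θ_j`, halfway between the least and the greatest of the `θ_{j,ℓ}`, `ℓ ≠ j`. -/
def midAngle {n : ℕ} (j : Fin n) (θ : Fin n → ℝ) : ℝ :=
  (sInf (θ '' {ℓ | ℓ ≠ j}) + sSup (θ '' {ℓ | ℓ ≠ j})) / 2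

/-- `Γ` is an admissible choice of the domain `Γ_j (d)`. -/
structure IsGamma {S : Type*} [TopologicalSpace S] (pr : S → ℂ) {n : ℕ} (j : Fin n)
    (θ : Fin n → ℝ) (Δ : Set S) (d : ℝ) (Γ : Set S) : Prop where
  isOpen : IsOpen Γ
  isConnected : IsConnected Γ
  subset : Γ ⊆ Δ
  disc : ∀ x ∈ Γ, DiscIn pr Δ d x
  ray : ∀ x ∈ Γ, ∀ ℓ, ℓ ≠ j → ∃ γ, IsRay pr x (θ ℓ) γ ∧ ∀ t : ℝ, 0 ≤ t → γ t ∈ Γ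

/-! ### The coefficients of the formal solutions -/

section Coefficients

variable {S : Type*} [TopologicalSpace S] {pr : S → ℂ}

/-- `X_j (ξ)`; here and below `φ` stands for the angle `θ_j`. -/
def X (pr : S → ℂ) (n j : ℕ) (φ : ℝ) (ψc : ℕ → ℕ → S → ℂ) (x : S) : ℂ :=
  -(1 / (n : ℂ)) *
    rayIntegral pr x φ (fun y => ∑ k ∈ Finset.range (n - 1), zeta n j (k + 1) * ψc k 1 y)

/-- The complete Bell polynomial `B_p (X_j', …, X_j^{(p)}) = exp (-X_j) (d/dξ)^p exp (X_j)`. -/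
def bellX (hpr : IsLocalHomeomorph pr) (n j : ℕ) (φ : ℝ) (ψc : ℕ → ℕ → S → ℂ) (p : ℕ) (x : S) : ℂ :=
  Complex.exp (-X pr n j φ ψc x) * dXi hpr p (fun y => Complex.exp (X pr n j φ ψc y)) x

/-- The right-hand side of the recurrence relation that expresses `A_{j,m}` through
`A_{j,0}, …, A_{j,m-1}`. -/
def recRHS (hpr : IsLocalHomeomorph pr) (n j : ℕ) (φ : ℝ) (ψc : ℕ → ℕ → S → ℂ)
    (A : ℕ → S → ℂ) (m : ℕ) (x : S) : ℂ :=
  1 / (n : ℂ) * ∑ p ∈ Finset.Icc 2 (min n (m + 1)), (n.choose p : ℂ) * zeta n j (n + 1 - p) *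
      ∑ r ∈ Finset.range (p + 1), (p.choose r : ℂ) *
        rayIntegral pr x φ (fun y =>
          bellX hpr n j φ ψc (p - r) y * dXi hpr r (A (m + 1 - p)) y)
  - 1 / (n : ℂ) * ∑ k ∈ Finset.range (n - 1), ∑ p ∈ Finset.Icc 1 (min m k),
      (k.choose p : ℂ) * zeta n j (k + 1 - p) *
      ∑ r ∈ Finset.range (p + 1), (p.choose r : ℂ) *
        rayIntegral pr x φ (fun y =>
          bellX hpr n j φ ψc (p - r) y * ψc k 1 y * dXi hpr r (A (m - p)) y)
  - 1 / (n : ℂ) * ∑ k ∈ Finset.range (n - 1), ∑ q ∈ Finset.range m,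
      ∑ p ∈ Finset.range (min k q + 1), (k.choose p : ℂ) * zeta n j (k + 1 - p) *
      ∑ r ∈ Finset.range (p + 1), (p.choose r : ℂ) *
        rayIntegral pr x φ (fun y =>
          bellX hpr n j φ ψc (p - r) y * ψc k (m + 1 - q) y * dXi hpr r (A (q - p)) y)

/-- The coefficients `A_{j,m}`: `A_{j,0} = 1`, and the recurrence relation for `m ≥ 1`
(see `coeffA_zero` and `coeffA_rec`). -/
def coeffA (hpr : IsLocalHomeomorph pr) (n j : ℕ) (φ : ℝ) (ψc : ℕ → ℕ → S → ℂ) (m : ℕ) : S → ℂ :=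
  if m = 0 then fun _ => 1
  else recRHS hpr n j φ ψc (fun q => if _h : q < m then coeffA hpr n j φ ψc q else fun _ => 0) m
termination_by m

theorem recRHS_congr (hpr : IsLocalHomeomorph pr) (n j : ℕ) (φ : ℝ) (ψc : ℕ → ℕ → S → ℂ)
    (A A' : ℕ → S → ℂ) (m : ℕ) (hm : 1 ≤ m) (h : ∀ q < m, A q = A' q) (x : S) :
    recRHS hpr n j φ ψc A m x = recRHS hpr n j φ ψc A' m x := by
  unfold recRHS
  refine congrArg₂ _ (congrArg₂ _ (congrArg _ ?_) (congrArg _ ?_)) (congrArg _ ?_)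
  · refine Finset.sum_congr rfl fun p hp => ?_
    rw [Finset.mem_Icc] at hp
    rw [h (m + 1 - p) (by omega)]
  · refine Finset.sum_congr rfl fun k _ => Finset.sum_congr rfl fun p hp => ?_
    rw [Finset.mem_Icc] at hp
    rw [h (m - p) (by omega)]
  · refine Finset.sum_congr rfl fun k _ => Finset.sum_congr rfl fun q hq =>
      Finset.sum_congr rfl fun p _ => ?_
    rw [Finset.mem_range] at hq
    rw [h (q - p) (by omega)]

theorem coeffA_zero (hpr : IsLocalHomeomorph pr) (n j : ℕ) (φ : ℝ) (ψc : ℕ → ℕ → S → ℂ) :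
    coeffA hpr n j φ ψc 0 = fun _ => 1 := by
  rw [coeffA, if_pos rfl]

theorem coeffA_rec (hpr : IsLocalHomeomorph pr) (n j : ℕ) (φ : ℝ) (ψc : ℕ → ℕ → S → ℂ)
    (m : ℕ) (hm : 1 ≤ m) :
    coeffA hpr n j φ ψc m = recRHS hpr n j φ ψc (coeffA hpr n j φ ψc) m := by
  funext x
  rw [coeffA, if_neg (by omega)]
  apply recRHS_congr hpr n j φ ψc _ _ m hm
  intro q hq
  simp only [hq, dite_true]

/-- `B_{j,m} (ω, ξ) = ∑_{r = 0}^m ω^{m - r} |s (m, r)| A_{j,r+1} (ξ)`;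
`Nat.stirlingFirst` is the unsigned Stirling number of the first kind. -/
def coeffB (hpr : IsLocalHomeomorph pr) (n j : ℕ) (φ : ℝ) (ψc : ℕ → ℕ → S → ℂ) (ω : ℝ) (m : ℕ)
    (x : S) : ℂ :=
  ∑ r ∈ Finset.range (m + 1),
    (ω : ℂ) ^ (m - r) * (Nat.stirlingFirst m r : ℂ) * coeffA hpr n j φ ψc (r + 1) x

/-- The `m`-th term of the factorial series. -/
def term (hpr : IsLocalHomeomorph pr) (n j : ℕ) (φ : ℝ) (ψc : ℕ → ℕ → S → ℂ) (ω : ℝ) (u : ℂ) (x : S)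
    (m : ℕ) : ℂ :=
  coeffB hpr n j φ ψc ω m x / ∏ i ∈ Finset.range (m + 1), (u + i * ω)

/-! ### The exact solutions -/

/-- `W_j (u, ξ) = exp (e^{2πij/n} u ξ + X_j (ξ)) (1 + η_j (u, ξ))`. -/
def W (pr : S → ℂ) (n j : ℕ) (φ : ℝ) (ψc : ℕ → ℕ → S → ℂ) (η : ℂ → S → ℂ) (u : ℂ) (x : S) : ℂ :=
  Complex.exp (zeta n j 1 * u * pr x + X pr n j φ ψc x) * (1 + η u x)

/-- `η` is the function `η_j`: it is analytic in `{Re u > σ'} × Γ`, the corresponding `W_j` solves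
`-W^{(n)} + ∑_{k ≤ n-2} u^{n-k} ψ_k W^{(k)} = 0`, and the derivatives of `η` of
order at most `n - 2` tend to zero along the paths `t ↦ ξ + t e^{iθ_j}`. -/
structure IsEta (hpr : IsLocalHomeomorph pr) (n j : ℕ) (φ σ' : ℝ) (ψ : ℕ → ℂ → S → ℂ)
    (ψc : ℕ → ℕ → S → ℂ) (Γ : Set S) (η : ℂ → S → ℂ) : Prop where
  analytic : AnalyticOnProd hpr η {u : ℂ | σ' < u.re} Γ
  ode : ∀ u : ℂ, σ' < u.re → ∀ x ∈ Γ,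
    -dXi hpr n (W pr n j φ ψc η u) x
      + ∑ k ∈ Finset.range (n - 1),
          u ^ (n - k) * ψ k u x * dXi hpr k (W pr n j φ ψc η u) x = 0
  limit : ∀ u : ℂ, σ' < u.re → ∀ x ∈ Γ, ∀ s ≤ n - 2,
    Tendsto (fun t : ℝ => dXi hpr s (η u) (ray pr x φ t)) atTop (𝓝 0)

end Coefficients

end FactorialSeries

end

open FactorialSeries

/-! # Factorial series solutions of linear differential equations with a large parameter

The solutions are built in the Borel plane: the equation for the Borel transform is integrated along
its characteristics and solved by a contraction argument in a weighted supremum norm, on sheets of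
the surface over neighbourhoods of cones (`Frame`, `Sheet`). The coefficients are the Taylor
coefficients of the Borel transform, and a bound for the Taylor coefficients after the substitution
`s = 1 - exp (-ω t)` gives the convergence of the factorial series. -/

open Filter Topology Asymptotics MeasureTheory
noncomputable section
namespace FactorialSeries

/-! ### Analyticity in two variables: Osgood's lemma and integrals with parameters -/

section ComplexAnalysis

open Metric

/-! Work on one sheet of the surface with coordinate z, put ζ = e^{2πij/n} and let V_k denote
e^{-ζuz} u^{-k} W^{(k)}. Equation (1) is then the first-order system V_k' = u (V_{k+1} - ζ V_k), k <
n, closed by V_n = V_0 + g with g = Σ_k (ψ_k - δ_{0,k}) V_k. Its constant part is a cyclic shift,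
which the n-th roots of unity μ diagonalise. With V_k = ζ^k + u L[Y_k] and g = L[G], where L is the
Laplace transform from t to u, this becomes Y_k = (1/n) Σ_μ μ^{k+1} T_μ with ∂_z T_μ = (μ - ζ) ∂_t
T_μ + G in the Borel plane. For μ ≠ ζ one integrates G along the characteristic with direction 1/(μ
- ζ) that ends on t = 0, where T_μ vanishes; for μ = ζ one integrates from infinity along the ray
with direction -1/ζ. Substitution into the definition of g leaves one linear integral equation for G
(`IsSource`).

That equation is solved on width(t)/a + dist(z, Q) < d, where Q is a cone of base points. Along a
characteristic the loss of width pays for the gain in distance, because a ≤ |μ - ζ|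
(`le_norm_omega_sub_one`, `char_mem_dom`). Since Re(ζ/(μ - ζ)) = -1/2, the coordinate Re(ζz) falls
along every characteristic, up to an error controlled by the width (`prog_char`). In the sup norm
with weight exp(K E(Re ζz) + l width(t) + σ max(Re t, 0)), where E is a primitive of (1+|x|)^{-1-ρ},
the transport operators have norm O(1/K) (`bnd_charInt`, `bnd_rayInt`), and multiplication or
convolution with the potentials restores the decay in z (`src_conv`). A large K therefore gives a
contraction, with constants that do not depend on Q (`exists_isSource`).

At t = 0 the convolutions vanish and 1 + Y_0(0, z) = exp X(z) (`exp_expo`). Hence η is the Laplace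
transform of e^{-X} ∂_t Y_0 (`lap_borelEta`), and comparison of Taylor coefficients in the system
shows that the m-th t-derivative of that function at 0 is A_{j,m+1} (`ac_rec`, `coeffA_eq`).

The map t = -log(1-s)/ω carries the unit disc into width(t) < π/(2ω), which lies inside the domain
of analyticity because ω > π/(2ad). The Taylor series in s = 1 - e^{-ωt}, integrated termwise, is
the factorial series. A bound of order m^{σ/ω-1} for its coefficients gives convergence for Re u >
σ, and σ > σ' is arbitrary (`exists_coeff_bound`, `hasSum_factorialSeries`).

For uniqueness let u be real. The difference of two solutions, followed along the ray, satisfies a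
perturbed cyclic system, and an inequality for its sum of squares shows that it can tend to zero
only if it vanishes (`eq_zero_of_cyclic`); the identity theorem covers complex u. The sheets come
from gluing the discs around the points of the cone spanned by the two extreme directions
(`exists_quadrant`, `exists_section`). -/

lemma exists_analytic_inv_circleMap (c : ℂ) {r : ℝ} (hr : 0 < r) {φ : ℝ × ℝ → ℝ}
    (hφ : Continuous φ) :
    ∃ K : ℂ → BoundedContinuousFunction (ℝ × ℝ) ℂ, ∀ z ∈ ball c r,
      AnalyticAt ℂ K z ∧ ∀ θ, K z θ = (circleMap c r (φ θ) - z)⁻¹ := by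
  have hcont : Continuous fun θ => circleMap c r (φ θ) := (continuous_circleMap c r).comp hφ
  let Z : BoundedContinuousFunction (ℝ × ℝ) ℂ :=
    BoundedContinuousFunction.ofNormedAddCommGroup (fun θ => circleMap c r (φ θ)) hcont (‖c‖ + r)
      (fun θ => by
        have h1 : ‖circleMap c r (φ θ) - c‖ = r := by
          simp [circleMap_sub_center, norm_circleMap_zero, abs_of_pos hr]
        calc ‖circleMap c r (φ θ)‖ = ‖c + (circleMap c r (φ θ) - c)‖ := by ring_nf
          _ ≤ ‖c‖ + ‖circleMap c r (φ θ) - c‖ := norm_add_le _ _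
          _ = ‖c‖ + r := by rw [h1])
  -- The Cauchy kernel is the inverse of an affine function of z in the Banach algebra of bounded
  -- continuous functions, where inversion is analytic. With φ one of the two projections, both
  -- kernels lie in the same algebra and can be multiplied.
  refine ⟨fun z => Ring.inverse (Z - z • 1), fun z hz => ?_⟩
  have hlow : ∀ θ, r - ‖z - c‖ ≤ ‖circleMap c r (φ θ) - z‖ := fun θ => by
    have h1 : ‖circleMap c r (φ θ) - c‖ = r := by
      simp [circleMap_sub_center, norm_circleMap_zero, abs_of_pos hr]
    have := norm_sub_norm_le (circleMap c r (φ θ) - c) (z - c)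
    rw [h1, sub_sub_sub_cancel_right] at this
    exact this
  have hpos : 0 < r - ‖z - c‖ := by
    rw [mem_ball, dist_eq_norm] at hz
    linarith
  have hne : ∀ θ, circleMap c r (φ θ) - z ≠ 0 := fun θ =>
    norm_pos_iff.1 (hpos.trans_le (hlow θ))
  let V : BoundedContinuousFunction (ℝ × ℝ) ℂ :=
    BoundedContinuousFunction.ofNormedAddCommGroup (fun θ => (circleMap c r (φ θ) - z)⁻¹)
      ((hcont.sub continuous_const).inv₀ hne) (r - ‖z - c‖)⁻¹
      (fun θ => by
        rw [norm_inv]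
        exact inv_anti₀ hpos (hlow θ))
  have hVmul : (Z - z • 1) * V = 1 := by
    ext θ
    change (circleMap c r (φ θ) - z * 1) * (circleMap c r (φ θ) - z)⁻¹ = 1
    rw [mul_one]
    exact mul_inv_cancel₀ (hne θ)
  have hu : IsUnit (Z - z • (1 : BoundedContinuousFunction (ℝ × ℝ) ℂ)) :=
    IsUnit.of_mul_eq_one _ hVmul
  refine ⟨?_, fun θ => ?_⟩
  · have h1 : AnalyticAt ℂ (fun z : ℂ => Z - z • (1 : BoundedContinuousFunction (ℝ × ℝ) ℂ)) z :=
      analyticAt_const.sub (analyticAt_id.smul analyticAt_const)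
    obtain ⟨u, hu⟩ := hu
    have h2 := analyticAt_inverse (𝕜 := ℂ) u
    rw [hu] at h2
    exact AnalyticAt.comp (g := Ring.inverse) h2 h1
  · have h3 : Ring.inverse (Z - z • 1) = V := by
      have h4 := Ring.inverse_mul_cancel _ hu
      calc Ring.inverse (Z - z • 1) = Ring.inverse (Z - z • 1) * ((Z - z • 1) * V) := by
            rw [hVmul, mul_one]
        _ = V := by rw [← mul_assoc, h4, one_mul]
    change (Ring.inverse (Z - z • 1)) θ = _
    rw [h3]
    rfl

/-- Osgood's lemma in two variables. -/
theorem analyticOnNhd_of_separately {f : ℂ × ℂ → ℂ} {O : Set (ℂ × ℂ)} (hO : IsOpen O)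
    (hc : ContinuousOn f O) (h1 : ∀ p ∈ O, DifferentiableAt ℂ (fun z => f (z, p.2)) p.1)
    (h2 : ∀ p ∈ O, DifferentiableAt ℂ (fun z => f (p.1, z)) p.2) : AnalyticOnNhd ℂ f O := by
  rintro ⟨z0, w0⟩ hp
  obtain ⟨r, hr, hrO⟩ := Metric.nhds_basis_closedBall.mem_iff.1 (hO.mem_nhds hp)
  rw [← closedBall_prod_same] at hrO
  have hcm : ∀ (c : ℂ) (θ : ℝ), circleMap c r θ ∈ closedBall c r := fun c θ =>
    circleMap_mem_closedBall c hr.le θ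
  set g : ℝ × ℝ → ℂ := fun θ => deriv (circleMap z0 r) θ.1 * (deriv (circleMap w0 r) θ.2 *
    f (circleMap z0 r θ.1, circleMap w0 r θ.2)) with hg
  have hgc : Continuous g := by
    have hd : ∀ c : ℂ, Continuous (deriv (circleMap c r)) := fun c => by
      have : deriv (circleMap c r) = fun θ => circleMap 0 r θ * Complex.I := by
        funext θ; exact deriv_circleMap c r θ
      rw [this]
      exact (continuous_circleMap 0 r).mul continuous_const
    refine ((hd z0).comp continuous_fst).mul (((hd w0).comp continuous_snd).mul ?_)
    refine hc.comp_continuous (((continuous_circleMap z0 r).comp continuous_fst).prodMk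
      ((continuous_circleMap w0 r).comp continuous_snd)) fun θ => hrO ⟨hcm _ _, hcm _ _⟩
  set ν : Measure ℝ := volume.restrict (Set.Ioc 0 (2 * Real.pi)) with hν
  have hgb : ∃ C : ℝ, ∀ᵐ θ ∂(ν.prod ν), ‖g θ‖ ≤ C := by
    have hK : IsCompact (Set.Icc (0 : ℝ) (2 * Real.pi) ×ˢ Set.Icc (0 : ℝ) (2 * Real.pi)) :=
      isCompact_Icc.prod isCompact_Icc
    obtain ⟨C, hC⟩ := hK.exists_bound_of_continuousOn hgc.continuousOn
    refine ⟨C, ?_⟩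
    rw [hν, Measure.prod_restrict]
    refine (ae_restrict_iff' (measurableSet_Ioc.prod measurableSet_Ioc)).2
      (Eventually.of_forall fun θ hθ => hC θ ⟨Set.Ioc_subset_Icc_self hθ.1,
        Set.Ioc_subset_Icc_self hθ.2⟩)
  obtain ⟨C, hC⟩ := hgb
  have hint : ∀ k : BoundedContinuousFunction (ℝ × ℝ) ℂ,
      Integrable (fun θ => k θ * g θ) (ν.prod ν) := fun k => by
    refine Integrable.mono' (g := fun _ => ‖k‖ * C) (integrable_const _)
      (k.continuous.mul hgc).aestronglyMeasurable ?_
    filter_upwards [hC] with θ hθ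
    rw [norm_mul]
    exact mul_le_mul (k.norm_coe_le_norm θ) hθ (norm_nonneg _) (norm_nonneg _)
  -- The double Cauchy integral is a bounded linear functional of the kernel, so the analytic
  -- dependence of the kernels on the point passes to f.
  let L : BoundedContinuousFunction (ℝ × ℝ) ℂ →L[ℂ] ℂ :=
    LinearMap.mkContinuous
      { toFun := fun k => ∫ θ, k θ * g θ ∂(ν.prod ν)
        map_add' := fun k l => by
          rw [← integral_add (hint k) (hint l)]
          congr 1; ext θ; simp [add_mul]
        map_smul' := fun a k => by
          rw [RingHom.id_apply, smul_eq_mul, ← integral_const_mul]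
          congr 1; ext θ; simp [mul_assoc] }
      (C * (ν.prod ν).real Set.univ) (fun k => by
        change ‖∫ θ, k θ * g θ ∂(ν.prod ν)‖ ≤ _
        have := norm_integral_le_of_norm_le_const (μ := ν.prod ν) (f := fun θ => k θ * g θ)
          (C := C * ‖k‖) (by
            filter_upwards [hC] with θ hθ
            rw [norm_mul, mul_comm]
            exact mul_le_mul hθ (k.norm_coe_le_norm θ) (norm_nonneg _) ((norm_nonneg _).trans hθ))
        linarith [this])
  obtain ⟨K1, hK1⟩ := exists_analytic_inv_circleMap z0 hr continuous_fst
  obtain ⟨K2, hK2⟩ := exists_analytic_inv_circleMap w0 hr continuous_snd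
  have hrep : ∀ p ∈ ball z0 r ×ˢ ball w0 r,
      f p = (2 * Real.pi * Complex.I)⁻¹ * ((2 * Real.pi * Complex.I)⁻¹ * L (K1 p.1 * K2 p.2)) := by
    rintro ⟨z, w⟩ ⟨hz, hw⟩
    have hpi : (2 * Real.pi * Complex.I : ℂ) ≠ 0 := Complex.two_pi_I_ne_zero
    have e1 : ∀ w ∈ closedBall w0 r, ∀ z ∈ ball z0 r,
        (∮ ζ in C(z0, r), (ζ - z)⁻¹ • f (ζ, w)) = (2 * Real.pi * Complex.I : ℂ) • f (z, w) :=
      fun w hw z hz => DifferentiableOn.circleIntegral_sub_inv_smul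
        (f := fun ζ => f (ζ, w)) (fun ζ hζ =>
          (h1 (ζ, w) (hrO ⟨hζ, hw⟩)).differentiableWithinAt) hz
    have e2 : ∀ z ∈ closedBall z0 r, ∀ w ∈ ball w0 r,
        (∮ ζ in C(w0, r), (ζ - w)⁻¹ • f (z, ζ)) = (2 * Real.pi * Complex.I : ℂ) • f (z, w) :=
      fun z hz w hw => DifferentiableOn.circleIntegral_sub_inv_smul
        (f := fun ζ => f (z, ζ)) (fun ζ hζ =>
          (h2 (z, ζ) (hrO ⟨hz, hζ⟩)).differentiableWithinAt) hw
    have e3 : L (K1 z * K2 w) = ∮ ζ in C(z0, r), (ζ - z)⁻¹ •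
        ∮ ξ in C(w0, r), (ξ - w)⁻¹ • f (ζ, ξ) := by
      change ∫ θ, (K1 z * K2 w) θ * g θ ∂(ν.prod ν) = _
      rw [integral_prod _ (hint _)]
      unfold circleIntegral
      rw [intervalIntegral.integral_of_le (by positivity)]
      refine integral_congr_ae (Eventually.of_forall fun θ => ?_)
      simp only [intervalIntegral.integral_of_le Real.two_pi_pos.le, smul_eq_mul]
      rw [← integral_const_mul, ← integral_const_mul]
      refine integral_congr_ae (Eventually.of_forall fun η => ?_)
      simp only [BoundedContinuousFunction.mul_apply, (hK1 z hz).2, (hK2 w hw).2, hg]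
      ring
    rw [e3]
    have e4 : (∮ ζ in C(z0, r), (ζ - z)⁻¹ • ∮ ξ in C(w0, r), (ξ - w)⁻¹ • f (ζ, ξ))
        = ∮ ζ in C(z0, r), (ζ - z)⁻¹ • ((2 * Real.pi * Complex.I : ℂ) • f (ζ, w)) := by
      refine circleIntegral.integral_congr hr.le fun ζ hζ => ?_
      simp only [e2 ζ (sphere_subset_closedBall hζ) w hw]
    rw [e4]
    have e5 : (∮ ζ in C(z0, r), (ζ - z)⁻¹ • ((2 * Real.pi * Complex.I : ℂ) • f (ζ, w)))
        = (2 * Real.pi * Complex.I : ℂ) • ∮ ζ in C(z0, r), (ζ - z)⁻¹ • f (ζ, w) := by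
      rw [← circleIntegral.integral_smul]
      congr 1; ext ζ; exact smul_comm _ _ _
    rw [e5, e1 w (ball_subset_closedBall hw) z hz, smul_eq_mul, smul_eq_mul]
    field_simp
  have hev : f =ᶠ[𝓝 (z0, w0)] fun p =>
      (2 * Real.pi * Complex.I)⁻¹ * ((2 * Real.pi * Complex.I)⁻¹ * L (K1 p.1 * K2 p.2)) :=
    eventuallyEq_of_mem ((isOpen_ball.prod isOpen_ball).mem_nhds
      ⟨mem_ball_self hr, mem_ball_self hr⟩) hrep
  refine AnalyticAt.congr ?_ hev.symm
  refine analyticAt_const.mul (analyticAt_const.mul ((L.analyticAt _).comp ?_))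
  have a1 : AnalyticAt ℂ (fun p : ℂ × ℂ => K1 p.1) (z0, w0) :=
    AnalyticAt.comp (g := K1) (f := Prod.fst) (hK1 z0 (mem_ball_self hr)).1 analyticAt_fst
  have a2 : AnalyticAt ℂ (fun p : ℂ × ℂ => K2 p.2) (z0, w0) :=
    AnalyticAt.comp (g := K2) (f := Prod.snd) (hK2 w0 (mem_ball_self hr)).1 analyticAt_snd
  exact a1.mul a2

/-- Cauchy's estimate on discs of half the radius turns a bound for the integrand into a bound for
its derivative. The derivative at z₀ is measurable in the parameter as a limit of difference
quotients. -/
theorem differentiableAt_integral_of_dominated {α : Type*} [MeasurableSpace α] {μ : Measure α}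
    {F : α → ℂ → ℂ} {z₀ : ℂ} {ε : ℝ} (hε : 0 < ε) {bound : α → ℝ}
    (hF : ∀ᵐ a ∂μ, DifferentiableOn ℂ (F a) (ball z₀ ε))
    (hm : ∀ z ∈ ball z₀ ε, AEStronglyMeasurable (fun a => F a z) μ)
    (hbi : Integrable bound μ) (hb : ∀ᵐ a ∂μ, ∀ z ∈ ball z₀ ε, ‖F a z‖ ≤ bound a) :
    DifferentiableAt ℂ (fun z => ∫ a, F a z ∂μ) z₀ := by
  have hz₀ : z₀ ∈ ball z₀ ε := mem_ball_self hε
  have hmeas : AEStronglyMeasurable (fun a => deriv (F a) z₀) μ := by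
    have hs : Tendsto (fun k : ℕ => (((ε / 2) * ((k : ℝ) + 1)⁻¹ : ℝ) : ℂ)) atTop (𝓝[≠] 0) := by
      refine tendsto_nhdsWithin_iff.2 ⟨?_, Eventually.of_forall fun k => ?_⟩
      · have h1 : Tendsto (fun k : ℕ => (ε / 2) * ((k : ℝ) + 1)⁻¹) atTop (𝓝 ((ε / 2) * 0)) :=
          tendsto_const_nhds.mul (tendsto_inv_atTop_zero.comp
            (tendsto_atTop_add_const_right _ _ tendsto_natCast_atTop_atTop))
        rw [mul_zero] at h1
        exact (Complex.continuous_ofReal.tendsto 0).comp h1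
      · have : (ε / 2) * ((k : ℝ) + 1)⁻¹ ≠ 0 := by positivity
        simpa using (Complex.ofReal_ne_zero.2 this)
    refine aestronglyMeasurable_of_tendsto_ae (u := atTop) (f := fun (k : ℕ) a =>
      ((((ε / 2) * ((k : ℝ) + 1)⁻¹ : ℝ) : ℂ))⁻¹ •
        (F a (z₀ + (((ε / 2) * ((k : ℝ) + 1)⁻¹ : ℝ) : ℂ)) - F a z₀)) (fun k => ?_) ?_
    · refine AEStronglyMeasurable.const_smul (f := fun a =>
        F a (z₀ + (((ε / 2) * ((k : ℝ) + 1)⁻¹ : ℝ) : ℂ)) - F a z₀) ((hm _ ?_).sub (hm _ hz₀))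
        ((((ε / 2) * ((k : ℝ) + 1)⁻¹ : ℝ) : ℂ))⁻¹
      have h2 : (ε / 2) * ((k : ℝ) + 1)⁻¹ < ε := by
        have : ((k : ℝ) + 1)⁻¹ ≤ 1 := inv_le_one_of_one_le₀ (by linarith [k.cast_nonneg (α := ℝ)])
        nlinarith
      rw [mem_ball, dist_eq_norm, add_sub_cancel_left, Complex.norm_real, Real.norm_eq_abs,
        abs_of_pos (by positivity)]
      exact h2
    · filter_upwards [hF] with a ha
      have := (ha.differentiableAt (isOpen_ball.mem_nhds hz₀)).hasDerivAt
      exact (hasDerivAt_iff_tendsto_slope_zero.1 this).comp hs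
  have key := hasDerivAt_integral_of_dominated_loc_of_deriv_le (μ := μ) (𝕜 := ℂ) (F := fun z a => F a z)
    (F' := fun z a => deriv (F a) z) (x₀ := z₀) (s := ball z₀ (ε / 2))
    (bound := fun a => bound a / (ε / 2)) (ball_mem_nhds _ (by positivity))
    (by filter_upwards [ball_mem_nhds z₀ hε] with z hz using hm z hz)
    (Integrable.mono' hbi (hm _ hz₀) (by filter_upwards [hb] with a ha using ha _ hz₀))
    hmeas ?_ (hbi.div_const _) ?_
  · exact key.2.differentiableAt
  · filter_upwards [hF, hb] with a ha hba z hz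
    have hsub : closedBall z (ε / 2) ⊆ ball z₀ ε := fun y hy => by
      rw [mem_ball] at hz ⊢
      rw [mem_closedBall] at hy
      linarith [dist_triangle y z z₀]
    refine Complex.norm_deriv_le_of_forall_mem_sphere_norm_le (by positivity) ?_ fun y hy =>
      hba y (hsub (sphere_subset_closedBall hy))
    refine DifferentiableOn.diffContOnCl ?_
    rw [closure_ball _ (by positivity)]
    exact ha.mono hsub
  · filter_upwards [hF] with a ha z hz
    exact (ha.differentiableAt (isOpen_ball.mem_nhds
      (ball_subset_ball (by linarith) hz))).hasDerivAt

/-- An integral of analytic functions of two variables, locally dominated by integrable functions,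
is analytic. -/
theorem analyticOnNhd_integral {α : Type*} [MeasurableSpace α] {μ : Measure α}
    {O : Set (ℂ × ℂ)} (hO : IsOpen O) {F : α → ℂ × ℂ → ℂ}
    (hF : ∀ᵐ a ∂μ, AnalyticOnNhd ℂ (F a) O)
    (hm : ∀ p ∈ O, AEStronglyMeasurable (fun a => F a p) μ)
    (hb : ∀ p ∈ O, ∃ bound : α → ℝ, Integrable bound μ ∧ ∃ V ∈ 𝓝 p, ∀ᵐ a ∂μ, ∀ q ∈ V,
      ‖F a q‖ ≤ bound a) :
    AnalyticOnNhd ℂ (fun p => ∫ a, F a p ∂μ) O := by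
  have hb' : ∀ p ∈ O, ∃ bound : α → ℝ, Integrable bound μ ∧ ∃ ε > 0,
      ball p.1 ε ×ˢ ball p.2 ε ⊆ O ∧
      ∀ᵐ a ∂μ, ∀ q ∈ ball p.1 ε ×ˢ ball p.2 ε, ‖F a q‖ ≤ bound a := by
    rintro p hp
    obtain ⟨b, hbi, V, hV, hbV⟩ := hb p hp
    obtain ⟨ε, hε, hεV⟩ := Metric.mem_nhds_iff.1 (Filter.inter_mem hV (hO.mem_nhds hp))
    rw [show p = (p.1, p.2) from rfl, ← ball_prod_same] at hεV
    refine ⟨b, hbi, ε, hε, fun q hq => (hεV hq).2, ?_⟩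
    filter_upwards [hbV] with a ha q hq using ha q (hεV hq).1
  refine analyticOnNhd_of_separately hO ?_ ?_ ?_
  · intro p hp
    obtain ⟨b, hbi, ε, hε, hsub, hbV⟩ := hb' p hp
    have hnhds : ball p.1 ε ×ˢ ball p.2 ε ∈ 𝓝 p :=
      (isOpen_ball.prod isOpen_ball).mem_nhds ⟨mem_ball_self hε, mem_ball_self hε⟩
    refine ContinuousAt.continuousWithinAt ?_
    refine continuousAt_of_dominated (bound := b) ?_ ?_ hbi ?_
    · filter_upwards [hnhds] with q hq using hm q (hsub hq)
    · filter_upwards [hnhds] with q hq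
      filter_upwards [hbV] with a ha using ha q hq
    · filter_upwards [hF] with a ha using (ha p hp).continuousAt
  · intro p hp
    obtain ⟨b, hbi, ε, hε, hsub, hbV⟩ := hb' p hp
    refine differentiableAt_integral_of_dominated hε (F := fun a z => F a (z, p.2)) (bound := b)
      ?_ (fun z hz => hm _ (hsub ⟨hz, mem_ball_self hε⟩)) hbi ?_
    · filter_upwards [hF] with a ha z hz
      exact ((ha (z, p.2) (hsub ⟨hz, mem_ball_self hε⟩)).differentiableAt.comp z
        (by fun_prop : DifferentiableAt ℂ (fun z : ℂ => (z, p.2)) z)).differentiableWithinAt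
    · filter_upwards [hbV] with a ha z hz using ha _ ⟨hz, mem_ball_self hε⟩
  · intro p hp
    obtain ⟨b, hbi, ε, hε, hsub, hbV⟩ := hb' p hp
    refine differentiableAt_integral_of_dominated hε (F := fun a z => F a (p.1, z)) (bound := b)
      ?_ (fun z hz => hm _ (hsub ⟨mem_ball_self hε, hz⟩)) hbi ?_
    · filter_upwards [hF] with a ha z hz
      exact ((ha (p.1, z) (hsub ⟨mem_ball_self hε, hz⟩)).differentiableAt.comp z
        (by fun_prop : DifferentiableAt ℂ (fun z : ℂ => (p.1, z)) z)).differentiableWithinAt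
    · filter_upwards [hbV] with a ha z hz using ha _ ⟨mem_ball_self hε, hz⟩

end ComplexAnalysis

end FactorialSeries
end

open Filter Topology Asymptotics MeasureTheory
noncomputable section
namespace FactorialSeries

/-! ### Neighbourhoods of the positive real axis and Cauchy estimates -/

section ComplexAnalysis

open Metric

/-- Positive part of the real part. -/
def rePos (t : ℂ) : ℝ := max t.re 0

/-- Distance from the nonnegative real axis. -/
def width (t : ℂ) : ℝ := ‖t - rePos t‖

lemma rePos_nonneg (t : ℂ) : 0 ≤ rePos t := le_max_right _ _

lemma width_nonneg (t : ℂ) : 0 ≤ width t := norm_nonneg _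

@[simp] lemma rePos_ofReal {t : ℝ} (ht : 0 ≤ t) : rePos (t : ℂ) = t := by simp [rePos, ht]

@[simp] lemma width_ofReal {t : ℝ} (ht : 0 ≤ t) : width (t : ℂ) = 0 := by simp [width, ht]

lemma width_le_norm_sub (t : ℂ) {x : ℝ} (hx : 0 ≤ x) : width t ≤ ‖t - x‖ := by
  unfold width rePos
  rcases le_total t.re 0 with h | h
  · rw [max_eq_right h, Complex.ofReal_zero, sub_zero]
    refine (sq_le_sq₀ (norm_nonneg _) (norm_nonneg _)).1 ?_
    rw [Complex.sq_norm, Complex.sq_norm, Complex.normSq_apply, Complex.normSq_apply]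
    simp
    nlinarith
  · rw [max_eq_left h]
    refine (sq_le_sq₀ (norm_nonneg _) (norm_nonneg _)).1 ?_
    rw [Complex.sq_norm, Complex.sq_norm, Complex.normSq_apply, Complex.normSq_apply]
    simp
    nlinarith [mul_self_nonneg (t.re - x)]

lemma width_add_le (t h : ℂ) : width (t + h) ≤ width t + ‖h‖ := by
  refine (width_le_norm_sub (t + h) (rePos_nonneg t)).trans ?_
  rw [show t + h - rePos t = (t - rePos t) + h by ring]
  exact norm_add_le _ _

lemma rePos_add_le (t h : ℂ) : rePos (t + h) ≤ rePos t + ‖h‖ := by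
  unfold rePos
  have := Complex.re_le_norm h
  refine max_le ?_ (by positivity)
  rw [Complex.add_re]
  linarith [le_max_left t.re 0]

lemma continuous_rePos : Continuous rePos := Complex.continuous_re.max continuous_const

lemma continuous_width : Continuous width :=
  (continuous_id.sub (Complex.continuous_ofReal.comp continuous_rePos)).norm

lemma rePos_smul {s : ℝ} (hs : 0 ≤ s) (t : ℂ) : rePos (s * t) = s * rePos t := by
  unfold rePos
  rw [Complex.re_ofReal_mul, mul_max_of_nonneg _ _ hs, mul_zero]

lemma width_smul {s : ℝ} (hs : 0 ≤ s) (t : ℂ) : width (s * t) = s * width t := by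
  unfold width
  rw [rePos_smul hs, Complex.ofReal_mul, ← mul_sub, norm_mul, Complex.norm_real,
    Real.norm_of_nonneg hs]

lemma norm_le_rePos_add_width (t : ℂ) : ‖t‖ ≤ rePos t + width t := by
  have := norm_add_le (rePos t : ℂ) (t - rePos t)
  rw [add_sub_cancel, Complex.norm_real, Real.norm_of_nonneg (rePos_nonneg t)] at this
  exact this

lemma mem_U_iff {r : ℝ} {t : ℂ} : t ∈ U r ↔ width t < r := by
  simp only [U, Set.mem_union, Set.mem_ofPred_eq, mem_ball, dist_zero_right]
  rcases le_or_gt t.re 0 with h | h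
  · have : width t = ‖t‖ := by simp [width, rePos, max_eq_right h]
    rw [this]
    constructor
    · rintro (h' | h')
      · exact absurd h'.1 (not_lt.2 h)
      · exact h'
    · exact Or.inr
  · have : width t = |t.im| := by
      unfold width rePos
      rw [max_eq_left h.le]
      have : t - (t.re : ℂ) = t.im * Complex.I := by
        apply Complex.ext <;> simp
      rw [this]; simp
    rw [this]
    constructor
    · rintro (h' | h')
      · exact h'.2
      · exact (Complex.abs_im_le_norm t).trans_lt h'
    · exact fun h' => Or.inl ⟨h, h'⟩

lemma closedBall_subset_width_lt {t : ℂ} {δ r : ℝ} (h : width t + δ < r) :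
    closedBall t δ ⊆ {t | width t < r} := fun y hy => by
  have := width_add_le t (y - t)
  rw [add_sub_cancel] at this
  rw [mem_closedBall, dist_eq_norm] at hy
  exact lt_of_le_of_lt this (by linarith)

/-- Cauchy's estimate on a disc of radius δ: a displacement by δ raises `rePos` by at most δ, which
costs the factor exp(σδ). -/
lemma norm_iteratedDeriv_le_of_width {F : ℂ → ℂ} {r C σ δ : ℝ} (hσ : 0 ≤ σ) (hδ : 0 < δ)
    (hC : 0 ≤ C) (hF : AnalyticOnNhd ℂ F {t | width t < r})
    (hb : ∀ t, width t < r → ‖F t‖ ≤ C * Real.exp (σ * rePos t)) (k : ℕ) {t : ℂ}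
    (ht : width t + δ < r) :
    ‖iteratedDeriv k F t‖ ≤ k.factorial * (C * Real.exp (σ * δ)) / δ ^ k
      * Real.exp (σ * rePos t) := by
  have hsub := closedBall_subset_width_lt ht
  have := Complex.norm_iteratedDeriv_le_of_forall_mem_sphere_norm_le (f := F) (c := t) (R := δ)
    (C := C * Real.exp (σ * (rePos t + δ))) k hδ
    (by
      refine DifferentiableOn.diffContOnCl ?_
      rw [closure_ball _ hδ.ne']
      exact hF.differentiableOn.mono hsub) (fun z hz => by
      refine (hb z (hsub (sphere_subset_closedBall hz))).trans ?_
      gcongr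
      have h1 := rePos_add_le t (z - t)
      rw [add_sub_cancel] at h1
      rw [mem_sphere, dist_eq_norm] at hz
      linarith)
  refine this.trans (le_of_eq ?_)
  rw [mul_add, Real.exp_add]
  ring

/-- Cauchy's formula with the mean value property applied to the majorant: Re f averages to Re f(0)
over the circle. A majorant that is large only on a short arc thus enters through its mean and not
through its maximum. -/
lemma norm_iteratedDeriv_le_of_re_bound {f h : ℂ → ℂ} {R B : ℝ} (hR : 0 < R) (m : ℕ)
    (hh : DiffContOnCl ℂ h (ball 0 R)) (hf : DiffContOnCl ℂ f (ball 0 R))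
    (hb : ∀ z ∈ sphere (0 : ℂ) R, ‖h z‖ ≤ B * (f z).re) :
    ‖iteratedDeriv m h 0‖ ≤ m.factorial * (B * (f 0).re) / R ^ m := by
  have h1 := DiffContOnCl.circleIntegral_one_div_sub_center_pow_smul hR m hh
  have hmem : ∀ θ, circleMap (0 : ℂ) R θ ∈ sphere (0 : ℂ) R := fun θ =>
    circleMap_mem_sphere _ hR.le θ
  have hcirc : ∀ g : ℂ → ℂ, ContinuousOn g (sphere 0 R) →
      Continuous fun θ => g (circleMap 0 R θ) := fun g hg =>
    hg.comp_continuous (continuous_circleMap 0 R) hmem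
  have hsub : sphere (0 : ℂ) R ⊆ closure (ball 0 R) := by
    rw [closure_ball _ hR.ne']; exact sphere_subset_closedBall
  have hfc := hcirc f (hf.continuousOn.mono hsub)
  have h2 : ‖∮ z in C(0, R), (1 / (z - 0) ^ (m + 1)) • h z‖ ≤
      ∫ θ in (0 : ℝ)..2 * Real.pi, (R ^ m)⁻¹ * (B * (f (circleMap 0 R θ)).re) := by
    unfold circleIntegral
    refine intervalIntegral.norm_integral_le_of_norm_le Real.two_pi_pos.le
      (Eventually.of_forall fun θ _ => ?_) ?_
    · rw [norm_smul, norm_smul, norm_div, norm_pow, deriv_circleMap, norm_mul]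
      simp only [norm_circleMap_zero, abs_of_pos hR, Complex.norm_I, mul_one, norm_one, sub_zero]
      rw [← mul_assoc]
      refine mul_le_mul ?_ (hb _ (hmem θ)) (norm_nonneg _) (by positivity)
      rw [pow_succ]
      exact le_of_eq (by field_simp)
    · refine Continuous.intervalIntegrable ?_ _ _
      exact continuous_const.mul (continuous_const.mul (Complex.continuous_re.comp hfc))
  have h3 : ∫ θ in (0 : ℝ)..2 * Real.pi, (R ^ m)⁻¹ * (B * (f (circleMap 0 R θ)).re)
      = (R ^ m)⁻¹ * (B * (2 * Real.pi * (f 0).re)) := by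
    have h4 : Real.circleAverage f 0 R = f 0 :=
      DiffContOnCl.circleAverage (by rwa [abs_of_pos hR])
    rw [Real.circleAverage_def] at h4
    have h5 : ∫ θ in (0 : ℝ)..2 * Real.pi, (f (circleMap 0 R θ)).re = 2 * Real.pi * (f 0).re := by
      have h6 := intervalIntegral.intervalIntegral_re (μ := volume) (hfc.intervalIntegrable 0 (2 * Real.pi))
      simp only [RCLike.re_to_complex] at h6
      rw [h6, ← h4, Complex.real_smul, Complex.re_ofReal_mul]
      field_simp
    rw [intervalIntegral.integral_const_mul, intervalIntegral.integral_const_mul, h5]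
  rw [h1, h3, norm_smul, norm_div] at h2
  simp only [norm_mul, Complex.norm_I, Complex.norm_natCast, Complex.norm_ofNat, Complex.norm_real,
    Real.norm_of_nonneg Real.pi_pos.le, mul_one] at h2
  have hfac : (0 : ℝ) < m.factorial := by positivity
  have h7 : 2 * Real.pi * ‖iteratedDeriv m h 0‖ ≤
      2 * Real.pi * (m.factorial * (B * (f 0).re) / R ^ m) := by
    calc 2 * Real.pi * ‖iteratedDeriv m h 0‖
        = m.factorial * (2 * Real.pi / m.factorial * ‖iteratedDeriv m h 0‖) := by field_simp
      _ ≤ m.factorial * ((R ^ m)⁻¹ * (B * (2 * Real.pi * (f 0).re))) := by gcongr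
      _ = _ := by ring
  exact le_of_mul_le_mul_left h7 Real.two_pi_pos

/-- The Laplace transform along the positive real axis. -/
def lap (f : ℂ → ℂ) (u : ℂ) : ℂ := ∫ t in Set.Ioi (0 : ℝ), Complex.exp (-u * t) * f t

end ComplexAnalysis

end FactorialSeries
end

open Filter Topology Asymptotics MeasureTheory
noncomputable section
namespace FactorialSeries

/-! ### Inverse factorial series of a Laplace transform -/

section FactorialSeriesExpansion

open Metric

variable {ω : ℝ}

lemma re_one_sub_pos {s : ℂ} (hs : s ∈ ball (0 : ℂ) 1) : 0 < (1 - s).re := by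
  rw [mem_ball, dist_zero_right] at hs
  have := Complex.re_le_norm s
  simp only [Complex.sub_re, Complex.one_re]
  linarith

/-- For |1-s| ≤ 1 the distance to the positive number -log|1-s| is |arg(1-s)| < π/2. For |1-s| > 1
the real part is negative, and the modulus of the logarithm has to be bounded. -/
lemma width_neg_log_lt {s : ℂ} (hs : s ∈ ball (0 : ℂ) 1) :
    width (-Complex.log (1 - s)) < Real.pi / 2 := by
  have hre := re_one_sub_pos hs
  rw [mem_ball, dist_zero_right] at hs
  set q := 1 - s with hq
  have hq0 : q ≠ 0 := fun h => by simp [h] at hre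
  have hqpos : 0 < ‖q‖ := norm_pos_iff.2 hq0
  have hnorm : ‖q‖ ^ 2 < 2 * q.re := by
    have h1 : ‖1 - q‖ ^ 2 < 1 := by
      rw [hq, sub_sub_cancel]
      exact pow_lt_one₀ (norm_nonneg _) hs two_ne_zero
    rw [Complex.sq_norm, Complex.normSq_apply] at h1 ⊢
    simp at h1
    nlinarith
  have harg : |Complex.arg q| < Real.pi / 2 := Complex.abs_arg_lt_pi_div_two_iff.2 (Or.inl hre)
  rcases le_or_gt ‖q‖ 1 with h | h
  · refine (width_le_norm_sub _ (x := -Real.log ‖q‖)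
      (neg_nonneg.2 (Real.log_nonpos (norm_nonneg _) h))).trans_lt ?_
    have : -Complex.log q - ((-Real.log ‖q‖ : ℝ) : ℂ) = -(Complex.arg q * Complex.I) := by
      unfold Complex.log; push_cast; ring
    rw [this, norm_neg, norm_mul, Complex.norm_I, mul_one, Complex.norm_real]
    exact harg
  · refine (width_le_norm_sub _ le_rfl).trans_lt ?_
    rw [Complex.ofReal_zero, sub_zero, norm_neg]
    have hcos : 1 / 2 < Real.cos (Complex.arg q) := by
      rw [Complex.cos_arg hq0, lt_div_iff₀ hqpos]
      nlinarith
    have harg3 : |Complex.arg q| < Real.pi / 3 := by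
      by_contra hcon
      rw [not_lt] at hcon
      have := Real.cos_le_cos_of_nonneg_of_le_pi (by positivity) (by linarith [Real.pi_pos]) hcon
      rw [Real.cos_abs, Real.cos_pi_div_three] at this
      linarith
    have hlog : Real.log ‖q‖ ≤ 1 := by
      have h2 : ‖q‖ ≤ 2 := by
        have := norm_sub_le (1 : ℂ) s
        rw [norm_one] at this
        linarith
      linarith [Real.log_le_sub_one_of_pos hqpos]
    have hlog0 : 0 ≤ Real.log ‖q‖ := Real.log_nonneg h.le
    refine (sq_lt_sq₀ (norm_nonneg _) (by positivity)).1 ?_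
    rw [Complex.sq_norm, Complex.normSq_apply, Complex.log_re, Complex.log_im]
    have h3 : Complex.arg q * Complex.arg q ≤ (Real.pi / 3) ^ 2 := by
      rw [← sq, ← sq_abs]
      exact pow_le_pow_left₀ (abs_nonneg _) harg3.le 2
    nlinarith [Real.pi_gt_three]

/-- The factor 2^κ accounts for the points with 1 < |1-s| ≤ 2, where `rePos` is 0 while -log|1-s| is
negative. -/
lemma rePos_neg_log_exp_le {s : ℂ} (hs : s ∈ ball (0 : ℂ) 1) {κ : ℝ} (hκ : 0 ≤ κ) :
    Real.exp (κ * rePos (-Complex.log (1 - s))) ≤ 2 ^ κ * ‖1 - s‖ ^ (-κ) := by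
  have hre := re_one_sub_pos hs
  rw [mem_ball, dist_zero_right] at hs
  have hq0 : (1 - s) ≠ 0 := fun h => by simp [h] at hre
  have hqpos : 0 < ‖1 - s‖ := norm_pos_iff.2 hq0
  have h2 : ‖1 - s‖ ≤ 2 := by
    have := norm_sub_le (1 : ℂ) s
    rw [norm_one] at this
    linarith
  have key : rePos (-Complex.log (1 - s)) ≤ Real.log 2 - Real.log ‖1 - s‖ := by
    unfold rePos
    rw [Complex.neg_re, Complex.log_re]
    refine max_le (by linarith [Real.log_pos one_lt_two]) ?_
    linarith [Real.log_le_log hqpos h2]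
  calc Real.exp (κ * rePos (-Complex.log (1 - s)))
      ≤ Real.exp (κ * (Real.log 2 - Real.log ‖1 - s‖)) := by gcongr
    _ = 2 ^ κ * ‖1 - s‖ ^ (-κ) := by
      rw [Real.rpow_def_of_pos two_pos, Real.rpow_def_of_pos hqpos, ← Real.exp_add]
      congr 1; ring

lemma analyticAt_iteratedDeriv {F : ℂ → ℂ} {t : ℂ} (hF : AnalyticAt ℂ F t) (k : ℕ) :
    AnalyticAt ℂ (iteratedDeriv k F) t := by
  rw [iteratedDeriv_eq_iterate]
  exact hF.iterated_deriv k

lemma hasDerivAt_iteratedDeriv {F : ℂ → ℂ} {t : ℂ} (hF : AnalyticAt ℂ F t) (k : ℕ) :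
    HasDerivAt (iteratedDeriv k F) (iteratedDeriv (k + 1) F t) t := by
  rw [iteratedDeriv_succ]
  exact (analyticAt_iteratedDeriv hF k).differentiableAt.hasDerivAt

/-- The change of variable `s = 1 - exp (-ω t)`, solved for `t`. -/
def logVar (ω : ℝ) (s : ℂ) : ℂ := ((ω⁻¹ : ℝ) : ℂ) * -Complex.log (1 - s)

lemma width_logVar_lt (hω : 0 < ω) {s : ℂ} (hs : s ∈ ball (0 : ℂ) 1) :
    width (logVar ω s) < Real.pi / (2 * ω) := by
  unfold logVar
  rw [width_smul (by positivity)]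
  calc ω⁻¹ * width (-Complex.log (1 - s)) < ω⁻¹ * (Real.pi / 2) := by
        gcongr; exact width_neg_log_lt hs
    _ = _ := by field_simp

lemma hasDerivAt_logVar {s : ℂ} (hs : s ∈ ball (0 : ℂ) 1) :
    HasDerivAt (logVar ω) (((ω⁻¹ : ℝ) : ℂ) * (1 - s)⁻¹) s := by
  have h1 : HasDerivAt (fun s : ℂ => Complex.log (1 - s)) (-1 / (1 - s)) s :=
    ((hasDerivAt_id s).const_sub 1).clog (Or.inl (re_one_sub_pos hs))
  have h2 := h1.neg.const_mul ((ω⁻¹ : ℝ) : ℂ)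
  exact h2.congr_deriv (by rw [neg_div, neg_neg, one_div])

/-- The coefficients of the inverse factorial series of the Laplace transform of `F`. -/
def facCoeff (ω : ℝ) (F : ℂ → ℂ) (m : ℕ) (t : ℂ) : ℂ :=
  ∑ k ∈ Finset.range (m + 1), (ω : ℂ) ^ (m - k) * (Nat.stirlingFirst m k : ℂ) * iteratedDeriv k F t

/-- The recurrence |s(m+1, k+1)| = m |s(m, k+1)| + |s(m, k)|, arranged as it arises when (1-s)^{-m}
times the m-th coefficient is differentiated by the product rule. -/
lemma facCoeff_succ (F : ℂ → ℂ) (m : ℕ) (t : ℂ) :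
    facCoeff ω F (m + 1) t = m * ω * facCoeff ω F m t +
      ∑ k ∈ Finset.range (m + 1),
        (ω : ℂ) ^ (m - k) * (Nat.stirlingFirst m k : ℂ) * iteratedDeriv (k + 1) F t := by
  unfold facCoeff
  rw [Finset.sum_range_succ']
  simp only [Nat.stirlingFirst_succ_zero, Nat.cast_zero, mul_zero, zero_mul, add_zero,
    Nat.add_sub_add_right, Nat.stirlingFirst_succ_succ, Nat.cast_add, Nat.cast_mul]
  simp only [mul_add, add_mul, Finset.sum_add_distrib]
  congr 1
  rw [Finset.mul_sum, Finset.sum_range_succ,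
    Nat.stirlingFirst_eq_zero_of_lt (Nat.lt_succ_self m), Finset.sum_range_succ' _ m]
  have h0 : (m : ℂ) * (Nat.stirlingFirst m 0 : ℂ) = 0 := by
    cases m <;> simp
  simp only [Nat.cast_zero, mul_zero, zero_mul, add_zero]
  have h1 : (m : ℂ) * ω * ((ω : ℂ) ^ (m - 0) * (Nat.stirlingFirst m 0 : ℂ) * iteratedDeriv 0 F t)
      = 0 := by
    linear_combination (ω * (ω : ℂ) ^ (m - 0) * iteratedDeriv 0 F t) * h0
  rw [h1, add_zero]
  refine Finset.sum_congr rfl fun k hk => ?_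
  rw [Finset.mem_range] at hk
  rw [show m - k = (m - (k + 1)) + 1 by omega, pow_succ]
  ring

/-- Each derivative in s is ω⁻¹ (1-s)⁻¹ d/dt, and the derivative of (1-s)^{-m} supplies the summand
mω of `facCoeff_succ`. At s = 0 the Stirling combinations appear as the Taylor coefficients of F in
the variable s. -/
lemma iteratedDeriv_comp_logVar {r : ℝ} (hω : 0 < ω) (hr : Real.pi / (2 * ω) ≤ r) {F : ℂ → ℂ}
    (hF : AnalyticOnNhd ℂ F {t | width t < r}) (m : ℕ) :
    ∀ s ∈ ball (0 : ℂ) 1, iteratedDeriv m (fun s => F (logVar ω s)) s =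
      (ω : ℂ)⁻¹ ^ m * ((1 - s)⁻¹ ^ m * facCoeff ω F m (logVar ω s)) := by
  have hω' : (ω : ℂ) ≠ 0 := Complex.ofReal_ne_zero.2 hω.ne'
  induction m with
  | zero => intro s hs; simp [facCoeff]
  | succ m ih =>
    intro s hs
    have hq : (1 - s) ≠ 0 := fun h => by
      have := re_one_sub_pos hs
      simp [h] at this
    have hmem : logVar ω s ∈ {t | width t < r} := (width_logVar_lt hω hs).trans_le hr
    rw [iteratedDeriv_succ]
    have hev : iteratedDeriv m (fun s => F (logVar ω s)) =ᶠ[𝓝 s] fun s =>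
      (ω : ℂ)⁻¹ ^ m * ((1 - s)⁻¹ ^ m * facCoeff ω F m (logVar ω s)) :=
      eventuallyEq_of_mem (isOpen_ball.mem_nhds hs) ih
    rw [hev.deriv_eq]
    have hG : HasDerivAt (fun s => facCoeff ω F m (logVar ω s))
        ((∑ k ∈ Finset.range (m + 1),
        (ω : ℂ) ^ (m - k) * (Nat.stirlingFirst m k : ℂ) * iteratedDeriv (k + 1) F (logVar ω s))
          * (((ω⁻¹ : ℝ) : ℂ) * (1 - s)⁻¹)) s := by
      unfold facCoeff
      rw [Finset.sum_mul]
      refine HasDerivAt.fun_sum fun k _ => ?_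
      rw [mul_assoc]
      refine HasDerivAt.const_mul _ ?_
      have h1 : HasDerivAt (iteratedDeriv k F) (iteratedDeriv (k + 1) F (logVar ω s))
          (logVar ω s) := hasDerivAt_iteratedDeriv (hF _ hmem) k
      exact h1.comp s (hasDerivAt_logVar hs)
    have hP : HasDerivAt (fun s : ℂ => (1 - s)⁻¹ ^ m) (m * (1 - s)⁻¹ ^ (m + 1)) s := by
      have h2 := (((hasDerivAt_id s).const_sub 1).inv hq).pow m
      refine h2.congr_deriv ?_
      rcases m with _ | m
      · simp
      · simp only [id, Nat.add_sub_cancel]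
        simp only [Pi.inv_apply, neg_neg, one_div, inv_pow]
        field_simp
        ring
    have hd : HasDerivAt (fun s => (ω : ℂ)⁻¹ ^ m * ((1 - s)⁻¹ ^ m * facCoeff ω F m (logVar ω s)))
      _ s := (hP.mul hG).const_mul _
    rw [hd.deriv, facCoeff_succ]
    push_cast
    simp only [pow_succ]
    field_simp

lemma norm_facCoeff_le {r : ℝ} (hω : 0 < ω) {F : ℂ → ℂ} {C σ δ : ℝ} (hσ : 0 ≤ σ) (hδ : 0 < δ)
    (hC : 0 ≤ C) (hF : AnalyticOnNhd ℂ F {t | width t < r})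
    (hb : ∀ t, width t < r → ‖F t‖ ≤ C * Real.exp (σ * rePos t)) (m : ℕ) {t : ℂ}
    (ht : width t + δ < r) :
    ‖facCoeff ω F m t‖ ≤ (∑ k ∈ Finset.range (m + 1), ω ^ (m - k) * (Nat.stirlingFirst m k : ℝ) *
      (k.factorial * (C * Real.exp (σ * δ)) / δ ^ k)) * Real.exp (σ * rePos t) := by
  unfold facCoeff
  rw [Finset.sum_mul]
  refine (norm_sum_le _ _).trans (Finset.sum_le_sum fun k _ => ?_)
  rw [norm_mul, norm_mul, norm_pow, Complex.norm_real, Complex.norm_natCast,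
    Real.norm_of_nonneg hω.le, mul_assoc _ _ (Real.exp _)]
  gcongr
  exact norm_iteratedDeriv_le_of_width hσ hδ hC hF hb k ht

/-- Put κ = σ/ω. The second derivative of F ∘ `logVar` is bounded by a multiple of |1-s|^{-κ-2}, and
|1-s|^{-2} is a multiple of the Poisson kernel, with mean 1/(1-R²) on |s| = R although its maximum
is (1-R)^{-2}. This saves one power of m, and the exponent κ - 1 is the one needed for convergence
whenever Re u > σ. -/
lemma exists_coeff_bound (hω : 0 < ω) {r : ℝ} (hr : Real.pi / (2 * ω) < r) {C σ : ℝ}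
    (hσ : 0 ≤ σ) (hC : 0 ≤ C) :
    ∃ K : ℝ, ∀ F : ℂ → ℂ, AnalyticOnNhd ℂ F {t | width t < r} →
      (∀ t, width t < r → ‖F t‖ ≤ C * Real.exp (σ * rePos t)) → ∀ m : ℕ,
      ‖(ω : ℂ)⁻¹ ^ (m + 2) * facCoeff ω F (m + 2) 0‖ ≤
        (m + 2).factorial * (K * ((m + 2 : ℕ) : ℝ) ^ (σ / ω - 1)) := by
  set δ := (r - Real.pi / (2 * ω)) / 2 with hδ
  have hδ0 : 0 < δ := by rw [hδ]; linarith
  set A := ∑ k ∈ Finset.range (2 + 1), ω ^ (2 - k) * (Nat.stirlingFirst 2 k : ℝ) *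
      (k.factorial * (C * Real.exp (σ * δ)) / δ ^ k) with hA
  have hA0 : 0 ≤ A := Finset.sum_nonneg fun k _ => by positivity
  set κ := σ / ω with hκ
  have hκ0 : 0 ≤ κ := by positivity
  refine ⟨6 * (ω⁻¹ ^ 2 * A * 2 ^ κ), fun F hF hb m => ?_⟩
  set G : ℂ → ℂ := fun s => F (logVar ω s) with hG
  have hGd : ∀ k, ∀ s ∈ ball (0 : ℂ) 1, iteratedDeriv k G s =
      (ω : ℂ)⁻¹ ^ k * ((1 - s)⁻¹ ^ k * facCoeff ω F k (logVar ω s)) :=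
    fun k => iteratedDeriv_comp_logVar hω hr.le hF k
  have hGan : ∀ s ∈ ball (0 : ℂ) 1, AnalyticAt ℂ G s := by
    have : DifferentiableOn ℂ G (ball 0 1) := fun s hs =>
      ((hF _ ((width_logVar_lt hω hs).trans_le hr.le)).differentiableAt.comp s
        (hasDerivAt_logVar hs).differentiableAt).differentiableWithinAt
    exact fun s hs => this.analyticAt (isOpen_ball.mem_nhds hs)
  have hbound : ∀ s ∈ ball (0 : ℂ) 1,
      ‖iteratedDeriv 2 G s‖ ≤ ω⁻¹ ^ 2 * A * 2 ^ κ * ‖1 - s‖ ^ (-κ) * (‖1 - s‖ ^ 2)⁻¹ := by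
    intro s hs
    rw [hGd 2 s hs, norm_mul, norm_mul, norm_pow, norm_inv, norm_pow, norm_inv, Complex.norm_real,
      Real.norm_of_nonneg hω.le]
    have h1 := norm_facCoeff_le hω hσ hδ0 hC hF hb 2 (t := logVar ω s) (by
      have := width_logVar_lt hω hs
      rw [hδ]; linarith)
    rw [← hA] at h1
    have h2 : Real.exp (σ * rePos (logVar ω s)) ≤ 2 ^ κ * ‖1 - s‖ ^ (-κ) := by
      have := rePos_neg_log_exp_le hs hκ0
      unfold logVar
      rw [rePos_smul (by positivity), ← mul_assoc]
      exact this
    calc ω⁻¹ ^ 2 * (‖1 - s‖⁻¹ ^ 2 * ‖facCoeff ω F 2 (logVar ω s)‖)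
        ≤ ω⁻¹ ^ 2 * (‖1 - s‖⁻¹ ^ 2 * (A * (2 ^ κ * ‖1 - s‖ ^ (-κ)))) := by
          gcongr
          exact h1.trans (by gcongr)
      _ = _ := by rw [inv_pow ‖1 - s‖]; ring
  -- With 1 - R = 1/(m+2) the powers of (1-R)⁻¹ become powers of m+2, while R^{-m} stays below e.
  set R : ℝ := ((m : ℝ) + 1) / (m + 2) with hR
  have hm0 : (0 : ℝ) ≤ m := m.cast_nonneg
  have hR0 : 0 < R := by positivity
  have hR1 : R < 1 := by rw [hR, div_lt_one (by positivity)]; linarith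
  have h1R : 1 - R = ((m : ℝ) + 2)⁻¹ := by rw [hR]; field_simp; ring
  have hcl : closedBall (0 : ℂ) R ⊆ ball 0 1 := closedBall_subset_ball hR1
  have hRsq : 0 < 1 - R ^ 2 := by nlinarith
  -- The real part of (1+s)/(1-s) is the Poisson kernel (1-|s|²)/|1-s|², and its value at s = 0 is
  -- 1.
  have hkey := norm_iteratedDeriv_le_of_re_bound (f := fun s : ℂ => (1 + s) / (1 - s))
    (h := iteratedDeriv 2 G) (R := R)
    (B := ω⁻¹ ^ 2 * A * 2 ^ κ * (1 - R) ^ (-κ) * (1 - R ^ 2)⁻¹) hR0 m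
    (by
      refine DifferentiableOn.diffContOnCl ?_
      rw [closure_ball _ hR0.ne']
      exact fun s hs => (analyticAt_iteratedDeriv (hGan s (hcl hs))
        2).differentiableAt.differentiableWithinAt)
    (by
      refine DifferentiableOn.diffContOnCl ?_
      rw [closure_ball _ hR0.ne']
      intro s hs
      have hq : (1 - s) ≠ 0 := fun h => by
        have := re_one_sub_pos (hcl hs)
        simp [h] at this
      exact DifferentiableAt.differentiableWithinAt (by fun_prop (disch := exact hq)))
    (fun s hs => by
      have hs1 := hcl (sphere_subset_closedBall hs)
      have hsR : ‖s‖ = R := by simpa using hs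
      have hq : (1 - s) ≠ 0 := fun h => by
        have := re_one_sub_pos hs1
        simp [h] at this
      have hqpos : 0 < ‖1 - s‖ := norm_pos_iff.2 hq
      have hre : ((1 + s) / (1 - s)).re = (1 - R ^ 2) * (‖1 - s‖ ^ 2)⁻¹ := by
        rw [Complex.div_re, ← Complex.sq_norm, ← hsR, Complex.sq_norm s, Complex.normSq_apply]
        simp only [Complex.add_re, Complex.one_re, Complex.sub_re, Complex.add_im, Complex.one_im,
          Complex.sub_im]
        ring
      rw [hre]
      refine (hbound s hs1).trans ?_
      have h3 : ‖1 - s‖ ^ (-κ) ≤ (1 - R) ^ (-κ) := by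
        refine Real.rpow_le_rpow_of_nonpos (by linarith) ?_ (by linarith)
        have := norm_sub_norm_le (1 : ℂ) s
        rw [norm_one, hsR] at this
        exact this
      calc ω⁻¹ ^ 2 * A * 2 ^ κ * ‖1 - s‖ ^ (-κ) * (‖1 - s‖ ^ 2)⁻¹
          ≤ ω⁻¹ ^ 2 * A * 2 ^ κ * (1 - R) ^ (-κ) * (‖1 - s‖ ^ 2)⁻¹ := by gcongr
        _ = _ := by field_simp)
  have hit : iteratedDeriv m (iteratedDeriv 2 G) 0 =
      (ω : ℂ)⁻¹ ^ (m + 2) * facCoeff ω F (m + 2) 0 := by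
    have : iteratedDeriv m (iteratedDeriv 2 G) = iteratedDeriv (m + 2) G := by
      simp only [iteratedDeriv_eq_iterate, ← Function.iterate_add_apply]
    rw [this, hGd _ 0 (mem_ball_self one_pos)]
    simp [logVar]
  rw [hit] at hkey
  refine hkey.trans ?_
  have hm2 : (0 : ℝ) < (m : ℝ) + 2 := by positivity
  have e1 : (1 - R) ^ (-κ) = ((m : ℝ) + 2) ^ κ := by
    rw [h1R, Real.inv_rpow hm2.le, Real.rpow_neg hm2.le, inv_inv]
  have e2 : (1 - R ^ 2)⁻¹ ≤ (m : ℝ) + 2 := by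
    rw [← inv_inv ((m : ℝ) + 2), ← h1R]
    refine inv_anti₀ (by linarith) (by nlinarith)
  have e3 : (R ^ m)⁻¹ ≤ 3 := by
    have h5 : R⁻¹ ≤ Real.exp (1 / (m + 1)) := by
      have := Real.add_one_le_exp (1 / ((m : ℝ) + 1))
      refine le_trans (le_of_eq ?_) this
      rw [hR]; field_simp; ring
    have h6 : (R ^ m)⁻¹ ≤ Real.exp 1 := by
      rw [← inv_pow]
      refine (pow_le_pow_left₀ (by positivity) h5 m).trans ?_
      rw [← Real.exp_nat_mul]
      refine Real.exp_le_exp.2 ?_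
      rw [mul_one_div, div_le_one (by positivity)]
      linarith
    linarith [Real.exp_one_lt_d9]
  have e4 : ((m + 2).factorial : ℝ) = (m + 2) * ((m + 1) * m.factorial) := by
    rw [Nat.factorial_succ, Nat.factorial_succ]; push_cast; ring
  have e5 : (((m + 2 : ℕ) : ℝ)) ^ (κ - 1) = ((m : ℝ) + 2) ^ κ / (m + 2) := by
    push_cast
    rw [Real.rpow_sub_one hm2.ne']
  have hf0 : (((1 : ℂ) + 0) / (1 - 0)).re = 1 := by simp
  simp only [hf0, mul_one]
  rw [e1, e5, e4, div_eq_mul_inv]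
  calc (m.factorial : ℝ) * (ω⁻¹ ^ 2 * A * 2 ^ κ * ((m : ℝ) + 2) ^ κ * (1 - R ^ 2)⁻¹) * (R ^ m)⁻¹
      ≤ (m.factorial : ℝ) * (ω⁻¹ ^ 2 * A * 2 ^ κ * ((m : ℝ) + 2) ^ κ * (m + 2)) * 3 := by gcongr
    _ = m.factorial * (ω⁻¹ ^ 2 * A * 2 ^ κ * ((m : ℝ) + 2) ^ κ) * (3 * (m + 2)) := by ring
    _ ≤ m.factorial * (ω⁻¹ ^ 2 * A * 2 ^ κ * ((m : ℝ) + 2) ^ κ) * (6 * (m + 1)) := by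
        gcongr ?_ * ?_
        linarith
    _ = _ := by field_simp

/-- One more factor 1 - e^{-ωt} produces the difference of the integrals at u and at u + ω, and the
two products share all but their extreme factors. -/
lemma integral_exp_mul_one_sub_pow (hω : 0 < ω) (m : ℕ) : ∀ u : ℂ, 0 < u.re →
    IntegrableOn (fun t : ℝ => Complex.exp (-u * t) * (1 - Complex.exp (-(ω * t))) ^ m)
      (Set.Ioi 0) ∧
    ∫ t in Set.Ioi (0 : ℝ), Complex.exp (-u * t) * (1 - Complex.exp (-(ω * t))) ^ m =
      m.factorial * (ω : ℂ) ^ m / ∏ i ∈ Finset.range (m + 1), (u + i * ω) := by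
  induction m with
  | zero =>
    intro u hu
    have hu' : (-u).re < 0 := by simpa using hu
    refine ⟨by simpa using integrableOn_exp_mul_complex_Ioi hu' 0, ?_⟩
    have := integral_exp_mul_complex_Ioi hu' 0
    simp only [pow_zero, mul_one]
    rw [this]
    simp [neg_div_neg_eq]
  | succ m ih =>
    intro u hu
    have hu2 : 0 < (u + ω).re := by simp; linarith
    obtain ⟨i1, e1⟩ := ih u hu
    obtain ⟨i2, e2⟩ := ih (u + ω) hu2
    have hfun : (fun t : ℝ => Complex.exp (-u * t) * (1 - Complex.exp (-(ω * t))) ^ (m + 1)) =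
        fun t : ℝ => Complex.exp (-u * t) * (1 - Complex.exp (-(ω * t))) ^ m -
          Complex.exp (-(u + ω) * t) * (1 - Complex.exp (-(ω * t))) ^ m := by
      funext t
      rw [show -(u + ω) * t = -u * t + -(ω * t) by ring, Complex.exp_add, pow_succ]
      ring
    rw [hfun]
    refine ⟨i1.sub i2, ?_⟩
    rw [integral_sub i1 i2, e1, e2]
    have hne : ∀ (v : ℂ) (i : ℕ), 0 < v.re → v + i * ω ≠ 0 := fun v i hv h => by
      have h1 : 0 < (v + i * ω).re := by
        have : 0 ≤ (i : ℝ) * ω := by positivity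
        simp
        linarith
      simp [h] at h1
    set P := ∏ i ∈ Finset.range (m + 1), (u + i * ω) with hP
    set P' := ∏ i ∈ Finset.range (m + 1), (u + ω + i * ω) with hP'
    have hP0 : P ≠ 0 := Finset.prod_ne_zero_iff.2 fun i _ => hne u i hu
    have hP'0 : P' ≠ 0 := Finset.prod_ne_zero_iff.2 fun i _ => hne _ i hu2
    have h1 : ∏ i ∈ Finset.range (m + 1 + 1), (u + i * ω) = P * (u + (m + 1 : ℕ) * ω) :=
      Finset.prod_range_succ _ _
    have h2 : ∏ i ∈ Finset.range (m + 1 + 1), (u + i * ω) = P' * u := by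
      rw [Finset.prod_range_succ', hP']
      congr 1
      · refine Finset.prod_congr rfl fun i _ => ?_
        push_cast; ring
      · simp
    have hlast := hne u (m + 1) hu
    rw [h1]
    have h3 : P' * u = P * (u + (m + 1 : ℕ) * ω) := h2.symm.trans h1
    have hu0 : u ≠ 0 := fun h => by simp [h] at hu
    have h4 : P' = P * (u + (m + 1 : ℕ) * ω) / u := by
      rw [← h3]; field_simp
    rw [h4, Nat.factorial_succ]
    field_simp
    push_cast
    ring

lemma integral_norm_exp_mul_one_sub_pow (hω : 0 < ω) (m : ℕ) (u : ℂ) (hu : 0 < u.re) :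
    ∫ t in Set.Ioi (0 : ℝ), ‖Complex.exp (-u * t) * (1 - Complex.exp (-(ω * t))) ^ m‖ =
      m.factorial * ω ^ m / ∏ i ∈ Finset.range (m + 1), (u.re + i * ω) := by
  have h1 := (integral_exp_mul_one_sub_pow hω m (u.re : ℂ) (by simpa using hu)).2
  have h2 : ∫ t in Set.Ioi (0 : ℝ), Complex.exp (-(u.re : ℂ) * t) *
      (1 - Complex.exp (-(ω * t))) ^ m = ∫ t in Set.Ioi (0 : ℝ),
        ((‖Complex.exp (-u * t) * (1 - Complex.exp (-(ω * t))) ^ m‖ : ℝ) : ℂ) := by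
    refine setIntegral_congr_fun measurableSet_Ioi fun t ht => ?_
    have ht' : 0 ≤ 1 - Real.exp (-(ω * t)) := by
      have : Real.exp (-(ω * t)) ≤ 1 := Real.exp_le_one_iff.2 (by
        have := mul_pos hω (Set.mem_Ioi.1 ht)
        linarith)
      linarith
    have e1 : (1 - Complex.exp (-(ω * t))) = ((1 - Real.exp (-(ω * t)) : ℝ) : ℂ) := by push_cast; rfl
    rw [e1, norm_mul, norm_pow, Complex.norm_real, Real.norm_of_nonneg ht', Complex.norm_exp]
    push_cast
    congr 2
    simp
  rw [h2, integral_complex_ofReal] at h1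
  apply Complex.ofReal_injective
  rw [h1]
  push_cast
  rfl

/-- The general term is ω⁻¹ m^{σ/ω-1-s/ω} times Euler's sequence for Γ(s/ω). That sequence
converges, hence is bounded, and the exponent is below -1 exactly because σ < s. -/
lemma summable_rpow_mul_factorial_div (hω : 0 < ω) {σ s : ℝ} (hσs : σ < s) (hs : 0 < s) :
    Summable fun m : ℕ => (m : ℝ) ^ (σ / ω - 1) *
      (m.factorial * ω ^ m / ∏ i ∈ Finset.range (m + 1), (s + i * ω)) := by
  have hx : 0 < s / ω := by positivity
  obtain ⟨B, hB⟩ := (Real.GammaSeq_tendsto_Gamma (s / ω)).bddAbove_range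
  have hsum : Summable fun m : ℕ => (m : ℝ) ^ (σ / ω - 1 - s / ω) := by
    rw [Real.summable_nat_rpow]
    have : σ / ω < s / ω := by gcongr
    linarith
  have hprod : ∀ m : ℕ, ∏ i ∈ Finset.range (m + 1), (s + i * ω) =
      ω ^ (m + 1) * ∏ i ∈ Finset.range (m + 1), (s / ω + i) := fun m => by
    rw [← Finset.card_range (m + 1), ← Finset.prod_const, Finset.card_range,
      ← Finset.prod_mul_distrib]
    refine Finset.prod_congr rfl fun i _ => ?_
    field_simp
  refine Summable.of_norm_bounded_eventually_nat (g := fun m : ℕ =>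
    (ω⁻¹ * B) * (m : ℝ) ^ (σ / ω - 1 - s / ω)) (hsum.mul_left _) ?_
  filter_upwards [eventually_gt_atTop 0] with m hm
  have hm' : (0 : ℝ) < m := Nat.cast_pos.2 hm
  have hpp : 0 < ∏ i ∈ Finset.range (m + 1), (s / ω + (i : ℝ)) :=
    Finset.prod_pos fun i _ => by positivity
  rw [Real.norm_of_nonneg (by
    rw [hprod]
    positivity)]
  have h1 : Real.GammaSeq (s / ω) m ≤ B := hB ⟨m, rfl⟩
  have h2 : (m : ℝ) ^ (σ / ω - 1) * (m.factorial * ω ^ m /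
      ∏ i ∈ Finset.range (m + 1), (s + i * ω)) =
      ω⁻¹ * Real.GammaSeq (s / ω) m * (m : ℝ) ^ (σ / ω - 1 - s / ω) := by
    rw [hprod, Real.GammaSeq, Real.rpow_sub hm' _ (s / ω), pow_succ]
    have : (m : ℝ) ^ (s / ω) ≠ 0 := (Real.rpow_pos_of_pos hm' _).ne'
    field_simp
  rw [h2]
  gcongr

/-- The Taylor series of F ∘ `logVar` at s = 1 - e^{-ωt} is integrated against e^{-ut} term by term.
The majorant M is chosen before F and u, which later gives uniformity in the base point as well as
in u. -/
theorem hasSum_factorialSeries (hω : 0 < ω) {r : ℝ} (hr : Real.pi / (2 * ω) < r) {C σ s : ℝ}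
    (hσ : 0 ≤ σ) (hσs : σ < s) (hC : 0 ≤ C) :
    ∃ M : ℕ → ℝ, Summable M ∧ ∀ F : ℂ → ℂ, AnalyticOnNhd ℂ F {t | width t < r} →
      (∀ t, width t < r → ‖F t‖ ≤ C * Real.exp (σ * rePos t)) → ∀ u : ℂ, s ≤ u.re →
      (∀ m, ‖facCoeff ω F m 0 / ∏ i ∈ Finset.range (m + 1), (u + i * ω)‖ ≤ M m) ∧
      HasSum (fun m => facCoeff ω F m 0 / ∏ i ∈ Finset.range (m + 1), (u + i * ω)) (lap F u) := by
  have hs : 0 < s := hσ.trans_lt hσs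
  have hr0 : 0 < r := lt_trans (by positivity) hr
  obtain ⟨K, hK⟩ := exists_coeff_bound hω hr hσ hC
  set T : ℕ → ℝ := fun m => m.factorial * ω ^ m / ∏ i ∈ Finset.range (m + 1), (s + i * ω) with hT
  have hprodpos : ∀ (v : ℝ) (m : ℕ), 0 < v → 0 < ∏ i ∈ Finset.range (m + 1), (v + i * ω) :=
    fun v m hv => Finset.prod_pos fun i _ => by positivity
  -- `exists_coeff_bound` starts at index 2; the first two coefficients are bounded directly by
  -- Cauchy's estimate with radius r/2.
  set N : ℕ → ℝ := fun m => if m < 2 then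
    (∑ k ∈ Finset.range (m + 1), ω ^ (m - k) * (Nat.stirlingFirst m k : ℝ) *
      (k.factorial * (C * Real.exp (σ * (r / 2))) / (r / 2) ^ k)) * ω⁻¹ ^ m / m.factorial
    else K * (m : ℝ) ^ (σ / ω - 1) with hN
  have hω' : (ω : ℂ) ≠ 0 := Complex.ofReal_ne_zero.2 hω.ne'
  have hM : Summable fun m => N m * T m := by
    rw [← summable_nat_add_iff 2]
    have h1 := (summable_nat_add_iff 2).2
      ((summable_rpow_mul_factorial_div hω hσs hs).mul_left K)
    refine h1.congr fun m => ?_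
    simp only [hN, hT, if_neg (show ¬ m + 2 < 2 by omega)]
    ring
  refine ⟨fun m => N m * T m, hM, fun F hF hb u hu => ?_⟩
  have hu0 : 0 < u.re := hs.trans_le hu
  set g : ℕ → ℂ := fun m => (ω : ℂ)⁻¹ ^ m * facCoeff ω F m 0 / m.factorial with hg
  have hgN : ∀ m, ‖g m‖ ≤ N m := fun m => by
    simp only [hN, hg]
    split_ifs with h
    · rw [norm_div, norm_mul, norm_pow, norm_inv, Complex.norm_real, Complex.norm_natCast,
        Real.norm_of_nonneg hω.le, mul_comm (ω⁻¹ ^ m)]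
      gcongr
      have := norm_facCoeff_le (ω := ω) hω hσ (half_pos hr0) hC hF hb m (t := 0)
        (by simp [width, rePos]; exact hr0)
      simpa [rePos] using this
    · obtain ⟨k, rfl⟩ : ∃ k, m = k + 2 := ⟨m - 2, by omega⟩
      rw [norm_div, Complex.norm_natCast, div_le_iff₀ (by positivity)]
      exact (hK F hF hb k).trans (le_of_eq (by ring))
  have hterm : ∀ m, facCoeff ω F m 0 / ∏ i ∈ Finset.range (m + 1), (u + i * ω) =
      g m * (m.factorial * (ω : ℂ) ^ m / ∏ i ∈ Finset.range (m + 1), (u + i * ω)) := fun m => by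
    simp only [hg]
    have h1 : (m.factorial : ℂ) ≠ 0 := Nat.cast_ne_zero.2 m.factorial_ne_zero
    have h2 : (ω : ℂ)⁻¹ ^ m * facCoeff ω F m 0 / m.factorial * (m.factorial * (ω : ℂ) ^ m) =
        facCoeff ω F m 0 := by
      rw [inv_pow]; field_simp
    rw [mul_div_assoc', h2]
  have hTu : ∀ m : ℕ, m.factorial * ω ^ m / ∏ i ∈ Finset.range (m + 1), (u.re + i * ω) ≤ T m :=
    fun m => by
      simp only [hT]
      refine div_le_div_of_nonneg_left (by positivity) (hprodpos s m hs) ?_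
      exact Finset.prod_le_prod (fun i _ => by positivity) fun i _ => by linarith
  have hT0 : ∀ m, 0 ≤ T m := fun m => by
    have := hprodpos s m hs
    simp only [hT]; positivity
  refine ⟨fun m => ?_, ?_⟩
  · rw [hterm, norm_mul]
    refine mul_le_mul (hgN m) ?_ (norm_nonneg _) ((norm_nonneg _).trans (hgN m))
    rw [norm_div, norm_mul, norm_pow, Complex.norm_real, Complex.norm_natCast,
      Real.norm_of_nonneg hω.le, norm_prod]
    simp only [hT]
    refine div_le_div_of_nonneg_left (by positivity) (hprodpos s m hs) ?_
    refine Finset.prod_le_prod (fun i _ => by positivity) fun i _ => ?_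
    have h1 := Complex.re_le_norm (u + i * ω)
    simp at h1
    linarith
  · have hint : ∀ m, IntegrableOn (fun t : ℝ => g m *
        (Complex.exp (-u * t) * (1 - Complex.exp (-(ω * t))) ^ m)) (Set.Ioi 0) :=
      fun m => (integral_exp_mul_one_sub_pow hω m u hu0).1.const_mul _
    have hval : ∀ m, ∫ t in Set.Ioi (0 : ℝ), g m *
        (Complex.exp (-u * t) * (1 - Complex.exp (-(ω * t))) ^ m) =
        facCoeff ω F m 0 / ∏ i ∈ Finset.range (m + 1), (u + i * ω) := fun m => by
      rw [integral_const_mul, (integral_exp_mul_one_sub_pow hω m u hu0).2, hterm]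
    have hnorm : ∀ m, ∫ t in Set.Ioi (0 : ℝ), ‖g m *
        (Complex.exp (-u * t) * (1 - Complex.exp (-(ω * t))) ^ m)‖ ≤ N m * T m := fun m => by
      simp only [norm_mul (g m)]
      rw [integral_const_mul, integral_norm_exp_mul_one_sub_pow hω m u hu0]
      exact mul_le_mul (hgN m) (hTu m) (by have := hprodpos u.re m hu0; positivity)
        ((norm_nonneg _).trans (hgN m))
    have hsum := hasSum_integral_of_summable_integral_norm hint
      (Summable.of_nonneg_of_le (fun m => integral_nonneg fun t => norm_nonneg _) hnorm hM)
    simp only [hval] at hsum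
    suffices hlap : lap F u = ∫ t in Set.Ioi (0 : ℝ), ∑' m, g m *
        (Complex.exp (-u * t) * (1 - Complex.exp (-(ω * t))) ^ m) by rwa [hlap]
    unfold lap
    refine setIntegral_congr_fun measurableSet_Ioi fun t ht => ?_
    have ht0 : 0 < ω * t := mul_pos hω ht
    have hG : DifferentiableOn ℂ (fun s => F (logVar ω s)) (ball 0 1) := fun s hs =>
      ((hF _ ((width_logVar_lt hω hs).trans_le hr.le)).differentiableAt.comp s
        (hasDerivAt_logVar hs).differentiableAt).differentiableWithinAt
    have e1 : (1 - Complex.exp (-(ω * t))) = ((1 - Real.exp (-(ω * t)) : ℝ) : ℂ) := by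
      push_cast; rfl
    have hmem : (1 - Complex.exp (-(ω * t))) ∈ ball (0 : ℂ) 1 := by
      have h1 : Real.exp (-(ω * t)) < 1 := Real.exp_lt_one_iff.2 (by linarith)
      have h2 := Real.exp_pos (-(ω * t))
      rw [e1, mem_ball, dist_zero_right, Complex.norm_real, Real.norm_eq_abs, abs_lt]
      constructor <;> linarith
    have hTay := Complex.hasSum_taylorSeries_on_ball hG hmem
    have hlog : logVar ω (1 - Complex.exp (-(ω * t))) = t := by
      unfold logVar
      rw [sub_sub_cancel, show -((ω : ℂ) * t) = ((-(ω * t) : ℝ) : ℂ) by push_cast; ring,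
        ← Complex.ofReal_exp, ← Complex.ofReal_log (Real.exp_pos _).le, Real.log_exp]
      push_cast
      field_simp
    simp only [hlog] at hTay
    rw [← hTay.tsum_eq, ← tsum_mul_left]
    refine tsum_congr fun m => ?_
    rw [iteratedDeriv_comp_logVar hω hr.le hF m 0 (mem_ball_self one_pos)]
    simp only [hg, sub_zero, inv_one, one_pow, one_mul, smul_eq_mul]
    have : logVar ω 0 = 0 := by simp [logVar]
    rw [this]
    ring

end FactorialSeriesExpansion

end FactorialSeries
end

open Filter Topology Asymptotics MeasureTheory
noncomputable section
namespace FactorialSeries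

/-! ### The integrable weight and its primitive -/

section Weights

/-- The integrable weight `(1 + |x|)^{-(1 + ρ)}`. -/
def wb (ρ x : ℝ) : ℝ := (1 + |x|) ^ (-(1 + ρ))

/-- The primitive of `wb` that vanishes at `-∞`. -/
def wE (ρ x : ℝ) : ℝ := ∫ y in Set.Iic x, wb ρ y

variable {ρ : ℝ}

lemma wb_pos (x : ℝ) : 0 < wb ρ x := Real.rpow_pos_of_pos (by positivity) _

lemma wb_le_one (hρ : 0 < ρ) (x : ℝ) : wb ρ x ≤ 1 :=
  Real.rpow_le_one_of_one_le_of_nonpos (by linarith [abs_nonneg x]) (by linarith)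

lemma continuous_wb : Continuous (wb ρ) :=
  (continuous_const.add continuous_abs).rpow_const fun x =>
    Or.inl (by positivity : (1 + |x|) ≠ 0)

lemma integrable_wb (hρ : 0 < ρ) : Integrable (wb ρ) := by
  have := integrable_one_add_norm (E := ℝ) (μ := volume) (r := 1 + ρ) (by simp; linarith)
  exact this

/-- Peetre's inequality 1 + |x| ≤ (1 + |x+y|)(1 + |y|), raised to the power 1 + ρ. -/
lemma wb_add_le (hρ : 0 < ρ) (x y : ℝ) : wb ρ (x + y) ≤ (1 + |y|) ^ (1 + ρ) * wb ρ x := by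
  unfold wb
  rw [Real.rpow_neg (by positivity), Real.rpow_neg (by positivity), ← div_eq_mul_inv,
    le_div_iff₀ (by positivity), ← div_eq_inv_mul, div_le_iff₀ (by positivity),
    ← Real.mul_rpow (by positivity) (by positivity)]
  refine Real.rpow_le_rpow (by positivity) ?_ (by linarith)
  have : |x| ≤ |x + y| + |y| := by
    have := abs_sub (x + y) y
    rwa [add_sub_cancel_right] at this
  nlinarith [abs_nonneg y, abs_nonneg (x + y)]

lemma wE_nonneg (x : ℝ) : 0 ≤ wE ρ x := integral_nonneg fun y => (wb_pos y).le

lemma wE_mono (hρ : 0 < ρ) : Monotone (wE ρ) := fun _ _ hxy =>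
  setIntegral_mono_set (integrable_wb hρ).integrableOn
    (Eventually.of_forall fun z => (wb_pos z).le) (Set.Iic_subset_Iic.2 hxy).eventuallyLE

lemma wE_le (hρ : 0 < ρ) (x : ℝ) : wE ρ x ≤ ∫ y, wb ρ y :=
  setIntegral_le_integral (integrable_wb hρ) (Eventually.of_forall fun z => (wb_pos z).le)

lemma hasDerivAt_wE (hρ : 0 < ρ) (x : ℝ) : HasDerivAt (wE ρ) (wb ρ x) x := by
  have h1 : ∀ y, wE ρ y = wE ρ 0 + ∫ t in (0 : ℝ)..y, wb ρ t := fun y => by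
    have := intervalIntegral.integral_Iic_sub_Iic (a := (0 : ℝ)) (b := y)
      (integrable_wb hρ).integrableOn (integrable_wb hρ).integrableOn
    unfold wE
    rw [← this]; ring
  have h2 : HasDerivAt (fun y => wE ρ 0 + ∫ t in (0 : ℝ)..y, wb ρ t) (wb ρ x) x :=
    (intervalIntegral.integral_hasDerivAt_right ((continuous_wb).intervalIntegrable _ _)
      (continuous_wb.stronglyMeasurableAtFilter _ _) continuous_wb.continuousAt).const_add _
  exact h2.congr_of_eventuallyEq (Eventually.of_forall h1)

lemma continuous_wE (hρ : 0 < ρ) : Continuous (wE ρ) :=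
  continuous_iff_continuousAt.2 fun x => (hasDerivAt_wE hρ x).continuousAt

lemma tendsto_wE : Tendsto (wE ρ) atBot (𝓝 0) :=
  tendsto_integral_Iic_zero tendsto_id

lemma tendsto_wb (hρ : 0 < ρ) : Tendsto (wb ρ) atBot (𝓝 0) := by
  have h1 : Tendsto (fun x : ℝ => 1 + |x|) atBot atTop :=
    tendsto_atTop_add_const_left _ _ tendsto_abs_atBot_atTop
  exact (tendsto_rpow_neg_atTop (by linarith : 0 < 1 + ρ)).comp h1

end Weights

/-! ### Geometry of the characteristics -/

section Geometry

open Metric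

/-- The data of a set `Q` of base points, together with the constants that govern the domain of
the Borel transforms over the `d`-neighbourhood of `Q`. -/
structure Frame where
  n : ℕ
  ζ : ℂ
  a : ℝ
  d : ℝ
  ρ : ℝ
  Q : Set ℂ

/-- `ζ` is an `n`-th root of unity, `a` bounds the distances to the other `n`-th roots of unity from
below, and `Q` is stable under translation along the characteristic directions. -/
structure Frame.Valid (P : Frame) : Prop where
  two_le : 2 ≤ P.n
  root : P.ζ ^ P.n = 1
  a_pos : 0 < P.a
  sep : ∀ μ : ℂ, μ ^ P.n = 1 → μ ≠ P.ζ → P.a ≤ ‖μ - P.ζ‖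
  ρ_pos : 0 < P.ρ
  nonempty : P.Q.Nonempty
  char_mem : ∀ z ∈ P.Q, ∀ μ : ℂ, μ ^ P.n = 1 → μ ≠ P.ζ → ∀ τ : ℝ, 0 ≤ τ → z + τ / (μ - P.ζ) ∈ P.Q
  ray_mem : ∀ z ∈ P.Q, ∀ τ : ℝ, 0 ≤ τ → z - τ / P.ζ ∈ P.Q

lemma infDist_add_le_of_translate {Q : Set ℂ} (hQ : Q.Nonempty) {v : ℂ} (hv : ∀ z ∈ Q, z + v ∈ Q)
    (z : ℂ) : infDist (z + v) Q ≤ infDist z Q := by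
  refine le_of_forall_gt fun r hr => ?_
  obtain ⟨y, hy, hyr⟩ := (infDist_lt_iff hQ).1 hr
  exact (infDist_lt_iff hQ).2 ⟨y + v, hv y hy, by rwa [dist_add_right]⟩

/-- The Möbius map w ↦ 1/(w-1) sends the unit circle to the line Re = -1/2; here w = μ/ζ. So all
characteristic directions descend at the same rate in the coordinate Re(ζz). -/
lemma re_div_sub {ζ μ : ℂ} (hζ : ‖ζ‖ = 1) (hμ : ‖μ‖ = 1) (h : μ ≠ ζ) :
    (ζ / (μ - ζ)).re = -1 / 2 := by
  have h1 : Complex.normSq ζ = 1 := by rw [← Complex.sq_norm, hζ]; norm_num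
  have h2 : Complex.normSq μ = 1 := by rw [← Complex.sq_norm, hμ]; norm_num
  have h3 : Complex.normSq (μ - ζ) ≠ 0 := (Complex.normSq_pos.2 (sub_ne_zero.2 h)).ne'
  rw [Complex.div_re]
  rw [Complex.normSq_apply] at h1 h2
  have h4 : Complex.normSq (μ - ζ) = 2 - 2 * (μ.re * ζ.re + μ.im * ζ.im) := by
    rw [Complex.normSq_apply]
    simp only [Complex.sub_re, Complex.sub_im]
    linarith
  rw [← add_div, div_eq_div_iff h3 two_ne_zero, h4]
  simp only [Complex.sub_re, Complex.sub_im]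
  linear_combination (-2 : ℝ) * h1

namespace Frame

variable {P : Frame}

/-- The domain in which the Borel transforms are constructed. -/
def dom (P : Frame) : Set (ℂ × ℂ) := {p | width p.1 / P.a + infDist p.2 P.Q < P.d}

/-- The coordinate that decreases along all characteristic directions. -/
def prog (P : Frame) (z : ℂ) : ℝ := (P.ζ * z).re

/-- The exponential weight. -/
def wt (P : Frame) (K l σ : ℝ) (p : ℂ × ℂ) : ℝ :=
  Real.exp (K * wE P.ρ (P.prog p.2) + l * width p.1 + σ * rePos p.1)

lemma continuous_prog : Continuous P.prog :=
  Complex.continuous_re.comp (continuous_const.mul continuous_id)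

lemma wt_pos (K l σ : ℝ) (p : ℂ × ℂ) : 0 < P.wt K l σ p := Real.exp_pos _

lemma isOpen_dom : IsOpen P.dom :=
  isOpen_lt (((continuous_width.comp continuous_fst).div_const _).add
    ((continuous_infDist_pt _).comp continuous_snd)) continuous_const

lemma real_mem_dom {t : ℝ} (ht : 0 ≤ t) {z : ℂ} : ((t : ℂ), z) ∈ P.dom ↔ infDist z P.Q < P.d := by
  change width (t : ℂ) / P.a + infDist z P.Q < P.d ↔ _
  rw [width_ofReal ht, zero_div, zero_add]

namespace Valid

variable (hP : P.Valid)
include hP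

lemma norm_ζ : ‖P.ζ‖ = 1 :=
  Complex.norm_eq_one_of_pow_eq_one hP.root (by have := hP.two_le; omega)

lemma norm_root {μ : ℂ} (hμ : μ ^ P.n = 1) : ‖μ‖ = 1 :=
  Complex.norm_eq_one_of_pow_eq_one hμ (by have := hP.two_le; omega)

lemma ζ_ne : P.ζ ≠ 0 := norm_pos_iff.1 (by rw [hP.norm_ζ]; exact one_pos)

lemma infDist_lt {p : ℂ × ℂ} (hp : p ∈ P.dom) : infDist p.2 P.Q < P.d := by
  have : 0 ≤ width p.1 / P.a := div_nonneg (width_nonneg _) hP.a_pos.le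
  have h : width p.1 / P.a + infDist p.2 P.Q < P.d := hp
  linarith

lemma width_lt {p : ℂ × ℂ} (hp : p ∈ P.dom) : width p.1 < P.a * P.d := by
  have h : width p.1 / P.a + infDist p.2 P.Q < P.d := hp
  have h0 : 0 ≤ infDist p.2 P.Q := infDist_nonneg
  have := (div_lt_iff₀ hP.a_pos).1 (by linarith : width p.1 / P.a < P.d)
  linarith [mul_comm P.a P.d]

lemma abs_prog_le (z : ℂ) : |P.prog z| ≤ ‖z‖ := by
  have := Complex.abs_re_le_norm (P.ζ * z)
  rwa [norm_mul, hP.norm_ζ, one_mul] at this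

lemma prog_sub_le (z w : ℂ) : |P.prog z - P.prog w| ≤ ‖z - w‖ := by
  have := hP.abs_prog_le (z - w)
  unfold prog at this ⊢
  rwa [mul_sub, Complex.sub_re] at this

lemma prog_ray (z : ℂ) (τ : ℝ) : P.prog (z - τ / P.ζ) = P.prog z - τ := by
  unfold prog
  rw [mul_sub, mul_div_cancel₀ _ hP.ζ_ne, Complex.sub_re, Complex.ofReal_re]

lemma ray_mem_dom {p : ℂ × ℂ} (hp : p ∈ P.dom) {τ : ℝ} (hτ : 0 ≤ τ) :
    (p.1, p.2 - τ / P.ζ) ∈ P.dom := by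
  have h1 := infDist_add_le_of_translate hP.nonempty (v := -(τ / P.ζ))
    (fun z hz => by simpa [sub_eq_add_neg] using hP.ray_mem z hz τ hτ) p.2
  rw [← sub_eq_add_neg] at h1
  exact lt_of_le_of_lt (add_le_add_right h1 _) hp

/-- The part of the displacement that comes from `rePos t` is a translation under which Q is stable
and costs nothing. The remainder has length at most s·width(t)/a, since |μ - ζ| ≥ a. -/
lemma infDist_char {μ : ℂ} (hμ : μ ^ P.n = 1) (hne : μ ≠ P.ζ) (z t : ℂ) {s : ℝ} (hs : 0 ≤ s) :
    infDist (z + s * t / (μ - P.ζ)) P.Q ≤ infDist z P.Q + s * (width t / P.a) := by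
  have hT := mul_nonneg hs (rePos_nonneg t)
  have h1 := infDist_add_le_of_translate hP.nonempty
    (v := ((s * rePos t : ℝ) : ℂ) / (μ - P.ζ))
    (fun z hz => hP.char_mem z hz μ hμ hne _ hT) z
  have h2 := infDist_le_infDist_add_dist (s := P.Q) (x := z + s * t / (μ - P.ζ))
    (y := z + ((s * rePos t : ℝ) : ℂ) / (μ - P.ζ))
  have h3 : dist (z + s * t / (μ - P.ζ)) (z + ((s * rePos t : ℝ) : ℂ) / (μ - P.ζ))
      ≤ s * (width t / P.a) := by
    rw [dist_add_left, dist_eq_norm, ← sub_div, Complex.ofReal_mul, ← mul_sub, norm_div, norm_mul,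
      Complex.norm_real, Real.norm_of_nonneg hs, mul_div_assoc]
    have := hP.a_pos
    have h4 := hP.sep μ hμ hne
    have h5 : ‖t - rePos t‖ = width t := rfl
    rw [h5]
    have := width_nonneg t
    gcongr
  linarith

/-- This is the reason for the shape of `dom`: on the way to t = 0 the term width/a loses
s·width(t)/a, and by `infDist_char` the distance to Q gains no more than that. -/
lemma char_mem_dom {μ : ℂ} (hμ : μ ^ P.n = 1) (hne : μ ≠ P.ζ) {p : ℂ × ℂ} (hp : p ∈ P.dom)
    {s : ℝ} (hs : s ∈ Set.Icc (0 : ℝ) 1) :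
    ((1 - s) * p.1, p.2 + s * p.1 / (μ - P.ζ)) ∈ P.dom := by
  have h1 := hP.infDist_char hμ hne p.2 p.1 hs.1
  have h2 : width ((1 - s) * p.1) = (1 - s) * width p.1 := by
    have := width_smul (s := 1 - s) (by linarith [hs.2]) p.1
    push_cast at this
    exact this
  have h3 : width p.1 / P.a + infDist p.2 P.Q < P.d := hp
  change width ((1 - s) * p.1) / P.a + infDist (p.2 + s * p.1 / (μ - P.ζ)) P.Q < P.d
  rw [h2, mul_div_assoc]
  nlinarith

lemma smul_mem_dom {p : ℂ × ℂ} (hp : p ∈ P.dom) {r : ℝ} (hr : r ∈ Set.Icc (0 : ℝ) 1) :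
    ((r : ℂ) * p.1, p.2) ∈ P.dom := by
  have h3 : width p.1 / P.a + infDist p.2 P.Q < P.d := hp
  have : 0 ≤ width p.1 / P.a := div_nonneg (width_nonneg _) hP.a_pos.le
  change width (r * p.1) / P.a + infDist p.2 P.Q < P.d
  rw [width_smul hr.1, mul_div_assoc]
  nlinarith [hr.2]

/-- By `re_div_sub` the part `rePos t` contributes exactly -rePos(t)/2. The rest of t has modulus
width(t) and is responsible for the error y. -/
lemma prog_char {μ : ℂ} (hμ : μ ^ P.n = 1) (hne : μ ≠ P.ζ) (z t : ℂ) :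
    ∃ y : ℝ, |y| ≤ width t / P.a ∧ ∀ s : ℝ,
      P.prog (z + s * t / (μ - P.ζ)) = P.prog z + s * (y - rePos t / 2) := by
  refine ⟨((t - rePos t) * (P.ζ / (μ - P.ζ))).re, ?_, fun s => ?_⟩
  · refine (Complex.abs_re_le_norm _).trans ?_
    rw [norm_mul, norm_div, hP.norm_ζ, mul_one_div]
    exact div_le_div_of_nonneg_left (width_nonneg _) hP.a_pos (hP.sep μ hμ hne)
  · unfold prog
    have h1 : P.ζ * (z + s * t / (μ - P.ζ)) = P.ζ * z + (s : ℂ) *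
        ((t - rePos t) * (P.ζ / (μ - P.ζ)) + (rePos t : ℂ) * (P.ζ / (μ - P.ζ))) := by ring
    rw [h1, Complex.add_re, Complex.re_ofReal_mul, Complex.add_re, Complex.re_ofReal_mul,
      re_div_sub hP.norm_ζ (hP.norm_root hμ) hne]
    ring

end Valid

end Frame

end Geometry

end FactorialSeries
end

open Filter Topology Asymptotics MeasureTheory
noncomputable section
namespace FactorialSeries

/-! ### Integration along characteristics and rays in weighted norms -/

section Operators

open Metric

namespace Frame

variable {P : Frame} {K l σ M : ℝ} {G : ℂ × ℂ → ℂ}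

/-- Analytic functions with the exponential bound. -/
structure Bnd (P : Frame) (K l σ M : ℝ) (G : ℂ × ℂ → ℂ) : Prop where
  analytic : AnalyticOnNhd ℂ G P.dom
  le : ∀ p ∈ P.dom, ‖G p‖ ≤ M * P.wt K l σ p

/-- Analytic functions with the exponential bound and integrable decay in the second variable. -/
structure Src (P : Frame) (K l σ M : ℝ) (G : ℂ × ℂ → ℂ) : Prop where
  analytic : AnalyticOnNhd ℂ G P.dom
  le : ∀ p ∈ P.dom, ‖G p‖ ≤ M * (wb P.ρ (P.prog p.2) * P.wt K l σ p)

/-- The integral along the characteristic belonging to the root of unity `μ`. -/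
def charInt (P : Frame) (μ : ℂ) (G : ℂ × ℂ → ℂ) (p : ℂ × ℂ) : ℂ :=
  p.1 / (P.ζ - μ) * ∫ s in (0 : ℝ)..1, G ((1 - s) * p.1, p.2 + s * p.1 / (μ - P.ζ))

/-- The integral along the ray. -/
def rayInt (P : Frame) (G : ℂ × ℂ → ℂ) (p : ℂ × ℂ) : ℂ :=
  P.ζ⁻¹ * ∫ τ in Set.Ioi (0 : ℝ), G (p.1, p.2 - τ / P.ζ)

namespace Valid

variable (hP : P.Valid)
include hP

lemma wt_le (hK : 0 ≤ K) (hl : 0 ≤ l) {p : ℂ × ℂ} (hp : p ∈ P.dom) :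
    P.wt K l σ p ≤ Real.exp (K * (∫ y, wb P.ρ y) + l * (P.a * P.d)) * Real.exp (σ * rePos p.1) := by
  unfold wt
  rw [← Real.exp_add]
  have h1 := wE_le hP.ρ_pos (P.prog p.2)
  have h2 := (hP.width_lt hp).le
  gcongr

lemma wt_ray_le (hK : 0 ≤ K) {τ : ℝ} (hτ : 0 ≤ τ) (p : ℂ × ℂ) :
    P.wt K l σ (p.1, p.2 - τ / P.ζ) ≤ P.wt K l σ p := by
  unfold wt
  simp only [hP.prog_ray]
  have := wE_mono hP.ρ_pos (by linarith : P.prog p.2 - τ ≤ P.prog p.2)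
  gcongr

lemma exists_nhds_norm_le (hK : 0 ≤ K) (hl : 0 ≤ l) (hσ : 0 ≤ σ) (p : ℂ × ℂ) :
    ∃ C : ℝ, 0 ≤ C ∧ ∃ V ∈ 𝓝 p, ∀ q ∈ V, q ∈ P.dom → ∀ s ∈ Set.Icc (0 : ℝ) 1, ∀ z,
      ((s * q.1, z) : ℂ × ℂ) ∈ P.dom → P.wt K l σ (s * q.1, z) ≤ C := by
  refine ⟨Real.exp (K * (∫ y, wb P.ρ y) + l * (P.a * P.d)) * Real.exp (σ * (rePos p.1 + 1)),
    by positivity, {q | rePos q.1 < rePos p.1 + 1},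
    (isOpen_lt (continuous_rePos.comp continuous_fst) continuous_const).mem_nhds (lt_add_one (rePos p.1)),
    fun q hq hqd s hs z hz => (hP.wt_le hK hl hz).trans ?_⟩
  gcongr
  rw [rePos_smul hs.1]
  have h1 := rePos_nonneg q.1
  have h2 : rePos q.1 < rePos p.1 + 1 := hq
  nlinarith [hs.2]

lemma char_path_continuousOn {G : ℂ × ℂ → ℂ} (hG : AnalyticOnNhd ℂ G P.dom) {μ : ℂ}
    (hμ : μ ^ P.n = 1) (hne : μ ≠ P.ζ) {p : ℂ × ℂ} (hp : p ∈ P.dom) :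
    ContinuousOn (fun s : ℝ => G ((1 - s) * p.1, p.2 + s * p.1 / (μ - P.ζ))) (Set.Icc 0 1) := by
  refine hG.continuousOn.comp (f := fun s : ℝ =>
    (((1 - s) * p.1, p.2 + s * p.1 / (μ - P.ζ)) : ℂ × ℂ)) ?_ fun s hs => hP.char_mem_dom hμ hne hp hs
  fun_prop

/-- Along the characteristic the weight is exp φ(s), and |t| times the decay factor is at most
(2/K)(-φ'(s)). The integrand is thus dominated by a multiple of the exact derivative of -exp φ,
which removes the length |t| of the path and leaves the gain 1/K. -/
lemma bnd_charInt (hK : 0 < K) (hl : K * (1 / P.a + 1 / 2) ≤ l) (hσ : 0 ≤ σ) (hM : 0 ≤ M)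
    (hG : P.Src K l σ M G) {μ : ℂ} (hμ : μ ^ P.n = 1) (hne : μ ≠ P.ζ) :
    P.Bnd K l σ (2 / (P.a * K) * M) (P.charInt μ G) := by
  have ha := hP.a_pos
  have hl0 : 0 ≤ l := le_trans (by positivity) hl
  have hsep := hP.sep μ hμ hne
  constructor
  · have h0 : AnalyticOnNhd ℂ (fun p : ℂ × ℂ => ∫ s in Set.Ioc (0 : ℝ) 1,
        G ((1 - s) * p.1, p.2 + s * p.1 / (μ - P.ζ))) P.dom := by
      refine analyticOnNhd_integral isOpen_dom ?_ ?_ ?_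
      · refine (ae_restrict_iff' measurableSet_Ioc).2 (Eventually.of_forall fun s hs p hp => ?_)
        have h1 := hG.analytic _ (hP.char_mem_dom hμ hne hp (Set.Ioc_subset_Icc_self hs))
        have h2 : AnalyticAt ℂ (fun p : ℂ × ℂ =>
          (((1 - s) * p.1, p.2 + s * p.1 / (μ - P.ζ)) : ℂ × ℂ)) p :=
          (analyticAt_const.mul analyticAt_fst).prod (analyticAt_snd.add
            ((analyticAt_const.mul analyticAt_fst).div analyticAt_const (sub_ne_zero.2 hne)))
        exact AnalyticAt.fun_comp h1 h2
      · intro p hp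
        exact ((hP.char_path_continuousOn hG.analytic hμ hne hp).mono
          Set.Ioc_subset_Icc_self).aestronglyMeasurable measurableSet_Ioc
      · intro p hp
        obtain ⟨C, hC, V, hV, hVC⟩ := hP.exists_nhds_norm_le hK.le hl0 hσ p
        refine ⟨fun _ => M * (1 * C), integrable_const _, V ∩ P.dom,
          inter_mem hV (isOpen_dom.mem_nhds hp), ?_⟩
        refine (ae_restrict_iff' measurableSet_Ioc).2 (Eventually.of_forall fun s hs q hq => ?_)
        have hmem := hP.char_mem_dom hμ hne hq.2 (Set.Ioc_subset_Icc_self hs)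
        refine (hG.le _ hmem).trans ?_
        have h1 := hVC q hq.1 hq.2 (1 - s) ⟨by linarith [hs.2], by linarith [hs.1]⟩
          (q.2 + s * q.1 / (μ - P.ζ)) (by push_cast; exact hmem)
        push_cast at h1
        have h2 := wb_le_one hP.ρ_pos (P.prog (q.2 + s * q.1 / (μ - P.ζ)))
        have h3 := (wt_pos (P := P) K l σ ((1 - s) * q.1, q.2 + s * q.1 / (μ - P.ζ))).le
        exact mul_le_mul_of_nonneg_left (mul_le_mul h2 h1 h3 zero_le_one) hM
    intro p hp
    have h1 := h0 p hp
    simp only [← intervalIntegral.integral_of_le zero_le_one] at h1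
    exact (analyticAt_fst.div analyticAt_const (sub_ne_zero.2 hne.symm)).mul h1
  · intro p hp
    obtain ⟨y, hy, hprog⟩ := hP.prog_char hμ hne p.2 p.1
    set x₀ := P.prog p.2 with hx₀
    set w := width p.1 with hw
    set T := rePos p.1 with hT
    have hw0 : 0 ≤ w := width_nonneg _
    have hT0 : 0 ≤ T := rePos_nonneg _
    set φ : ℝ → ℝ := fun s => K * wE P.ρ (x₀ + s * (y - T / 2)) + l * ((1 - s) * w)
      + σ * ((1 - s) * T) with hφ
    set φ' : ℝ → ℝ := fun s => K * (wb P.ρ (x₀ + s * (y - T / 2)) * (y - T / 2)) - l * w - σ * T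
      with hφ'
    have hder : ∀ s, HasDerivAt (fun s => -Real.exp (φ s)) (-(Real.exp (φ s) * φ' s)) s := fun s => by
      refine HasDerivAt.neg (HasDerivAt.exp ?_)
      have h1 : HasDerivAt (fun s : ℝ => x₀ + s * (y - T / 2)) (y - T / 2) s := by
        simpa using ((hasDerivAt_id s).mul_const (y - T / 2)).const_add x₀
      have h2 := ((hasDerivAt_wE hP.ρ_pos (x₀ + s * (y - T / 2))).comp s h1).const_mul K
      have h3 : HasDerivAt (fun s : ℝ => (1 - s)) (-1) s := by
        simpa using (hasDerivAt_id s).const_sub 1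
      exact ((h2.add ((h3.mul_const w).const_mul l)).add
        ((h3.mul_const T).const_mul σ)).congr_deriv (by simp only [hφ']; ring)
    have hcE : Continuous φ := by
      have := continuous_wE hP.ρ_pos
      simp only [hφ]; fun_prop
    have hcE' : Continuous φ' := by
      have := continuous_wb (ρ := P.ρ)
      simp only [hφ']; fun_prop
    have hpt : ∀ s ∈ Set.Icc (0 : ℝ) 1,
        ‖p.1‖ * ‖G ((1 - s) * p.1, p.2 + s * p.1 / (μ - P.ζ))‖ ≤
          2 / K * M * -(Real.exp (φ s) * φ' s) := fun s hs => by
      have h1 := hG.le _ (hP.char_mem_dom hμ hne hp hs)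
      have hwt : P.wt K l σ ((1 - s) * p.1, p.2 + s * p.1 / (μ - P.ζ)) = Real.exp (φ s) := by
        have e1 := width_smul (s := 1 - s) (by linarith [hs.2]) p.1
        have e2 := rePos_smul (s := 1 - s) (by linarith [hs.2]) p.1
        push_cast at e1 e2
        simp only [wt, hφ, hprog, e1, e2, ← hw, ← hT]
      rw [hwt] at h1
      simp only [hprog] at h1
      set b := wb P.ρ (x₀ + s * (y - T / 2)) with hb
      have hb0 : 0 < b := wb_pos _
      have hb1 : b ≤ 1 := wb_le_one hP.ρ_pos _
      -- The fall T/2 of `prog` yields K b T/2. The possible rise y ≤ w/a is paid for by l w, since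
      -- l ≥ K(1/a + 1/2) and b ≤ 1; what is left over supplies K b w/2.
      have h2 : K / 2 * (b * (T + w)) ≤ -φ' s := by
        simp only [hφ', ← hb]
        have h3 : y ≤ w / P.a := (le_abs_self y).trans hy
        have h4 : K * (b * y) ≤ K * (b * (w / P.a)) := by gcongr
        have h5 : K * (1 / P.a + 1 / 2) * w ≤ l * w := by gcongr
        have h6 : K * (1 / P.a + 1 / 2) * w * b ≤ K * (1 / P.a + 1 / 2) * w :=
          mul_le_of_le_one_right (by positivity) hb1
        have h7 : 0 ≤ σ * T := by positivity
        have h8 : K * (b * (w / P.a)) + K / 2 * (b * w) = K * (1 / P.a + 1 / 2) * w * b := by ring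
        linarith
      have hn := norm_le_rePos_add_width p.1
      rw [← hT, ← hw] at hn
      calc ‖p.1‖ * ‖G ((1 - s) * p.1, p.2 + s * p.1 / (μ - P.ζ))‖
          ≤ (T + w) * (M * (b * Real.exp (φ s))) := by gcongr
        _ = 2 / K * M * (Real.exp (φ s) * (K / 2 * (b * (T + w)))) := by field_simp
        _ ≤ 2 / K * M * (Real.exp (φ s) * -φ' s) := by gcongr
        _ = _ := by ring
    have hint : ‖∫ s in (0 : ℝ)..1, p.1 * G ((1 - s) * p.1, p.2 + s * p.1 / (μ - P.ζ))‖ ≤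
        2 / K * M * P.wt K l σ p := by
      have h1 : ‖∫ s in (0 : ℝ)..1, p.1 * G ((1 - s) * p.1, p.2 + s * p.1 / (μ - P.ζ))‖ ≤
          ∫ s in (0 : ℝ)..1, 2 / K * M * -(Real.exp (φ s) * φ' s) := by
        refine intervalIntegral.norm_integral_le_of_norm_le zero_le_one
          (Eventually.of_forall fun s hs => ?_) ?_
        · rw [norm_mul]
          exact hpt s (Set.Ioc_subset_Icc_self hs)
        · exact Continuous.intervalIntegrable (by fun_prop) _ _
      refine h1.trans ?_
      rw [intervalIntegral.integral_const_mul,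
        intervalIntegral.integral_eq_sub_of_hasDerivAt (fun s _ => hder s)
          (Continuous.intervalIntegrable (by fun_prop) _ _)]
      have h2 : Real.exp (φ 0) = P.wt K l σ p := by
        simp only [hφ, wt]
        simp [hx₀, hw, hT]
      rw [h2]
      have := Real.exp_pos (φ 1)
      gcongr
      linarith
    rw [intervalIntegral.integral_const_mul] at hint
    unfold charInt
    rw [div_mul_eq_mul_div, norm_div, norm_sub_rev]
    calc ‖p.1 * ∫ s in (0 : ℝ)..1, G ((1 - s) * p.1, p.2 + s * p.1 / (μ - P.ζ))‖ / ‖μ - P.ζ‖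
        ≤ (2 / K * M * P.wt K l σ p) / P.a := by
          have := (norm_nonneg _).trans hint
          gcongr
      _ = _ := by field_simp

lemma norm_src_ray_le (hK : 0 ≤ K) (hM : 0 ≤ M) (hG : P.Src K l σ M G) {p : ℂ × ℂ}
    (hp : p ∈ P.dom) {τ : ℝ} (hτ : 0 ≤ τ) :
    ‖G (p.1, p.2 - τ / P.ζ)‖ ≤ M * (wb P.ρ (P.prog p.2 - τ) * P.wt K l σ p) := by
  refine (hG.le _ (hP.ray_mem_dom hp hτ)).trans ?_
  rw [hP.prog_ray]
  have := hP.wt_ray_le (l := l) (σ := σ) hK hτ p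
  have := (wb_pos (ρ := P.ρ) (P.prog p.2 - τ)).le
  gcongr

lemma ray_path_aesm {G : ℂ × ℂ → ℂ} (hG : AnalyticOnNhd ℂ G P.dom) {p : ℂ × ℂ} (hp : p ∈ P.dom) :
    AEStronglyMeasurable (fun τ : ℝ => G (p.1, p.2 - τ / P.ζ)) (volume.restrict (Set.Ioi 0)) := by
  refine ContinuousOn.aestronglyMeasurable ?_ measurableSet_Ioi
  refine hG.continuousOn.comp (f := fun τ : ℝ => ((p.1, p.2 - τ / P.ζ) : ℂ × ℂ)) (by fun_prop)
    fun τ hτ => hP.ray_mem_dom hp (le_of_lt hτ)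

lemma integrable_wb_sub (x : ℝ) : IntegrableOn (fun τ => wb P.ρ (x - τ)) (Set.Ioi 0) :=
  ((integrable_wb hP.ρ_pos).comp_sub_left x).integrableOn

lemma integrableOn_ray (hK : 0 ≤ K) (hM : 0 ≤ M) (hG : P.Src K l σ M G) {p : ℂ × ℂ}
    (hp : p ∈ P.dom) : IntegrableOn (fun τ : ℝ => G (p.1, p.2 - τ / P.ζ)) (Set.Ioi 0) := by
  refine Integrable.mono' (g := fun τ => M * (wb P.ρ (P.prog p.2 - τ) * P.wt K l σ p))
    (((hP.integrable_wb_sub _).mul_const _).const_mul _) (hP.ray_path_aesm hG.analytic hp) ?_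
  exact (ae_restrict_iff' measurableSet_Ioi).2 (Eventually.of_forall fun τ hτ =>
    hP.norm_src_ray_le hK hM hG hp (le_of_lt hτ))

/-- `prog` falls at unit rate along the ray, so the decay factor times exp(K `wE`) is, up to the
factor 1/K, an exact derivative in τ. -/
lemma bnd_rayInt (hK : 0 < K) (hl : 0 ≤ l) (hσ : 0 ≤ σ) (hM : 0 ≤ M)
    (hG : P.Src K l σ M G) : P.Bnd K l σ (1 / K * M) (P.rayInt G) := by
  constructor
  · have h0 : AnalyticOnNhd ℂ (fun p : ℂ × ℂ => ∫ τ in Set.Ioi (0 : ℝ),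
        G (p.1, p.2 - τ / P.ζ)) P.dom := by
      refine analyticOnNhd_integral isOpen_dom ?_ (fun p hp => hP.ray_path_aesm hG.analytic hp) ?_
      · refine (ae_restrict_iff' measurableSet_Ioi).2 (Eventually.of_forall fun τ hτ p hp => ?_)
        have h1 := hG.analytic _ (hP.ray_mem_dom hp (le_of_lt hτ))
        have h2 : AnalyticAt ℂ (fun p : ℂ × ℂ => ((p.1, p.2 - τ / P.ζ) : ℂ × ℂ)) p :=
          analyticAt_fst.prod (analyticAt_snd.sub analyticAt_const)
        exact AnalyticAt.fun_comp h1 h2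
      · intro p hp
        obtain ⟨C, hC, V, hV, hVC⟩ := hP.exists_nhds_norm_le hK.le hl hσ p
        refine ⟨fun τ => M * ((2 ^ (1 + P.ρ) * wb P.ρ (P.prog p.2 - τ)) * C),
          (((hP.integrable_wb_sub _).const_mul _).mul_const _).const_mul _,
          V ∩ (P.dom ∩ {q | ‖q.2 - p.2‖ < 1}),
          inter_mem hV (inter_mem (isOpen_dom.mem_nhds hp) ((isOpen_lt (by fun_prop)
            continuous_const).mem_nhds (by simp))), ?_⟩
        refine (ae_restrict_iff' measurableSet_Ioi).2 (Eventually.of_forall fun τ hτ q hq => ?_)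
        refine (hP.norm_src_ray_le hK.le hM hG hq.2.1 (le_of_lt hτ)).trans ?_
        have h1 := hVC q hq.1 hq.2.1 1 ⟨zero_le_one, le_rfl⟩ q.2 (by simpa using hq.2.1)
        simp only [Complex.ofReal_one, one_mul] at h1
        have h2 := wb_add_le hP.ρ_pos (P.prog p.2 - τ) (P.prog q.2 - P.prog p.2)
        have h3 : |P.prog q.2 - P.prog p.2| ≤ 1 := (hP.prog_sub_le _ _).trans (le_of_lt hq.2.2)
        have h4 : (1 + |P.prog q.2 - P.prog p.2|) ^ (1 + P.ρ) ≤ 2 ^ (1 + P.ρ) :=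
          Real.rpow_le_rpow (by positivity) (by linarith) (by linarith [hP.ρ_pos])
        have h5 := (wb_pos (ρ := P.ρ) (P.prog p.2 - τ)).le
        have h6 := (wt_pos (P := P) K l σ q).le
        have h7 : wb P.ρ (P.prog q.2 - τ) ≤ 2 ^ (1 + P.ρ) * wb P.ρ (P.prog p.2 - τ) := by
          have e : P.prog p.2 - τ + (P.prog q.2 - P.prog p.2) = P.prog q.2 - τ := by ring
          rw [e] at h2
          exact h2.trans (by gcongr)
        exact mul_le_mul_of_nonneg_left (mul_le_mul h7 h1 h6 (by positivity)) hM
    exact fun p hp => analyticAt_const.mul (h0 p hp)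
  · intro p hp
    unfold rayInt
    rw [norm_mul, norm_inv, hP.norm_ζ, inv_one, one_mul]
    set x₀ := P.prog p.2 with hx₀
    set A := l * width p.1 + σ * rePos p.1 with hA
    have hder : ∀ τ ∈ Set.Ici (0 : ℝ), HasDerivAt
        (fun τ => -(1 / K * M * Real.exp (K * wE P.ρ (x₀ - τ) + A)))
        (M * (wb P.ρ (x₀ - τ) * Real.exp (K * wE P.ρ (x₀ - τ) + A))) τ := fun τ _ => by
      have h1 := ((hasDerivAt_wE hP.ρ_pos (x₀ - τ)).comp τ
        ((hasDerivAt_id τ).const_sub x₀)).const_mul K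
      exact (((h1.add_const A).exp.const_mul (1 / K * M)).neg).congr_deriv (by
        simp only [Function.comp]
        field_simp)
    have hlim : Tendsto (fun τ => -(1 / K * M * Real.exp (K * wE P.ρ (x₀ - τ) + A))) atTop
        (𝓝 (-(1 / K * M * Real.exp (K * 0 + A)))) := by
      have h1 : Tendsto (fun τ => wE P.ρ (x₀ - τ)) atTop (𝓝 0) :=
        tendsto_wE.comp (tendsto_atBot_add_const_left _ x₀ tendsto_neg_atTop_atBot)
      exact ((Real.continuous_exp.tendsto _).comp
        ((h1.const_mul K).add_const A)).const_mul _ |>.neg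
    have hbd : ∀ τ ∈ Set.Ioi (0 : ℝ), ‖G (p.1, p.2 - τ / P.ζ)‖ ≤
        M * (wb P.ρ (x₀ - τ) * Real.exp (K * wE P.ρ (x₀ - τ) + A)) := fun τ hτ => by
      have h1 := hG.le _ (hP.ray_mem_dom hp (le_of_lt hτ))
      simpa only [wt, hP.prog_ray, hA, ← add_assoc] using h1
    have hi : IntegrableOn (fun τ => M * (wb P.ρ (x₀ - τ) *
        Real.exp (K * wE P.ρ (x₀ - τ) + A))) (Set.Ioi 0) := by
      refine integrableOn_Ioi_deriv_of_nonneg' hder (fun τ _ => ?_) hlim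
      have := (wb_pos (ρ := P.ρ) (x₀ - τ)).le
      positivity
    refine (norm_integral_le_of_norm_le hi
      ((ae_restrict_iff' measurableSet_Ioi).2 (Eventually.of_forall hbd))).trans ?_
    rw [integral_Ioi_of_hasDerivAt_of_tendsto' hder hi hlim]
    have h2 : P.wt K l σ p = Real.exp (K * wE P.ρ (x₀ - 0) + A) := by
      simp only [wt, hA, hx₀, sub_zero, add_assoc]
    rw [h2]
    have : 0 ≤ 1 / K * M * Real.exp (K * 0 + A) := by positivity
    linarith

end Valid

end Frame

end Operators

end FactorialSeries
end

open Filter Topology Asymptotics MeasureTheory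
noncomputable section
namespace FactorialSeries

/-! ### The integral operator for the source -/

section FixedPoint

open Metric

/-- A series is an integral against the counting measure, so `analyticOnNhd_integral` applies. -/
theorem analyticOnNhd_tsum {O : Set (ℂ × ℂ)} (hO : IsOpen O) {f : ℕ → ℂ × ℂ → ℂ}
    (hf : ∀ m, AnalyticOnNhd ℂ (f m) O)
    (hb : ∀ p ∈ O, ∃ b : ℕ → ℝ, Summable b ∧ ∃ V ∈ 𝓝 p, ∀ m, ∀ q ∈ V, ‖f m q‖ ≤ b m) :
    AnalyticOnNhd ℂ (fun p => ∑' m, f m p) O := by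
  have h1 := analyticOnNhd_integral (μ := (Measure.count : Measure ℕ)) hO (F := f)
    (Eventually.of_forall hf) (fun p _ => (measurable_of_countable _).aestronglyMeasurable)
    (fun p hp => by
      obtain ⟨b, hbs, V, hV, hbV⟩ := hb p hp
      refine ⟨fun m => |b m|, integrable_count_iff.2 (by simpa using hbs.norm), V, hV,
        Eventually.of_forall fun m q hq => (hbV m q hq).trans (le_abs_self _)⟩)
  intro p hp
  refine (h1 p hp).congr ?_
  obtain ⟨b, hbs, V, hV, hbV⟩ := hb p hp
  filter_upwards [hV] with q hq
  rw [integral_countable (integrable_count_iff.2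
    (Summable.of_nonneg_of_le (fun m => norm_nonneg _) (fun m => hbV m q hq) hbs))]
  simp

/-- Partial derivative in the first variable. -/
def dFst (f : ℂ × ℂ → ℂ) (p : ℂ × ℂ) : ℂ := deriv (fun t => f (t, p.2)) p.1

/-- Partial derivative in the second variable. -/
def dSnd (f : ℂ × ℂ → ℂ) (p : ℂ × ℂ) : ℂ := deriv (fun z => f (p.1, z)) p.2

lemma hasDerivAt_fst {f : ℂ × ℂ → ℂ} {p : ℂ × ℂ} (hf : AnalyticAt ℂ f p) :
    HasDerivAt (fun t => f (t, p.2)) (fderiv ℂ f p (1, 0)) p.1 := by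
  have h1 : HasFDerivAt f (fderiv ℂ f p) (p.1, p.2) := hf.differentiableAt.hasFDerivAt
  have h2 : HasDerivAt (fun t : ℂ => (t, p.2)) ((1, 0) : ℂ × ℂ) p.1 :=
    (hasDerivAt_id p.1).prodMk (hasDerivAt_const p.1 p.2)
  exact h1.comp_hasDerivAt p.1 h2

lemma hasDerivAt_snd {f : ℂ × ℂ → ℂ} {p : ℂ × ℂ} (hf : AnalyticAt ℂ f p) :
    HasDerivAt (fun z => f (p.1, z)) (fderiv ℂ f p (0, 1)) p.2 := by
  have h1 : HasFDerivAt f (fderiv ℂ f p) (p.1, p.2) := hf.differentiableAt.hasFDerivAt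
  have h2 : HasDerivAt (fun t : ℂ => (p.1, t)) ((0, 1) : ℂ × ℂ) p.2 :=
    (hasDerivAt_const p.2 p.1).prodMk (hasDerivAt_id p.2)
  exact h1.comp_hasDerivAt p.2 h2

lemma analyticAt_dFst {f : ℂ × ℂ → ℂ} {p : ℂ × ℂ} (hf : AnalyticAt ℂ f p) :
    AnalyticAt ℂ (dFst f) p := by
  have h1 : AnalyticAt ℂ (fun q => fderiv ℂ f q (1, 0)) p :=
    ((ContinuousLinearMap.apply ℂ ℂ ((1, 0) : ℂ × ℂ)).analyticAt _).comp hf.fderiv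
  refine h1.congr ?_
  filter_upwards [hf.eventually_analyticAt] with q hq
  exact (hasDerivAt_fst hq).deriv.symm

lemma analyticAt_dSnd {f : ℂ × ℂ → ℂ} {p : ℂ × ℂ} (hf : AnalyticAt ℂ f p) :
    AnalyticAt ℂ (dSnd f) p := by
  have h1 : AnalyticAt ℂ (fun q => fderiv ℂ f q (0, 1)) p :=
    ((ContinuousLinearMap.apply ℂ ℂ ((0, 1) : ℂ × ℂ)).analyticAt _).comp hf.fderiv
  refine h1.congr ?_
  filter_upwards [hf.eventually_analyticAt] with q hq
  exact (hasDerivAt_snd hq).deriv.symm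

namespace Frame

variable {P : Frame} {K l σ σ' M : ℝ} {G : ℂ × ℂ → ℂ}

open Classical in
/-- The operator that inverts `ζ - μ + u⁻¹ d/dz`, divided by `u`, in the Borel plane. -/
def transport (P : Frame) (μ : ℂ) (G : ℂ × ℂ → ℂ) : ℂ × ℂ → ℂ :=
  if μ = P.ζ then P.rayInt G else P.charInt μ G

/-- The set of `n`-th roots of unity. -/
def roots (P : Frame) : Finset ℂ := Polynomial.nthRootsFinset P.n (1 : ℂ)

/-- The Borel plane counterpart of `(ζ + u⁻¹ d/dz)^k` applied to the solution with source `G`. -/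
def Y (P : Frame) (G : ℂ × ℂ → ℂ) (k : ℕ) (p : ℂ × ℂ) : ℂ :=
  (1 / (P.n : ℂ)) * ∑ μ ∈ P.roots, μ ^ (k + 1) * P.transport μ G p

/-- Convolution in the first variable. -/
def conv (Φ H : ℂ × ℂ → ℂ) (p : ℂ × ℂ) : ℂ :=
  p.1 * ∫ r in (0 : ℝ)..1, Φ ((1 - r) * p.1, p.2) * H (r * p.1, p.2)

/-- The product domain that contains `P.dom`. -/
def box (P : Frame) : Set (ℂ × ℂ) := {p | width p.1 < P.a * P.d ∧ infDist p.2 P.Q < P.d}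

/-- Functions on the box with exponential growth in the first and integrable decay in the second
variable. -/
structure Potential (P : Frame) (c σ : ℝ) (Φ : ℂ × ℂ → ℂ) : Prop where
  analytic : AnalyticOnNhd ℂ Φ P.box
  le : ∀ p ∈ P.box, ‖Φ p‖ ≤ c * (wb P.ρ (P.prog p.2) * Real.exp (σ * rePos p.1))

/-- The linear part of the integral equation for the source. -/
def feedback (P : Frame) (Ψ : ℕ → ℂ × ℂ → ℂ) (G : ℂ × ℂ → ℂ) (p : ℂ × ℂ) : ℂ :=
  ∑ k ∈ Finset.range (P.n - 1), (Ψ k (0, p.2) * P.Y G k p + conv (dFst (Ψ k)) (P.Y G k) p)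

lemma Src.sub {M' : ℝ} {G' : ℂ × ℂ → ℂ} (h : P.Src K l σ M G) (h' : P.Src K l σ M' G') :
    P.Src K l σ (M + M') (fun p => G p - G' p) :=
  ⟨fun p hp => (h.analytic p hp).sub (h'.analytic p hp), fun p hp => by
    refine (norm_sub_le _ _).trans ?_
    rw [add_mul]
    exact add_le_add (h.le p hp) (h'.le p hp)⟩

lemma Bnd.mono {M' : ℝ} (h : P.Bnd K l σ M G) (hM : M ≤ M') : P.Bnd K l σ M' G :=
  ⟨h.analytic, fun p hp => (h.le p hp).trans (by
    have := (wt_pos (P := P) K l σ p).le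
    gcongr)⟩

lemma Src.mono {M' : ℝ} (h : P.Src K l σ M G) (hM : M ≤ M') : P.Src K l σ M' G :=
  ⟨h.analytic, fun p hp => (h.le p hp).trans (by
    have := (wt_pos (P := P) K l σ p).le
    have := (wb_pos (ρ := P.ρ) (P.prog p.2)).le
    gcongr)⟩

lemma smul_mem_box {p : ℂ × ℂ} (hp : p ∈ P.box) {r : ℝ} (hr : r ∈ Set.Icc (0 : ℝ) 1) :
    ((r : ℂ) * p.1, p.2) ∈ P.box := by
  refine ⟨?_, hp.2⟩
  change width (r * p.1) < _
  rw [width_smul hr.1]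
  nlinarith [hr.2, width_nonneg p.1, hp.1]

namespace Valid

variable (hP : P.Valid)
include hP

lemma n_pos : 0 < P.n := by have := hP.two_le; omega

lemma mem_roots {μ : ℂ} : μ ∈ P.roots ↔ μ ^ P.n = 1 :=
  Polynomial.mem_nthRootsFinset hP.n_pos 1

lemma card_roots : P.roots.card = P.n :=
  (Complex.isPrimitiveRoot_exp P.n hP.n_pos.ne').card_nthRootsFinset

lemma mem_box {p : ℂ × ℂ} (hp : p ∈ P.dom) : p ∈ P.box := ⟨hP.width_lt hp, hP.infDist_lt hp⟩

lemma bnd_transport (hK : 0 < K) (hl : K * (1 / P.a + 1 / 2) ≤ l) (hσ : 0 ≤ σ) (hM : 0 ≤ M)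
    (hG : P.Src K l σ M G) {μ : ℂ} (hμ : μ ∈ P.roots) :
    P.Bnd K l σ ((2 / P.a + 1) / K * M) (P.transport μ G) := by
  have ha := hP.a_pos
  have hl0 : 0 ≤ l := le_trans (by positivity) hl
  unfold transport
  split_ifs with h
  · refine (hP.bnd_rayInt hK hl0 hσ hM hG).mono ?_
    gcongr
    have : 0 ≤ 2 / P.a := by positivity
    linarith
  · refine (hP.bnd_charInt hK hl hσ hM hG (hP.mem_roots.1 hμ) h).mono ?_
    have : 2 / (P.a * K) = 2 / P.a / K := by field_simp
    rw [this]
    gcongr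
    linarith

lemma bnd_Y (hK : 0 < K) (hl : K * (1 / P.a + 1 / 2) ≤ l) (hσ : 0 ≤ σ) (hM : 0 ≤ M)
    (hG : P.Src K l σ M G) (k : ℕ) : P.Bnd K l σ ((2 / P.a + 1) / K * M) (P.Y G k) := by
  have ht := fun μ (hμ : μ ∈ P.roots) => hP.bnd_transport hK hl hσ hM hG hμ
  constructor
  · intro p hp
    refine analyticAt_const.mul (Finset.analyticAt_fun_sum _ fun μ hμ => ?_)
    exact analyticAt_const.mul ((ht μ hμ).analytic p hp)
  · intro p hp
    unfold Y
    have hn : (0 : ℝ) < P.n := Nat.cast_pos.2 hP.n_pos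
    rw [norm_mul, norm_div, norm_one, Complex.norm_natCast]
    have h1 : ‖∑ μ ∈ P.roots, μ ^ (k + 1) * P.transport μ G p‖ ≤
        ∑ μ ∈ P.roots, (2 / P.a + 1) / K * M * P.wt K l σ p := by
      refine (norm_sum_le _ _).trans (Finset.sum_le_sum fun μ hμ => ?_)
      rw [norm_mul, norm_pow, hP.norm_root (hP.mem_roots.1 hμ), one_pow, one_mul]
      exact (ht μ hμ).le p hp
    rw [Finset.sum_const, hP.card_roots, nsmul_eq_mul] at h1
    calc 1 / (P.n : ℝ) * ‖∑ μ ∈ P.roots, μ ^ (k + 1) * P.transport μ G p‖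
        ≤ 1 / (P.n : ℝ) * (P.n * ((2 / P.a + 1) / K * M * P.wt K l σ p)) := by gcongr
      _ = _ := by field_simp

lemma conv_path_continuousOn {Φ H : ℂ × ℂ → ℂ} (hΦ : AnalyticOnNhd ℂ Φ P.box)
    (hH : AnalyticOnNhd ℂ H P.dom) {p : ℂ × ℂ} (hp : p ∈ P.dom) :
    ContinuousOn (fun r : ℝ => Φ ((1 - r) * p.1, p.2) * H (r * p.1, p.2)) (Set.Icc 0 1) := by
  refine ContinuousOn.mul ?_ ?_
  · refine hΦ.continuousOn.comp (f := fun r : ℝ => (((1 - r) * p.1, p.2) : ℂ × ℂ)) (by fun_prop)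
      fun r hr => ?_
    have := smul_mem_box (hP.mem_box hp) (r := 1 - r) ⟨by linarith [hr.2], by linarith [hr.1]⟩
    push_cast at this
    exact this
  · exact hH.continuousOn.comp (f := fun r : ℝ => ((r * p.1, p.2) : ℂ × ℂ)) (by fun_prop)
      fun r hr => hP.smul_mem_dom hp hr

/-- Let N = rePos(t) + width(t) ≥ |t|. Passing from t to rt lowers the weight of H by more than Φ
grows: a factor exp(-νN(1-r)) remains, because l and σ - σ' are both at least ν. The integral of N
exp(-νN(1-r)) over r is at most 1/ν for every t. The decay in z is inherited from Φ, which is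
evaluated at the same z. -/
lemma src_conv {c A ν : ℝ} {Φ H : ℂ × ℂ → ℂ} (hK : 0 ≤ K) (hc : 0 ≤ c) (hA : 0 ≤ A)
    (hσ' : 0 ≤ σ') (hν : 0 < ν) (hνl : ν ≤ l) (hνσ : ν ≤ σ - σ') (hΦ : P.Potential c σ' Φ)
    (hH : P.Bnd K l σ A H) : P.Src K l σ (c * A / ν) (conv Φ H) := by
  have hl : 0 ≤ l := hν.le.trans hνl
  have hσ : 0 ≤ σ := by linarith
  have hbox : ∀ p ∈ P.dom, ∀ r ∈ Set.Icc (0 : ℝ) 1, ((1 - (r : ℂ)) * p.1, p.2) ∈ P.box := by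
    intro p hp r hr
    have := smul_mem_box (hP.mem_box hp) (r := 1 - r) ⟨by linarith [hr.2], by linarith [hr.1]⟩
    push_cast at this
    exact this
  have hrp : ∀ p : ℂ × ℂ, ∀ r ∈ Set.Icc (0 : ℝ) 1, rePos ((1 - (r : ℂ)) * p.1) =
      (1 - r) * rePos p.1 := fun p r hr => by
    have := rePos_smul (s := 1 - r) (by linarith [hr.2]) p.1
    push_cast at this
    exact this
  constructor
  · have h0 : AnalyticOnNhd ℂ (fun p : ℂ × ℂ => ∫ r in Set.Ioc (0 : ℝ) 1,
        Φ ((1 - r) * p.1, p.2) * H (r * p.1, p.2)) P.dom := by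
      refine analyticOnNhd_integral isOpen_dom ?_ ?_ ?_
      · refine (ae_restrict_iff' measurableSet_Ioc).2 (Eventually.of_forall fun r hr p hp => ?_)
        have hr' := Set.Ioc_subset_Icc_self hr
        have h2 : AnalyticAt ℂ (fun p : ℂ × ℂ => (((1 - r) * p.1, p.2) : ℂ × ℂ)) p :=
          (analyticAt_const.mul analyticAt_fst).prod analyticAt_snd
        have h3 : AnalyticAt ℂ (fun p : ℂ × ℂ => ((r * p.1, p.2) : ℂ × ℂ)) p :=
          (analyticAt_const.mul analyticAt_fst).prod analyticAt_snd
        exact (AnalyticAt.comp (g := Φ) (f := fun p : ℂ × ℂ => (((1 - r) * p.1, p.2) : ℂ × ℂ))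
          (hΦ.analytic _ (hbox p hp r hr')) h2).mul (AnalyticAt.comp (g := H)
            (f := fun p : ℂ × ℂ => ((r * p.1, p.2) : ℂ × ℂ)) (hH.analytic _ (hP.smul_mem_dom hp hr')) h3)
      · intro p hp
        exact ((hP.conv_path_continuousOn hΦ.analytic hH.analytic hp).mono
          Set.Ioc_subset_Icc_self).aestronglyMeasurable measurableSet_Ioc
      · intro p hp
        obtain ⟨C, hC, V, hV, hVC⟩ := hP.exists_nhds_norm_le hK hl hσ p
        refine ⟨fun _ => c * (1 * Real.exp (σ' * (rePos p.1 + 1))) * (A * C), integrable_const _,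
          V ∩ (P.dom ∩ {q | rePos q.1 < rePos p.1 + 1}),
          inter_mem hV (inter_mem (isOpen_dom.mem_nhds hp)
            ((isOpen_lt (continuous_rePos.comp continuous_fst) continuous_const).mem_nhds
              (lt_add_one (rePos p.1)))), ?_⟩
        refine (ae_restrict_iff' measurableSet_Ioc).2 (Eventually.of_forall fun r hr q hq => ?_)
        have hr' := Set.Ioc_subset_Icc_self hr
        have h1 := hΦ.le _ (hbox q hq.2.1 r hr')
        have h2 := hH.le _ (hP.smul_mem_dom hq.2.1 hr')
        have h3 := hVC q hq.1 hq.2.1 r hr' q.2 (hP.smul_mem_dom hq.2.1 hr')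
        have h4 := wb_le_one hP.ρ_pos (P.prog q.2)
        have h4' := (wb_pos (ρ := P.ρ) (P.prog q.2)).le
        have h5 : rePos ((1 - (r : ℂ)) * q.1) ≤ rePos p.1 + 1 := by
          rw [hrp q r hr']
          have h6 : rePos q.1 < rePos p.1 + 1 := hq.2.2
          nlinarith [rePos_nonneg q.1, hr.1]
        rw [norm_mul]
        refine mul_le_mul (h1.trans ?_) (h2.trans (by gcongr)) (norm_nonneg _) (by positivity)
        simp only
        gcongr
    intro p hp
    have h1 := h0 p hp
    simp only [← intervalIntegral.integral_of_le zero_le_one] at h1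
    exact analyticAt_fst.mul h1
  · intro p hp
    set N := rePos p.1 + width p.1 with hN
    have hN0 : 0 ≤ N := add_nonneg (rePos_nonneg _) (width_nonneg _)
    set b := wb P.ρ (P.prog p.2) with hb
    have hb0 : 0 < b := wb_pos _
    set B := c * A * b * P.wt K l σ p with hB
    have hB0 : 0 ≤ B := by
      have := (wt_pos (P := P) K l σ p).le
      positivity
    have hpt : ∀ r ∈ Set.Icc (0 : ℝ) 1, ‖p.1 * (Φ ((1 - r) * p.1, p.2) * H (r * p.1, p.2))‖ ≤
        B / ν * (Real.exp (ν * N * (r - 1)) * (ν * N)) := fun r hr => by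
      have h1 := hΦ.le _ (hbox p hp r hr)
      have h2 := hH.le _ (hP.smul_mem_dom hp hr)
      simp only [hrp p r hr, ← hb] at h1
      have h3 : Real.exp (σ' * ((1 - r) * rePos p.1)) * P.wt K l σ (r * p.1, p.2) ≤
          P.wt K l σ p * Real.exp (ν * N * (r - 1)) := by
        simp only [wt, ← Real.exp_add, rePos_smul hr.1, width_smul hr.1, hN]
        refine Real.exp_le_exp.2 ?_
        have e1 : (1 - r) * (ν * width p.1) ≤ (1 - r) * (l * width p.1) := by
          have := width_nonneg p.1
          have : 0 ≤ 1 - r := by linarith [hr.2]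
          gcongr
        have e2 : (1 - r) * (ν * rePos p.1) ≤ (1 - r) * ((σ - σ') * rePos p.1) := by
          have := rePos_nonneg p.1
          have : 0 ≤ 1 - r := by linarith [hr.2]
          gcongr
        linarith
      rw [norm_mul, norm_mul]
      calc ‖p.1‖ * (‖Φ ((1 - r) * p.1, p.2)‖ * ‖H (r * p.1, p.2)‖)
          ≤ N * ((c * (b * Real.exp (σ' * ((1 - r) * rePos p.1)))) *
            (A * P.wt K l σ (r * p.1, p.2))) := by
            have := norm_le_rePos_add_width p.1
            gcongr
        _ = N * (c * A * b) * (Real.exp (σ' * ((1 - r) * rePos p.1)) *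
            P.wt K l σ (r * p.1, p.2)) := by ring
        _ ≤ N * (c * A * b) * (P.wt K l σ p * Real.exp (ν * N * (r - 1))) := by gcongr
        _ = _ := by rw [hB]; field_simp
    have hder : ∀ r : ℝ, HasDerivAt (fun r => Real.exp (ν * N * (r - 1)))
        (Real.exp (ν * N * (r - 1)) * (ν * N)) r := fun r => by
      simpa using (((hasDerivAt_id r).sub_const 1).const_mul (ν * N)).exp
    have h1 : ‖∫ r in (0 : ℝ)..1, p.1 * (Φ ((1 - r) * p.1, p.2) * H (r * p.1, p.2))‖ ≤
        ∫ r in (0 : ℝ)..1, B / ν * (Real.exp (ν * N * (r - 1)) * (ν * N)) :=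
      intervalIntegral.norm_integral_le_of_norm_le zero_le_one
        (Eventually.of_forall fun r hr => hpt r (Set.Ioc_subset_Icc_self hr))
        (Continuous.intervalIntegrable (by fun_prop) _ _)
    rw [intervalIntegral.integral_const_mul, intervalIntegral.integral_const_mul,
      intervalIntegral.integral_eq_sub_of_hasDerivAt (fun r _ => hder r)
      (Continuous.intervalIntegrable (by fun_prop) _ _)] at h1
    unfold conv
    refine h1.trans ?_
    have h2 : Real.exp (ν * N * (1 - 1)) - Real.exp (ν * N * (0 - 1)) ≤ 1 := by
      have := Real.exp_pos (ν * N * (0 - 1))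
      simp
      positivity
    calc B / ν * (Real.exp (ν * N * (1 - 1)) - Real.exp (ν * N * (0 - 1))) ≤ B / ν * 1 := by gcongr
      _ = _ := by rw [hB]; ring

/-- Transport gains 1/K but loses the decay in z; the potentials restore it. With the other
parameters fixed, the constant is O(1/K). -/
lemma src_feedback {c ν : ℝ} {Ψ : ℕ → ℂ × ℂ → ℂ} (hK : 0 < K)
    (hl : K * (1 / P.a + 1 / 2) ≤ l) (hc : 0 ≤ c) (hσ' : 0 ≤ σ') (hν : 0 < ν) (hνl : ν ≤ l)
    (hνσ : ν ≤ σ - σ') (hM : 0 ≤ M) (hΨ : ∀ k < P.n - 1, P.Potential c σ' (Ψ k))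
    (hΨ' : ∀ k < P.n - 1, P.Potential c σ' (dFst (Ψ k))) (hG : P.Src K l σ M G) :
    P.Src K l σ (P.n * (c * ((2 / P.a + 1) / K * M) + c * ((2 / P.a + 1) / K * M) / ν))
      (P.feedback Ψ G) := by
  have ha := hP.a_pos
  have hσ : 0 ≤ σ := by linarith
  set A := (2 / P.a + 1) / K * M with hA
  have hA0 : 0 ≤ A := by positivity
  have hY := hP.bnd_Y hK hl hσ hM hG
  have hterm : ∀ k ∈ Finset.range (P.n - 1),
      P.Src K l σ (c * A + c * A / ν)
        (fun p => Ψ k (0, p.2) * P.Y G k p + conv (dFst (Ψ k)) (P.Y G k) p) := by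
    intro k hk
    rw [Finset.mem_range] at hk
    have h1 := hP.src_conv hK.le hc hA0 hσ' hν hνl hνσ (hΨ' k hk) (hY k)
    have hmem : ∀ p ∈ P.dom, ((0 : ℂ), p.2) ∈ P.box := fun p hp => by
      have := smul_mem_box (hP.mem_box hp) (r := 0) ⟨le_rfl, zero_le_one⟩
      simpa using this
    constructor
    · intro p hp
      refine AnalyticAt.add (AnalyticAt.mul ?_ ((hY k).analytic p hp)) (h1.analytic p hp)
      exact AnalyticAt.fun_comp ((hΨ k hk).analytic _ (hmem p hp))
        (analyticAt_const.prod analyticAt_snd)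
    · intro p hp
      refine (norm_add_le _ _).trans ?_
      rw [norm_mul, add_mul]
      refine add_le_add ?_ (h1.le p hp)
      have h2 := (hΨ k hk).le _ (hmem p hp)
      have h3 := (hY k).le p hp
      have h4 : rePos 0 = 0 := by simp [rePos]
      simp only [h4, mul_zero, Real.exp_zero, mul_one] at h2
      calc ‖Ψ k (0, p.2)‖ * ‖P.Y G k p‖
          ≤ (c * wb P.ρ (P.prog p.2)) * (A * P.wt K l σ p) :=
            mul_le_mul h2 h3 (norm_nonneg _) ((norm_nonneg _).trans h2)
        _ = _ := by ring
  constructor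
  · intro p hp
    exact Finset.analyticAt_fun_sum _ fun k hk => (hterm k hk).analytic p hp
  · intro p hp
    unfold feedback
    refine (norm_sum_le _ _).trans ((Finset.sum_le_sum fun k hk => (hterm k hk).le p hp).trans ?_)
    rw [Finset.sum_const, Finset.card_range, nsmul_eq_mul, mul_assoc (P.n : ℝ)]
    have h1 := (wt_pos (P := P) K l σ p).le
    have h2 := (wb_pos (ρ := P.ρ) (P.prog p.2)).le
    gcongr
    omega

end Valid

end Frame

end FixedPoint

end FactorialSeries
end

open Filter Topology Asymptotics MeasureTheory
noncomputable section
namespace FactorialSeries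

/-! ### Solution of the integral equation by iteration -/

section Neumann

namespace Frame

variable {P : Frame} {K l σ σ' M M' A A' : ℝ} {G G' H H' Φ : ℂ × ℂ → ℂ}

lemma Src.congr (h : P.Src K l σ M G) (hGG' : ∀ p ∈ P.dom, G' p = G p) : P.Src K l σ M G' :=
  ⟨fun p hp => (h.analytic p hp).congr (by
    filter_upwards [isOpen_dom.mem_nhds hp] with q hq
    exact (hGG' q hq).symm), fun p hp => by rw [hGG' p hp]; exact h.le p hp⟩

lemma Src.add (h : P.Src K l σ M G) (h' : P.Src K l σ M' G') :
    P.Src K l σ (M + M') (fun p => G p + G' p) :=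
  ⟨fun p hp => (h.analytic p hp).add (h'.analytic p hp), fun p hp => by
    refine (norm_add_le _ _).trans ?_
    rw [add_mul]
    exact add_le_add (h.le p hp) (h'.le p hp)⟩

namespace Valid

variable (hP : P.Valid)
include hP

lemma transport_sub (hK : 0 ≤ K) (hM : 0 ≤ M) (hM' : 0 ≤ M') (hG : P.Src K l σ M G)
    (hG' : P.Src K l σ M' G') {μ : ℂ} (hμ : μ ∈ P.roots) {p : ℂ × ℂ} (hp : p ∈ P.dom) :
    P.transport μ (fun p => G p - G' p) p = P.transport μ G p - P.transport μ G' p := by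
  unfold transport
  split_ifs with h
  · unfold rayInt
    rw [integral_sub (hP.integrableOn_ray hK hM hG hp) (hP.integrableOn_ray hK hM' hG' hp), mul_sub]
  · have h1 := fun {F : ℂ × ℂ → ℂ} (hF : AnalyticOnNhd ℂ F P.dom) =>
      (hP.char_path_continuousOn hF (hP.mem_roots.1 hμ) h hp).intervalIntegrable_of_Icc
        (μ := volume) zero_le_one
    unfold charInt
    rw [intervalIntegral.integral_sub (h1 hG.analytic) (h1 hG'.analytic), mul_sub]

lemma Y_sub (hK : 0 ≤ K) (hM : 0 ≤ M) (hM' : 0 ≤ M') (hG : P.Src K l σ M G)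
    (hG' : P.Src K l σ M' G') (k : ℕ) {p : ℂ × ℂ} (hp : p ∈ P.dom) :
    P.Y (fun p => G p - G' p) k p = P.Y G k p - P.Y G' k p := by
  unfold Y
  rw [← mul_sub, ← Finset.sum_sub_distrib]
  refine congrArg _ (Finset.sum_congr rfl fun μ hμ => ?_)
  rw [hP.transport_sub hK hM hM' hG hG' hμ hp, mul_sub]

lemma conv_sub {F : ℂ × ℂ → ℂ} (hΦ : AnalyticOnNhd ℂ Φ P.box) (hH : AnalyticOnNhd ℂ H P.dom)
    (hH' : AnalyticOnNhd ℂ H' P.dom) (hF : ∀ p ∈ P.dom, F p = H p - H' p) {p : ℂ × ℂ}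
    (hp : p ∈ P.dom) : conv Φ F p = conv Φ H p - conv Φ H' p := by
  unfold conv
  have h1 := fun {F : ℂ × ℂ → ℂ} (hF : AnalyticOnNhd ℂ F P.dom) =>
      (hP.conv_path_continuousOn hΦ hF hp).intervalIntegrable_of_Icc (μ := volume) zero_le_one
  rw [← mul_sub, ← intervalIntegral.integral_sub (h1 hH) (h1 hH')]
  congr 1
  refine intervalIntegral.integral_congr fun r hr => ?_
  rw [Set.uIcc_of_le zero_le_one] at hr
  rw [hF _ (hP.smul_mem_dom hp hr), mul_sub]

lemma feedback_sub {Ψ : ℕ → ℂ × ℂ → ℂ} {c : ℝ} (hK : 0 < K) (hl : K * (1 / P.a + 1 / 2) ≤ l)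
    (hσ : 0 ≤ σ) (hM : 0 ≤ M) (hM' : 0 ≤ M') (hΨ' : ∀ k < P.n - 1, P.Potential c σ' (dFst (Ψ k)))
    (hG : P.Src K l σ M G) (hG' : P.Src K l σ M' G') {p : ℂ × ℂ} (hp : p ∈ P.dom) :
    P.feedback Ψ (fun p => G p - G' p) p = P.feedback Ψ G p - P.feedback Ψ G' p := by
  unfold feedback
  rw [← Finset.sum_sub_distrib]
  refine Finset.sum_congr rfl fun k hk => ?_
  have hsub := fun p hp => hP.Y_sub hK.le hM hM' hG hG' k (p := p) hp
  rw [hsub p hp, hP.conv_sub (hΨ' k (Finset.mem_range.1 hk)).analytic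
    (hP.bnd_Y hK hl hσ hM hG k).analytic (hP.bnd_Y hK hl hσ hM' hG' k).analytic hsub hp]
  ring

lemma src_potential {c : ℝ} (hK : 0 ≤ K) (hl : 0 ≤ l) (hc : 0 ≤ c) (hσσ : σ' ≤ σ)
    (hΦ : P.Potential c σ' Φ) : P.Src K l σ c Φ := by
  refine ⟨fun p hp => hΦ.analytic p (hP.mem_box hp), fun p hp =>
    (hΦ.le p (hP.mem_box hp)).trans ?_⟩
  have h1 := (wb_pos (ρ := P.ρ) (P.prog p.2)).le
  gcongr
  unfold wt
  have h2 := rePos_nonneg p.1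
  have h3 := width_nonneg p.1
  have h4 := wE_nonneg (ρ := P.ρ) (P.prog p.2)
  have : σ' * rePos p.1 ≤ σ * rePos p.1 := by gcongr
  gcongr
  have : 0 ≤ K * wE P.ρ (P.prog p.2) + l * width p.1 := by positivity
  linarith

end Valid

/-- The integral equation satisfied by the source of the transport equations. -/
def IsSource (P : Frame) (Ψ : ℕ → ℂ × ℂ → ℂ) (G : ℂ × ℂ → ℂ) : Prop :=
  ∀ p ∈ P.dom, G p = ∑ k ∈ Finset.range (P.n - 1), P.ζ ^ k * Ψ k p + P.feedback Ψ G p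

lemma Valid.src_sum_potential {c : ℝ} {Ψ : ℕ → ℂ × ℂ → ℂ} (hP : P.Valid) (hK : 0 ≤ K) (hl : 0 ≤ l)
    (hc : 0 ≤ c) (hσσ : σ' ≤ σ) (hΨ : ∀ k < P.n - 1, P.Potential c σ' (Ψ k)) :
    P.Src K l σ (P.n * c) (fun p => ∑ k ∈ Finset.range (P.n - 1), P.ζ ^ k * Ψ k p) := by
  have h := fun k hk => hP.src_potential hK hl hc hσσ (hΨ k hk)
  refine ⟨fun p hp => Finset.analyticAt_fun_sum _ fun k hk =>
    analyticAt_const.mul ((h k (Finset.mem_range.1 hk)).analytic p hp), fun p hp => ?_⟩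
  have h1 : ‖∑ k ∈ Finset.range (P.n - 1), P.ζ ^ k * Ψ k p‖ ≤
      ∑ k ∈ Finset.range (P.n - 1), c * (wb P.ρ (P.prog p.2) * P.wt K l σ p) := by
    refine (norm_sum_le _ _).trans (Finset.sum_le_sum fun k hk => ?_)
    rw [norm_mul, norm_pow, hP.norm_ζ, one_pow, one_mul]
    exact (h k (Finset.mem_range.1 hk)).le p hp
  refine h1.trans ?_
  rw [Finset.sum_const, Finset.card_range, nsmul_eq_mul, mul_assoc (P.n : ℝ)]
  have h2 := (wb_pos (ρ := P.ρ) (P.prog p.2)).le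
  have h3 := (wt_pos (P := P) K l σ p).le
  gcongr
  omega

/-- Solution of the integral equation when the feedback halves the norm. -/
lemma Valid.exists_isSource_of_contraction {c : ℝ} {Ψ : ℕ → ℂ × ℂ → ℂ} (hP : P.Valid) (hK : 0 < K)
    (hl : K * (1 / P.a + 1 / 2) ≤ l) (hc : 0 ≤ c) (hσ' : 0 ≤ σ') (hσσ : σ' ≤ σ)
    (hΨ : ∀ k < P.n - 1, P.Potential c σ' (Ψ k))
    (hΨ' : ∀ k < P.n - 1, P.Potential c σ' (dFst (Ψ k)))
    (hcon : ∀ M G, 0 ≤ M → P.Src K l σ M G → P.Src K l σ (M / 2) (P.feedback Ψ G)) :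
    ∃ G, P.Src K l σ (2 * (P.n * c)) G ∧ P.IsSource Ψ G := by
  have ha := hP.a_pos
  have hl0 : 0 ≤ l := le_trans (by positivity) hl
  have hσ : 0 ≤ σ := by linarith
  set M₀ := P.n * c with hM₀
  have hM₀0 : 0 ≤ M₀ := by positivity
  set G₀ : ℂ × ℂ → ℂ := fun p => ∑ k ∈ Finset.range (P.n - 1), P.ζ ^ k * Ψ k p with hG₀
  have hG₀s : P.Src K l σ M₀ G₀ := hP.src_sum_potential hK.le hl0 hc hσσ hΨ
  -- Picard iteration from 0. The increments halve at every step, so the iterates keep the bound 2M₀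
  -- and converge geometrically relative to the weight.
  set S : ℕ → ℂ × ℂ → ℂ := fun N => Nat.rec (fun _ => 0)
    (fun _ F p => G₀ p + P.feedback Ψ F p) N with hS
  have hS1 : ∀ N p, S (N + 1) p = G₀ p + P.feedback Ψ (S N) p := fun N p => rfl
  have hSs : ∀ N, P.Src K l σ (2 * M₀) (S N) := by
    intro N
    induction N with
    | zero =>
      refine ⟨fun p _ => analyticAt_const, fun p _ => ?_⟩
      have h2 := (wb_pos (ρ := P.ρ) (P.prog p.2)).le
      have h3 := (wt_pos (P := P) K l σ p).le
      change ‖(0 : ℂ)‖ ≤ _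
      rw [norm_zero]
      positivity
    | succ N ih =>
      refine (hG₀s.add (hcon _ _ (by positivity) ih)).mono ?_
      linarith
  have hD : ∀ N, P.Src K l σ (M₀ * (1 / 2) ^ N) (fun p => S (N + 1) p - S N p) := by
    intro N
    induction N with
    | zero =>
      have h0 : P.Src K l σ (0 : ℝ) (S 0) :=
        ⟨fun p _ => analyticAt_const, fun p _ => by
          change ‖(0 : ℂ)‖ ≤ _
          rw [norm_zero, zero_mul]⟩
      have h1 : P.Src K l σ (0 / 2 : ℝ) (P.feedback Ψ (S 0)) := hcon 0 _ le_rfl h0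
      refine ((hG₀s.add h1).sub h0).mono (by simp)
    | succ N ih =>
      refine ((hcon _ _ (by positivity) ih).congr fun p hp => ?_).mono
        (le_of_eq (by rw [pow_succ]; ring))
      have h1 := hP.feedback_sub hK hl hσ (by positivity) (by positivity) hΨ' (hSs (N + 1)) (hSs N)
        hp
      have h2 := hS1 (N + 1) p
      have h3 := hS1 N p
      rw [h1]
      linear_combination h2 - h3
  set w : ℂ × ℂ → ℝ := fun p => wb P.ρ (P.prog p.2) * P.wt K l σ p with hw
  have hw0 : ∀ p, 0 ≤ w p := fun p => (mul_pos (wb_pos _) (wt_pos _ _ _ _)).le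
  have hwc : Continuous w := by
    have h1 : Continuous fun p : ℂ × ℂ => P.prog p.2 := continuous_prog.comp continuous_snd
    have h2 : Continuous fun p : ℂ × ℂ => wE P.ρ (P.prog p.2) := (continuous_wE hP.ρ_pos).comp h1
    have h3 : Continuous fun p : ℂ × ℂ => width p.1 := continuous_width.comp continuous_fst
    have h4 : Continuous fun p : ℂ × ℂ => rePos p.1 := continuous_rePos.comp continuous_fst
    exact (continuous_wb.comp h1).mul (Real.continuous_exp.comp
      (((h2.const_mul K).add (h3.const_mul l)).add (h4.const_mul σ)))
  have hgeo := summable_geometric_two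
  have hsum : ∀ p ∈ P.dom, ∀ N, ‖S (N + 1) p - S N p‖ ≤ (1 / 2 : ℝ) ^ N * (M₀ * w p) :=
    fun p hp N => ((hD N).le p hp).trans (le_of_eq (by rw [hw]; ring))
  have hsumm : ∀ p ∈ P.dom, Summable fun N => S (N + 1) p - S N p := fun p hp =>
    Summable.of_norm_bounded (hgeo.mul_right _) (hsum p hp)
  set G : ℂ × ℂ → ℂ := fun p => ∑' N, (S (N + 1) p - S N p) with hG
  have hGan : AnalyticOnNhd ℂ G P.dom := by
    refine analyticOnNhd_tsum isOpen_dom (fun m => (hD m).analytic) fun p hp => ?_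
    refine ⟨fun N => (1 / 2 : ℝ) ^ N * (M₀ * (w p + 1)), hgeo.mul_right _,
      P.dom ∩ {q | w q < w p + 1}, inter_mem (isOpen_dom.mem_nhds hp)
        ((isOpen_lt hwc continuous_const).mem_nhds (lt_add_one (w p))), fun m q hq => ?_⟩
    refine (hsum q hq.1 m).trans ?_
    have : w q ≤ w p + 1 := le_of_lt hq.2
    exact mul_le_mul_of_nonneg_left (mul_le_mul_of_nonneg_left this hM₀0) (by positivity)
  have hrem : ∀ p ∈ P.dom, ∀ N, ‖G p - S N p‖ ≤ (2 * M₀ * (1 / 2) ^ N) * w p := by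
    intro p hp N
    have h1 := (hsumm p hp).sum_add_tsum_nat_add N
    rw [Finset.sum_range_sub (fun N => S N p)] at h1
    have h2 : G p - S N p = ∑' m, (S (m + N + 1) p - S (m + N) p) := by
      rw [hG]
      simp only
      rw [← h1]
      change _ - (0 : ℂ) + _ - _ = _
      ring
    rw [h2]
    have h3 : ∀ m, ‖S (m + N + 1) p - S (m + N) p‖ ≤ (1 / 2 : ℝ) ^ m * ((1 / 2) ^ N * (M₀ * w p)) :=
      fun m => (hsum p hp (m + N)).trans (le_of_eq (by rw [pow_add]; ring))
    refine (tsum_of_norm_bounded (hgeo.mul_right _).hasSum h3).trans ?_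
    rw [tsum_mul_right, tsum_geometric_two]
    exact le_of_eq (by ring)
  have hrs : ∀ N, P.Src K l σ (2 * M₀ * (1 / 2) ^ N) (fun p => G p - S N p) := fun N =>
    ⟨fun p hp => (hGan p hp).sub ((hSs N).analytic p hp), fun p hp => hrem p hp N⟩
  have hGs : P.Src K l σ (2 * M₀) G :=
    ⟨hGan, fun p hp => by simpa [hS] using hrem p hp 0⟩
  refine ⟨G, hGs, fun p hp => ?_⟩
  -- By linearity of the feedback this expression is the defect of G in the equation, for every N.
  -- It also tends to zero, so the defect is zero.
  have hlim : Tendsto (fun N => (G p - S (N + 1) p) - P.feedback Ψ (fun p => G p - S N p) p) atTop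
      (𝓝 0) := by
    have hz : Tendsto (fun N : ℕ => (4 * M₀ * w p) * (1 / 2 : ℝ) ^ N) atTop (𝓝 0) := by
      simpa using (tendsto_pow_atTop_nhds_zero_of_lt_one (by norm_num : (0 : ℝ) ≤ 1 / 2)
        (by norm_num)).const_mul (4 * M₀ * w p)
    refine squeeze_zero_norm (fun N => ?_) hz
    have h1 := hrem p hp (N + 1)
    have h2 := (hcon _ _ (by positivity) (hrs N)).le p hp
    refine (norm_sub_le _ _).trans ((add_le_add h1 h2).trans ?_)
    rw [pow_succ]
    change _ + _ * w p ≤ _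
    have : 0 ≤ M₀ * w p * (1 / 2) ^ N := by have := hw0 p; positivity
    nlinarith
  have hconst : ∀ N, (G p - S (N + 1) p) - P.feedback Ψ (fun p => G p - S N p) p =
      G p - (G₀ p + P.feedback Ψ G p) := fun N => by
    rw [hP.feedback_sub hK hl hσ (by positivity) (by positivity) hΨ' hGs (hSs _) hp, hS1 N]
    ring
  simp only [hconst] at hlim
  exact sub_eq_zero.1 (tendsto_nhds_unique tendsto_const_nhds hlim)

/-- The integral equation is solvable, with constants that do not depend on the base points. -/
theorem exists_isSource (n : ℕ) {a c σ σ' : ℝ} (ha : 0 < a) (hc : 0 ≤ c) (hσ' : 0 ≤ σ')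
    (hσσ : σ' < σ) :
    ∃ K l : ℝ, 0 < K ∧ K * (1 / a + 1 / 2) ≤ l ∧ ∀ P : Frame, P.Valid → P.n = n → P.a = a →
      ∀ Ψ : ℕ → ℂ × ℂ → ℂ, (∀ k < P.n - 1, P.Potential c σ' (Ψ k)) →
        (∀ k < P.n - 1, P.Potential c σ' (dFst (Ψ k))) →
        ∃ G, P.Src K l σ (2 * (n * c)) G ∧ P.IsSource Ψ G := by
  -- `src_conv` needs ν ≤ l. The cap 1/2 ensures it, since K = 1 + B ≥ 1 makes l at least 1/2.
  set ν := min (1 / 2) (σ - σ') with hν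
  have hν0 : 0 < ν := lt_min (by norm_num) (by linarith)
  -- For K = 1 + B the constant of `src_feedback` equals B/(1+B) · M/2, which is at most M/2.
  set B := 2 * (n * (c * (2 / a + 1) * (1 + 1 / ν))) with hB
  have hB0 : 0 ≤ B := by positivity
  refine ⟨1 + B, (1 + B) * (1 / a + 1 / 2), by positivity, le_rfl, ?_⟩
  rintro P hP rfl rfl Ψ hΨ hΨ'
  have hνl : ν ≤ (1 + B) * (1 / P.a + 1 / 2) := by
    refine (min_le_left _ _).trans ?_
    have : 0 ≤ 1 / P.a := by positivity
    nlinarith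
  refine hP.exists_isSource_of_contraction (by positivity) le_rfl hc hσ' hσσ.le hΨ hΨ'
    fun M G hM hG => ?_
  refine (hP.src_feedback (by positivity) le_rfl hc hσ' hν0 hνl (min_le_right _ _) hM hΨ hΨ'
    hG).mono ?_
  have : (P.n : ℝ) * (c * ((2 / P.a + 1) / (1 + B) * M) + c * ((2 / P.a + 1) / (1 + B) * M) / ν) =
      B / (1 + B) * (M / 2) := by
    rw [hB]; field_simp
  rw [this]
  have h1 : B / (1 + B) ≤ 1 := (div_le_one (by positivity)).2 (by linarith)
  nlinarith

end Frame

end Neumann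

end FactorialSeries
end

open Filter Topology Asymptotics MeasureTheory
noncomputable section
namespace FactorialSeries

/-! ### Calculus of the two partial derivatives -/

section PartialDerivatives

lemma dFst_eq {f : ℂ × ℂ → ℂ} {p : ℂ × ℂ} (hf : AnalyticAt ℂ f p) :
    dFst f p = fderiv ℂ f p (1, 0) := (hasDerivAt_fst hf).deriv

lemma dSnd_eq {f : ℂ × ℂ → ℂ} {p : ℂ × ℂ} (hf : AnalyticAt ℂ f p) :
    dSnd f p = fderiv ℂ f p (0, 1) := (hasDerivAt_snd hf).deriv

lemma hasDerivAt_dFst {f : ℂ × ℂ → ℂ} {t z : ℂ} (hf : AnalyticAt ℂ f (t, z)) :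
    HasDerivAt (fun t => f (t, z)) (dFst f (t, z)) t := by
  rw [dFst_eq hf]; exact hasDerivAt_fst hf

lemma hasDerivAt_dSnd {f : ℂ × ℂ → ℂ} {t z : ℂ} (hf : AnalyticAt ℂ f (t, z)) :
    HasDerivAt (fun z => f (t, z)) (dSnd f (t, z)) z := by
  rw [dSnd_eq hf]; exact hasDerivAt_snd hf

lemma hasDerivAt_line {f : ℂ × ℂ → ℂ} {p : ℂ × ℂ} (hf : AnalyticAt ℂ f p) (v w : ℂ) :
    HasDerivAt (fun s : ℝ => f (p.1 + s * v, p.2 + s * w)) (v * dFst f p + w * dSnd f p) 0 := by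
  have h1 : HasDerivAt (fun s : ℂ => ((p.1 + s * v, p.2 + s * w) : ℂ × ℂ)) (v, w) 0 := by
    simpa using (((hasDerivAt_id (0 : ℂ)).mul_const v).const_add p.1).prodMk
      (((hasDerivAt_id (0 : ℂ)).mul_const w).const_add p.2)
  have h2 : HasFDerivAt f (fderiv ℂ f p) (p.1 + 0 * v, p.2 + 0 * w) := by
    simpa using hf.differentiableAt.hasFDerivAt
  have h3 := h2.comp_hasDerivAt (0 : ℂ) h1
  have h4 : fderiv ℂ f p (v, w) = v * dFst f p + w * dSnd f p := by
    rw [dFst_eq hf, dSnd_eq hf, ← smul_eq_mul, ← smul_eq_mul, ← map_smul, ← map_smul, ← map_add]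
    simp
  rw [h4] at h3
  exact HasDerivAt.comp_ofReal (z := 0) (by simpa using h3)

lemma dFst_eventuallyEq {f g : ℂ × ℂ → ℂ} {p : ℂ × ℂ} (h : f =ᶠ[𝓝 p] g) :
    dFst f =ᶠ[𝓝 p] dFst g := by
  filter_upwards [eventually_eventually_nhds.2 h] with q hq
  refine Filter.EventuallyEq.deriv_eq ?_
  have hc : Tendsto (fun t : ℂ => (t, q.2)) (𝓝 q.1) (𝓝 q) := by
    have : Continuous fun t : ℂ => (t, q.2) := by fun_prop
    exact this.tendsto q.1
  exact hc.eventually hq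

lemma dFst_iterate_eventuallyEq {f g : ℂ × ℂ → ℂ} {p : ℂ × ℂ} (h : f =ᶠ[𝓝 p] g) (m : ℕ) :
    dFst^[m] f =ᶠ[𝓝 p] dFst^[m] g := by
  induction m with
  | zero => exact h
  | succ m ih =>
    rw [Function.iterate_succ_apply', Function.iterate_succ_apply']
    exact dFst_eventuallyEq ih

lemma analyticAt_dFst_iterate {f : ℂ × ℂ → ℂ} {p : ℂ × ℂ} (hf : AnalyticAt ℂ f p) (m : ℕ) :
    AnalyticAt ℂ (dFst^[m] f) p := by
  induction m with
  | zero => exact hf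
  | succ m ih =>
    rw [Function.iterate_succ_apply']
    exact analyticAt_dFst ih

lemma dFst_iterate (f : ℂ × ℂ → ℂ) (m : ℕ) : ∀ p : ℂ × ℂ,
    dFst^[m] f p = iteratedDeriv m (fun t => f (t, p.2)) p.1 := by
  induction m with
  | zero => intro p; simp
  | succ m ih =>
    intro p
    rw [Function.iterate_succ_apply', iteratedDeriv_succ]
    unfold dFst
    congr 1
    funext t
    exact ih (t, p.2)

lemma dFst_iterate_sum {ι : Type*} (s : Finset ι) {f : ι → ℂ × ℂ → ℂ}
    {p : ℂ × ℂ} (hf : ∀ i ∈ s, AnalyticAt ℂ (f i) p) (m : ℕ) :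
    dFst^[m] (fun q => ∑ i ∈ s, f i q) =ᶠ[𝓝 p] fun q => ∑ i ∈ s, dFst^[m] (f i) q := by
  induction m with
  | zero => rfl
  | succ m ih =>
    simp only [Function.iterate_succ_apply']
    refine (dFst_eventuallyEq ih).trans ?_
    have h : ∀ᶠ q in 𝓝 p, ∀ i ∈ s, AnalyticAt ℂ (f i) q :=
      (Filter.eventually_all_finset s).2 fun i hi => (hf i hi).eventually_analyticAt
    filter_upwards [h] with q hq
    exact (HasDerivAt.fun_sum fun i hi => hasDerivAt_dFst (t := q.1) (z := q.2)
      (analyticAt_dFst_iterate (hq i hi) m)).deriv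

lemma dFst_iterate_mul_add (c : ℂ → ℂ) {f g : ℂ × ℂ → ℂ} {p : ℂ × ℂ} (hf : AnalyticAt ℂ f p)
    (hg : AnalyticAt ℂ g p) (m : ℕ) :
    dFst^[m] (fun q => c q.2 * f q + g q) =ᶠ[𝓝 p]
      fun q => c q.2 * dFst^[m] f q + dFst^[m] g q := by
  induction m with
  | zero => rfl
  | succ m ih =>
    simp only [Function.iterate_succ_apply']
    refine (dFst_eventuallyEq ih).trans ?_
    filter_upwards [hf.eventually_analyticAt, hg.eventually_analyticAt] with q hq hq'
    exact (((hasDerivAt_dFst (t := q.1) (z := q.2) (analyticAt_dFst_iterate hq m)).const_mul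
      (c q.2)).add (hasDerivAt_dFst (t := q.1) (z := q.2) (analyticAt_dFst_iterate hq' m))).deriv

lemma dSnd_dFst {f : ℂ × ℂ → ℂ} {p : ℂ × ℂ} (hf : AnalyticAt ℂ f p) :
    dSnd (dFst f) p = dFst (dSnd f) p := by
  have hF := hf.fderiv.differentiableAt.hasFDerivAt
  have h1 : dFst f =ᶠ[𝓝 p] fun q => fderiv ℂ f q (1, 0) := by
    filter_upwards [hf.eventually_analyticAt] with q hq using dFst_eq hq
  have h2 : dSnd f =ᶠ[𝓝 p] fun q => fderiv ℂ f q (0, 1) := by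
    filter_upwards [hf.eventually_analyticAt] with q hq using dSnd_eq hq
  rw [dSnd_eq (analyticAt_dFst hf), dFst_eq (analyticAt_dSnd hf), h1.fderiv_eq, h2.fderiv_eq]
  have e1 : ∀ v : ℂ × ℂ, fderiv ℂ (fun q => fderiv ℂ f q v) p =
      (ContinuousLinearMap.apply ℂ ℂ v).comp (fderiv ℂ (fderiv ℂ f) p) := fun v =>
    ((ContinuousLinearMap.apply ℂ ℂ v).hasFDerivAt.comp p hF).fderiv
  rw [e1, e1]
  have hs : IsSymmSndFDerivAt ℂ f p :=
    ContDiffAt.isSymmSndFDerivAt (n := 2) hf.contDiffAt (by simp)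
  exact hs (0, 1) (1, 0)

lemma dSnd_dFst_iterate {f : ℂ × ℂ → ℂ} {p : ℂ × ℂ} (hf : AnalyticAt ℂ f p) (m : ℕ) :
    dSnd (dFst^[m] f) =ᶠ[𝓝 p] dFst^[m] (dSnd f) := by
  induction m with
  | zero => rfl
  | succ m ih =>
    simp only [Function.iterate_succ_apply']
    refine Filter.EventuallyEq.trans ?_ (dFst_eventuallyEq ih)
    filter_upwards [hf.eventually_analyticAt] with q hq
    exact dSnd_dFst (analyticAt_dFst_iterate hq m)

lemma hasDerivAt_intervalIntegral_of_continuousOn {F F' : ℂ → ℝ → ℂ} {t : ℂ} {ε : ℝ} (hε : 0 < ε)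
    (hF : ∀ s ∈ Metric.closedBall t ε, ∀ r ∈ Set.Icc (0 : ℝ) 1,
      HasDerivAt (fun s => F s r) (F' s r) s)
    (hFc : ∀ s ∈ Metric.closedBall t ε, ContinuousOn (F s) (Set.Icc 0 1))
    (hF' : ContinuousOn (Function.uncurry F') (Metric.closedBall t ε ×ˢ Set.Icc 0 1)) :
    HasDerivAt (fun s => ∫ r in (0 : ℝ)..1, F s r) (∫ r in (0 : ℝ)..1, F' t r) t := by
  obtain ⟨C, hC⟩ := ((isCompact_closedBall t ε).prod isCompact_Icc).exists_bound_of_continuousOn hF'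
  have hsub : ∀ s ∈ Metric.closedBall t ε, ContinuousOn (F' s) (Set.Icc 0 1) := fun s hs =>
    hF'.comp (f := fun r : ℝ => (s, r)) (by fun_prop) fun r hr => ⟨hs, hr⟩
  refine (intervalIntegral.hasDerivAt_integral_of_dominated_loc_of_deriv_le
    (bound := fun _ => C) (Metric.closedBall_mem_nhds t hε) ?_ ?_ ?_ ?_ ?_ ?_).2
  · filter_upwards [Metric.closedBall_mem_nhds t hε] with s hs
    rw [Set.uIoc_of_le zero_le_one]
    exact ((hFc s hs).mono Set.Ioc_subset_Icc_self).aestronglyMeasurable measurableSet_Ioc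
  · exact (hFc t (Metric.mem_closedBall_self hε.le)).intervalIntegrable_of_Icc zero_le_one
  · rw [Set.uIoc_of_le zero_le_one]
    exact ((hsub t (Metric.mem_closedBall_self hε.le)).mono
      Set.Ioc_subset_Icc_self).aestronglyMeasurable measurableSet_Ioc
  · refine Eventually.of_forall fun r hr s hs => ?_
    rw [Set.uIoc_of_le zero_le_one] at hr
    exact hC (s, r) ⟨hs, Set.Ioc_subset_Icc_self hr⟩
  · exact intervalIntegrable_const
  · refine Eventually.of_forall fun r hr s hs => ?_
    rw [Set.uIoc_of_le zero_le_one] at hr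
    exact hF s hs r (Set.Ioc_subset_Icc_self hr)

end PartialDerivatives

/-! ### The transport equations and the cyclic system in the Borel plane -/

section Transport

namespace Frame

variable {P : Frame} {K l σ σ' M : ℝ} {G Φ H : ℂ × ℂ → ℂ}

lemma Valid.sum_roots_pow (hP : P.Valid) {k : ℕ} (hk : 0 < k) (hkn : k < P.n) :
    ∑ μ ∈ P.roots, μ ^ k = 0 := by
  have hprim := Complex.isPrimitiveRoot_exp P.n hP.n_pos.ne'
  set g := Complex.exp (2 * Real.pi * Complex.I / P.n) with hg
  have hg0 : g ≠ 0 := Complex.exp_ne_zero _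
  have h1 : ∑ μ ∈ P.roots, (g * μ) ^ k = ∑ μ ∈ P.roots, μ ^ k := by
    refine Finset.sum_bij (fun μ _ => g * μ) (fun μ hμ => ?_) (fun μ _ μ' _ h => ?_)
      (fun μ hμ => ⟨g⁻¹ * μ, ?_, ?_⟩) fun _ _ => rfl
    · rw [hP.mem_roots] at hμ ⊢
      rw [mul_pow, hμ, hprim.pow_eq_one, one_mul]
    · exact mul_left_cancel₀ hg0 h
    · rw [hP.mem_roots] at hμ ⊢
      rw [mul_pow, hμ, inv_pow, hprim.pow_eq_one, inv_one, one_mul]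
    · rw [mul_inv_cancel_left₀ hg0]
  simp only [mul_pow, ← Finset.mul_sum] at h1
  have h2 : g ^ k ≠ 1 := hprim.pow_ne_one_of_pos_of_lt hk.ne' hkn
  have h3 : (g ^ k - 1) * ∑ μ ∈ P.roots, μ ^ k = 0 := by rw [sub_mul, h1, one_mul, sub_self]
  exact (mul_eq_zero.1 h3).resolve_left (sub_ne_zero.2 h2)

lemma Valid.sum_roots_pow_n (hP : P.Valid) : ∑ μ ∈ P.roots, μ ^ P.n = P.n := by
  rw [Finset.sum_congr rfl fun μ hμ => hP.mem_roots.1 hμ, Finset.sum_const, hP.card_roots]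
  simp

lemma Valid.Y_add_n (hP : P.Valid) (G : ℂ × ℂ → ℂ) (k : ℕ) : P.Y G (k + P.n) = P.Y G k := by
  funext p
  unfold Y
  refine congrArg _ (Finset.sum_congr rfl fun μ hμ => ?_)
  rw [show k + P.n + 1 = (k + 1) + P.n by ring, pow_add, hP.mem_roots.1 hμ, mul_one]

lemma transport_zero {μ : ℂ} (h : μ ≠ P.ζ) (G : ℂ × ℂ → ℂ) (z : ℂ) :
    P.transport μ G (0, z) = 0 := by
  unfold transport charInt
  rw [if_neg h]
  simp

/-- The characteristic integrals carry the factor t, so at t = 0 only the ray integral for μ = ζ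
survives. -/
lemma Valid.Y_zero (hP : P.Valid) (G : ℂ × ℂ → ℂ) (k : ℕ) (z : ℂ) :
    P.Y G k (0, z) = 1 / P.n * (P.ζ ^ (k + 1) * P.transport P.ζ G (0, z)) := by
  unfold Y
  rw [Finset.sum_eq_single P.ζ (fun μ _ h => by rw [transport_zero h, mul_zero])
    (fun h => absurd (hP.mem_roots.2 hP.root) h)]

/-- Differentiation along the ray. -/
lemma Valid.dSnd_rayInt (hP : P.Valid) (hK : 0 < K) (hl : 0 ≤ l) (hσ : 0 ≤ σ)
    (hM : 0 ≤ M) (hG : P.Src K l σ M G) {p : ℂ × ℂ} (hp : p ∈ P.dom) :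
    dSnd (P.rayInt G) p = G p := by
  have hb := hP.bnd_rayInt hK hl hσ hM hG
  have hint := hP.integrableOn_ray hK.le hM hG hp
  set g : ℝ → ℂ := fun τ => G (p.1, p.2 - τ / P.ζ) with hg
  have hgc : ContinuousOn g (Set.Ici 0) := by
    refine hG.analytic.continuousOn.comp (f := fun τ : ℝ => ((p.1, p.2 - τ / P.ζ) : ℂ × ℂ))
      (by fun_prop) fun τ hτ => hP.ray_mem_dom hp hτ
  -- Advancing the base point along its own ray removes an initial segment of the integral.
  have h1 : ∀ s : ℝ, 0 ≤ s → P.rayInt G (p.1 + s * 0, p.2 + s * (-1 / P.ζ)) =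
      P.ζ⁻¹ * ((∫ τ in Set.Ioi 0, g τ) - ∫ τ in (0 : ℝ)..s, g τ) := fun s hs => by
    rw [← intervalIntegral.integral_Ioi_sub_Ioi hint hs, sub_sub_cancel]
    unfold rayInt
    congr 1
    have h2 := (measurePreserving_add_right volume s).setIntegral_preimage_emb
      (measurableEmbedding_addRight s) g (Set.Ioi s)
    rw [← h2]
    have h3 : (fun x => x + s) ⁻¹' Set.Ioi s = Set.Ioi 0 := by ext; simp
    rw [h3]
    refine setIntegral_congr_fun measurableSet_Ioi fun τ _ => ?_
    simp only [hg]
    congr 2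
    · simp
    · push_cast; ring
  have h2 : HasDerivWithinAt (fun s : ℝ => P.ζ⁻¹ * ((∫ τ in Set.Ioi 0, g τ) - ∫ τ in (0 : ℝ)..s, g τ))
      (P.ζ⁻¹ * (-g 0)) (Set.Ici 0) 0 := by
    refine (HasDerivWithinAt.const_sub _ ?_).const_mul _
    refine intervalIntegral.integral_hasDerivWithinAt_right (t := Set.Ioi 0) (by simp) ?_
      ((hgc 0 Set.self_mem_Ici).mono Set.Ioi_subset_Ici_self)
    exact ⟨Set.Ioi 0, self_mem_nhdsWithin,
      (hgc.mono Set.Ioi_subset_Ici_self).aestronglyMeasurable measurableSet_Ioi⟩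
  have h3 := (hasDerivAt_line (hb.analytic p hp) 0 (-1 / P.ζ)).hasDerivWithinAt (s := Set.Ici 0)
  -- The ray integral is already known to be analytic, so a one-sided derivative along the ray
  -- identifies its partial derivative.
  have h4 := (uniqueDiffOn_Ici (0 : ℝ) 0 Set.self_mem_Ici).eq_deriv _ h3
    (h2.congr (fun s hs => h1 s hs) (h1 0 le_rfl))
  have hζ := hP.ζ_ne
  have h5 : g 0 = G p := by simp [hg]
  rw [h5] at h4
  field_simp at h4
  linear_combination -h4

/-- The transport equation along the characteristics. -/
lemma Valid.dSnd_charInt (hP : P.Valid) (hK : 0 < K) (hl : K * (1 / P.a + 1 / 2) ≤ l) (hσ : 0 ≤ σ)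
    (hM : 0 ≤ M) (hG : P.Src K l σ M G) {μ : ℂ} (hμ : μ ^ P.n = 1) (hne : μ ≠ P.ζ) {p : ℂ × ℂ}
    (hp : p ∈ P.dom) :
    dSnd (P.charInt μ G) p = (μ - P.ζ) * dFst (P.charInt μ G) p + G p := by
  have hb := hP.bnd_charInt hK hl hσ hM hG hμ hne
  have hsub : μ - P.ζ ≠ 0 := sub_ne_zero.2 hne
  have hsub' : P.ζ - μ ≠ 0 := sub_ne_zero.2 hne.symm
  have key : ∀ p ∈ P.dom, p.1 ≠ 0 →
      dSnd (P.charInt μ G) p = (μ - P.ζ) * dFst (P.charInt μ G) p + G p := by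
    intro p hp hp0
    set g : ℝ → ℂ := fun s => G ((1 - s) * p.1, p.2 + s * p.1 / (μ - P.ζ)) with hg
    have hgc : ContinuousOn g (Set.Icc 0 1) := hP.char_path_continuousOn hG.analytic hμ hne hp
    -- The points of a characteristic share their endpoint on t = 0: restricted to it, the integral
    -- is the tail from s to 1 of a single integral, whose derivative at s = 0 is known.
    have h1 : ∀ s ∈ Set.Icc (0 : ℝ) 1,
        P.charInt μ G (p.1 + s * (-p.1), p.2 + s * (p.1 / (μ - P.ζ))) =
        p.1 / (P.ζ - μ) * ∫ s in s..1, g s := fun s hs => by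
      unfold charInt
      have h2 := intervalIntegral.smul_integral_comp_mul_add (a := 0) (b := 1) g (1 - s) s
      rw [mul_zero, zero_add, mul_one, sub_add_cancel] at h2
      rw [← h2, Complex.real_smul]
      have h3 : (∫ r in (0 : ℝ)..1, G ((1 - r) * (p.1 + s * -p.1),
          p.2 + s * (p.1 / (μ - P.ζ)) + r * (p.1 + s * -p.1) / (μ - P.ζ))) =
          ∫ r in (0 : ℝ)..1, g ((1 - s) * r + s) := by
        refine intervalIntegral.integral_congr fun r _ => ?_
        simp only [hg]
        congr 2
        · push_cast; ring
        · push_cast; ring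
      change (p.1 + s * -p.1) / (P.ζ - μ) * _ = _
      rw [h3]
      push_cast
      ring
    have h2 : HasDerivWithinAt (fun s : ℝ => p.1 / (P.ζ - μ) * ∫ s in s..1, g s)
        (p.1 / (P.ζ - μ) * (-g 0)) (Set.Icc 0 1) 0 := by
      refine HasDerivWithinAt.const_mul _ ?_
      have : Fact ((0 : ℝ) ∈ Set.Icc (0 : ℝ) 1) := ⟨Set.left_mem_Icc.2 zero_le_one⟩
      refine intervalIntegral.integral_hasDerivWithinAt_left (t := Set.Icc 0 1)
        (hgc.intervalIntegrable_of_Icc zero_le_one) ?_ (hgc 0 (Set.left_mem_Icc.2 zero_le_one))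
      exact ⟨Set.Icc 0 1, self_mem_nhdsWithin, hgc.aestronglyMeasurable measurableSet_Icc⟩
    have h3 := (hasDerivAt_line (hb.analytic p hp) (-p.1) (p.1 / (μ - P.ζ))).hasDerivWithinAt
      (s := Set.Icc 0 1)
    have h4 := (uniqueDiffOn_Icc zero_lt_one (0 : ℝ) (Set.left_mem_Icc.2 zero_le_one)).eq_deriv _ h3
      (h2.congr (fun s hs => h1 s hs) (h1 0 (Set.left_mem_Icc.2 zero_le_one)))
    have h5 : g 0 = G p := by simp [hg]
    rw [h5] at h4
    have h6 : p.1 / (P.ζ - μ) = -(p.1 / (μ - P.ζ)) := by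
      rw [← neg_sub μ P.ζ, div_neg]
    rw [h6] at h4
    field_simp at h4
    linear_combination h4
  -- For t = 0 the characteristic degenerates to a point and carries no information; the equation
  -- follows there by continuity from t ≠ 0.
  by_cases hp0 : p.1 = 0
  · have hc : Tendsto (fun t : ℂ => (t, p.2)) (𝓝[≠] p.1) (𝓝 p) := by
      have : Continuous fun t : ℂ => (t, p.2) := by fun_prop
      exact (this.tendsto p.1).mono_left nhdsWithin_le_nhds
    have ha := hb.analytic p hp
    have e1 := (analyticAt_dSnd ha).continuousAt.tendsto.comp hc
    have e2 := (((analyticAt_dFst ha).continuousAt.tendsto.const_mul (μ - P.ζ)).add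
      (hG.analytic p hp).continuousAt.tendsto).comp hc
    refine tendsto_nhds_unique (e1.congr' ?_) e2
    filter_upwards [hc.eventually (isOpen_dom.mem_nhds hp), self_mem_nhdsWithin] with t ht ht0
    rw [hp0] at ht0
    exact key _ ht ht0
  · exact key p hp hp0

lemma Valid.dSnd_transport (hP : P.Valid) (hK : 0 < K) (hl : K * (1 / P.a + 1 / 2) ≤ l)
    (hσ : 0 ≤ σ) (hM : 0 ≤ M) (hG : P.Src K l σ M G) {μ : ℂ} (hμ : μ ∈ P.roots) {p : ℂ × ℂ}
    (hp : p ∈ P.dom) :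
    dSnd (P.transport μ G) p = (μ - P.ζ) * dFst (P.transport μ G) p + G p := by
  have ha := hP.a_pos
  have hl0 : 0 ≤ l := le_trans (by positivity) hl
  unfold transport
  split_ifs with h
  · rw [hP.dSnd_rayInt hK hl0 hσ hM hG hp, h, sub_self, zero_mul, zero_add]
  · exact hP.dSnd_charInt hK hl hσ hM hG (hP.mem_roots.1 hμ) h hp

/-- Multiplication by μ raises k by one, so the decoupled equations for the roots become a chain in
k. The source enters with (1/n) Σ μ^{k+1}, which is 0 for k + 1 < n and 1 for k + 1 = n. -/
lemma Valid.dSnd_Y (hP : P.Valid) (hK : 0 < K) (hl : K * (1 / P.a + 1 / 2) ≤ l)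
    (hσ : 0 ≤ σ) (hM : 0 ≤ M) (hG : P.Src K l σ M G) (k : ℕ) {p : ℂ × ℂ} (hp : p ∈ P.dom) :
    dSnd (P.Y G k) p = dFst (P.Y G (k + 1)) p - P.ζ * dFst (P.Y G k) p +
      (1 / P.n * ∑ μ ∈ P.roots, μ ^ (k + 1)) * G p := by
  have ht := fun μ (hμ : μ ∈ P.roots) => (hP.bnd_transport hK hl hσ hM hG hμ).analytic p hp
  have h1 : ∀ k, dFst (P.Y G k) p = 1 / P.n * ∑ μ ∈ P.roots, μ ^ (k + 1) * dFst (P.transport μ G) p :=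
    fun k => HasDerivAt.deriv ((HasDerivAt.fun_sum fun μ hμ =>
      (hasDerivAt_dFst (t := p.1) (z := p.2) (ht μ hμ)).const_mul _).const_mul _)
  have h2 : dSnd (P.Y G k) p = 1 / P.n * ∑ μ ∈ P.roots, μ ^ (k + 1) * dSnd (P.transport μ G) p :=
    HasDerivAt.deriv ((HasDerivAt.fun_sum fun μ hμ =>
      (hasDerivAt_dSnd (t := p.1) (z := p.2) (ht μ hμ)).const_mul _).const_mul _)
  rw [h2, h1, h1, Finset.sum_congr rfl fun μ hμ => by
    rw [hP.dSnd_transport hK hl hσ hM hG hμ hp]]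
  rw [mul_assoc _ _ (G p), Finset.sum_mul, ← mul_assoc P.ζ, mul_comm P.ζ, mul_assoc _ P.ζ,
    Finset.mul_sum _ _ P.ζ, ← mul_sub, ← mul_add, ← Finset.sum_sub_distrib,
    ← Finset.sum_add_distrib]
  refine congrArg _ (Finset.sum_congr rfl fun μ _ => ?_)
  ring

end Frame

end Transport

end FactorialSeries
end

open Filter Topology Asymptotics MeasureTheory
noncomputable section
namespace FactorialSeries

/-! ### Derivatives and Taylor coefficients of convolutions -/

section Convolution

namespace Frame

variable {P : Frame} {K l σ σ' M : ℝ} {G Φ H : ℂ × ℂ → ℂ}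

lemma Valid.one_sub_smul_mem_box (hP : P.Valid) {p : ℂ × ℂ} (hp : p ∈ P.dom) {r : ℝ}
    (hr : r ∈ Set.Icc (0 : ℝ) 1) : ((1 - (r : ℂ)) * p.1, p.2) ∈ P.box := by
  have := smul_mem_box (hP.mem_box hp) (r := 1 - r) ⟨by linarith [hr.2], by linarith [hr.1]⟩
  push_cast at this
  exact this

lemma analyticAt_comp_smul_fst {f : ℂ × ℂ → ℂ} {p : ℂ × ℂ} {c : ℂ}
    (hf : AnalyticAt ℂ f (c * p.1, p.2)) :
    AnalyticAt ℂ (fun q : ℂ × ℂ => f (c * q.1, q.2)) p :=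
  AnalyticAt.comp (g := f) (f := fun q : ℂ × ℂ => ((c * q.1, q.2) : ℂ × ℂ)) hf
    ((analyticAt_const.mul analyticAt_fst).prod analyticAt_snd)

lemma Valid.continuousOn_conv_integrand (hP : P.Valid) (hΦ : ContinuousOn Φ P.box)
    (hH : ContinuousOn H P.dom) {A : Set (ℂ × ℂ)} (hA : A ⊆ P.dom) :
    ContinuousOn (fun x : (ℂ × ℂ) × ℝ => Φ ((1 - x.2) * x.1.1, x.1.2) * H (x.2 * x.1.1, x.1.2))
      (A ×ˢ Set.Icc 0 1) := by
  refine ContinuousOn.mul ?_ ?_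
  · exact hΦ.comp (f := fun x : (ℂ × ℂ) × ℝ => (((1 - x.2) * x.1.1, x.1.2) : ℂ × ℂ)) (by fun_prop)
      fun x hx => hP.one_sub_smul_mem_box (hA hx.1) hx.2
  · exact hH.comp (f := fun x : (ℂ × ℂ) × ℝ => ((x.2 * x.1.1, x.1.2) : ℂ × ℂ)) (by fun_prop)
      fun x hx => hP.smul_mem_dom (hA hx.1) hx.2

lemma Valid.analyticOnNhd_conv (hP : P.Valid) (hΦ : AnalyticOnNhd ℂ Φ P.box)
    (hH : AnalyticOnNhd ℂ H P.dom) : AnalyticOnNhd ℂ (conv Φ H) P.dom := by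
  have h0 : AnalyticOnNhd ℂ (fun p : ℂ × ℂ => ∫ r in Set.Ioc (0 : ℝ) 1,
      Φ ((1 - r) * p.1, p.2) * H (r * p.1, p.2)) P.dom := by
    refine analyticOnNhd_integral isOpen_dom ?_ ?_ ?_
    · refine (ae_restrict_iff' measurableSet_Ioc).2 (Eventually.of_forall fun r hr p hp => ?_)
      have hr' := Set.Ioc_subset_Icc_self hr
      exact (analyticAt_comp_smul_fst (hΦ _ (hP.one_sub_smul_mem_box hp hr'))).mul
        (analyticAt_comp_smul_fst (hH _ (hP.smul_mem_dom hp hr')))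
    · intro p hp
      exact ((hP.conv_path_continuousOn hΦ hH hp).mono
        Set.Ioc_subset_Icc_self).aestronglyMeasurable measurableSet_Ioc
    · intro p hp
      obtain ⟨ε, hε, hεs⟩ := Metric.nhds_basis_closedBall.mem_iff.1 (isOpen_dom.mem_nhds hp)
      obtain ⟨C, hC⟩ := ((isCompact_closedBall p ε).prod
        (isCompact_Icc (a := (0 : ℝ)) (b := 1))).exists_bound_of_continuousOn
        (hP.continuousOn_conv_integrand hΦ.continuousOn hH.continuousOn hεs)
      refine ⟨fun _ => C, integrable_const _, Metric.closedBall p ε,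
        Metric.closedBall_mem_nhds p hε, ?_⟩
      refine (ae_restrict_iff' measurableSet_Ioc).2 (Eventually.of_forall fun r hr q hq => ?_)
      exact hC (q, r) ⟨hq, Set.Ioc_subset_Icc_self hr⟩
  intro p hp
  have h1 := h0 p hp
  simp only [← intervalIntegral.integral_of_le zero_le_one] at h1
  exact analyticAt_fst.mul h1

/-- Differentiation under the integral distributes the derivative over both factors with weights 1-r
and r. An integration by parts in r moves it onto Φ and leaves the boundary term at r = 1. -/
lemma Valid.dFst_conv (hP : P.Valid) (hΦ : AnalyticOnNhd ℂ Φ P.box)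
    (hH : AnalyticOnNhd ℂ H P.dom) {p : ℂ × ℂ} (hp : p ∈ P.dom) :
    dFst (conv Φ H) p = Φ (0, p.2) * H p + conv (dFst Φ) H p := by
  obtain ⟨t, z⟩ := p
  have hΦ' : AnalyticOnNhd ℂ (dFst Φ) P.box := fun p hp => analyticAt_dFst (hΦ p hp)
  have hH' : AnalyticOnNhd ℂ (dFst H) P.dom := fun p hp => analyticAt_dFst (hH p hp)
  have hopen : IsOpen {s : ℂ | (s, z) ∈ P.dom} := isOpen_dom.preimage (by fun_prop)
  obtain ⟨ε, hε, hεs⟩ := Metric.nhds_basis_closedBall.mem_iff.1 (hopen.mem_nhds hp)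
  have hsub : (fun s : ℂ => (s, z)) '' Metric.closedBall t ε ⊆ P.dom := by
    rintro _ ⟨s, hs, rfl⟩
    exact hεs hs
  set F : ℂ → ℝ → ℂ := fun s r => Φ ((1 - r) * s, z) * H (r * s, z) with hF
  set F' : ℂ → ℝ → ℂ := fun s r =>
    (1 - r) * (dFst Φ ((1 - r) * s, z) * H (r * s, z)) +
      r * (Φ ((1 - r) * s, z) * dFst H (r * s, z)) with hF'
  have hcont : ∀ {Φ H : ℂ × ℂ → ℂ}, AnalyticOnNhd ℂ Φ P.box → AnalyticOnNhd ℂ H P.dom →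
      ContinuousOn (fun x : ℂ × ℝ => Φ ((1 - x.2) * x.1, z) * H (x.2 * x.1, z))
        (Metric.closedBall t ε ×ˢ Set.Icc 0 1) := fun h1 h2 =>
    (hP.continuousOn_conv_integrand h1.continuousOn h2.continuousOn hsub).comp
      (f := fun x : ℂ × ℝ => (((x.1, z), x.2) : (ℂ × ℂ) × ℝ)) (by fun_prop)
      fun x hx => ⟨Set.mem_image_of_mem _ hx.1, hx.2⟩
  have hder := hasDerivAt_intervalIntegral_of_continuousOn (F := F) (F' := F') hε
    (fun s hs r hr => by
      have h1 := (hasDerivAt_dFst (hΦ _ (hP.one_sub_smul_mem_box (hεs hs) hr))).comp s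
        ((hasDerivAt_id s).const_mul (1 - (r : ℂ)))
      have h2 := (hasDerivAt_dFst (hH _ (hP.smul_mem_dom (hεs hs) hr))).comp s
        ((hasDerivAt_id s).const_mul (r : ℂ))
      convert! h1.mul h2 using 1
      simp only [hF', Function.comp]
      ring)
    (fun s hs => hP.conv_path_continuousOn hΦ hH (hεs hs))
    (by
      have c1 : Continuous fun x : ℂ × ℝ => (1 - (x.2 : ℂ)) := by fun_prop
      have c2 : Continuous fun x : ℂ × ℝ => (x.2 : ℂ) := by fun_prop
      exact (c1.continuousOn.mul (hcont hΦ' hH)).add (c2.continuousOn.mul (hcont hΦ hH')))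
  have hd := ((hasDerivAt_id t).mul hder).deriv
  have hii : ∀ {Φ H : ℂ × ℂ → ℂ}, AnalyticOnNhd ℂ Φ P.box → AnalyticOnNhd ℂ H P.dom →
      ContinuousOn (fun r : ℝ => Φ ((1 - r) * t, z) * H (r * t, z)) (Set.Icc 0 1) := fun h1 h2 =>
    hP.conv_path_continuousOn h1 h2 hp
  -- The integrand is the r-derivative of r Φ((1-r)t, z) H(rt, z).
  have hparts : (∫ r in (0 : ℝ)..1, (F t r + t * F' t r -
      t * (dFst Φ ((1 - r) * t, z) * H (r * t, z)))) = Φ (0, z) * H (t, z) := by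
    rw [intervalIntegral.integral_eq_sub_of_hasDerivAt (f := fun r : ℝ => r * F t r)]
    · simp [hF]
    · intro r hr
      rw [Set.uIcc_of_le zero_le_one] at hr
      have h1 : HasDerivAt (fun r : ℂ => Φ ((1 - r) * t, z)) (dFst Φ ((1 - r) * t, z) * (-1 * t)) r :=
        HasDerivAt.comp (h₂ := fun s => Φ (s, z)) (h := fun r : ℂ => (1 - r) * t) (r : ℂ)
          (hasDerivAt_dFst (hΦ _ (hP.one_sub_smul_mem_box hp hr)))
          (((hasDerivAt_id (r : ℂ)).const_sub 1).mul_const t)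
      have h2 : HasDerivAt (fun r : ℂ => H (r * t, z)) (dFst H (r * t, z) * (1 * t)) r :=
        HasDerivAt.comp (h₂ := fun s => H (s, z)) (h := fun r : ℂ => r * t) (r : ℂ)
          (hasDerivAt_dFst (hH _ (hP.smul_mem_dom hp hr))) ((hasDerivAt_id (r : ℂ)).mul_const t)
      have h3 := ((hasDerivAt_id (r : ℂ)).mul (h1.mul h2)).comp_ofReal
      convert! h3 using 1
      simp only [hF, hF', id, Pi.mul_apply]
      ring
    · refine ContinuousOn.intervalIntegrable_of_Icc zero_le_one ?_
      have c1 : Continuous fun r : ℝ => (1 - (r : ℂ)) := by fun_prop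
      have c2 : Continuous fun r : ℝ => (r : ℂ) := by fun_prop
      exact ((hii hΦ hH).add (continuousOn_const.mul ((c1.continuousOn.mul (hii hΦ' hH)).add
        (c2.continuousOn.mul (hii hΦ hH'))))).sub (continuousOn_const.mul (hii hΦ' hH))
  have hFi : IntervalIntegrable (F t) volume 0 1 :=
    (hii hΦ hH).intervalIntegrable_of_Icc zero_le_one
  have hF'i : IntervalIntegrable (F' t) volume 0 1 := by
    have c1 : Continuous fun r : ℝ => (1 - (r : ℂ)) := by fun_prop
    have c2 : Continuous fun r : ℝ => (r : ℂ) := by fun_prop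
    exact ((c1.continuousOn.mul (hii hΦ' hH)).add
        (c2.continuousOn.mul (hii hΦ hH'))).intervalIntegrable_of_Icc zero_le_one
  have hgi := (hii hΦ' hH).intervalIntegrable_of_Icc (μ := volume) zero_le_one
  rw [intervalIntegral.integral_sub (hFi.add (hF'i.const_mul t)) (hgi.const_mul t),
    intervalIntegral.integral_add hFi (hF'i.const_mul t), intervalIntegral.integral_const_mul,
    intervalIntegral.integral_const_mul] at hparts
  change deriv (fun s => conv Φ H (s, z)) t = _
  have e : (fun s => conv Φ H (s, z)) = (fun x => id x) * fun s => ∫ r in (0 : ℝ)..1, F s r := rfl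
  rw [e]
  refine hd.trans ?_
  unfold conv
  simp only [id, one_mul]
  linear_combination hparts

/-- The Taylor coefficients of a convolution. -/
lemma Valid.dFst_iterate_conv_zero (hP : P.Valid) (hH : AnalyticOnNhd ℂ H P.dom) (m : ℕ) :
    ∀ {Φ : ℂ × ℂ → ℂ}, AnalyticOnNhd ℂ Φ P.box → ∀ {z : ℂ}, (0, z) ∈ P.dom →
      dFst^[m] (conv Φ H) (0, z) =
        ∑ i ∈ Finset.range m, dFst^[m - 1 - i] Φ (0, z) * dFst^[i] H (0, z) := by
  induction m with
  | zero => intro Φ _ z _; simp [conv]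
  | succ m ih =>
    intro Φ hΦ z hz
    have hΦ' : AnalyticOnNhd ℂ (dFst Φ) P.box := fun p hp => analyticAt_dFst (hΦ p hp)
    have h1 : dFst (conv Φ H) =ᶠ[𝓝 (0, z)] fun q => (fun w => Φ (0, w)) q.2 * H q +
        conv (dFst Φ) H q := by
      filter_upwards [isOpen_dom.mem_nhds hz] with q hq using hP.dFst_conv hΦ hH hq
    rw [Function.iterate_succ_apply, (dFst_iterate_eventuallyEq h1 m).eq_of_nhds,
      (dFst_iterate_mul_add (fun w => Φ (0, w)) (hH _ hz) (hP.analyticOnNhd_conv hΦ' hH _ hz) m).eq_of_nhds,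
      ih hΦ' hz, Finset.sum_range_succ, add_comm]
    congr 1
    · refine Finset.sum_congr rfl fun i hi => ?_
      rw [Finset.mem_range] at hi
      rw [← Function.iterate_succ_apply, show (m - 1 - i).succ = m + 1 - 1 - i by omega]
    · simp

/-- The definition of `feedback` keeps the t-derivative on the potentials, whose derivatives obey
bounds on the whole box, whereas a derivative of `Y` would cost part of the domain. The present form
is the one from which Taylor coefficients are read. -/
lemma Valid.feedback_eq (hP : P.Valid) {Ψ : ℕ → ℂ × ℂ → ℂ}
    (hΨ : ∀ k < P.n - 1, AnalyticOnNhd ℂ (Ψ k) P.box) (hY : ∀ k, AnalyticOnNhd ℂ (P.Y G k) P.dom)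
    {p : ℂ × ℂ} (hp : p ∈ P.dom) :
    P.feedback Ψ G p = ∑ k ∈ Finset.range (P.n - 1), dFst (conv (Ψ k) (P.Y G k)) p := by
  unfold feedback
  refine Finset.sum_congr rfl fun k hk => ?_
  rw [hP.dFst_conv (hΨ k (Finset.mem_range.1 hk)) (hY k) hp]

/-- The Taylor coefficients of the source. -/
lemma Valid.dFst_iterate_source_zero (hP : P.Valid) {Ψ : ℕ → ℂ × ℂ → ℂ}
    (hΨ : ∀ k < P.n - 1, AnalyticOnNhd ℂ (Ψ k) P.box) (hY : ∀ k, AnalyticOnNhd ℂ (P.Y G k) P.dom)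
    (hG : P.IsSource Ψ G) (m : ℕ) {z : ℂ} (hz : (0, z) ∈ P.dom) :
    dFst^[m] G (0, z) = ∑ k ∈ Finset.range (P.n - 1), (P.ζ ^ k * dFst^[m] (Ψ k) (0, z) +
      ∑ i ∈ Finset.range (m + 1), dFst^[m - i] (Ψ k) (0, z) * dFst^[i] (P.Y G k) (0, z)) := by
  have h1 : G =ᶠ[𝓝 (0, z)] fun q => ∑ k ∈ Finset.range (P.n - 1),
      ((fun _ => P.ζ ^ k) q.2 * Ψ k q + dFst (conv (Ψ k) (P.Y G k)) q) := by
    filter_upwards [isOpen_dom.mem_nhds hz] with q hq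
    rw [hG q hq, hP.feedback_eq hΨ hY hq, ← Finset.sum_add_distrib]
  have hΨz := fun k (hk : k ∈ Finset.range (P.n - 1)) =>
    hΨ k (Finset.mem_range.1 hk) _ (hP.mem_box hz)
  have hcz := fun k (hk : k ∈ Finset.range (P.n - 1)) => analyticAt_dFst
    (hP.analyticOnNhd_conv (hΨ k (Finset.mem_range.1 hk)) (hY k) _ hz)
  rw [(dFst_iterate_eventuallyEq h1 m).eq_of_nhds, (dFst_iterate_sum _
    (fun k hk => AnalyticAt.fun_add (AnalyticAt.fun_mul analyticAt_const (hΨz k hk)) (hcz k hk))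
    m).eq_of_nhds]
  refine Finset.sum_congr rfl fun k hk => ?_
  rw [(dFst_iterate_mul_add (fun _ => P.ζ ^ k) (hΨz k hk) (hcz k hk) m).eq_of_nhds,
    ← Function.iterate_succ_apply,
    hP.dFst_iterate_conv_zero (hY k) (m + 1) (hΨ k (Finset.mem_range.1 hk)) hz]
  rfl

end Frame

end Convolution

end FactorialSeries
end

open Filter Topology Asymptotics MeasureTheory
noncomputable section
namespace FactorialSeries

/-! ### Laplace transforms along the positive axis -/

section Laplace

/-- Continuity and exponential growth on the positive real axis. -/
structure LapBound (C σ : ℝ) (f : ℂ → ℂ) : Prop where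
  cont : ContinuousOn (fun t : ℝ => f t) (Set.Ici 0)
  le : ∀ t : ℝ, 0 ≤ t → ‖f t‖ ≤ C * Real.exp (σ * t)

variable {C C' σ : ℝ} {f g : ℂ → ℂ} {u : ℂ}

lemma norm_exp_neg_mul (u : ℂ) (t : ℝ) : ‖Complex.exp (-u * t)‖ = Real.exp (-u.re * t) := by
  rw [Complex.norm_exp]; simp

lemma LapBound.norm_le (hf : LapBound C σ f) {t : ℝ} (ht : 0 ≤ t) :
    ‖Complex.exp (-u * t) * f t‖ ≤ C * Real.exp (-(u.re - σ) * t) := by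
  rw [norm_mul, norm_exp_neg_mul]
  calc Real.exp (-u.re * t) * ‖f t‖ ≤ Real.exp (-u.re * t) * (C * Real.exp (σ * t)) := by
        gcongr; exact hf.le t ht
    _ = C * (Real.exp (-u.re * t) * Real.exp (σ * t)) := by ring
    _ = _ := by rw [← Real.exp_add]; ring_nf

lemma integrableOn_exp_neg {b : ℝ} (hb : 0 < b) :
    IntegrableOn (fun t : ℝ => Real.exp (-b * t)) (Set.Ioi 0) := exp_neg_integrableOn_Ioi 0 hb

lemma aesm_lap {f : ℂ → ℂ} (hf : ContinuousOn (fun t : ℝ => f t) (Set.Ici 0)) (u : ℂ) :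
    AEStronglyMeasurable (fun t : ℝ => Complex.exp (-u * t) * f t)
      (volume.restrict (Set.Ioi 0)) := by
  refine ContinuousOn.aestronglyMeasurable ?_ measurableSet_Ioi
  exact (Continuous.continuousOn (by fun_prop)).mul (hf.mono Set.Ioi_subset_Ici_self)

lemma LapBound.integrableOn (hf : LapBound C σ f) (hu : σ < u.re) :
    IntegrableOn (fun t : ℝ => Complex.exp (-u * t) * f t) (Set.Ioi 0) := by
  refine Integrable.mono' ((integrableOn_exp_neg (sub_pos.2 hu)).const_mul C) (aesm_lap hf.cont u) ?_
  exact (ae_restrict_iff' measurableSet_Ioi).2 (Eventually.of_forall fun t ht =>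
    hf.norm_le (le_of_lt ht))

lemma LapBound.norm_lap_le (hf : LapBound C σ f) (hu : σ < u.re) :
    ‖lap f u‖ ≤ C / (u.re - σ) := by
  have h1 : ‖lap f u‖ ≤ ∫ t in Set.Ioi (0 : ℝ), C * Real.exp (-(u.re - σ) * t) :=
    norm_integral_le_of_norm_le ((integrableOn_exp_neg (sub_pos.2 hu)).const_mul C)
      ((ae_restrict_iff' measurableSet_Ioi).2 (Eventually.of_forall fun t ht =>
        hf.norm_le (le_of_lt ht)))
  rw [integral_const_mul, integral_exp_mul_Ioi (by linarith) 0] at h1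
  refine h1.trans (le_of_eq ?_)
  rw [mul_zero, Real.exp_zero, neg_div_neg_eq, mul_one_div]

lemma LapBound.add (hf : LapBound C σ f) (hg : LapBound C' σ g) :
    LapBound (C + C') σ (fun t => f t + g t) :=
  ⟨hf.cont.add hg.cont, fun t ht => (norm_add_le _ _).trans (by
    rw [add_mul]; exact add_le_add (hf.le t ht) (hg.le t ht))⟩

lemma LapBound.const_mul (hf : LapBound C σ f) (c : ℂ) :
    LapBound (‖c‖ * C) σ (fun t => c * f t) :=
  ⟨continuousOn_const.mul hf.cont, fun t ht => by
    rw [norm_mul, mul_assoc]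
    exact mul_le_mul_of_nonneg_left (hf.le t ht) (norm_nonneg _)⟩

lemma lap_congr (h : ∀ t : ℝ, 0 ≤ t → f t = g t) (u : ℂ) : lap f u = lap g u :=
  setIntegral_congr_fun measurableSet_Ioi fun t ht => by rw [h t (le_of_lt ht)]

lemma lap_const_mul (c : ℂ) (f : ℂ → ℂ) (u : ℂ) : lap (fun t => c * f t) u = c * lap f u := by
  unfold lap
  rw [← integral_const_mul]
  refine integral_congr_ae (Eventually.of_forall fun t => ?_)
  simp only
  ring

lemma lap_add (hf : LapBound C σ f) (hg : LapBound C' σ g) (hu : σ < u.re) :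
    lap (fun t => f t + g t) u = lap f u + lap g u := by
  unfold lap
  rw [← integral_add (hf.integrableOn hu) (hg.integrableOn hu)]
  refine integral_congr_ae (Eventually.of_forall fun t => ?_)
  simp only
  ring

lemma lap_sum {ι : Type*} (s : Finset ι) {f : ι → ℂ → ℂ} {C : ι → ℝ}
    (hf : ∀ i ∈ s, LapBound (C i) σ (f i)) (hu : σ < u.re) :
    lap (fun t => ∑ i ∈ s, f i t) u = ∑ i ∈ s, lap (f i) u := by
  unfold lap
  rw [← integral_finsetSum s fun i hi => (hf i hi).integrableOn hu]
  refine integral_congr_ae (Eventually.of_forall fun t => ?_)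
  simp only
  rw [Finset.mul_sum]

/-- Laplace transform of a derivative. -/
lemma lap_deriv (hf : LapBound C σ f) (hg : LapBound C' σ g)
    (hd : ∀ t : ℝ, 0 ≤ t → HasDerivAt f (g t) t) (hu : σ < u.re) :
    u * lap f u = f 0 + lap g u := by
  have h1 : ∀ t ∈ Set.Ici (0 : ℝ), HasDerivAt (fun t : ℝ => Complex.exp (-u * t) * f t)
      (-u * (Complex.exp (-u * t) * f t) + Complex.exp (-u * t) * g t) t := fun t ht => by
    have e1 : HasDerivAt (fun t : ℂ => Complex.exp (-u * t)) (Complex.exp (-u * t) * (-u * 1)) t :=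
      ((hasDerivAt_id (t : ℂ)).const_mul (-u)).cexp
    have e2 := (e1.mul (hd t ht)).comp_ofReal
    convert! e2 using 1
    ring
  have h2 : Tendsto (fun t : ℝ => Complex.exp (-u * t) * f t) atTop (𝓝 0) := by
    have hz : Tendsto (fun t : ℝ => C * Real.exp (-(u.re - σ) * t)) atTop (𝓝 0) := by
      have : Tendsto (fun t : ℝ => -(u.re - σ) * t) atTop atBot :=
        tendsto_id.const_mul_atTop_of_neg (by linarith)
      simpa using (Real.tendsto_exp_atBot.comp this).const_mul C
    refine squeeze_zero_norm' ?_ hz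
    filter_upwards [eventually_ge_atTop 0] with t ht using hf.norm_le ht
  have h3 := integral_Ioi_of_hasDerivAt_of_tendsto' h1
    (((hf.integrableOn hu).const_mul (-u)).add (hg.integrableOn hu)) h2
  rw [integral_add ((hf.integrableOn hu).const_mul (-u)) (hg.integrableOn hu),
    integral_const_mul] at h3
  change -u * lap f u + lap g u = _ at h3
  simp only [Complex.ofReal_zero, mul_zero, Complex.exp_zero, one_mul, zero_sub] at h3
  linear_combination -h3

/-- Laplace transform of a convolution. -/
lemma lap_conv (hf : LapBound C σ f) (hg : LapBound C' σ g) (hu : σ < u.re) :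
    lap (fun t => t * ∫ r in (0 : ℝ)..1, f ((1 - r) * t) * g (r * t)) u = lap f u * lap g u := by
  have h1 := integral_posConvolution (hg.integrableOn hu) (hf.integrableOn hu)
    (ContinuousLinearMap.mul ℝ ℂ) (μ := volume) (ν := volume)
  simp only [ContinuousLinearMap.mul_apply'] at h1
  rw [mul_comm]
  refine Eq.trans ?_ h1
  unfold lap
  refine setIntegral_congr_fun measurableSet_Ioi fun x _ => ?_
  simp only
  have h2 := intervalIntegral.smul_integral_comp_mul_left (a := 0) (b := 1)
    (fun t : ℝ => Complex.exp (-u * t) * g t * (Complex.exp (-u * ((x - t : ℝ) : ℂ)) * f ((x - t : ℝ) : ℂ))) x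
  rw [mul_zero, mul_one] at h2
  rw [← h2, Complex.real_smul, mul_left_comm, ← intervalIntegral.integral_const_mul]
  congr 1
  refine intervalIntegral.integral_congr fun r _ => ?_
  have e : Complex.exp (-u * x) = Complex.exp (-u * ((x * r : ℝ) : ℂ)) *
      Complex.exp (-u * ((x - x * r : ℝ) : ℂ)) := by
    rw [← Complex.exp_add]; congr 1; push_cast; ring
  have e1 : (1 - (r : ℂ)) * x = ((x - x * r : ℝ) : ℂ) := by push_cast; ring
  have e2 : (r : ℂ) * x = ((x * r : ℝ) : ℂ) := by push_cast; ring
  rw [e, e1, e2]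
  ring

/-- Differentiation of a Laplace transform with respect to a parameter. -/
lemma hasDerivAt_lap {H : ℂ × ℂ → ℂ} {z₀ : ℂ} {r : ℝ} (hr : 0 < r)
    (hH : ∀ t : ℝ, 0 ≤ t → ∀ z ∈ Metric.ball z₀ r, AnalyticAt ℂ H (t, z))
    (hb : ∀ t : ℝ, 0 ≤ t → ∀ z ∈ Metric.ball z₀ r, ‖H (t, z)‖ ≤ C * Real.exp (σ * t))
    (hu : σ < u.re) :
    LapBound (C / (r / 2)) σ (fun t => dSnd H (t, z₀)) ∧
    HasDerivAt (fun z => lap (fun t => H (t, z)) u) (lap (fun t => dSnd H (t, z₀)) u) z₀ := by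
  have hH' : ∀ t : ℝ, 0 ≤ t → ∀ z ∈ Metric.ball z₀ r, AnalyticAt ℂ (dSnd H) (t, z) :=
    fun t ht z hz => analyticAt_dSnd (hH t ht z hz)
  have hcont : ∀ {F : ℂ × ℂ → ℂ} {z : ℂ}, (∀ t : ℝ, 0 ≤ t → AnalyticAt ℂ F (t, z)) →
      ContinuousOn (fun t : ℝ => F (t, z)) (Set.Ici 0) := fun {F z} h t ht =>
    (ContinuousAt.comp (g := F) (f := fun t : ℝ => ((t, z) : ℂ × ℂ)) (h t ht).continuousAt
      (by fun_prop)).continuousWithinAt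
  have hbd : ∀ t : ℝ, 0 ≤ t → ∀ z ∈ Metric.ball z₀ (r / 2),
      ‖dSnd H (t, z)‖ ≤ C / (r / 2) * Real.exp (σ * t) := fun t ht z hz => by
    have hsub : Metric.closedBall z (r / 2) ⊆ Metric.ball z₀ r := fun w hw => by
      rw [Metric.mem_ball] at hz ⊢
      rw [Metric.mem_closedBall] at hw
      linarith [dist_triangle w z z₀]
    have h1 := Complex.norm_deriv_le_of_forall_mem_sphere_norm_le (c := z) (R := r / 2)
      (C := C * Real.exp (σ * t)) (f := fun z => H (t, z)) (by positivity)
      (DifferentiableOn.diffContOnCl_ball (U := Metric.ball z₀ r)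
        (fun w hw => (hasDerivAt_dSnd (hH t ht w hw)).differentiableAt.differentiableWithinAt) hsub)
      fun w hw => hb t ht w (hsub (Metric.sphere_subset_closedBall hw))
    refine h1.trans (le_of_eq (by ring))
  have hmem : z₀ ∈ Metric.ball z₀ (r / 2) := Metric.mem_ball_self (by positivity)
  have hmem' : z₀ ∈ Metric.ball z₀ r := Metric.mem_ball_self hr
  have hlb : LapBound (C / (r / 2)) σ (fun t => dSnd H (t, z₀)) :=
    ⟨hcont fun t ht => hH' t ht z₀ hmem', fun t ht => hbd t ht z₀ hmem⟩
  refine ⟨hlb, ?_⟩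
  have hHl : ∀ z ∈ Metric.ball z₀ r, LapBound C σ (fun t => H (t, z)) := fun z hz =>
    ⟨hcont fun t ht => hH t ht z hz, fun t ht => hb t ht z hz⟩
  have hsub : Metric.ball z₀ (r / 2) ⊆ Metric.ball z₀ r := Metric.ball_subset_ball (by linarith)
  refine (hasDerivAt_integral_of_dominated_loc_of_deriv_le (𝕜 := ℂ)
    (F := fun z (t : ℝ) => Complex.exp (-u * t) * H (t, z))
    (F' := fun z (t : ℝ) => Complex.exp (-u * t) * dSnd H (t, z))
    (bound := fun t => C / (r / 2) * Real.exp (-(u.re - σ) * t))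
    (Metric.ball_mem_nhds z₀ (by positivity : 0 < r / 2)) ?_ ((hHl z₀ hmem').integrableOn hu)
    (aesm_lap (f := fun t => dSnd H (t, z₀)) hlb.cont u) ?_ ((integrableOn_exp_neg (sub_pos.2 hu)).const_mul _) ?_).2
  · filter_upwards [Metric.ball_mem_nhds z₀ (by positivity : 0 < r / 2)] with z hz
    exact aesm_lap (f := fun t => H (t, z)) (hHl z (hsub hz)).cont u
  · refine (ae_restrict_iff' measurableSet_Ioi).2 (Eventually.of_forall fun t ht z hz => ?_)
    have : LapBound (C / (r / 2)) σ (fun t => dSnd H (t, z)) :=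
      ⟨hcont fun t ht => hH' t ht z (hsub hz), fun t ht => hbd t ht z hz⟩
    exact this.norm_le (le_of_lt ht)
  · refine (ae_restrict_iff' measurableSet_Ioi).2 (Eventually.of_forall fun t ht z hz => ?_)
    exact (hasDerivAt_dSnd (hH t (le_of_lt ht) z (hsub hz))).const_mul _

/-- Joint analyticity of a Laplace transform with a parameter. -/
lemma analyticOnNhd_lap {H : ℂ × ℂ → ℂ} {O : Set ℂ} (hO : IsOpen O)
    (hH : ∀ t : ℝ, 0 ≤ t → ∀ z ∈ O, AnalyticAt ℂ H (t, z))
    (hb : ∀ t : ℝ, 0 ≤ t → ∀ z ∈ O, ‖H (t, z)‖ ≤ C * Real.exp (σ * t)) :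
    AnalyticOnNhd ℂ (fun p : ℂ × ℂ => lap (fun t => H (t, p.2)) p.1)
      {p | σ < p.1.re ∧ p.2 ∈ O} := by
  have hopen : IsOpen {p : ℂ × ℂ | σ < p.1.re ∧ p.2 ∈ O} :=
    (isOpen_lt continuous_const (Complex.continuous_re.comp continuous_fst)).inter
      (hO.preimage continuous_snd)
  have hlb : ∀ z ∈ O, LapBound C σ (fun t => H (t, z)) := fun z hz =>
    ⟨fun t ht => (ContinuousAt.comp (g := H) (f := fun t : ℝ => ((t, z) : ℂ × ℂ))
      (hH t ht z hz).continuousAt (by fun_prop)).continuousWithinAt, fun t ht => hb t ht z hz⟩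
  refine analyticOnNhd_integral hopen (μ := volume.restrict (Set.Ioi (0 : ℝ)))
    (F := fun (t : ℝ) (p : ℂ × ℂ) => Complex.exp (-p.1 * t) * H (t, p.2)) ?_ ?_ ?_
  · refine (ae_restrict_iff' measurableSet_Ioi).2 (Eventually.of_forall fun t ht p hp => ?_)
    refine AnalyticAt.mul ?_ ?_
    · exact (analyticAt_fst.neg.mul analyticAt_const).cexp
    · exact AnalyticAt.comp (g := H) (f := fun q : ℂ × ℂ => (((t : ℂ), q.2) : ℂ × ℂ))
        (hH t (le_of_lt ht) p.2 hp.2) (analyticAt_const.prod analyticAt_snd)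
  · exact fun p hp => aesm_lap (f := fun t => H (t, p.2)) (hlb p.2 hp.2).cont p.1
  · intro p hp
    -- Half of the gap between Re u and σ is given up so that one bound serves a whole neighbourhood
    -- of u.
    refine ⟨fun t => C * Real.exp (-((p.1.re - σ) / 2) * t),
      (integrableOn_exp_neg (by linarith [hp.1])).const_mul _,
      {q | (p.1.re + σ) / 2 < q.1.re ∧ q.2 ∈ O}, ?_, ?_⟩
    · refine IsOpen.mem_nhds ?_ ⟨by linarith [hp.1], hp.2⟩
      exact (isOpen_lt continuous_const (Complex.continuous_re.comp continuous_fst)).inter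
        (hO.preimage continuous_snd)
    · refine (ae_restrict_iff' measurableSet_Ioi).2 (Eventually.of_forall fun t ht q hq => ?_)
      have ht' : 0 < t := ht
      have hC : 0 ≤ C := by
        have := (norm_nonneg _).trans (hb 0 le_rfl q.2 hq.2)
        simpa using this
      refine ((hlb q.2 hq.2).norm_le ht'.le).trans ?_
      refine mul_le_mul_of_nonneg_left (Real.exp_le_exp.2 ?_) hC
      have := hq.1
      nlinarith

end Laplace

end FactorialSeries
end

open Filter Topology Asymptotics MeasureTheory
noncomputable section
namespace FactorialSeries

/-! ### From the Borel plane back to the differential equation -/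

section BorelLaplace

namespace Frame

/-- The base domain. -/
def base (P : Frame) : Set ℂ := {z | Metric.infDist z P.Q < P.d}

lemma isOpen_base {P : Frame} : IsOpen P.base :=
  isOpen_lt (Metric.continuous_infDist_pt _) continuous_const

/-- A source of the transport equations, together with the potentials it belongs to. -/
structure Solution (P : Frame) (K l σ σ' c M : ℝ) (Ψ : ℕ → ℂ × ℂ → ℂ) (G : ℂ × ℂ → ℂ) : Prop where
  valid : P.Valid
  K_pos : 0 < K
  l_le : K * (1 / P.a + 1 / 2) ≤ l
  σ'_nonneg : 0 ≤ σ'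
  σ'_lt : σ' < σ
  c_nonneg : 0 ≤ c
  M_nonneg : 0 ≤ M
  pot : ∀ k < P.n - 1, P.Potential c σ' (Ψ k)
  pot' : ∀ k < P.n - 1, P.Potential c σ' (dFst (Ψ k))
  src : P.Src K l σ M G
  eqn : P.IsSource Ψ G

variable {P : Frame} {K l σ σ' c M A : ℝ} {Ψ : ℕ → ℂ × ℂ → ℂ} {G H : ℂ × ℂ → ℂ}

/-- A bound for the weights that do not depend on the first variable. -/
def wtBound (P : Frame) (K l : ℝ) : ℝ := Real.exp (K * (∫ y, wb P.ρ y) + l * (P.a * P.d))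

lemma wtBound_pos : 0 < P.wtBound K l := Real.exp_pos _

lemma continuousOn_real {z : ℂ} (hz : z ∈ P.base) (hH : AnalyticOnNhd ℂ H P.dom) :
    ContinuousOn (fun t : ℝ => H (t, z)) (Set.Ici 0) := fun t ht =>
  (ContinuousAt.comp (g := H) (f := fun t : ℝ => ((t, z) : ℂ × ℂ))
    (hH _ ((real_mem_dom ht).2 hz)).continuousAt (by fun_prop)).continuousWithinAt

lemma Bnd.lapBound (hP : P.Valid) (hK : 0 ≤ K) (hl : 0 ≤ l) (hA : 0 ≤ A) (hH : P.Bnd K l σ A H)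
    {z : ℂ} (hz : z ∈ P.base) : LapBound (A * P.wtBound K l) σ (fun t => H (t, z)) := by
  refine ⟨continuousOn_real hz hH.analytic, fun t ht => ?_⟩
  have hp := (real_mem_dom (P := P) ht).2 hz
  refine (hH.le _ hp).trans ?_
  rw [mul_assoc]
  have := hP.wt_le (σ := σ) hK hl hp
  rw [rePos_ofReal ht] at this
  gcongr
  exact this

lemma Src.bnd (hP : P.Valid) (hM : 0 ≤ M) (hG : P.Src K l σ M G) : P.Bnd K l σ M G :=
  ⟨hG.analytic, fun p hp => (hG.le p hp).trans (by
    have := wb_le_one hP.ρ_pos (P.prog p.2)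
    have h1 := (wt_pos (P := P) K l σ p).le
    gcongr
    nlinarith)⟩

lemma Bnd.norm_dFst_le (hP : P.Valid) (hK : 0 ≤ K) (hl : 0 ≤ l) (hσ : 0 ≤ σ) (hA : 0 ≤ A)
    (hH : P.Bnd K l σ A H) {δ : ℝ} (hδ : 0 < δ) {p : ℂ × ℂ}
    (hp : width p.1 / P.a + Metric.infDist p.2 P.Q + δ < P.d) :
    ‖dFst H p‖ ≤ A * P.wtBound K l * Real.exp (σ * (P.a * δ)) / (P.a * δ) *
      Real.exp (σ * rePos p.1) := by
  have ha := hP.a_pos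
  have hmem : ∀ t, width t < P.a * (P.d - Metric.infDist p.2 P.Q) → (t, p.2) ∈ P.dom := fun t ht => by
    change width t / P.a + Metric.infDist p.2 P.Q < P.d
    have : width t / P.a < P.d - Metric.infDist p.2 P.Q := (div_lt_iff₀' ha).2 ht
    linarith
  have h1 := norm_iteratedDeriv_le_of_width (F := fun t => H (t, p.2))
    (r := P.a * (P.d - Metric.infDist p.2 P.Q)) (C := A * P.wtBound K l) (σ := σ) (δ := P.a * δ)
    hσ (by positivity) (mul_nonneg hA wtBound_pos.le)
    (fun t ht => AnalyticAt.comp (g := H) (f := fun t : ℂ => ((t, p.2) : ℂ × ℂ))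
      (hH.analytic _ (hmem t ht)) (analyticAt_id.prod analyticAt_const))
    (fun t ht => by
      have h2 := hP.wt_le (σ := σ) hK hl (hmem t ht)
      refine (hH.le _ (hmem t ht)).trans ?_
      rw [mul_assoc]
      gcongr
      exact h2) 1 (t := p.1) (by
        have : width p.1 / P.a < P.d - Metric.infDist p.2 P.Q - δ := by linarith
        have := (div_lt_iff₀' ha).1 this
        linarith)
  rw [iteratedDeriv_one, pow_one, Nat.factorial_one, Nat.cast_one, one_mul] at h1
  exact h1

lemma Bnd.lapBound_dFst (hP : P.Valid) (hK : 0 ≤ K) (hl : 0 ≤ l) (hσ : 0 ≤ σ) (hA : 0 ≤ A)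
    (hH : P.Bnd K l σ A H) {z : ℂ} (hz : z ∈ P.base) :
    ∃ C, LapBound C σ (fun t => dFst H (t, z)) := by
  have hδ : 0 < (P.d - Metric.infDist z P.Q) / 2 := by
    have : Metric.infDist z P.Q < P.d := hz
    linarith
  refine ⟨A * P.wtBound K l * Real.exp (σ * (P.a * ((P.d - Metric.infDist z P.Q) / 2))) /
      (P.a * ((P.d - Metric.infDist z P.Q) / 2)),
    continuousOn_real hz fun p hp => analyticAt_dFst (hH.analytic p hp), fun t ht => ?_⟩
  have h1 := hH.norm_dFst_le hP hK hl hσ hA hδ (p := ((t : ℂ), z)) (by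
    change width (t : ℂ) / P.a + Metric.infDist z P.Q + _ < P.d
    rw [width_ofReal ht, zero_div]
    linarith [hδ])
  rw [rePos_ofReal ht] at h1
  exact h1

/-- Laplace transform of the derivative of a function on `P.dom`. -/
lemma Bnd.lap_dFst (hP : P.Valid) (hK : 0 ≤ K) (hl : 0 ≤ l) (hσ : 0 ≤ σ) (hA : 0 ≤ A)
    (hH : P.Bnd K l σ A H) {z : ℂ} (hz : z ∈ P.base) {u : ℂ} (hu : σ < u.re) :
    lap (fun t => dFst H (t, z)) u = u * lap (fun t => H (t, z)) u - H (0, z) := by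
  obtain ⟨C, hC⟩ := hH.lapBound_dFst hP hK hl hσ hA hz
  have h1 := lap_deriv (hH.lapBound hP hK hl hA hz) hC
    (fun t ht => hasDerivAt_dFst (hH.analytic _ ((real_mem_dom ht).2 hz))) hu
  rw [h1]; ring

lemma zero_mem_dom {z : ℂ} (hz : z ∈ P.base) : ((0 : ℂ), z) ∈ P.dom := by
  have := (real_mem_dom (P := P) (le_refl (0 : ℝ))).2 hz
  simpa using this

/-- The functions `e^{-ζuz} u^{-k} (d/dz)^k W` for the solution `W`. -/
def V (P : Frame) (G : ℂ × ℂ → ℂ) (k : ℕ) (u z : ℂ) : ℂ :=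
  P.ζ ^ k + u * lap (fun t => P.Y G k (t, z)) u

namespace Solution

variable (hs : P.Solution K l σ σ' c M Ψ G)
include hs

lemma σ_nonneg : 0 ≤ σ := hs.σ'_nonneg.trans hs.σ'_lt.le

lemma l_pos : 0 < l := by
  have ha := hs.valid.a_pos
  have := hs.K_pos
  exact lt_of_lt_of_le (by positivity) hs.l_le

lemma bnd_Y (k : ℕ) : P.Bnd K l σ ((2 / P.a + 1) / K * M) (P.Y G k) :=
  hs.valid.bnd_Y hs.K_pos hs.l_le hs.σ_nonneg hs.M_nonneg hs.src k

lemma coef_nonneg : 0 ≤ (2 / P.a + 1) / K * M := by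
  have ha := hs.valid.a_pos
  have := hs.K_pos
  have := hs.M_nonneg
  positivity

lemma lapBound_Y (k : ℕ) {z : ℂ} (hz : z ∈ P.base) :
    LapBound ((2 / P.a + 1) / K * M * P.wtBound K l) σ (fun t => P.Y G k (t, z)) :=
  (hs.bnd_Y k).lapBound hs.valid hs.K_pos.le hs.l_pos.le hs.coef_nonneg hz

lemma lapBound_G {z : ℂ} (hz : z ∈ P.base) : LapBound (M * P.wtBound K l) σ (fun t => G (t, z)) :=
  (hs.src.bnd hs.valid hs.M_nonneg).lapBound hs.valid hs.K_pos.le hs.l_pos.le hs.M_nonneg hz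

lemma bnd_Ψ {k : ℕ} (hk : k < P.n - 1) : P.Bnd K l σ c (Ψ k) :=
  (hs.valid.src_potential hs.K_pos.le hs.l_pos.le hs.c_nonneg hs.σ'_lt.le (hs.pot k hk)).bnd
    hs.valid hs.c_nonneg

lemma lapBound_Ψ {k : ℕ} (hk : k < P.n - 1) {z : ℂ} (hz : z ∈ P.base) :
    LapBound (c * P.wtBound K l) σ (fun t => Ψ k (t, z)) :=
  (hs.bnd_Ψ hk).lapBound hs.valid hs.K_pos.le hs.l_pos.le hs.c_nonneg hz

lemma analytic_Ψ {k : ℕ} (hk : k < P.n - 1) : AnalyticOnNhd ℂ (Ψ k) P.box := (hs.pot k hk).analytic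

lemma analytic_Y (k : ℕ) : AnalyticOnNhd ℂ (P.Y G k) P.dom := (hs.bnd_Y k).analytic

/-- Only μ = ζ contributes at t = 0, and its coefficient is ζ^{k+1}. -/
lemma Y_zero_eq (k : ℕ) (z : ℂ) : P.Y G k (0, z) = P.ζ ^ k * P.Y G 0 (0, z) := by
  rw [hs.valid.Y_zero, hs.valid.Y_zero, zero_add, pow_one, pow_succ]
  ring

/-- The Laplace transform of the integral equation. Transforming ∂_tΨ_k * Y_k gives (u L[Ψ_k] -
Ψ_k(0, z)) L[Y_k]; the term Ψ_k(0, z) Y_k cancels the boundary value, and ζ^k Ψ_k completes u L[Y_k]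
to V_k. -/
lemma lap_source {z : ℂ} (hz : z ∈ P.base) {u : ℂ} (hu : σ < u.re) :
    lap (fun t => G (t, z)) u =
      ∑ k ∈ Finset.range (P.n - 1), lap (fun t => Ψ k (t, z)) u * P.V G k u z := by
  have hP := hs.valid
  set ν := min l (σ - σ') with hν
  have hν0 : 0 < ν := lt_min hs.l_pos (by linarith [hs.σ'_lt])
  have hconv : ∀ k ∈ Finset.range (P.n - 1),
      ∃ C, LapBound C σ (fun t => conv (dFst (Ψ k)) (P.Y G k) (t, z)) := fun k hk => by
    have h1 := hP.src_conv hs.K_pos.le hs.c_nonneg hs.coef_nonneg hs.σ'_nonneg hν0 (min_le_left _ _)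
      (min_le_right _ _) (hs.pot' k (Finset.mem_range.1 hk)) (hs.bnd_Y k)
    have hc : 0 ≤ c * ((2 / P.a + 1) / K * M) / ν :=
      div_nonneg (mul_nonneg hs.c_nonneg hs.coef_nonneg) hν0.le
    exact ⟨_, (h1.bnd hP hc).lapBound hP hs.K_pos.le hs.l_pos.le hc hz⟩
  choose! C hC using hconv
  have hterm : ∀ k ∈ Finset.range (P.n - 1), LapBound (‖P.ζ ^ k‖ * (c * P.wtBound K l) +
      (‖Ψ k (0, z)‖ * ((2 / P.a + 1) / K * M * P.wtBound K l) + C k)) σ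
      (fun t => P.ζ ^ k * Ψ k (t, z) +
        (Ψ k (0, z) * P.Y G k (t, z) + conv (dFst (Ψ k)) (P.Y G k) (t, z))) := fun k hk =>
    ((hs.lapBound_Ψ (Finset.mem_range.1 hk) hz).const_mul _).add
      (((hs.lapBound_Y k hz).const_mul _).add (hC k hk))
  have h1 : lap (fun t => G (t, z)) u = lap (fun t => ∑ k ∈ Finset.range (P.n - 1),
      (P.ζ ^ k * Ψ k (t, z) +
        (Ψ k (0, z) * P.Y G k (t, z) + conv (dFst (Ψ k)) (P.Y G k) (t, z)))) u :=
    lap_congr (fun t ht => by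
      rw [hs.eqn _ ((real_mem_dom ht).2 hz), Finset.sum_add_distrib]
      rfl) u
  rw [h1, lap_sum _ hterm hu]
  refine Finset.sum_congr rfl fun k hk => ?_
  have hk' := Finset.mem_range.1 hk
  rw [lap_add ((hs.lapBound_Ψ hk' hz).const_mul _)
    (((hs.lapBound_Y k hz).const_mul _).add (hC k hk)) hu,
    lap_add ((hs.lapBound_Y k hz).const_mul _) (hC k hk) hu, lap_const_mul, lap_const_mul]
  have hΨ' : P.Bnd K l σ c (dFst (Ψ k)) :=
    (hP.src_potential hs.K_pos.le hs.l_pos.le hs.c_nonneg hs.σ'_lt.le (hs.pot' k hk')).bnd hP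
      hs.c_nonneg
  have h2 := lap_conv (hΨ'.lapBound hP hs.K_pos.le hs.l_pos.le hs.c_nonneg hz)
    (hs.lapBound_Y k hz) hu
  have h3 := (hs.bnd_Ψ hk').lap_dFst hP hs.K_pos.le hs.l_pos.le hs.σ_nonneg hs.c_nonneg hz hu
  change lap (fun t => conv (dFst (Ψ k)) (P.Y G k) (t, z)) u = _ at h2
  rw [h2, h3]
  unfold V
  ring

/-- The Laplace transform of `dSnd_Y`. The boundary values at t = 0 produced by the two
t-derivatives cancel by `Y_zero_eq`. -/
lemma hasDerivAt_V (k : ℕ) {z : ℂ} (hz : z ∈ P.base) {u : ℂ} (hu : σ < u.re) :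
    HasDerivAt (P.V G k u) (u * (P.V G (k + 1) u z - P.ζ * P.V G k u z +
      (1 / P.n * ∑ μ ∈ P.roots, μ ^ (k + 1)) * lap (fun t => G (t, z)) u)) z := by
  have hP := hs.valid
  obtain ⟨r, hr, hrs⟩ := Metric.isOpen_iff.1 isOpen_base z hz
  have h1 := (hasDerivAt_lap (C := (2 / P.a + 1) / K * M * P.wtBound K l) (σ := σ) hr
    (fun t ht w hw => hs.analytic_Y k _ ((real_mem_dom ht).2 (hrs hw)))
    (fun t ht w hw => (hs.lapBound_Y k (hrs hw)).le t ht) hu).2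
  convert! (h1.const_mul u).const_add (P.ζ ^ k) using 1
  congr 1
  obtain ⟨C1, hC1⟩ := (hs.bnd_Y (k + 1)).lapBound_dFst hP hs.K_pos.le hs.l_pos.le hs.σ_nonneg
    hs.coef_nonneg hz
  obtain ⟨C2, hC2⟩ := (hs.bnd_Y k).lapBound_dFst hP hs.K_pos.le hs.l_pos.le hs.σ_nonneg
    hs.coef_nonneg hz
  set S : ℂ := 1 / P.n * ∑ μ ∈ P.roots, μ ^ (k + 1) with hS
  have h2 : lap (fun t => dSnd (P.Y G k) (t, z)) u =
      lap (fun t => dFst (P.Y G (k + 1)) (t, z) +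
        ((-P.ζ) * dFst (P.Y G k) (t, z) + S * G (t, z))) u :=
    lap_congr (fun t ht => by
      rw [hP.dSnd_Y hs.K_pos hs.l_le hs.σ_nonneg hs.M_nonneg hs.src k ((real_mem_dom ht).2 hz)]
      ring) u
  rw [h2, lap_add hC1 ((hC2.const_mul _).add ((hs.lapBound_G hz).const_mul _)) hu,
    lap_add (hC2.const_mul _) ((hs.lapBound_G hz).const_mul _) hu, lap_const_mul, lap_const_mul,
    (hs.bnd_Y (k + 1)).lap_dFst hP hs.K_pos.le hs.l_pos.le hs.σ_nonneg hs.coef_nonneg hz hu,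
    (hs.bnd_Y k).lap_dFst hP hs.K_pos.le hs.l_pos.le hs.σ_nonneg hs.coef_nonneg hz hu,
    hs.Y_zero_eq (k + 1), hs.Y_zero_eq k]
  unfold V
  ring

lemma hasDerivAt_V_of_lt {k : ℕ} (hk : k + 1 < P.n) {z : ℂ} (hz : z ∈ P.base) {u : ℂ}
    (hu : σ < u.re) :
    HasDerivAt (P.V G k u) (u * (P.V G (k + 1) u z - P.ζ * P.V G k u z)) z := by
  have h := hs.hasDerivAt_V k hz hu
  rw [hs.valid.sum_roots_pow (Nat.succ_pos k) hk] at h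
  simpa using h

lemma V_n (u z : ℂ) : P.V G P.n u z = P.V G 0 u z := by
  unfold V
  have := hs.valid.Y_add_n G 0
  rw [zero_add] at this
  rw [this, hs.valid.root, pow_zero]

/-- For k = n - 1 the chain closes: V_n has the same value as V_0, the source enters with
coefficient 1, and `lap_source` expresses it through the V_k. -/
lemma hasDerivAt_V_last {z : ℂ} (hz : z ∈ P.base) {u : ℂ} (hu : σ < u.re) :
    HasDerivAt (P.V G (P.n - 1) u) (u * (P.V G 0 u z + ∑ k ∈ Finset.range (P.n - 1),
      lap (fun t => Ψ k (t, z)) u * P.V G k u z - P.ζ * P.V G (P.n - 1) u z)) z := by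
  have hn := hs.valid.n_pos
  have h := hs.hasDerivAt_V (P.n - 1) hz hu
  have hn' : (P.n : ℂ) ≠ 0 := Nat.cast_ne_zero.2 hn.ne'
  rw [Nat.sub_add_cancel hn, hs.valid.sum_roots_pow_n, hs.V_n, one_div, inv_mul_cancel₀ hn', one_mul,
    hs.lap_source hz hu] at h
  convert! h using 2
  ring

/-- The function `e^{ζuz} V₀` and its derivatives. -/
lemma iteratedDeriv_exp_mul_V {u : ℂ} (hu : σ < u.re) (k : ℕ) (hk : k < P.n) :
    ∀ z ∈ P.base, iteratedDeriv k (fun z => Complex.exp (P.ζ * u * z) * P.V G 0 u z) z =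
      u ^ k * (Complex.exp (P.ζ * u * z) * P.V G k u z) := by
  induction k with
  | zero => intro z _; simp
  | succ k ih =>
    intro z hz
    have h1 : iteratedDeriv k (fun z => Complex.exp (P.ζ * u * z) * P.V G 0 u z) =ᶠ[𝓝 z]
        fun z => u ^ k * (Complex.exp (P.ζ * u * z) * P.V G k u z) := by
      filter_upwards [isOpen_base.mem_nhds hz] with w hw using ih (by omega) w hw
    rw [iteratedDeriv_succ, h1.deriv_eq]
    have h2 : HasDerivAt (fun z => Complex.exp (P.ζ * u * z))
        (Complex.exp (P.ζ * u * z) * (P.ζ * u * 1)) z :=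
      ((hasDerivAt_id z).const_mul (P.ζ * u)).cexp
    have h3 := (h2.mul (hs.hasDerivAt_V_of_lt hk hz hu)).const_mul (u ^ k)
    refine h3.deriv.trans ?_
    rw [pow_succ]
    ring

lemma iteratedDeriv_n_exp_mul_V {u : ℂ} (hu : σ < u.re) {z : ℂ} (hz : z ∈ P.base) :
    iteratedDeriv P.n (fun z => Complex.exp (P.ζ * u * z) * P.V G 0 u z) z =
      u ^ P.n * (Complex.exp (P.ζ * u * z) * (P.V G 0 u z + ∑ k ∈ Finset.range (P.n - 1),
      lap (fun t => Ψ k (t, z)) u * P.V G k u z)) := by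
  have hn := hs.valid.n_pos
  have h1 : iteratedDeriv (P.n - 1) (fun z => Complex.exp (P.ζ * u * z) * P.V G 0 u z) =ᶠ[𝓝 z]
      fun z => u ^ (P.n - 1) * (Complex.exp (P.ζ * u * z) * P.V G (P.n - 1) u z) := by
    filter_upwards [isOpen_base.mem_nhds hz] with w hw using
      hs.iteratedDeriv_exp_mul_V hu (P.n - 1) (by omega) w hw
  have h0 := iteratedDeriv_succ (n := P.n - 1)
    (f := fun z => Complex.exp (P.ζ * u * z) * P.V G 0 u z)
  rw [Nat.sub_add_cancel hn] at h0
  rw [h0, h1.deriv_eq]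
  have h2 : HasDerivAt (fun z => Complex.exp (P.ζ * u * z))
      (Complex.exp (P.ζ * u * z) * (P.ζ * u * 1)) z :=
    ((hasDerivAt_id z).const_mul (P.ζ * u)).cexp
  have h3 := (h2.mul (hs.hasDerivAt_V_last hz hu)).const_mul (u ^ (P.n - 1))
  refine h3.deriv.trans ?_
  have h4 : u ^ P.n = u ^ (P.n - 1) * u := by rw [← pow_succ, Nat.sub_add_cancel hn]
  rw [h4]
  ring

lemma ode_exp_mul_V {u : ℂ} (hu : σ < u.re) {z : ℂ} (hz : z ∈ P.base) :
    -iteratedDeriv P.n (fun z => Complex.exp (P.ζ * u * z) * P.V G 0 u z) z +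
      ∑ k ∈ Finset.range (P.n - 1), u ^ (P.n - k) *
        ((if k = 0 then 1 else 0) + lap (fun t => Ψ k (t, z)) u) *
        iteratedDeriv k (fun z => Complex.exp (P.ζ * u * z) * P.V G 0 u z) z = 0 := by
  have hn := hs.valid.two_le
  rw [hs.iteratedDeriv_n_exp_mul_V hu hz]
  have h1 : ∀ k ∈ Finset.range (P.n - 1), u ^ (P.n - k) *
        ((if k = 0 then 1 else 0) + lap (fun t => Ψ k (t, z)) u) *
        iteratedDeriv k (fun z => Complex.exp (P.ζ * u * z) * P.V G 0 u z) z =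
      u ^ P.n * Complex.exp (P.ζ * u * z) * ((if k = 0 then P.V G 0 u z else 0) +
        lap (fun t => Ψ k (t, z)) u * P.V G k u z) := fun k hk => by
    rw [Finset.mem_range] at hk
    rw [hs.iteratedDeriv_exp_mul_V hu k (by omega) z hz]
    have : u ^ P.n = u ^ (P.n - k) * u ^ k := by rw [← pow_add, Nat.sub_add_cancel (by omega)]
    rw [this]
    by_cases h : k = 0
    · simp only [h, if_true]; ring
    · simp only [h, if_false]; ring
  rw [Finset.sum_congr rfl h1, ← Finset.mul_sum, Finset.sum_add_distrib,
    Finset.sum_ite_eq' (Finset.range (P.n - 1)) 0, if_pos (Finset.mem_range.2 (by omega))]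
  ring

end Solution

end Frame

end BorelLaplace

end FactorialSeries
end

open Filter Topology Asymptotics MeasureTheory
noncomputable section
namespace FactorialSeries

/-! ### Integrals along rays and decay at infinity -/

section RayIntegrals

namespace Frame

variable {P : Frame} {K l σ σ' c M C A : ℝ} {Ψ : ℕ → ℂ × ℂ → ℂ} {G H : ℂ × ℂ → ℂ} {g : ℂ → ℂ}

/-- The integral of `g` along the ray that starts at `z`. -/
def rint (P : Frame) (g : ℂ → ℂ) (z : ℂ) : ℂ :=
  ∫ τ in Set.Ioi (0 : ℝ), g (z - τ / P.ζ) * (-1 / P.ζ)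

/-- Analytic functions on the base with integrable decay. -/
structure Dec (P : Frame) (C : ℝ) (g : ℂ → ℂ) : Prop where
  analytic : AnalyticOnNhd ℂ g P.base
  le : ∀ z ∈ P.base, ‖g z‖ ≤ C * wb P.ρ (P.prog z)

lemma mem_base_of_mem_dom (ha : 0 < P.a) {p : ℂ × ℂ} (hp : p ∈ P.dom) : p.2 ∈ P.base := by
  have h : width p.1 / P.a + Metric.infDist p.2 P.Q < P.d := hp
  have : 0 ≤ width p.1 / P.a := div_nonneg (width_nonneg _) ha.le
  change Metric.infDist p.2 P.Q < P.d
  linarith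

lemma one_le_wt {p : ℂ × ℂ} (hK : 0 ≤ K) (hl : 0 ≤ l) (hσ : 0 ≤ σ) : 1 ≤ P.wt K l σ p := by
  have h1 := rePos_nonneg p.1
  have h2 := width_nonneg p.1
  have h3 := wE_nonneg (ρ := P.ρ) (P.prog p.2)
  exact Real.one_le_exp (by positivity)

lemma Dec.src (hP : P.Valid) (hC : 0 ≤ C) (hK : 0 ≤ K) (hl : 0 ≤ l) (hσ : 0 ≤ σ)
    (hg : P.Dec C g) : P.Src K l σ C (fun p => g p.2) := by
  refine ⟨fun p hp => AnalyticAt.comp (hg.analytic _ (mem_base_of_mem_dom hP.a_pos hp))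
    analyticAt_snd, fun p hp => (hg.le _ (mem_base_of_mem_dom hP.a_pos hp)).trans ?_⟩
  have h1 := one_le_wt (P := P) (p := p) hK hl hσ
  have h2 := (wb_pos (ρ := P.ρ) (P.prog p.2)).le
  gcongr
  nlinarith

lemma Dec.nonneg (hg : P.Dec C g) {z : ℂ} (hz : z ∈ P.base) : 0 ≤ C :=
  nonneg_of_mul_nonneg_left ((norm_nonneg _).trans (hg.le z hz)) (wb_pos _)

lemma rint_eq (z : ℂ) : P.rint g z = -P.rayInt (fun p => g p.2) (0, z) := by
  unfold rint rayInt
  rw [integral_mul_const]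
  ring

lemma integral_wb_sub {ρ : ℝ} (x : ℝ) : ∫ τ in Set.Ioi (0 : ℝ), wb ρ (x - τ) = wE ρ x := by
  have h1 := integral_comp_neg_Ioi 0 (fun τ => wb ρ (x + τ))
  rw [neg_zero] at h1
  have h2 := (measurePreserving_add_left volume x).setIntegral_preimage_emb
    (measurableEmbedding_addLeft x) (wb ρ) (Set.Iic x)
  have h3 : (fun τ => x + τ) ⁻¹' Set.Iic x = Set.Iic 0 := by ext; simp
  rw [h3] at h2
  unfold wE
  rw [← h2, ← h1]
  rfl

namespace Valid

variable (hP : P.Valid)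
include hP

lemma ray_mem_base {z : ℂ} (hz : z ∈ P.base) {τ : ℝ} (hτ : 0 ≤ τ) : z - τ / P.ζ ∈ P.base :=
  mem_base_of_mem_dom (p := (0, z - τ / P.ζ)) hP.a_pos (hP.ray_mem_dom (p := (0, z)) (zero_mem_dom hz) hτ)

lemma integrableOn_rint (hg : P.Dec C g) {z : ℂ} (hz : z ∈ P.base) :
    IntegrableOn (fun τ : ℝ => g (z - τ / P.ζ) * (-1 / P.ζ)) (Set.Ioi 0) :=
  (hP.integrableOn_ray zero_le_one (hg.nonneg hz)
    (hg.src hP (hg.nonneg hz) zero_le_one zero_le_one (σ := 0) le_rfl) (zero_mem_dom hz)).mul_const _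

lemma hasDerivAt_rint (hg : P.Dec C g) {z : ℂ} (hz : z ∈ P.base) :
    HasDerivAt (P.rint g) (-g z) z := by
  have hC := hg.nonneg hz
  have hsrc := hg.src (K := 1) (l := 1) (σ := 0) hP hC zero_le_one zero_le_one le_rfl
  have h1 := hP.bnd_rayInt zero_lt_one zero_le_one le_rfl hC hsrc
  have h2 := hP.dSnd_rayInt zero_lt_one zero_le_one le_rfl hC hsrc (zero_mem_dom hz)
  have h3 := hasDerivAt_dSnd (h1.analytic _ (zero_mem_dom hz))
  rw [h2] at h3
  exact h3.neg.congr_of_eventuallyEq (Eventually.of_forall fun z => rint_eq z)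

lemma norm_rint_le (hg : P.Dec C g) {z : ℂ} (hz : z ∈ P.base) :
    ‖P.rint g z‖ ≤ C * wE P.ρ (P.prog z) := by
  rw [← integral_wb_sub, ← integral_const_mul]
  refine norm_integral_le_of_norm_le ((hP.integrable_wb_sub _).const_mul C)
    ((ae_restrict_iff' measurableSet_Ioi).2 (Eventually.of_forall fun τ hτ => ?_))
  have := hg.le _ (hP.ray_mem_base hz (le_of_lt hτ))
  rw [hP.prog_ray] at this
  rw [norm_mul, norm_div, norm_neg, norm_one, hP.norm_ζ, div_one, mul_one]
  exact this

lemma tendsto_ray_prog (z : ℂ) : Tendsto (fun τ : ℝ => P.prog (z - τ / P.ζ)) atTop atBot := by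
  simp only [hP.prog_ray]
  exact tendsto_atBot_add_const_left _ _ tendsto_neg_atTop_atBot

lemma tendsto_rint (hg : P.Dec C g) {z : ℂ} (hz : z ∈ P.base) :
    Tendsto (fun τ : ℝ => P.rint g (z - τ / P.ζ)) atTop (𝓝 0) := by
  have h1 : Tendsto (fun τ : ℝ => C * wE P.ρ (P.prog (z - τ / P.ζ))) atTop (𝓝 0) := by
    simpa using (tendsto_wE.comp (hP.tendsto_ray_prog z)).const_mul C
  refine squeeze_zero_norm' ?_ h1
  filter_upwards [eventually_ge_atTop 0] with τ hτ using hP.norm_rint_le hg (hP.ray_mem_base hz hτ)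

/-- Constancy along the single ray from z is enough, so connectedness of the base plays no part. -/
lemma eq_of_hasDerivAt_zero {f : ℂ → ℂ} {L : ℂ} (hf : ∀ w ∈ P.base, HasDerivAt f 0 w) {z : ℂ}
    (hz : z ∈ P.base) (hL : Tendsto (fun τ : ℝ => f (z - τ / P.ζ)) atTop (𝓝 L)) : f z = L := by
  have h1 : ∀ τ : ℝ, 0 ≤ τ → HasDerivAt (fun τ : ℝ => f (z - τ / P.ζ)) 0 τ := fun τ hτ => by
    have e1 : HasDerivAt (fun τ : ℂ => z - τ / P.ζ) (-(1 / P.ζ)) (τ : ℂ) :=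
      ((hasDerivAt_id (τ : ℂ)).div_const _).const_sub z
    have e2 := (hf _ (hP.ray_mem_base hz hτ)).comp (τ : ℂ) e1
    rw [zero_mul] at e2
    exact e2.comp_ofReal
  have h2 : ∀ T : ℝ, 0 ≤ T → f (z - T / P.ζ) = f z := fun T hT => by
    have := constant_of_has_deriv_right_zero (a := 0) (b := T) (f := fun τ : ℝ => f (z - τ / P.ζ))
      (fun τ hτ => (h1 τ hτ.1).continuousAt.continuousWithinAt)
      (fun τ hτ => (h1 τ hτ.1).hasDerivWithinAt) T ⟨hT, le_rfl⟩
    simpa using this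
  refine tendsto_nhds_unique (Tendsto.congr' ?_ (tendsto_const_nhds (x := f z))) hL
  filter_upwards [eventually_ge_atTop 0] with τ hτ using (h2 τ hτ).symm

lemma eq_rint {h : ℂ → ℂ} (hg : P.Dec C g) (hh : ∀ w ∈ P.base, HasDerivAt h (-g w) w) {z : ℂ}
    (hz : z ∈ P.base) (h0 : Tendsto (fun τ : ℝ => h (z - τ / P.ζ)) atTop (𝓝 0)) :
    h z = P.rint g z := by
  refine sub_eq_zero.1 (hP.eq_of_hasDerivAt_zero (f := fun z => h z - P.rint g z) (fun w hw => ?_) hz ?_)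
  · have := (hh w hw).sub (hP.hasDerivAt_rint hg hw)
    rwa [sub_self] at this
  · simpa using h0.sub (hP.tendsto_rint hg hz)

/-- The weight by which the transported functions decay. -/
lemma tendsto_null_weight (d : ℝ) :
    Tendsto (fun x => wb P.ρ (x + d) + wE P.ρ x) atBot (𝓝 0) := by
  have h1 := (tendsto_wb hP.ρ_pos).comp (tendsto_atBot_add_const_right atBot d tendsto_id)
  simpa using h1.add (tendsto_wE (ρ := P.ρ))

lemma wb_le_of_le {x y : ℝ} (hxy : x ≤ y) (hy : y ≤ 0) : wb P.ρ x ≤ wb P.ρ y := by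
  unfold wb
  rw [abs_of_nonpos hy, abs_of_nonpos (hxy.trans hy)]
  exact Real.rpow_le_rpow_of_nonpos (by linarith) (by linarith) (by linarith [hP.ρ_pos])

/-- Decay for `prog` → -∞, which the weighted norm alone does not show. A characteristic can raise
`prog` by at most d, so the source along it is at most of size `wb` at `prog` + d; the ray integral
is of size `wE`. The condition `prog` ≤ -d keeps the arguments where `wb` is monotone. -/
lemma norm_transport_le (hK : 0 ≤ K) (hl : 0 ≤ l) (hσ : 0 ≤ σ) (hM : 0 ≤ M)
    (hG : P.Src K l σ M G) {μ : ℂ} (hμ : μ ∈ P.roots) {p : ℂ × ℂ} (hp : p ∈ P.dom)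
    (hx : P.prog p.2 ≤ -P.d) :
    ‖P.transport μ G p‖ ≤ (1 + ‖p.1‖ / P.a) * (M * P.wtBound K l * Real.exp (σ * rePos p.1)) *
      (wb P.ρ (P.prog p.2 + P.d) + wE P.ρ (P.prog p.2)) := by
  have ha := hP.a_pos
  set x := P.prog p.2 with hxdef
  set B := M * P.wtBound K l * Real.exp (σ * rePos p.1) with hB
  have hB0 : 0 ≤ B := mul_nonneg (mul_nonneg hM wtBound_pos.le) (Real.exp_pos _).le
  have hwb := (wb_pos (ρ := P.ρ) (x + P.d)).le
  have hwE := wE_nonneg (ρ := P.ρ) x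
  have hpa : 0 ≤ ‖p.1‖ / P.a := by positivity
  unfold transport
  split_ifs with h
  · have h1 : ‖P.rayInt G p‖ ≤ B * wE P.ρ x := by
      unfold rayInt
      rw [norm_mul, norm_inv, hP.norm_ζ, inv_one, one_mul, ← integral_wb_sub,
        ← integral_const_mul]
      refine norm_integral_le_of_norm_le ((hP.integrable_wb_sub _).const_mul _)
        ((ae_restrict_iff' measurableSet_Ioi).2 (Eventually.of_forall fun τ hτ => ?_))
      refine (hP.norm_src_ray_le hK hM hG hp (le_of_lt hτ)).trans ?_
      have h2 := hP.wt_le (σ := σ) hK hl hp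
      have h3 := (wb_pos (ρ := P.ρ) (x - τ)).le
      calc M * (wb P.ρ (x - τ) * P.wt K l σ p) ≤
          M * (wb P.ρ (x - τ) * (P.wtBound K l * Real.exp (σ * rePos p.1))) := by
            gcongr; exact h2
        _ = _ := by rw [hB]; ring
    refine h1.trans ?_
    have : B * wE P.ρ x ≤ B * (wb P.ρ (x + P.d) + wE P.ρ x) := by gcongr; linarith
    have h4 : 0 ≤ B * (wb P.ρ (x + P.d) + wE P.ρ x) := by positivity
    nlinarith
  · have hμ' := hP.mem_roots.1 hμ
    have h1 : ‖∫ s in (0 : ℝ)..1, G ((1 - s) * p.1, p.2 + s * p.1 / (μ - P.ζ))‖ ≤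
        B * wb P.ρ (x + P.d) * |(1 : ℝ) - 0| := by
      refine intervalIntegral.norm_integral_le_of_norm_le_const fun s hs => ?_
      rw [Set.uIoc_of_le zero_le_one] at hs
      have hs' := Set.Ioc_subset_Icc_self hs
      have hm := hP.char_mem_dom hμ' h hp hs'
      refine (hG.le _ hm).trans ?_
      have h2 := hP.wt_le (σ := σ) hK hl hm
      obtain ⟨y, hy, hys⟩ := hP.prog_char hμ' h p.2 p.1
      have hyd : y ≤ P.d := by
        have h5 : width p.1 / P.a ≤ P.d := by
          have h6 : width p.1 / P.a + Metric.infDist p.2 P.Q < P.d := hp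
          have : 0 ≤ Metric.infDist p.2 P.Q := Metric.infDist_nonneg
          linarith
        exact (le_abs_self y).trans (hy.trans h5)
      have hd0 : 0 ≤ P.d := (abs_nonneg y).trans (hy.trans (by
        have h6 : width p.1 / P.a + Metric.infDist p.2 P.Q < P.d := hp
        have : 0 ≤ Metric.infDist p.2 P.Q := Metric.infDist_nonneg
        linarith))
      have h3 : wb P.ρ (P.prog (p.2 + s * p.1 / (μ - P.ζ))) ≤ wb P.ρ (x + P.d) := by
        refine hP.wb_le_of_le ?_ (by linarith)
        rw [hys]
        have := rePos_nonneg p.1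
        nlinarith [hs'.1, hs'.2]
      have h4 : rePos ((1 - (s : ℂ)) * p.1) ≤ rePos p.1 := by
        have := rePos_smul (s := 1 - s) (by linarith [hs'.2]) p.1
        push_cast at this
        rw [this]
        nlinarith [rePos_nonneg p.1, hs'.1]
      calc M * (wb P.ρ (P.prog (p.2 + s * p.1 / (μ - P.ζ))) *
          P.wt K l σ ((1 - s) * p.1, p.2 + s * p.1 / (μ - P.ζ)))
          ≤ M * (wb P.ρ (x + P.d) * (P.wtBound K l * Real.exp (σ * rePos p.1))) := by
            have := (wt_pos (P := P) K l σ ((1 - s) * p.1, p.2 + s * p.1 / (μ - P.ζ))).le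
            refine mul_le_mul_of_nonneg_left (mul_le_mul h3 (h2.trans ?_) this hwb) hM
            change P.wtBound K l * _ ≤ _
            have := (wtBound_pos (P := P) (K := K) (l := l)).le
            gcongr
        _ = _ := by rw [hB]; ring
    unfold charInt
    rw [norm_mul, norm_div, norm_sub_rev]
    have h5 : ‖p.1‖ / ‖μ - P.ζ‖ ≤ ‖p.1‖ / P.a :=
      div_le_div_of_nonneg_left (norm_nonneg _) ha (hP.sep μ hμ' h)
    calc _ ≤ ‖p.1‖ / P.a * (B * wb P.ρ (x + P.d) * |(1 : ℝ) - 0|) :=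
          mul_le_mul h5 h1 (norm_nonneg _) hpa
      _ = ‖p.1‖ / P.a * B * wb P.ρ (x + P.d) := by rw [sub_zero, abs_one]; ring
      _ ≤ (1 + ‖p.1‖ / P.a) * B * (wb P.ρ (x + P.d) + wE P.ρ x) := by
          gcongr
          · linarith
          · linarith

lemma norm_Y_le (hK : 0 ≤ K) (hl : 0 ≤ l) (hσ : 0 ≤ σ) (hM : 0 ≤ M)
    (hG : P.Src K l σ M G) (k : ℕ) {p : ℂ × ℂ} (hp : p ∈ P.dom) (hx : P.prog p.2 ≤ -P.d) :
    ‖P.Y G k p‖ ≤ (1 + ‖p.1‖ / P.a) * (M * P.wtBound K l * Real.exp (σ * rePos p.1)) *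
      (wb P.ρ (P.prog p.2 + P.d) + wE P.ρ (P.prog p.2)) := by
  have hn : (0 : ℝ) < P.n := Nat.cast_pos.2 hP.n_pos
  set B := (1 + ‖p.1‖ / P.a) * (M * P.wtBound K l * Real.exp (σ * rePos p.1)) *
      (wb P.ρ (P.prog p.2 + P.d) + wE P.ρ (P.prog p.2)) with hB
  have h1 : ‖∑ μ ∈ P.roots, μ ^ (k + 1) * P.transport μ G p‖ ≤ ∑ μ ∈ P.roots, B := by
    refine (norm_sum_le _ _).trans (Finset.sum_le_sum fun μ hμ => ?_)
    rw [norm_mul, norm_pow, hP.norm_root (hP.mem_roots.1 hμ), one_pow, one_mul]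
    exact hP.norm_transport_le hK hl hσ hM hG hμ hp hx
  rw [Finset.sum_const, hP.card_roots, nsmul_eq_mul] at h1
  unfold Y
  rw [norm_mul, norm_div, norm_one, Complex.norm_natCast]
  calc 1 / (P.n : ℝ) * ‖∑ μ ∈ P.roots, μ ^ (k + 1) * P.transport μ G p‖
      ≤ 1 / (P.n : ℝ) * (P.n * B) := by gcongr
    _ = B := by field_simp

end Valid

end Frame

end RayIntegrals

end FactorialSeries
end

open Filter Topology Asymptotics MeasureTheory
noncomputable section
namespace FactorialSeries

/-! ### The function η as a Laplace transform -/

section ExactSolution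

namespace Frame

variable {P : Frame} {K l σ σ' c M C A : ℝ} {Ψ : ℕ → ℂ × ℂ → ℂ} {G H : ℂ × ℂ → ℂ} {g : ℂ → ℂ}

/-- The integrand of the exponent `X`. -/
def slope (P : Frame) (Ψ : ℕ → ℂ × ℂ → ℂ) (z : ℂ) : ℂ :=
  ∑ k ∈ Finset.range (P.n - 1), P.ζ ^ (k + 1) * Ψ k (0, z)

/-- The exponent `X`. -/
def expo (P : Frame) (Ψ : ℕ → ℂ × ℂ → ℂ) (z : ℂ) : ℂ := -(1 / (P.n : ℂ)) * P.rint (P.slope Ψ) z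

/-- The function `η`. -/
def eta (P : Frame) (Ψ : ℕ → ℂ × ℂ → ℂ) (G : ℂ × ℂ → ℂ) (u z : ℂ) : ℂ :=
  Complex.exp (-P.expo Ψ z) * P.V G 0 u z - 1

/-- The Borel transform of `η`. -/
def borelEta (P : Frame) (Ψ : ℕ → ℂ × ℂ → ℂ) (G : ℂ × ℂ → ℂ) (p : ℂ × ℂ) : ℂ :=
  Complex.exp (-P.expo Ψ p.2) * dFst (P.Y G 0) p

lemma one_add_eta (u z : ℂ) :
    Complex.exp (P.expo Ψ z) * (1 + P.eta Ψ G u z) = P.V G 0 u z := by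
  unfold eta
  rw [add_sub_cancel, ← mul_assoc, ← Complex.exp_add, add_neg_cancel, Complex.exp_zero, one_mul]

lemma zero_mem_box {z : ℂ} (hz : z ∈ P.base) (ha : 0 < P.a) : ((0 : ℂ), z) ∈ P.box := by
  have h1 := zero_mem_dom hz
  have h0 : 0 < P.d := lt_of_le_of_lt Metric.infDist_nonneg hz
  refine ⟨?_, hz⟩
  have : width 0 = 0 := by simpa using width_ofReal (le_refl (0 : ℝ))
  change width 0 < _
  rw [this]
  positivity

lemma Potential.dec (hP : P.Valid) (hΨ : P.Potential c σ H) : P.Dec c (fun z => H (0, z)) := by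
  refine ⟨fun z hz => AnalyticAt.comp (g := H) (f := fun z : ℂ => ((0, z) : ℂ × ℂ))
    (hΨ.analytic _ (zero_mem_box hz hP.a_pos)) (analyticAt_const.prod analyticAt_id), fun z hz => ?_⟩
  have h1 := hΨ.le _ (zero_mem_box hz hP.a_pos)
  have h4 : rePos 0 = 0 := by simp [rePos]
  simpa [h4] using h1

lemma Valid.dec_slope (hP : P.Valid) (hΨ : ∀ k < P.n - 1, P.Potential c σ (Ψ k)) :
    P.Dec ((P.n - 1 : ℕ) * c) (P.slope Ψ) := by
  have hd := fun k hk => (hΨ k hk).dec hP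
  refine ⟨fun z hz => Finset.analyticAt_fun_sum _ fun k hk =>
    analyticAt_const.mul ((hd k (Finset.mem_range.1 hk)).analytic z hz), fun z hz => ?_⟩
  have h1 : ‖P.slope Ψ z‖ ≤ ∑ k ∈ Finset.range (P.n - 1), c * wb P.ρ (P.prog z) := by
    refine (norm_sum_le _ _).trans (Finset.sum_le_sum fun k hk => ?_)
    rw [norm_mul, norm_pow, hP.norm_ζ, one_pow, one_mul]
    exact (hd k (Finset.mem_range.1 hk)).le z hz
  rw [Finset.sum_const, Finset.card_range, nsmul_eq_mul, ← mul_assoc] at h1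
  exact h1

lemma Valid.hasDerivAt_expo (hP : P.Valid) (hΨ : ∀ k < P.n - 1, P.Potential c σ (Ψ k)) {z : ℂ}
    (hz : z ∈ P.base) : HasDerivAt (P.expo Ψ) (1 / P.n * P.slope Ψ z) z := by
  have h := (hP.hasDerivAt_rint (hP.dec_slope hΨ) hz).const_mul (-(1 / (P.n : ℂ)))
  convert! h using 1
  ring

lemma Valid.norm_expo_le (hP : P.Valid) (hΨ : ∀ k < P.n - 1, P.Potential c σ (Ψ k)) {z : ℂ}
    (hz : z ∈ P.base) (hc : 0 ≤ c) : ‖P.expo Ψ z‖ ≤ c * wE P.ρ (P.prog z) := by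
  have h := hP.norm_rint_le (hP.dec_slope hΨ) hz
  have hn : (0 : ℝ) < P.n := Nat.cast_pos.2 hP.n_pos
  have hw := wE_nonneg (ρ := P.ρ) (P.prog z)
  unfold expo
  rw [norm_mul, norm_neg, norm_div, norm_one, Complex.norm_natCast]
  calc 1 / (P.n : ℝ) * ‖P.rint (P.slope Ψ) z‖
      ≤ 1 / (P.n : ℝ) * ((P.n - 1 : ℕ) * c * wE P.ρ (P.prog z)) := by gcongr
    _ ≤ 1 / (P.n : ℝ) * ((P.n : ℝ) * c * wE P.ρ (P.prog z)) := by
        gcongr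
        omega
    _ = _ := by field_simp

lemma Valid.tendsto_expo (hP : P.Valid) (hΨ : ∀ k < P.n - 1, P.Potential c σ (Ψ k)) {z : ℂ}
    (hz : z ∈ P.base) : Tendsto (fun τ : ℝ => P.expo Ψ (z - τ / P.ζ)) atTop (𝓝 0) := by
  have h := (hP.tendsto_rint (hP.dec_slope hΨ) hz).const_mul (-(1 / (P.n : ℂ)))
  rwa [mul_zero] at h

lemma Valid.analyticAt_expo (hP : P.Valid) (hΨ : ∀ k < P.n - 1, P.Potential c σ (Ψ k)) {z : ℂ}
    (hz : z ∈ P.base) : AnalyticAt ℂ (P.expo Ψ) z :=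
  DifferentiableOn.analyticAt (s := P.base)
    (fun _ hw => (hP.hasDerivAt_expo hΨ hw).differentiableAt.differentiableWithinAt)
    (isOpen_base.mem_nhds hz)

namespace Solution

variable (hs : P.Solution K l σ σ' c M Ψ G)
include hs

/-- The weight that bounds the transported functions. -/
lemma norm_Y_real_le (k : ℕ) {ε : ℝ} (hε : 0 < ε) {z : ℂ} (hz : z ∈ P.base)
    (hx : P.prog z ≤ -P.d) :
    LapBound ((1 + 1 / (P.a * ε)) * (M * P.wtBound K l) *
      (wb P.ρ (P.prog z + P.d) + wE P.ρ (P.prog z))) (σ + ε) (fun t => P.Y G k (t, z)) := by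
  refine ⟨(hs.lapBound_Y k hz).cont, fun t ht => ?_⟩
  have ha := hs.valid.a_pos
  have h1 := hs.valid.norm_Y_le hs.K_pos.le hs.l_pos.le hs.σ_nonneg hs.M_nonneg hs.src k
    ((real_mem_dom ht).2 hz) hx
  simp only [Complex.norm_real, Real.norm_of_nonneg ht, rePos_ofReal ht] at h1
  refine h1.trans ?_
  set w := wb P.ρ (P.prog z + P.d) + wE P.ρ (P.prog z) with hw
  have hw0 : 0 ≤ w := add_nonneg (wb_pos _).le (wE_nonneg _)
  have hB : 0 ≤ M * P.wtBound K l := mul_nonneg hs.M_nonneg wtBound_pos.le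
  -- The linear growth in t from the length of the characteristics is absorbed by a small increase ε
  -- of the exponential rate.
  have h2 : 1 + t / P.a ≤ (1 + 1 / (P.a * ε)) * Real.exp (ε * t) := by
    have h3 := Real.add_one_le_exp (ε * t)
    have h4 : t / P.a ≤ 1 / (P.a * ε) * Real.exp (ε * t) := by
      calc t / P.a = 1 / (P.a * ε) * (ε * t) := by field_simp
        _ ≤ _ := by gcongr; linarith
    have h5 := Real.one_le_exp (by positivity : 0 ≤ ε * t)
    linarith
  calc (1 + t / P.a) * (M * P.wtBound K l * Real.exp (σ * t)) * w
      ≤ ((1 + 1 / (P.a * ε)) * Real.exp (ε * t)) * (M * P.wtBound K l * Real.exp (σ * t)) * w := by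
        gcongr
    _ = (1 + 1 / (P.a * ε)) * (M * P.wtBound K l) * w * (Real.exp (σ * t) * Real.exp (ε * t)) := by
        ring
    _ = _ := by rw [← Real.exp_add, add_mul σ]

/-- The Laplace transforms tend to zero at infinity. -/
lemma exists_norm_lap_le (k : ℕ) {u : ℂ} (hu : σ < u.re) {δ : ℝ} (hδ : 0 < δ) :
    ∃ x₀ : ℝ, ∀ z ∈ P.base, P.prog z ≤ x₀ → ‖lap (fun t => P.Y G k (t, z)) u‖ ≤ δ := by
  set ε := (u.re - σ) / 2 with hε
  have hε0 : 0 < ε := by linarith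
  set B := (1 + 1 / (P.a * ε)) * (M * P.wtBound K l) with hB
  have h1 : Tendsto (fun x => B * (wb P.ρ (x + P.d) + wE P.ρ x) / (u.re - (σ + ε))) atBot (𝓝 0) := by
    simpa using ((hs.valid.tendsto_null_weight P.d).const_mul B).div_const (u.re - (σ + ε))
  obtain ⟨x₁, hx₁⟩ := eventually_atBot.1 (h1.eventually (Iic_mem_nhds hδ))
  refine ⟨min x₁ (-P.d), fun z hz hx => ?_⟩
  refine ((hs.norm_Y_real_le k hε0 hz (hx.trans (min_le_right _ _))).norm_lap_le
    (by linarith)).trans (hx₁ _ (hx.trans (min_le_left _ _)))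

lemma tendsto_Y_zero (k : ℕ) {z : ℂ} (hz : z ∈ P.base) :
    Tendsto (fun τ : ℝ => P.Y G k (0, z - τ / P.ζ)) atTop (𝓝 0) := by
  have hP := hs.valid
  have h1 : Tendsto (fun τ : ℝ => M * P.wtBound K l *
      (wb P.ρ (P.prog (z - τ / P.ζ) + P.d) + wE P.ρ (P.prog (z - τ / P.ζ)))) atTop (𝓝 0) := by
    simpa using ((hP.tendsto_null_weight P.d).comp (hP.tendsto_ray_prog z)).const_mul
      (M * P.wtBound K l)
  refine squeeze_zero_norm' ?_ h1
  filter_upwards [eventually_ge_atTop 0, (hP.tendsto_ray_prog z).eventually_le_atBot (-P.d)]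
    with τ hτ hx
  have h2 := hP.norm_Y_le hs.K_pos.le hs.l_pos.le hs.σ_nonneg hs.M_nonneg hs.src k
    (zero_mem_dom (hP.ray_mem_base hz hτ)) hx
  have h4 : rePos 0 = 0 := by simp [rePos]
  simpa [h4] using h2

/-- At t = 0 the convolutions vanish and, by `Y_zero_eq`, the source is Σ ζ^k Ψ_k(0, z) (1 + Y_0(0,
z)). So 1 + Y_0(0, z) satisfies the linear equation of exp X. -/
lemma hasDerivAt_Y_zero {z : ℂ} (hz : z ∈ P.base) :
    HasDerivAt (fun z => P.Y G 0 (0, z)) (1 / P.n * P.slope Ψ z * (1 + P.Y G 0 (0, z))) z := by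
  have hP := hs.valid
  have hz0 := zero_mem_dom hz
  have h1 := hs.analytic_Y 0 _ hz0
  have ht := (hP.bnd_transport hs.K_pos hs.l_le hs.σ_nonneg hs.M_nonneg hs.src
    (hP.mem_roots.2 hP.root)).analytic _ hz0
  have h2 : HasDerivAt (fun z => P.Y G 0 (0, z))
      (1 / P.n * (P.ζ ^ (0 + 1) * dSnd (P.transport P.ζ G) (0, z))) z := by
    refine (((hasDerivAt_dSnd ht).const_mul _).const_mul _).congr_of_eventuallyEq
      (Eventually.of_forall fun w => hP.Y_zero G 0 w)
  rw [hP.dSnd_transport hs.K_pos hs.l_le hs.σ_nonneg hs.M_nonneg hs.src (hP.mem_roots.2 hP.root) hz0,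
    sub_self, zero_mul, zero_add, hs.eqn _ hz0] at h2
  convert! h2 using 1
  unfold feedback slope
  rw [← Finset.sum_add_distrib, zero_add, pow_one, mul_assoc, Finset.sum_mul, Finset.mul_sum (a := P.ζ)]
  refine congrArg _ (Finset.sum_congr rfl fun k _ => ?_)
  rw [hs.Y_zero_eq k]
  have : conv (dFst (Ψ k)) (P.Y G k) (0, z) = 0 := by simp [conv]
  rw [this, pow_succ]
  ring

/-- Both sides solve the same homogeneous linear equation of first order and tend to 1 along the
ray, so their quotient is constantly 1. -/
lemma exp_expo {z : ℂ} (hz : z ∈ P.base) : Complex.exp (P.expo Ψ z) = 1 + P.Y G 0 (0, z) := by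
  have hP := hs.valid
  have h1 := hP.eq_of_hasDerivAt_zero (L := 1)
    (f := fun z => Complex.exp (-P.expo Ψ z) * (1 + P.Y G 0 (0, z))) (fun w hw => ?_) hz ?_
  · have h2 : Complex.exp (P.expo Ψ z) * (Complex.exp (-P.expo Ψ z) * (1 + P.Y G 0 (0, z))) =
        Complex.exp (P.expo Ψ z) * 1 := congrArg _ h1
    rw [← mul_assoc, ← Complex.exp_add, add_neg_cancel, Complex.exp_zero, one_mul, mul_one] at h2
    exact h2.symm
  · have h2 := ((hP.hasDerivAt_expo hs.pot hw).neg.cexp).mul ((hs.hasDerivAt_Y_zero hw).const_add 1)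
    convert! h2 using 1
    ring
  · have h2 := (hP.tendsto_expo hs.pot hz).neg.cexp.mul ((hs.tendsto_Y_zero 0 hz).const_add 1)
    simpa using h2

lemma exp_neg_expo_mul {z : ℂ} (hz : z ∈ P.base) :
    Complex.exp (-P.expo Ψ z) * (1 + P.Y G 0 (0, z)) = 1 := by
  rw [← hs.exp_expo hz, ← Complex.exp_add, neg_add_cancel, Complex.exp_zero]

/-- V_0 = 1 + u L[Y_0] = 1 + Y_0(0, z) + L[∂_t Y_0], and the normalisation `exp_expo` makes e^{-X}(1
+ Y_0(0, z)) equal to 1. -/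
lemma lap_borelEta {z : ℂ} (hz : z ∈ P.base) {u : ℂ} (hu : σ < u.re) :
    lap (fun t => P.borelEta Ψ G (t, z)) u = P.eta Ψ G u z := by
  have h1 := (hs.bnd_Y 0).lap_dFst hs.valid hs.K_pos.le hs.l_pos.le hs.σ_nonneg hs.coef_nonneg hz hu
  unfold borelEta
  simp only
  rw [lap_const_mul, h1]
  have h2 := hs.exp_neg_expo_mul hz
  unfold eta V
  linear_combination -h2

lemma norm_exp_neg_expo_le {z : ℂ} (hz : z ∈ P.base) :
    ‖Complex.exp (-P.expo Ψ z)‖ ≤ Real.exp (c * ∫ y, wb P.ρ y) := by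
  rw [Complex.norm_exp]
  refine Real.exp_le_exp.2 ((Complex.re_le_norm _).trans ?_)
  rw [norm_neg]
  refine (hs.valid.norm_expo_le hs.pot hz hs.c_nonneg).trans ?_
  exact mul_le_mul_of_nonneg_left (wE_le hs.valid.ρ_pos _) hs.c_nonneg

lemma analytic_borelEta : AnalyticOnNhd ℂ (P.borelEta Ψ G) P.dom := fun p hp => by
  have hz := mem_base_of_mem_dom hs.valid.a_pos hp
  have h1 : AnalyticAt ℂ (fun p : ℂ × ℂ => P.expo Ψ p.2) p :=
    AnalyticAt.comp (g := P.expo Ψ) (hs.valid.analyticAt_expo hs.pot hz) analyticAt_snd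
  exact h1.neg.cexp.mul (analyticAt_dFst (hs.analytic_Y 0 p hp))

/-- Cauchy's estimate in t with radius aδ. The constant involves neither Q nor the point, which is
what makes the factorial series converge uniformly on all of Γ. -/
lemma norm_borelEta_le {δ : ℝ} (hδ : 0 < δ) {p : ℂ × ℂ}
    (hp : width p.1 / P.a + Metric.infDist p.2 P.Q + δ < P.d) :
    ‖P.borelEta Ψ G p‖ ≤ Real.exp (c * ∫ y, wb P.ρ y) *
      ((2 / P.a + 1) / K * M * P.wtBound K l * Real.exp (σ * (P.a * δ)) / (P.a * δ)) *
      Real.exp (σ * rePos p.1) := by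
  have hz : p.2 ∈ P.base := mem_base_of_mem_dom hs.valid.a_pos (by
    change width p.1 / P.a + Metric.infDist p.2 P.Q < P.d
    linarith)
  have h1 := (hs.bnd_Y 0).norm_dFst_le hs.valid hs.K_pos.le hs.l_pos.le hs.σ_nonneg hs.coef_nonneg hδ hp
  unfold borelEta
  rw [norm_mul, mul_assoc]
  exact mul_le_mul (hs.norm_exp_neg_expo_le hz) h1 (norm_nonneg _) (Real.exp_pos _).le

lemma analyticOnNhd_eta :
    AnalyticOnNhd ℂ (fun p : ℂ × ℂ => P.eta Ψ G p.1 p.2) {p | σ < p.1.re ∧ p.2 ∈ P.base} := by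
  have h1 := analyticOnNhd_lap (C := (2 / P.a + 1) / K * M * P.wtBound K l) (σ := σ)
    (H := P.Y G 0) isOpen_base (fun t ht z hz => hs.analytic_Y 0 _ ((real_mem_dom ht).2 hz))
    (fun t ht z hz => (hs.lapBound_Y 0 hz).le t ht)
  intro p hp
  have h2 : AnalyticAt ℂ (fun p : ℂ × ℂ => P.expo Ψ p.2) p :=
    AnalyticAt.comp (g := P.expo Ψ) (hs.valid.analyticAt_expo hs.pot hp.2) analyticAt_snd
  exact (h2.neg.cexp.mul (analyticAt_const.add (analyticAt_fst.mul (h1 p hp)))).sub analyticAt_const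

lemma exists_norm_eta_le {u : ℂ} (hu : σ < u.re) {δ : ℝ} (hδ : 0 < δ) :
    ∃ x₀ : ℝ, ∀ z ∈ P.base, P.prog z ≤ x₀ → ‖P.eta Ψ G u z‖ ≤ δ := by
  have hcont : ContinuousAt (fun q : ℂ × ℂ => Complex.exp (-q.1) * (P.ζ ^ 0 + u * q.2) - 1) (0, 0) := by
    fun_prop
  obtain ⟨r, hr, hrs⟩ := Metric.continuousAt_iff.1 hcont δ hδ
  simp only [neg_zero, Complex.exp_zero, pow_zero, mul_zero, add_zero, mul_one, sub_self,
    dist_zero_right] at hrs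
  obtain ⟨x₁, hx₁⟩ := hs.exists_norm_lap_le 0 hu (half_pos hr)
  have h1 : Tendsto (fun x => c * wE P.ρ x) atBot (𝓝 0) := by
    simpa using (tendsto_wE (ρ := P.ρ)).const_mul c
  obtain ⟨x₂, hx₂⟩ := eventually_atBot.1 (h1.eventually (Iic_mem_nhds (half_pos hr)))
  refine ⟨min x₁ x₂, fun z hz hx => ?_⟩
  have e1 := hx₁ z hz (hx.trans (min_le_left _ _))
  have e2 := (hs.valid.norm_expo_le hs.pot hz hs.c_nonneg).trans
    (hx₂ _ (hx.trans (min_le_right _ _)))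
  have e3 := @hrs (P.expo Ψ z, lap (fun t => P.Y G 0 (t, z)) u) (by
    rw [Prod.mk_zero_zero, dist_zero_right, Prod.norm_def]
    exact max_lt (lt_of_le_of_lt e2 (by linarith)) (lt_of_le_of_lt e1 (by linarith)))
  rw [← pow_zero P.ζ] at e3
  exact e3.le

/-- The derivatives of `η` tend to zero along the rays. -/
lemma tendsto_iteratedDeriv_eta {u : ℂ} (hu : σ < u.re) (s : ℕ) {z : ℂ} (hz : z ∈ P.base) :
    Tendsto (fun τ : ℝ => iteratedDeriv s (P.eta Ψ G u) (z - τ / P.ζ)) atTop (𝓝 0) := by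
  have hP := hs.valid
  obtain ⟨r, hr, hrs⟩ := Metric.nhds_basis_closedBall.mem_iff.1 (isOpen_base.mem_nhds hz)
  have han : ∀ w ∈ P.base, AnalyticAt ℂ (P.eta Ψ G u) w := fun w hw =>
    AnalyticAt.comp (g := fun p : ℂ × ℂ => P.eta Ψ G p.1 p.2) (f := fun w : ℂ => ((u, w) : ℂ × ℂ))
      (hs.analyticOnNhd_eta (u, w) ⟨hu, hw⟩) (analyticAt_const.prod analyticAt_id)
  rw [Metric.tendsto_atTop]
  intro δ hδ
  set δ' := δ * r ^ s / s.factorial / 2 with hδ'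
  have hδ'0 : 0 < δ' := by positivity
  obtain ⟨x₀, hx₀⟩ := hs.exists_norm_eta_le hu hδ'0
  obtain ⟨T, hT⟩ := eventually_atTop.1 ((hP.tendsto_ray_prog z).eventually_le_atBot (x₀ - r))
  refine ⟨max T 0, fun τ hτ => ?_⟩
  have hτ0 : 0 ≤ τ := (le_max_right _ _).trans hτ
  -- The base is stable under translation along the ray, so one radius serves for Cauchy's estimate
  -- at every point of the ray.
  have hball : Metric.closedBall (z - τ / P.ζ) r ⊆ P.base := fun w hw => by
    have h1 : w + τ / P.ζ ∈ P.base := hrs (by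
      rw [mem_closedBall_iff_norm] at hw ⊢
      rwa [show w + τ / P.ζ - z = w - (z - τ / P.ζ) by ring])
    simpa using hP.ray_mem_base h1 hτ0
  have h1 := Complex.norm_iteratedDeriv_le_of_forall_mem_sphere_norm_le (f := P.eta Ψ G u) s hr
    (C := δ') (c := z - τ / P.ζ) (DifferentiableOn.diffContOnCl_ball (U := P.base)
      (fun w hw => (han w hw).differentiableAt.differentiableWithinAt) hball) (fun w hw => ?_)
  · rw [dist_zero_right]
    refine lt_of_le_of_lt h1 ?_
    rw [hδ']
    have : (0 : ℝ) < s.factorial := by positivity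
    field_simp
    linarith
  · have hw' := Metric.sphere_subset_closedBall hw
    refine hx₀ w (hball hw') ?_
    have h2 := hP.prog_sub_le w (z - τ / P.ζ)
    rw [mem_closedBall_iff_norm] at hw'
    have h3 := hT τ ((le_max_left _ _).trans hτ)
    have := le_abs_self (P.prog w - P.prog (z - τ / P.ζ))
    linarith

end Solution

end Frame

end ExactSolution

end FactorialSeries
end

open Filter Topology Asymptotics MeasureTheory
noncomputable section
namespace FactorialSeries

/-! ### Bounded and decaying functions, stable under differentiation -/

section DecayClasses

namespace Frame

variable {P : Frame} {K l σ σ' c M C A : ℝ} {Ψ : ℕ → ℂ × ℂ → ℂ} {G H : ℂ × ℂ → ℂ} {f g : ℂ → ℂ}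

/-- Analytic functions on the base that are bounded on every smaller neighbourhood. -/
structure LBdd (P : Frame) (g : ℂ → ℂ) : Prop where
  analytic : AnalyticOnNhd ℂ g P.base
  le : ∀ ε < P.d, ∃ C, 0 ≤ C ∧ ∀ z, Metric.infDist z P.Q < ε → ‖g z‖ ≤ C

/-- Analytic functions on the base with integrable decay on every smaller neighbourhood. -/
structure LDec (P : Frame) (g : ℂ → ℂ) : Prop where
  analytic : AnalyticOnNhd ℂ g P.base
  le : ∀ ε < P.d, ∃ C, 0 ≤ C ∧ ∀ z, Metric.infDist z P.Q < ε → ‖g z‖ ≤ C * wb P.ρ (P.prog z)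

/-- The frame with a smaller neighbourhood. -/
def shrink (P : Frame) (ε : ℝ) : Frame := { P with d := ε }

lemma Valid.shrink (hP : P.Valid) (ε : ℝ) : (P.shrink ε).Valid :=
  ⟨hP.two_le, hP.root, hP.a_pos, hP.sep, hP.ρ_pos, hP.nonempty, hP.char_mem, hP.ray_mem⟩

lemma LDec.dec_shrink (hg : P.LDec g) {z : ℂ} (hz : z ∈ P.base) :
    ∃ ε C, z ∈ (P.shrink ε).base ∧ ε < P.d ∧ (P.shrink ε).Dec C g := by
  have hz' : Metric.infDist z P.Q < P.d := hz
  obtain ⟨ε, h1, h2⟩ := exists_between hz'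
  obtain ⟨C, _, hC⟩ := hg.le ε h2
  exact ⟨ε, C, h1, h2, fun w hw => hg.analytic w (lt_trans hw h2), fun w hw => hC w hw⟩

lemma LBdd.mul_dec (hf : P.LBdd f) (hg : P.LDec g) : P.LDec (fun z => f z * g z) := by
  refine ⟨fun z hz => (hf.analytic z hz).mul (hg.analytic z hz), fun ε hε => ?_⟩
  obtain ⟨C, hC0, hC⟩ := hf.le ε hε
  obtain ⟨D, hD0, hD⟩ := hg.le ε hε
  refine ⟨C * D, by positivity, fun z hz => ?_⟩
  rw [norm_mul, mul_assoc]
  exact mul_le_mul (hC z hz) (hD z hz) (norm_nonneg _) hC0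

lemma LDec.mul_bdd (hf : P.LDec f) (hg : P.LBdd g) : P.LDec (fun z => f z * g z) := by
  have := hg.mul_dec hf
  simpa only [mul_comm] using this

lemma LBdd.mul (hf : P.LBdd f) (hg : P.LBdd g) : P.LBdd (fun z => f z * g z) := by
  refine ⟨fun z hz => (hf.analytic z hz).mul (hg.analytic z hz), fun ε hε => ?_⟩
  obtain ⟨C, hC0, hC⟩ := hf.le ε hε
  obtain ⟨D, hD0, hD⟩ := hg.le ε hε
  refine ⟨C * D, by positivity, fun z hz => ?_⟩
  rw [norm_mul]
  exact mul_le_mul (hC z hz) (hD z hz) (norm_nonneg _) hC0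

lemma LBdd.const (c : ℂ) : P.LBdd (fun _ => c) :=
  ⟨fun _ _ => analyticAt_const, fun _ _ => ⟨‖c‖, norm_nonneg _, fun _ _ => le_rfl⟩⟩

lemma LDec.zero : P.LDec (fun _ => 0) :=
  ⟨fun _ _ => analyticAt_const, fun _ _ => ⟨0, le_rfl, fun _ _ => by simp⟩⟩

lemma LDec.add (hf : P.LDec f) (hg : P.LDec g) : P.LDec (fun z => f z + g z) := by
  refine ⟨fun z hz => (hf.analytic z hz).add (hg.analytic z hz), fun ε hε => ?_⟩
  obtain ⟨C, hC0, hC⟩ := hf.le ε hε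
  obtain ⟨D, hD0, hD⟩ := hg.le ε hε
  refine ⟨C + D, by positivity, fun z hz => (norm_add_le _ _).trans ?_⟩
  rw [add_mul]
  exact add_le_add (hC z hz) (hD z hz)

lemma LDec.const_mul (hg : P.LDec g) (c : ℂ) : P.LDec (fun z => c * g z) := (LBdd.const c).mul_dec hg

lemma LDec.sum {ι : Type*} {s : Finset ι} {f : ι → ℂ → ℂ} (hf : ∀ i ∈ s, P.LDec (f i)) :
    P.LDec (fun z => ∑ i ∈ s, f i z) := by
  classical
  induction s using Finset.induction_on with
  | empty => simpa using LDec.zero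
  | insert i s hi ih =>
    simp only [Finset.sum_insert hi]
    exact (hf i (Finset.mem_insert_self i s)).add
      (ih fun j hj => hf j (Finset.mem_insert_of_mem hj))

lemma LDec.congr (hf : P.LDec f) (h : ∀ z ∈ P.base, g z = f z) : P.LDec g :=
  ⟨fun z hz => (hf.analytic z hz).congr (by
    filter_upwards [isOpen_base.mem_nhds hz] with w hw using (h w hw).symm), fun ε hε => by
    obtain ⟨C, hC0, hC⟩ := hf.le ε hε
    exact ⟨C, hC0, fun z hz => by rw [h z (lt_trans hz hε)]; exact hC z hz⟩⟩

lemma norm_deriv_le_of_base {z : ℂ} {r B : ℝ} (hr : 0 < r) (hg : AnalyticOnNhd ℂ g P.base)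
    (hz : Metric.infDist z P.Q + r < P.d) (hB : ∀ w ∈ Metric.sphere z r, ‖g w‖ ≤ B) :
    ‖deriv g z‖ ≤ B / r := by
  refine Complex.norm_deriv_le_of_forall_mem_sphere_norm_le hr
    (DifferentiableOn.diffContOnCl_ball (U := P.base)
      (fun w hw => (hg w hw).differentiableAt.differentiableWithinAt) fun w hw => ?_) hB
  have h1 := Metric.infDist_le_infDist_add_dist (s := P.Q) (x := w) (y := z)
  rw [Metric.mem_closedBall] at hw
  change Metric.infDist w P.Q < P.d
  linarith

lemma LBdd.deriv (hg : P.LBdd g) : P.LBdd (deriv g) := by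
  refine ⟨fun z hz => (hg.analytic z hz).deriv, fun ε hε => ?_⟩
  -- With a third of the gap, circles of radius r around points at distance less than ε from Q stay
  -- within distance ε + 2r < d.
  set r := (P.d - ε) / 3 with hr
  have hr0 : 0 < r := by rw [hr]; linarith
  obtain ⟨C, hC0, hC⟩ := hg.le (ε + 2 * r) (by linarith)
  refine ⟨C / r, by positivity, fun z hz => norm_deriv_le_of_base hr0 hg.analytic (by linarith)
    fun w hw => hC w ?_⟩
  have h1 := Metric.infDist_le_infDist_add_dist (s := P.Q) (x := w) (y := z)
  rw [Metric.mem_sphere] at hw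
  linarith

lemma LDec.deriv (hP : P.Valid) (hg : P.LDec g) : P.LDec (deriv g) := by
  refine ⟨fun z hz => (hg.analytic z hz).deriv, fun ε hε => ?_⟩
  set r := (P.d - ε) / 3 with hr
  have hr0 : 0 < r := by rw [hr]; linarith
  obtain ⟨C, hC0, hC⟩ := hg.le (ε + 2 * r) (by linarith)
  refine ⟨C * (1 + r) ^ (1 + P.ρ) / r, by positivity, fun z hz => ?_⟩
  have h2 := norm_deriv_le_of_base (B := C * (1 + r) ^ (1 + P.ρ) * wb P.ρ (P.prog z)) hr0
    hg.analytic (by linarith : Metric.infDist z P.Q + r < P.d) fun w hw => by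
      have h1 := Metric.infDist_le_infDist_add_dist (s := P.Q) (x := w) (y := z)
      rw [Metric.mem_sphere] at hw
      refine (hC w (by linarith)).trans ?_
      rw [mul_assoc]
      refine mul_le_mul_of_nonneg_left ?_ hC0
      have h3 := wb_add_le hP.ρ_pos (P.prog z) (P.prog w - P.prog z)
      rw [add_sub_cancel] at h3
      refine h3.trans ?_
      have h4 := hP.prog_sub_le w z
      rw [← dist_eq_norm, hw] at h4
      have h5 := hP.ρ_pos
      have := (wb_pos (ρ := P.ρ) (P.prog z)).le
      gcongr
  refine h2.trans (le_of_eq ?_)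
  ring

lemma LBdd.iteratedDeriv (hg : P.LBdd g) (k : ℕ) : P.LBdd (iteratedDeriv k g) := by
  induction k with
  | zero => simpa using hg
  | succ k ih => rw [iteratedDeriv_succ]; exact ih.deriv

lemma LDec.iteratedDeriv (hP : P.Valid) (hg : P.LDec g) (k : ℕ) : P.LDec (iteratedDeriv k g) := by
  induction k with
  | zero => simpa using hg
  | succ k ih => rw [iteratedDeriv_succ]; exact ih.deriv hP

lemma LDec.integrableOn (hP : P.Valid) (hg : P.LDec g) {z : ℂ} (hz : z ∈ P.base) :
    IntegrableOn (fun τ : ℝ => g (z - τ / P.ζ) * (-1 / P.ζ)) (Set.Ioi 0) := by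
  obtain ⟨ε, C, h1, _, h3⟩ := hg.dec_shrink hz
  exact (hP.shrink ε).integrableOn_rint h3 h1

lemma LDec.eq_rint {h : ℂ → ℂ} (hP : P.Valid) (hg : P.LDec g)
    (hh : ∀ w ∈ P.base, HasDerivAt h (-g w) w) {z : ℂ}
    (hz : z ∈ P.base) (h0 : Tendsto (fun τ : ℝ => h (z - τ / P.ζ)) atTop (𝓝 0)) :
    h z = P.rint g z := by
  obtain ⟨ε, C, h1, h2, h3⟩ := hg.dec_shrink hz
  exact (hP.shrink ε).eq_rint h3 (fun w hw => hh w (lt_trans hw h2)) h1 h0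

/-- Formal expressions that are linear in the functions from which they are built, and that commute
with integration along rays. -/
def RayLinear (P : Frame) (F : ((ℂ → ℂ) → ℂ) → ℂ) : Prop :=
  P.LDec (fun y => F fun g => g y) ∧
    ∀ z ∈ P.base, P.rint (fun y => F fun g => g y) z = F fun g => P.rint g z

lemma LDec.rayLinear (hg : P.LDec g) : P.RayLinear (fun L => L g) := ⟨hg, fun _ _ => rfl⟩

variable {F F' : ((ℂ → ℂ) → ℂ) → ℂ}

lemma RayLinear.const_mul (h : P.RayLinear F) (c : ℂ) : P.RayLinear (fun L => c * F L) := by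
  refine ⟨h.1.const_mul c, fun z hz => ?_⟩
  simp only
  rw [← h.2 z hz]
  unfold rint
  rw [← integral_const_mul]
  exact integral_congr_ae (Eventually.of_forall fun τ => mul_assoc _ _ _)

lemma RayLinear.sum (hP : P.Valid) {ι : Type*} {s : Finset ι} {F : ι → ((ℂ → ℂ) → ℂ) → ℂ}
    (h : ∀ i ∈ s, P.RayLinear (F i)) : P.RayLinear (fun L => ∑ i ∈ s, F i L) := by
  refine ⟨LDec.sum fun i hi => (h i hi).1, fun z hz => ?_⟩
  simp only
  rw [Finset.sum_congr rfl fun i hi => ((h i hi).2 z hz).symm]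
  unfold rint
  rw [← integral_finsetSum s fun i hi => (h i hi).1.integrableOn hP hz]
  exact integral_congr_ae (Eventually.of_forall fun τ => Finset.sum_mul _ _ _)

lemma RayLinear.sub (hP : P.Valid) (h : P.RayLinear F) (h' : P.RayLinear F') :
    P.RayLinear (fun L => F L - F' L) := by
  have h1 := h'.1.const_mul (-1)
  refine ⟨(h.1.add h1).congr fun z _ => by ring, fun z hz => ?_⟩
  simp only
  rw [← h.2 z hz, ← h'.2 z hz]
  unfold rint
  rw [← integral_sub (h.1.integrableOn hP hz) (h'.1.integrableOn hP hz)]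
  exact integral_congr_ae (Eventually.of_forall fun τ => sub_mul _ _ _)

end Frame

end DecayClasses

end FactorialSeries
end

open Filter Topology Asymptotics MeasureTheory
noncomputable section
namespace FactorialSeries

/-! ### Taylor coefficients of the system: the formal solution -/

section FormalSolution

/-- The shape of the recurrence relation for the coefficients of the formal solutions; `L` stands
for the integration along a ray, and `D r q` for the derivative of order `r` of the coefficient with
index `q`. -/
def recForm {α : Type*} (n : ℕ) (ζ : ℂ) (B : ℕ → α → ℂ) (ψ D : ℕ → ℕ → α → ℂ) (m : ℕ)
    (L : (α → ℂ) → ℂ) : ℂ :=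
  1 / (n : ℂ) * ∑ p ∈ Finset.Icc 2 (min n (m + 1)), (n.choose p : ℂ) * ζ ^ (n + 1 - p) *
      ∑ r ∈ Finset.range (p + 1), (p.choose r : ℂ) * L (fun y => B (p - r) y * D r (m + 1 - p) y)
  - 1 / (n : ℂ) * ∑ k ∈ Finset.range (n - 1), ∑ p ∈ Finset.Icc 1 (min m k),
      (k.choose p : ℂ) * ζ ^ (k + 1 - p) *
      ∑ r ∈ Finset.range (p + 1), (p.choose r : ℂ) *
        L (fun y => B (p - r) y * ψ k 1 y * D r (m - p) y)
  - 1 / (n : ℂ) * ∑ k ∈ Finset.range (n - 1), ∑ q ∈ Finset.range m,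
      ∑ p ∈ Finset.range (min k q + 1), (k.choose p : ℂ) * ζ ^ (k + 1 - p) *
      ∑ r ∈ Finset.range (p + 1), (p.choose r : ℂ) *
        L (fun y => B (p - r) y * ψ k (m + 1 - q) y * D r (q - p) y)

/-- Only coefficients with index below m occur, and only such integrals need comparison; this
carries the recurrence from the surface to a sheet by induction. -/
lemma recForm_congr {α β : Type*} (n : ℕ) (ζ : ℂ) {B : ℕ → α → ℂ} {ψ D : ℕ → ℕ → α → ℂ} {m : ℕ}
    {L : (α → ℂ) → ℂ} {B' : ℕ → β → ℂ} {ψ' D' : ℕ → ℕ → β → ℂ} {L' : (β → ℂ) → ℂ}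
    (h1 : ∀ p r, ∀ q < m, L (fun y => B p y * D r q y) = L' (fun y => B' p y * D' r q y))
    (h2 : ∀ p r, ∀ q < m, ∀ k < n - 1, ∀ i, 1 ≤ i → L (fun y => B p y * ψ k i y * D r q y) =
      L' (fun y => B' p y * ψ' k i y * D' r q y)) :
    recForm n ζ B ψ D m L = recForm n ζ B' ψ' D' m L' := by
  unfold recForm
  refine congrArg₂ _ (congrArg₂ _ (congrArg _ ?_) (congrArg _ ?_)) (congrArg _ ?_)
  · refine Finset.sum_congr rfl fun p hp => ?_
    rw [Finset.mem_Icc] at hp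
    exact congrArg _ (Finset.sum_congr rfl fun r _ => congrArg _ (h1 _ _ _ (by omega)))
  · refine Finset.sum_congr rfl fun k hk => Finset.sum_congr rfl fun p hp => ?_
    rw [Finset.mem_Icc] at hp
    rw [Finset.mem_range] at hk
    exact congrArg _ (Finset.sum_congr rfl fun r _ =>
      congrArg _ (h2 _ _ _ (by omega) _ hk _ le_rfl))
  · refine Finset.sum_congr rfl fun k hk => Finset.sum_congr rfl fun q hq =>
      Finset.sum_congr rfl fun p _ => ?_
    rw [Finset.mem_range] at hk hq
    exact congrArg _ (Finset.sum_congr rfl fun r _ =>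
      congrArg _ (h2 _ _ _ (by omega) _ hk _ (by omega)))

/-- The Taylor coefficients of the Borel transforms. -/
def psiC (Ψ : ℕ → ℂ × ℂ → ℂ) (k m : ℕ) (z : ℂ) : ℂ := dFst^[m - 1] (Ψ k) (0, z)

namespace Frame

variable {P : Frame} {K l σ σ' c M C A : ℝ} {Ψ : ℕ → ℂ × ℂ → ℂ} {G H : ℂ × ℂ → ℂ} {f g : ℂ → ℂ}

/-- The coefficients of the expansion of `P.V G k` in powers of `u⁻¹`. -/
def vc (P : Frame) (G : ℂ × ℂ → ℂ) (k m : ℕ) (z : ℂ) : ℂ :=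
  (if m = 0 then P.ζ ^ k else 0) + dFst^[m] (P.Y G k) (0, z)

/-- The coefficients of the expansion of `1 + η` in powers of `u⁻¹`. -/
def ac (P : Frame) (Ψ : ℕ → ℂ × ℂ → ℂ) (G : ℂ × ℂ → ℂ) (m : ℕ) (z : ℂ) : ℂ :=
  Complex.exp (-P.expo Ψ z) * P.vc G 0 m z

/-- The Bell polynomials of the derivatives of the exponent. -/
def bell (P : Frame) (Ψ : ℕ → ℂ × ℂ → ℂ) (p : ℕ) (z : ℂ) : ℂ :=
  Complex.exp (-P.expo Ψ z) * iteratedDeriv p (fun y => Complex.exp (P.expo Ψ y)) z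

/-- The derivative of order `p` of the coefficient with index `m - p`, zero if there is none. -/
def ec (P : Frame) (G : ℂ × ℂ → ℂ) (p m : ℕ) (z : ℂ) : ℂ :=
  if p ≤ m then iteratedDeriv p (P.vc G 0 (m - p)) z else 0

lemma analyticAt_snd_of {F : ℂ × ℂ → ℂ} {t z : ℂ} (hF : AnalyticAt ℂ F (t, z)) :
    AnalyticAt ℂ (fun z => F (t, z)) z :=
  AnalyticAt.comp (g := F) (f := fun z : ℂ => ((t, z) : ℂ × ℂ)) hF
    (analyticAt_const.prod analyticAt_id)

lemma analyticAt_fst_of {F : ℂ × ℂ → ℂ} {t z : ℂ} (hF : AnalyticAt ℂ F (t, z)) :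
    AnalyticAt ℂ (fun t => F (t, z)) t :=
  AnalyticAt.comp (g := F) (f := fun t : ℂ => ((t, z) : ℂ × ℂ)) hF
    (analyticAt_id.prod analyticAt_const)

namespace Solution

variable (hs : P.Solution K l σ σ' c M Ψ G)
include hs

lemma analyticAt_vc (k m : ℕ) {z : ℂ} (hz : z ∈ P.base) : AnalyticAt ℂ (P.vc G k m) z :=
  analyticAt_const.add (analyticAt_snd_of
    (analyticAt_dFst_iterate (hs.analytic_Y k _ (zero_mem_dom hz)) m))

lemma dFst_iterate_source (m : ℕ) {z : ℂ} (hz : z ∈ P.base) :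
    dFst^[m] G (0, z) = ∑ k ∈ Finset.range (P.n - 1), ∑ i ∈ Finset.range (m + 1),
      psiC Ψ k (m + 1 - i) z * P.vc G k i z := by
  rw [hs.valid.dFst_iterate_source_zero (fun k hk => hs.analytic_Ψ hk) hs.analytic_Y hs.eqn m
    (zero_mem_dom hz)]
  refine Finset.sum_congr rfl fun k _ => ?_
  unfold vc
  simp only [mul_add, Finset.sum_add_distrib, mul_ite, mul_zero]
  rw [Finset.sum_ite_eq' (Finset.range (m + 1)) 0, if_pos (Finset.mem_range.2 (Nat.succ_pos m))]
  unfold psiC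
  refine congrArg₂ _ ?_ (Finset.sum_congr rfl fun i hi => ?_)
  · simp [mul_comm]
  · rw [Nat.sub_right_comm, Nat.add_sub_cancel]

/-- The Taylor coefficient at t = 0 of the equation `dSnd_Y`, that is, the coefficient of a power of
u⁻¹ in `hasDerivAt_V`. -/
lemma hasDerivAt_vc (k m : ℕ) {z : ℂ} (hz : z ∈ P.base) :
    HasDerivAt (P.vc G k m) (P.vc G (k + 1) (m + 1) z - P.ζ * P.vc G k (m + 1) z +
      (1 / P.n * ∑ μ ∈ P.roots, μ ^ (k + 1)) * dFst^[m] G (0, z)) z := by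
  have hP := hs.valid
  have hz0 := zero_mem_dom hz
  set S : ℂ := 1 / P.n * ∑ μ ∈ P.roots, μ ^ (k + 1) with hS
  have hY := hs.analytic_Y k _ hz0
  have hY' := hs.analytic_Y (k + 1) _ hz0
  have hG := hs.src.analytic _ hz0
  have h1 := (hasDerivAt_dSnd (analyticAt_dFst_iterate hY m)).const_add
    (if m = 0 then P.ζ ^ k else 0)
  convert! h1 using 1
  have h2 : dSnd (P.Y G k) =ᶠ[𝓝 (0, z)] fun q => (fun _ => -P.ζ) q.2 * dFst (P.Y G k) q +
      ((fun _ => S) q.2 * G q + dFst (P.Y G (k + 1)) q) := by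
    filter_upwards [isOpen_dom.mem_nhds hz0] with q hq
    rw [hP.dSnd_Y hs.K_pos hs.l_le hs.σ_nonneg hs.M_nonneg hs.src k hq]
    ring
  rw [(dSnd_dFst_iterate hY m).eq_of_nhds, (dFst_iterate_eventuallyEq h2 m).eq_of_nhds,
    (dFst_iterate_mul_add (fun _ => -P.ζ) (analyticAt_dFst hY)
      (AnalyticAt.fun_add (AnalyticAt.fun_mul analyticAt_const hG) (analyticAt_dFst hY'))
      m).eq_of_nhds,
    (dFst_iterate_mul_add (fun _ => S) hG (analyticAt_dFst hY') m).eq_of_nhds,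
    ← Function.iterate_succ_apply, ← Function.iterate_succ_apply]
  unfold vc
  simp only [Nat.succ_ne_zero, if_false, zero_add, Nat.succ_eq_add_one]
  ring

lemma hasDerivAt_ec (p m : ℕ) {z : ℂ} (hz : z ∈ P.base) :
    HasDerivAt (P.ec G p m) (P.ec G (p + 1) (m + 1) z) z := by
  unfold ec
  by_cases h : p ≤ m
  · simp only [h, if_true, Nat.succ_le_succ_iff, Nat.add_sub_add_right]
    exact hasDerivAt_iteratedDeriv (hs.analyticAt_vc 0 (m - p) hz) p
  · simp only [h, if_false, Nat.succ_le_succ_iff]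
    exact hasDerivAt_const z 0

/-- One application of ζ + u⁻¹ d/dz to the binomial expansion of (ζ + u⁻¹ d/dz)^k V_0, coefficient
by coefficient, with Pascal's rule. The source term is kept because it vanishes for k + 1 < n and
does not for k + 1 = n, and both cases are needed. -/
lemma vc_succ_add (k m : ℕ) (hk : ∀ z ∈ P.base, ∀ m, P.vc G k m z =
      ∑ p ∈ Finset.range (k + 1), (k.choose p : ℂ) * (P.ζ ^ (k - p) * P.ec G p m z))
    {z : ℂ} (hz : z ∈ P.base) :
    P.vc G (k + 1) (m + 1) z + (1 / P.n * ∑ μ ∈ P.roots, μ ^ (k + 1)) * dFst^[m] G (0, z) =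
      ∑ p ∈ Finset.range (k + 2), ((k + 1).choose p : ℂ) *
        (P.ζ ^ (k + 1 - p) * P.ec G p (m + 1) z) := by
  have h1 := hs.hasDerivAt_vc k m hz
  have h2 : HasDerivAt (P.vc G k m) (∑ p ∈ Finset.range (k + 1),
      (k.choose p : ℂ) * (P.ζ ^ (k - p) * P.ec G (p + 1) (m + 1) z)) z := by
    refine HasDerivAt.congr_of_eventuallyEq (HasDerivAt.fun_sum fun p _ =>
      ((hs.hasDerivAt_ec p m hz).const_mul _).const_mul _) ?_
    filter_upwards [isOpen_base.mem_nhds hz] with w hw using hk w hw m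
  have h3 := h1.unique h2
  have h4 := Finset.sum_choose_succ_mul (fun p q => P.ζ ^ q * P.ec G p (m + 1) z) k
  rw [h4, ← h3, hk z hz (m + 1)]
  have h5 : ∀ p ∈ Finset.range (k + 1), (k.choose p : ℂ) * (P.ζ ^ (k + 1 - p) * P.ec G p (m + 1) z) =
      P.ζ * ((k.choose p : ℂ) * (P.ζ ^ (k - p) * P.ec G p (m + 1) z)) := fun p hp => by
    rw [Finset.mem_range] at hp
    rw [show k + 1 - p = (k - p) + 1 by omega, pow_succ]
    ring
  rw [Finset.sum_congr rfl h5, ← Finset.mul_sum]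
  ring

lemma vc_eq (k : ℕ) (hk : k < P.n) : ∀ z ∈ P.base, ∀ m, P.vc G k m z =
    ∑ p ∈ Finset.range (k + 1), (k.choose p : ℂ) * (P.ζ ^ (k - p) * P.ec G p m z) := by
  induction k with
  | zero => intro z _ m; simp [ec]
  | succ k ih =>
    intro z hz m
    cases m with
    | zero =>
      -- The factor u^{-p} shifts indices by p, so only p = 0 reaches index 0. This index is out of
      -- reach of `vc_succ_add` and follows from the values of `Y` at t = 0.
      rw [Finset.sum_eq_single 0 (fun p _ hp => by
        rw [ec, if_neg (by omega), mul_zero, mul_zero]) (by simp)]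
      have := hs.Y_zero_eq (k + 1) z
      simp only [vc, ec, if_true, Function.iterate_zero, id, Nat.choose_zero_right, Nat.cast_one,
        one_mul, le_refl, Nat.sub_zero, iteratedDeriv_zero, pow_zero, this]
      ring
    | succ m =>
      rw [← hs.vc_succ_add k m (ih (by omega)) hz, hs.valid.sum_roots_pow (Nat.succ_pos k) hk]
      ring

/-- The equation of order `n` for the coefficients. -/
lemma vc_last (m : ℕ) {z : ℂ} (hz : z ∈ P.base) :
    P.vc G 0 (m + 1) z + ∑ k ∈ Finset.range (P.n - 1), ∑ i ∈ Finset.range (m + 1),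
      psiC Ψ k (m + 1 - i) z * ∑ p ∈ Finset.range (k + 1),
        (k.choose p : ℂ) * (P.ζ ^ (k - p) * P.ec G p i z) =
      ∑ p ∈ Finset.range (P.n + 1), (P.n.choose p : ℂ) *
        (P.ζ ^ (P.n - p) * P.ec G p (m + 1) z) := by
  have hn := hs.valid.n_pos
  have h1 := hs.vc_succ_add (P.n - 1) m (hs.vc_eq (P.n - 1) (by omega)) hz
  rw [show P.n - 1 + 2 = P.n + 1 by omega, Nat.sub_add_cancel hn] at h1
  have hn' : (P.n : ℂ) ≠ 0 := Nat.cast_ne_zero.2 hn.ne'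
  rw [← h1, hs.valid.sum_roots_pow_n, one_div, inv_mul_cancel₀ hn', one_mul,
    hs.dFst_iterate_source m hz]
  congr 1
  · unfold vc
    have := hs.valid.Y_add_n G 0
    rw [zero_add] at this
    rw [this]
    simp
  · refine Finset.sum_congr rfl fun k hk => Finset.sum_congr rfl fun i _ => ?_
    rw [Finset.mem_range] at hk
    rw [hs.vc_eq k (by omega) z hz i]

end Solution

end Frame

end FormalSolution

end FactorialSeries
end

open Filter Topology Asymptotics MeasureTheory
noncomputable section
namespace FactorialSeries

/-! ### The recurrence relation for the coefficients -/

section Recurrence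

namespace Frame

variable {P : Frame} {K l σ σ' c M C A : ℝ} {Ψ : ℕ → ℂ × ℂ → ℂ} {G H : ℂ × ℂ → ℂ} {f g : ℂ → ℂ}

lemma Valid.lbdd_exp_expo (hP : P.Valid) (hc : 0 ≤ c)
    (hΨ : ∀ k < P.n - 1, P.Potential c σ (Ψ k)) :
    P.LBdd (fun z => Complex.exp (P.expo Ψ z)) ∧ P.LBdd (fun z => Complex.exp (-P.expo Ψ z)) := by
  have h1 : ∀ z ∈ P.base, ‖P.expo Ψ z‖ ≤ c * ∫ y, wb P.ρ y := fun z hz =>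
    (hP.norm_expo_le hΨ hz hc).trans (mul_le_mul_of_nonneg_left (wE_le hP.ρ_pos _) hc)
  constructor
  · refine ⟨fun z hz => (hP.analyticAt_expo hΨ hz).cexp, fun ε hε =>
      ⟨Real.exp (c * ∫ y, wb P.ρ y), (Real.exp_pos _).le, fun z hz => ?_⟩⟩
    rw [Complex.norm_exp]
    exact Real.exp_le_exp.2 ((Complex.re_le_norm _).trans (h1 z (lt_trans hz hε)))
  · refine ⟨fun z hz => (hP.analyticAt_expo hΨ hz).neg.cexp, fun ε hε =>
      ⟨Real.exp (c * ∫ y, wb P.ρ y), (Real.exp_pos _).le, fun z hz => ?_⟩⟩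
    rw [Complex.norm_exp]
    refine Real.exp_le_exp.2 ((Complex.re_le_norm _).trans ?_)
    rw [norm_neg]
    exact h1 z (lt_trans hz hε)

lemma Dec.ldec (hC : 0 ≤ C) (hg : P.Dec C g) : P.LDec g :=
  ⟨hg.analytic, fun _ hε => ⟨C, hC, fun z hz => hg.le z (lt_trans hz hε)⟩⟩

lemma Valid.lbdd_bell (hP : P.Valid) (hc : 0 ≤ c) (hΨ : ∀ k < P.n - 1, P.Potential c σ (Ψ k))
    (p : ℕ) : P.LBdd (P.bell Ψ p) :=
  (hP.lbdd_exp_expo hc hΨ).2.mul ((hP.lbdd_exp_expo hc hΨ).1.iteratedDeriv p)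

lemma Valid.deriv_exp_expo (hP : P.Valid) (hΨ : ∀ k < P.n - 1, P.Potential c σ (Ψ k)) {z : ℂ}
    (hz : z ∈ P.base) : deriv (fun y => Complex.exp (P.expo Ψ y)) z =
      Complex.exp (P.expo Ψ z) * (1 / P.n * P.slope Ψ z) :=
  (hP.hasDerivAt_expo hΨ hz).cexp.deriv

/-- The first derivative of exp X already contains the factor X', a multiple of the decaying
function `slope`, and further derivatives preserve the decay. -/
lemma Valid.ldec_bell (hP : P.Valid) (hc : 0 ≤ c) (hΨ : ∀ k < P.n - 1, P.Potential c σ (Ψ k))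
    {p : ℕ} (hp : 0 < p) : P.LDec (P.bell Ψ p) := by
  obtain ⟨p, rfl⟩ := Nat.exists_eq_add_of_lt hp
  rw [zero_add]
  refine (hP.lbdd_exp_expo hc hΨ).2.mul_dec ?_
  rw [iteratedDeriv_succ']
  refine LDec.iteratedDeriv hP (LDec.congr ?_ fun z hz => hP.deriv_exp_expo hΨ hz) p
  exact (hP.lbdd_exp_expo hc hΨ).1.mul_dec (((hP.dec_slope hΨ).ldec (by positivity)).const_mul _)

lemma Valid.bell_one (hP : P.Valid) (hΨ : ∀ k < P.n - 1, P.Potential c σ (Ψ k)) {z : ℂ}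
    (hz : z ∈ P.base) : P.bell Ψ 1 z = 1 / P.n * P.slope Ψ z := by
  unfold bell
  rw [iteratedDeriv_one, hP.deriv_exp_expo hΨ hz, ← mul_assoc, ← Complex.exp_add, neg_add_cancel,
    Complex.exp_zero, one_mul]

lemma bell_zero (z : ℂ) : P.bell Ψ 0 z = 1 := by
  unfold bell
  rw [iteratedDeriv_zero, ← Complex.exp_add, neg_add_cancel, Complex.exp_zero]

lemma exp_mul_ac (m : ℕ) (z : ℂ) : Complex.exp (P.expo Ψ z) * P.ac Ψ G m z = P.vc G 0 m z := by
  unfold ac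
  rw [← mul_assoc, ← Complex.exp_add, add_neg_cancel, Complex.exp_zero, one_mul]

lemma Potential.ldec_dFst (hP : P.Valid) (hσ : 0 ≤ σ) (hc : 0 ≤ c) (hH : P.Potential c σ H)
    (m : ℕ) : P.LDec (fun z => dFst^[m] H (0, z)) := by
  refine ⟨fun z hz => analyticAt_snd_of
    (analyticAt_dFst_iterate (hH.analytic _ (zero_mem_box hz hP.a_pos)) m), fun ε hε => ?_⟩
  by_cases hd : P.d ≤ 0
  · refine ⟨0, le_rfl, fun z hz => ?_⟩
    have : 0 ≤ Metric.infDist z P.Q := Metric.infDist_nonneg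
    linarith
  have ha := hP.a_pos
  set δ := P.a * P.d / 2 with hδ
  have hδ0 : 0 < δ := by rw [hδ]; have := not_le.1 hd; positivity
  refine ⟨m.factorial * (c * Real.exp (σ * δ)) / δ ^ m, by positivity, fun z hz => ?_⟩
  have hz' : z ∈ P.base := lt_trans hz hε
  have hw := (wb_pos (ρ := P.ρ) (P.prog z)).le
  have h1 := norm_iteratedDeriv_le_of_width (F := fun t => H (t, z)) (r := P.a * P.d)
    (C := c * wb P.ρ (P.prog z)) (σ := σ) (δ := δ) hσ hδ0 (by positivity)
    (fun t ht => analyticAt_fst_of (hH.analytic (t, z) ⟨ht, hz'⟩))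
    (fun t ht => by
      have := hH.le (t, z) ⟨ht, hz'⟩
      rw [mul_assoc]; exact this) m (t := 0) (by
        have : width 0 = 0 := by simpa using width_ofReal (le_refl (0 : ℝ))
        rw [this]
        linarith)
  have h4 : rePos 0 = 0 := by simp [rePos]
  rw [h4, mul_zero, Real.exp_zero, mul_one] at h1
  rw [dFst_iterate]
  refine h1.trans (le_of_eq ?_)
  ring

namespace Solution

variable (hs : P.Solution K l σ σ' c M Ψ G)
include hs

lemma ldec_psiC {k : ℕ} (hk : k < P.n - 1) (m : ℕ) : P.LDec (psiC Ψ k m) :=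
  (hs.pot k hk).ldec_dFst hs.valid hs.σ'_nonneg hs.c_nonneg _

lemma width_lt_iff_mem_dom {t z : ℂ} :
    (t, z) ∈ P.dom ↔ width t < P.a * (P.d - Metric.infDist z P.Q) := by
  rw [← div_lt_iff₀' hs.valid.a_pos, lt_sub_iff_add_lt]
  rfl

lemma lbdd_vc (k m : ℕ) : P.LBdd (P.vc G k m) := by
  refine ⟨fun z hz => hs.analyticAt_vc k m hz, fun ε hε => ?_⟩
  have ha := hs.valid.a_pos
  set δ := P.a * (P.d - ε) / 2 with hδ
  have hδ0 : 0 < δ := by rw [hδ]; have : 0 < P.d - ε := by linarith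
                         positivity
  set B := (2 / P.a + 1) / K * M * P.wtBound K l with hB
  have hB0 : 0 ≤ B := mul_nonneg hs.coef_nonneg wtBound_pos.le
  refine ⟨‖P.ζ ^ k‖ + m.factorial * (B * Real.exp (σ * δ)) / δ ^ m, by positivity, fun z hz => ?_⟩
  have h1 := norm_iteratedDeriv_le_of_width (F := fun t => P.Y G k (t, z))
    (r := P.a * (P.d - Metric.infDist z P.Q)) (C := B) (σ := σ) (δ := δ) hs.σ_nonneg hδ0 hB0
    (fun t ht => analyticAt_fst_of (hs.analytic_Y k _ (hs.width_lt_iff_mem_dom.2 ht)))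
    (fun t ht => by
      have hp := hs.width_lt_iff_mem_dom.2 ht
      refine ((hs.bnd_Y k).le _ hp).trans ?_
      refine (mul_le_mul_of_nonneg_left (hs.valid.wt_le hs.K_pos.le hs.l_pos.le hp)
        hs.coef_nonneg).trans (le_of_eq ?_)
      rw [hB]
      unfold wtBound
      ring) m
    (t := 0) (by
        have : width 0 = 0 := by simpa using width_ofReal (le_refl (0 : ℝ))
        rw [this, zero_add, hδ]
        nlinarith)
  have h4 : rePos 0 = 0 := by simp [rePos]
  rw [h4, mul_zero, Real.exp_zero, mul_one] at h1
  unfold vc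
  refine (norm_add_le _ _).trans (add_le_add ?_ ?_)
  · split_ifs
    · exact le_rfl
    · simp
  · rw [dFst_iterate]
    exact h1

lemma tendsto_dFst_Y (k m : ℕ) {z : ℂ} (hz : z ∈ P.base) :
    Tendsto (fun τ : ℝ => dFst^[m] (P.Y G k) (0, z - τ / P.ζ)) atTop (𝓝 0) := by
  have hP := hs.valid
  have ha := hP.a_pos
  set δ := P.a * (P.d - Metric.infDist z P.Q) / 2 with hδ
  have hδ0 : 0 < δ := by
    have : 0 < P.d - Metric.infDist z P.Q := sub_pos.2 hz
    rw [hδ]; positivity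
  set B := (1 + δ / P.a) * (M * P.wtBound K l * Real.exp (σ * δ)) with hB
  have hMw : 0 ≤ M * P.wtBound K l := mul_nonneg hs.M_nonneg wtBound_pos.le
  have h1 : Tendsto (fun τ : ℝ => m.factorial * (B *
      (wb P.ρ (P.prog (z - τ / P.ζ) + P.d) + wE P.ρ (P.prog (z - τ / P.ζ)))) / δ ^ m) atTop
      (𝓝 0) := by
    simpa using ((((hP.tendsto_null_weight P.d).comp (hP.tendsto_ray_prog z)).const_mul
      B).const_mul (m.factorial : ℝ)).div_const (δ ^ m)
  refine squeeze_zero_norm' ?_ h1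
  filter_upwards [eventually_ge_atTop 0, (hP.tendsto_ray_prog z).eventually_le_atBot (-P.d)]
    with τ hτ hx
  have hdist : Metric.infDist (z - τ / P.ζ) P.Q ≤ Metric.infDist z P.Q := by
    have := infDist_add_le_of_translate hP.nonempty (v := -(τ / P.ζ))
      (fun z hz => by simpa [sub_eq_add_neg] using hP.ray_mem z hz τ hτ) z
    rwa [← sub_eq_add_neg] at this
  have hmem : ∀ t ∈ Metric.closedBall (0 : ℂ) δ, (t, z - τ / P.ζ) ∈ P.dom := fun t ht => by
    rw [hs.width_lt_iff_mem_dom]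
    have h2 := width_le_norm_sub t (le_refl 0)
    rw [mem_closedBall_zero_iff] at ht
    simp only [Complex.ofReal_zero, sub_zero] at h2
    have h3 : P.a * (P.d - Metric.infDist z P.Q) ≤ P.a * (P.d - Metric.infDist (z - τ / P.ζ) P.Q) := by
      gcongr
    linarith
  rw [dFst_iterate]
  refine Complex.norm_iteratedDeriv_le_of_forall_mem_sphere_norm_le m hδ0
    (DifferentiableOn.diffContOnCl_ball (U := {t : ℂ | (t, z - τ / P.ζ) ∈ P.dom}) (fun t ht =>
      (analyticAt_fst_of (hs.analytic_Y k _ ht)).differentiableAt.differentiableWithinAt) hmem)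
    fun t ht => ?_
  have ht' := hmem t (Metric.sphere_subset_closedBall ht)
  refine (hP.norm_Y_le hs.K_pos.le hs.l_pos.le hs.σ_nonneg hs.M_nonneg hs.src k ht' hx).trans ?_
  rw [mem_sphere_zero_iff_norm] at ht
  have h5 : rePos t ≤ δ := by
    have := rePos_add_le 0 t
    have h4 : rePos 0 = 0 := by simp [rePos]
    rwa [zero_add, h4, zero_add, ht] at this
  have h6 : 0 ≤ wb P.ρ (P.prog (z - τ / P.ζ) + P.d) + wE P.ρ (P.prog (z - τ / P.ζ)) :=
    add_nonneg (wb_pos _).le (wE_nonneg _)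
  have h7 := hs.σ_nonneg
  simp only [ht, hB]
  gcongr

lemma lbdd_ac (m : ℕ) : P.LBdd (P.ac Ψ G m) :=
  (hs.valid.lbdd_exp_expo hs.c_nonneg hs.pot).2.mul (hs.lbdd_vc 0 m)

lemma tendsto_ac {m : ℕ} (hm : 0 < m) {z : ℂ} (hz : z ∈ P.base) :
    Tendsto (fun τ : ℝ => P.ac Ψ G m (z - τ / P.ζ)) atTop (𝓝 0) := by
  have h := (hs.valid.tendsto_expo hs.pot hz).neg.cexp.mul (hs.tendsto_dFst_Y 0 m hz)
  rw [mul_zero] at h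
  unfold ac vc
  simpa only [hm.ne', if_false, zero_add] using h

lemma ac_zero {z : ℂ} (hz : z ∈ P.base) : P.ac Ψ G 0 z = 1 := by
  have := hs.exp_neg_expo_mul hz
  simpa [ac, vc] using this

/-- Leibniz rule for the coefficients. -/
lemma exp_neg_mul_ec {p m : ℕ} (hpm : p ≤ m) {z : ℂ} (hz : z ∈ P.base) :
    Complex.exp (-P.expo Ψ z) * P.ec G p m z = ∑ r ∈ Finset.range (p + 1),
      (p.choose r : ℂ) * (P.bell Ψ (p - r) z * iteratedDeriv r (P.ac Ψ G (m - p)) z) := by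
  have hX := (hs.valid.lbdd_exp_expo hs.c_nonneg hs.pot).1.analytic z hz
  have hA := (hs.lbdd_ac (m - p)).analytic z hz
  have h1 : P.vc G 0 (m - p) = P.ac Ψ G (m - p) * fun y => Complex.exp (P.expo Ψ y) := by
    funext y
    rw [← exp_mul_ac (Ψ := Ψ), mul_comm]
    rfl
  rw [ec, if_pos hpm, h1, iteratedDeriv_mul hA.contDiffAt hX.contDiffAt, Finset.mul_sum]
  refine Finset.sum_congr rfl fun r _ => ?_
  unfold bell
  ring

lemma ac_sum_ec (k i : ℕ) {z : ℂ} (hz : z ∈ P.base) :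
    Complex.exp (-P.expo Ψ z) * ∑ p ∈ Finset.range (k + 1),
        (k.choose p : ℂ) * (P.ζ ^ (k - p) * P.ec G p i z) =
      ∑ p ∈ Finset.range (min k i + 1), (k.choose p : ℂ) * P.ζ ^ (k - p) *
        ∑ r ∈ Finset.range (p + 1),
          (p.choose r : ℂ) * (P.bell Ψ (p - r) z * iteratedDeriv r (P.ac Ψ G (i - p)) z) := by
  have h1 : Finset.range (min k i + 1) ⊆ Finset.range (k + 1) :=
    Finset.range_subset_range.2 (by omega)
  rw [← Finset.sum_subset h1 (fun p hp hp' => ?_), Finset.mul_sum]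
  · refine Finset.sum_congr rfl fun p hp => ?_
    rw [Finset.mem_range] at hp
    rw [← hs.exp_neg_mul_ec (by omega) hz]
    ring
  · rw [Finset.mem_range] at hp hp'
    rw [ec, if_neg (by omega), mul_zero, mul_zero]

/-- Multiply `vc_last` by ζ e^{-X}. The terms with A_{m+1} on the two sides cancel; the term p = 1
of the right side is n(X' A_m + A_m'); and nX' A_m cancels the terms with ψ_{k,1} A_m, since nX' = Σ
ζ^{k+1} ψ_{k,1}. What remains expresses A_m' through coefficients of lower index. -/
lemma neg_deriv_ac (m : ℕ) {z : ℂ} (hz : z ∈ P.base) :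
    HasDerivAt (P.ac Ψ G m) (-recForm P.n P.ζ (P.bell Ψ) (psiC Ψ)
      (fun r q => iteratedDeriv r (P.ac Ψ G q)) m (fun g => g z)) z := by
  have hP := hs.valid
  have hn := hP.two_le
  have hn0 : (P.n : ℂ) ≠ 0 := Nat.cast_ne_zero.2 (by omega)
  have hA := ((hs.lbdd_ac m).analytic z hz).differentiableAt.hasDerivAt
  refine hA.congr_deriv ?_
  set R : ℕ → ℕ → ℂ := fun p q => ∑ r ∈ Finset.range (p + 1),
    (p.choose r : ℂ) * (P.bell Ψ (p - r) z * iteratedDeriv r (P.ac Ψ G (q - p)) z) with hR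
  have hR0 : ∀ q, R 0 q = P.ac Ψ G q z := fun q => by simp [hR, bell_zero]
  have hR1 : R 1 (m + 1) = 1 / P.n * P.slope Ψ z * P.ac Ψ G m z + deriv (P.ac Ψ G m) z := by
    simp [hR, Finset.sum_range_succ, bell_zero, hP.bell_one hs.pot hz]
  have hlast := congrArg (fun w => P.ζ * (Complex.exp (-P.expo Ψ z) * w)) (hs.vc_last m hz)
  simp only [mul_add] at hlast
  rw [hs.ac_sum_ec P.n (m + 1) hz] at hlast
  have hvc : Complex.exp (-P.expo Ψ z) * P.vc G 0 (m + 1) z = P.ac Ψ G (m + 1) z := rfl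
  rw [hvc] at hlast
  have hpow : ∀ N p, p ≤ N → P.ζ * P.ζ ^ (N - p) = P.ζ ^ (N + 1 - p) := fun N p hp => by
    rw [show N + 1 - p = (N - p) + 1 by omega, pow_succ, mul_comm]
  -- The terms p = 0 and p = 1 are split off; ζ^n = 1 simplifies their powers of ζ.
  have hright : P.ζ * ∑ p ∈ Finset.range (min P.n (m + 1) + 1), (P.n.choose p : ℂ) *
      P.ζ ^ (P.n - p) * R p (m + 1) = P.ζ * P.ac Ψ G (m + 1) z + P.n * R 1 (m + 1) +
      ∑ p ∈ Finset.Icc 2 (min P.n (m + 1)), (P.n.choose p : ℂ) * P.ζ ^ (P.n + 1 - p) *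
        R p (m + 1) := by
    have h1 : Finset.range (min P.n (m + 1) + 1) =
        insert 0 (insert 1 (Finset.Icc 2 (min P.n (m + 1)))) := by
      ext p
      simp only [Finset.mem_range, Finset.mem_insert, Finset.mem_Icc]
      omega
    rw [h1, Finset.sum_insert (by simp), Finset.sum_insert (by simp), hR0, Nat.choose_zero_right,
      Nat.choose_one_right, Nat.sub_zero, hP.root, mul_add, mul_add,
      Finset.mul_sum (Finset.Icc 2 (min P.n (m + 1))) _ P.ζ]
    have h2 : P.ζ * P.ζ ^ (P.n - 1) = 1 := by
      rw [hpow P.n 1 (by omega), Nat.add_sub_cancel, hP.root]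
    have h3 : ∀ p ∈ Finset.Icc 2 (min P.n (m + 1)),
        P.ζ * ((P.n.choose p : ℂ) * P.ζ ^ (P.n - p) * R p (m + 1)) =
        (P.n.choose p : ℂ) * P.ζ ^ (P.n + 1 - p) * R p (m + 1) := fun p hp => by
      rw [Finset.mem_Icc] at hp
      rw [← hpow P.n p (by omega)]
      ring
    rw [Finset.sum_congr rfl h3]
    linear_combination (P.n : ℂ) * R 1 (m + 1) * h2
  have hkm : ∀ k q, P.ζ * ∑ p ∈ Finset.range (min k q + 1), (k.choose p : ℂ) *
      P.ζ ^ (k - p) * R p q = ∑ p ∈ Finset.range (min k q + 1), (k.choose p : ℂ) *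
      P.ζ ^ (k + 1 - p) * R p q := fun k q => by
    rw [Finset.mul_sum]
    refine Finset.sum_congr rfl fun p hp => ?_
    rw [Finset.mem_range] at hp
    rw [← hpow k p (by omega)]
    ring
  have hsplit : ∀ k, ∑ p ∈ Finset.range (min k m + 1), (k.choose p : ℂ) *
      P.ζ ^ (k + 1 - p) * R p m = P.ζ ^ (k + 1) * P.ac Ψ G m z +
      ∑ p ∈ Finset.Icc 1 (min m k), (k.choose p : ℂ) * P.ζ ^ (k + 1 - p) * R p m := fun k => by
    have h1 : Finset.range (min k m + 1) = insert 0 (Finset.Icc 1 (min m k)) := by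
      ext p
      simp only [Finset.mem_range, Finset.mem_insert, Finset.mem_Icc]
      omega
    rw [h1, Finset.sum_insert (by simp), hR0, Nat.choose_zero_right, Nat.sub_zero, Nat.cast_one,
      one_mul]
  have hmid : P.ζ * (Complex.exp (-P.expo Ψ z) * ∑ k ∈ Finset.range (P.n - 1),
      ∑ i ∈ Finset.range (m + 1), psiC Ψ k (m + 1 - i) z * ∑ p ∈ Finset.range (k + 1),
        (k.choose p : ℂ) * (P.ζ ^ (k - p) * P.ec G p i z)) =
      (∑ k ∈ Finset.range (P.n - 1), ∑ q ∈ Finset.range m, psiC Ψ k (m + 1 - q) z *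
        ∑ p ∈ Finset.range (min k q + 1), (k.choose p : ℂ) * P.ζ ^ (k + 1 - p) * R p q) +
      (P.slope Ψ z * P.ac Ψ G m z + ∑ k ∈ Finset.range (P.n - 1), psiC Ψ k 1 z *
        ∑ p ∈ Finset.Icc 1 (min m k), (k.choose p : ℂ) * P.ζ ^ (k + 1 - p) * R p m) := by
    have h1 : P.slope Ψ z = ∑ k ∈ Finset.range (P.n - 1), P.ζ ^ (k + 1) * psiC Ψ k 1 z := rfl
    rw [h1, Finset.sum_mul, ← Finset.sum_add_distrib, ← Finset.sum_add_distrib, Finset.mul_sum,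
      Finset.mul_sum]
    refine Finset.sum_congr rfl fun k _ => ?_
    have h2 : ∀ i, P.ζ * (Complex.exp (-P.expo Ψ z) * (psiC Ψ k (m + 1 - i) z *
        ∑ p ∈ Finset.range (k + 1), (k.choose p : ℂ) * (P.ζ ^ (k - p) * P.ec G p i z))) =
        psiC Ψ k (m + 1 - i) z * ∑ p ∈ Finset.range (min k i + 1), (k.choose p : ℂ) *
          P.ζ ^ (k + 1 - p) * R p i := fun i => by
      rw [← hkm, ← hs.ac_sum_ec k i hz]
      ring
    rw [Finset.mul_sum, Finset.mul_sum, Finset.sum_congr rfl fun i _ => h2 i,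
      Finset.sum_range_succ, hsplit, show m + 1 - m = 1 by omega]
    ring
  rw [hright, hmid, hR1] at hlast
  have hform : recForm P.n P.ζ (P.bell Ψ) (psiC Ψ) (fun r q => iteratedDeriv r (P.ac Ψ G q)) m
      (fun g => g z) =
      1 / (P.n : ℂ) * (∑ p ∈ Finset.Icc 2 (min P.n (m + 1)), (P.n.choose p : ℂ) *
        P.ζ ^ (P.n + 1 - p) * R p (m + 1)) -
      1 / (P.n : ℂ) * (∑ k ∈ Finset.range (P.n - 1), psiC Ψ k 1 z *
        ∑ p ∈ Finset.Icc 1 (min m k), (k.choose p : ℂ) * P.ζ ^ (k + 1 - p) * R p m) -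
      1 / (P.n : ℂ) * (∑ k ∈ Finset.range (P.n - 1), ∑ q ∈ Finset.range m,
        psiC Ψ k (m + 1 - q) z * ∑ p ∈ Finset.range (min k q + 1), (k.choose p : ℂ) *
          P.ζ ^ (k + 1 - p) * R p q) := by
    have e : ∀ (x : ℂ) (p q : ℕ), x * R p q = ∑ r ∈ Finset.range (p + 1), (p.choose r : ℂ) *
        (P.bell Ψ (p - r) z * x * iteratedDeriv r (P.ac Ψ G (q - p)) z) := fun x p q => by
      rw [hR, Finset.mul_sum]
      refine Finset.sum_congr rfl fun r _ => ?_
      ring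
    unfold recForm
    refine congrArg₂ _ (congrArg₂ _ rfl (congrArg _ ?_)) (congrArg _ ?_)
    · refine Finset.sum_congr rfl fun k _ => ?_
      rw [Finset.mul_sum]
      refine Finset.sum_congr rfl fun p _ => ?_
      rw [← e]
      ring
    · refine Finset.sum_congr rfl fun k _ => Finset.sum_congr rfl fun q _ => ?_
      rw [Finset.mul_sum]
      refine Finset.sum_congr rfl fun p _ => ?_
      rw [← e]
      ring
  rw [hform]
  field_simp at hlast ⊢
  linear_combination -hlast

/-- Every integrand needs a factor that decays. In the second and third sums it is the potential. In
the first it is a Bell polynomial of positive order if r < p; if r = p, then r ≥ 2 and it is a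
derivative of a lower coefficient, which decays by `hD`. -/
lemma rayLinear_recForm {m : ℕ} (hD : ∀ q < m, P.LDec (deriv (P.ac Ψ G q))) :
    P.RayLinear (recForm P.n P.ζ (P.bell Ψ) (psiC Ψ)
      (fun r q => iteratedDeriv r (P.ac Ψ G q)) m) := by
  have hP := hs.valid
  have hB := hP.lbdd_bell hs.c_nonneg hs.pot
  have hpsi : ∀ k ∈ Finset.range (P.n - 1), ∀ p i r q, P.RayLinear (fun L =>
      L (fun y => P.bell Ψ p y * psiC Ψ k i y * iteratedDeriv r (P.ac Ψ G q) y)) :=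
    fun k hk p i r q => (((hB p).mul_dec (hs.ldec_psiC (Finset.mem_range.1 hk) i)).mul_bdd
      ((hs.lbdd_ac q).iteratedDeriv r)).rayLinear
  unfold recForm
  refine RayLinear.sub hP (RayLinear.sub hP ?_ ?_) ?_
  · refine (RayLinear.sum hP fun p hp => (RayLinear.sum hP fun r hr =>
      RayLinear.const_mul ?_ _).const_mul _).const_mul _
    rw [Finset.mem_Icc] at hp
    rw [Finset.mem_range] at hr
    refine LDec.rayLinear ?_
    rcases lt_or_ge r p with h | h
    · exact (hP.ldec_bell hs.c_nonneg hs.pot (by omega)).mul_bdd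
        ((hs.lbdd_ac _).iteratedDeriv r)
    · obtain ⟨r', rfl⟩ : ∃ r', r = r' + 1 := ⟨r - 1, by omega⟩
      simp only [iteratedDeriv_succ']
      exact (hB _).mul_dec ((hD _ (by omega)).iteratedDeriv hP r')
  · exact (RayLinear.sum hP fun k hk => RayLinear.sum hP fun p _ => (RayLinear.sum hP fun r _ =>
      (hpsi k hk _ _ _ _).const_mul _).const_mul _).const_mul _
  · exact (RayLinear.sum hP fun k hk => RayLinear.sum hP fun q _ => RayLinear.sum hP fun p _ =>
      (RayLinear.sum hP fun r _ => (hpsi k hk _ _ _ _).const_mul _).const_mul _).const_mul _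

lemma ldec_deriv_ac (m : ℕ) : P.LDec (deriv (P.ac Ψ G m)) := by
  induction m using Nat.strong_induction_on with
  | _ m ih =>
    refine ((hs.rayLinear_recForm ih).1.const_mul (-1)).congr fun z hz => ?_
    rw [(hs.neg_deriv_ac m hz).deriv, neg_one_mul]

/-- The recurrence relation for the coefficients. -/
theorem ac_rec {m : ℕ} (hm : 0 < m) {z : ℂ} (hz : z ∈ P.base) :
    P.ac Ψ G m z = recForm P.n P.ζ (P.bell Ψ) (psiC Ψ)
      (fun r q => iteratedDeriv r (P.ac Ψ G q)) m (fun g => P.rint g z) := by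
  have h := hs.rayLinear_recForm (m := m) fun q _ => hs.ldec_deriv_ac q
  rw [← h.2 z hz]
  exact h.1.eq_rint hs.valid (fun w hw => hs.neg_deriv_ac m hw) hz (hs.tendsto_ac hm hz)

end Solution

/-- The index shift reflects that the t-derivative of `Y` and not `Y` itself enters the Borel
transform of η. -/
lemma ac_succ (P : Frame) (Ψ : ℕ → ℂ × ℂ → ℂ) (G : ℂ × ℂ → ℂ) (m : ℕ) (z : ℂ) :
    P.ac Ψ G (m + 1) z = iteratedDeriv m (fun t => P.borelEta Ψ G (t, z)) 0 := by
  unfold ac vc borelEta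
  simp only [Nat.succ_ne_zero, if_false, zero_add]
  rw [Function.iterate_succ_apply, dFst_iterate]
  exact (iteratedDeriv_const_mul_field _ _).symm

end Frame

end Recurrence

end FactorialSeries
end

open Filter Topology Asymptotics MeasureTheory
noncomputable section
namespace FactorialSeries

/-! ### Watson's lemma and uniqueness of asymptotic coefficients -/

section Watson

/-- A function is determined by its values on the positive axis up to `o (u ^ -N)` for at most one
sequence of coefficients. -/
lemma coeff_unique {f : ℝ → ℂ} {e : ℂ} {α β : ℕ → ℂ}
    (hα : ∀ N : ℕ, (fun u : ℝ => f u - (e + ∑ m ∈ Finset.Icc 1 N, α m / (u : ℂ) ^ m))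
      =o[atTop] fun u : ℝ => 1 / u ^ N)
    (hβ : ∀ N : ℕ, (fun u : ℝ => f u - (e + ∑ m ∈ Finset.Icc 1 N, β m / (u : ℂ) ^ m))
      =o[atTop] fun u : ℝ => 1 / u ^ N) {m : ℕ} (hm : 1 ≤ m) : α m = β m := by
  induction m using Nat.strong_induction_on with
  | _ m ih =>
    have h1 := (hβ m).sub (hα m)
    have h2 : ∀ u : ℝ, (f u - (e + ∑ i ∈ Finset.Icc 1 m, β i / (u : ℂ) ^ i)) -
        (f u - (e + ∑ i ∈ Finset.Icc 1 m, α i / (u : ℂ) ^ i)) =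
        (α m - β m) / (u : ℂ) ^ m := fun u => by
      rw [show m = (m - 1) + 1 by omega, Finset.sum_Icc_succ_top (by omega),
        Finset.sum_Icc_succ_top (by omega)]
      have h3 : ∑ i ∈ Finset.Icc 1 (m - 1), α i / (u : ℂ) ^ i =
          ∑ i ∈ Finset.Icc 1 (m - 1), β i / (u : ℂ) ^ i :=
        Finset.sum_congr rfl fun i hi => by
          rw [Finset.mem_Icc] at hi
          rw [ih i (by omega) hi.1]
      rw [h3]
      ring
    have h4 : (fun _ : ℝ => α m - β m) =o[atTop] fun _ : ℝ => (1 : ℝ) := by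
      have h6 : (fun u : ℝ => 1 / u ^ m * ‖(u : ℂ) ^ m‖) =ᶠ[atTop] fun _ => (1 : ℝ) := by
        filter_upwards [eventually_gt_atTop 0] with u hu
        rw [norm_pow, Complex.norm_real, Real.norm_of_nonneg hu.le, one_div_mul_cancel (by positivity)]
      have h7 : (fun u : ℝ => (α m - β m) / (u : ℂ) ^ m * (u : ℂ) ^ m) =ᶠ[atTop]
          fun _ => α m - β m := by
        filter_upwards [eventually_gt_atTop 0] with u hu
        have : (u : ℂ) ≠ 0 := by exact_mod_cast hu.ne'
        field_simp
      refine IsLittleO.congr' ?_ h7 h6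
      exact (h1.congr_left h2).mul_isBigO
        (isBigO_refl (fun u : ℝ => (u : ℂ) ^ m) atTop).norm_right
    exact sub_eq_zero.1 (isLittleO_const_const_iff.1 h4)

variable {F : ℂ → ℂ} {r C σ : ℝ}

lemma exists_lapBound_iteratedDeriv (hr : 0 < r) (hσ : 0 ≤ σ) (hC : 0 ≤ C)
    (hF : AnalyticOnNhd ℂ F {t | width t < r})
    (hb : ∀ t, width t < r → ‖F t‖ ≤ C * Real.exp (σ * rePos t)) (k : ℕ) :
    ∃ C', LapBound C' σ (iteratedDeriv k F) := by
  refine ⟨k.factorial * (C * Real.exp (σ * (r / 2))) / (r / 2) ^ k, fun t ht => ?_, fun t ht => ?_⟩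
  · have h0 : (t : ℂ) ∈ {t | width t < r} := by simpa [width_ofReal (Set.mem_Ici.1 ht)] using hr
    exact (ContinuousAt.comp (g := iteratedDeriv k F) (f := fun t : ℝ => (t : ℂ))
      (analyticAt_iteratedDeriv (hF _ h0) k).continuousAt
      Complex.continuous_ofReal.continuousAt).continuousWithinAt
  · have := norm_iteratedDeriv_le_of_width hσ (half_pos hr) hC hF hb k (t := t)
      (by rw [width_ofReal ht]; linarith)
    rwa [rePos_ofReal ht] at this

/-- Watson's lemma. -/
lemma lap_isLittleO (hr : 0 < r) (hσ : 0 ≤ σ) (hC : 0 ≤ C)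
    (hF : AnalyticOnNhd ℂ F {t | width t < r})
    (hb : ∀ t, width t < r → ‖F t‖ ≤ C * Real.exp (σ * rePos t)) (N : ℕ) :
    (fun u : ℝ => lap F u - ∑ m ∈ Finset.Icc 1 N, iteratedDeriv (m - 1) F 0 / (u : ℂ) ^ m)
      =o[atTop] fun u : ℝ => 1 / u ^ N := by
  have hL := exists_lapBound_iteratedDeriv hr hσ hC hF hb
  have h0 : ∀ t : ℝ, 0 ≤ t → (t : ℂ) ∈ {t | width t < r} := fun t ht => by
    simpa [width_ofReal ht] using hr
  -- N integrations by parts leave an exact remainder: the transform of the N-th derivative divided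
  -- by u^N.
  have hrem : ∀ u : ℝ, σ < u → lap F u - ∑ m ∈ Finset.Icc 1 N,
      iteratedDeriv (m - 1) F 0 / (u : ℂ) ^ m = lap (iteratedDeriv N F) u / (u : ℂ) ^ N := by
    intro u hu
    have hu0 : (u : ℂ) ≠ 0 := by exact_mod_cast (lt_of_le_of_lt hσ hu).ne'
    induction N with
    | zero => simp
    | succ N ih =>
      obtain ⟨C₁, h1⟩ := hL N
      obtain ⟨C₂, h2⟩ := hL (N + 1)
      have h3 := lap_deriv h1 h2 (u := u) (fun t ht => by
        rw [iteratedDeriv_succ]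
        exact (analyticAt_iteratedDeriv (hF _ (h0 t ht)) N).differentiableAt.hasDerivAt) (by simpa using hu)
      rw [Finset.sum_Icc_succ_top (by omega), ← sub_sub, ih, Nat.add_sub_cancel]
      rw [pow_succ, eq_sub_of_add_eq' h3.symm]
      field_simp
  obtain ⟨C', hC'⟩ := hL N
  have h1 : (fun u : ℝ => lap (iteratedDeriv N F) u) =o[atTop] fun _ : ℝ => (1 : ℝ) := by
    rw [isLittleO_one_iff]
    refine squeeze_zero_norm' (a := fun u : ℝ => C' / (u - σ)) ?_
      (Tendsto.div_atTop tendsto_const_nhds (tendsto_atTop_add_const_right _ _ tendsto_id))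
    filter_upwards [eventually_gt_atTop σ] with u hu
    simpa using hC'.norm_lap_le (u := u) (by simpa using hu)
  have h2 : (fun u : ℝ => 1 / (u : ℂ) ^ N) =O[atTop] fun u : ℝ => 1 / u ^ N :=
    IsBigO.of_bound 1 (Eventually.of_forall fun u => by simp)
  refine (h1.mul_isBigO h2).congr' ?_ (Eventually.of_forall fun u => one_mul _)
  filter_upwards [eventually_gt_atTop σ] with u hu
  rw [hrem u hu]
  ring

end Watson

end FactorialSeries
end

open Filter Topology Asymptotics MeasureTheory
noncomputable section
namespace FactorialSeries

/-! ### Decaying solutions of perturbed cyclic systems -/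

section Uniqueness

variable {u : ℝ} {y : ℕ → ℝ → ℂ}

/-- An interpolation argument of Landau's type. Where h is small, e^{-ut} g is almost constant on
intervals of length one; it is, up to the factor -u, the derivative of e^{-ut} f, so the small
increment of the latter forces g to be small. -/
lemma tendsto_zero_of_hasDerivAt (hu : 0 < u) {f g h : ℝ → ℂ}
    (hf : ∀ t, 0 ≤ t → HasDerivAt f (u * (f t - g t)) t)
    (hg : ∀ t, 0 ≤ t → HasDerivAt g (u * (g t - h t)) t) (hf0 : Tendsto f atTop (𝓝 0))
    (hh0 : Tendsto h atTop (𝓝 0)) : Tendsto g atTop (𝓝 0) := by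
  have hE : ∀ {p q : ℝ → ℂ}, (∀ t, 0 ≤ t → HasDerivAt p (u * (p t - q t)) t) → ∀ t, 0 ≤ t →
      HasDerivAt (fun t : ℝ => Real.exp (-u * t) * p t) (-u * (Real.exp (-u * t) * q t)) t := by
    intro p q hp t ht
    have h1 : HasDerivAt (fun t : ℝ => Real.exp (-u * t)) (Real.exp (-u * t) * (-u * 1)) t :=
      ((hasDerivAt_id t).const_mul (-u)).exp
    have h2 := h1.ofReal_comp.mul (hp t ht)
    refine h2.congr_deriv ?_
    push_cast
    ring
  have hkey : ∀ ε T : ℝ, 0 ≤ ε → 0 ≤ T → (∀ t, T ≤ t → ‖h t‖ ≤ ε) → ∀ t, T ≤ t →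
      ‖g t‖ ≤ u * ε + (‖f (t + 1)‖ + ‖f t‖) / u := by
    intro ε T hε hT hb t ht
    have ht0 : 0 ≤ t := hT.trans ht
    have hexp : ∀ s ∈ Set.Icc t (t + 1), Real.exp (-u * s) ≤ Real.exp (-u * t) := fun s hs =>
      Real.exp_le_exp.2 (by nlinarith [hs.1])
    have hc : Convex ℝ (Set.Icc t (t + 1)) := convex_Icc _ _
    have hl : t ∈ Set.Icc t (t + 1) := ⟨le_refl _, by linarith⟩
    have h1 : ∀ s ∈ Set.Icc t (t + 1),
        ‖Real.exp (-u * s) * g s - Real.exp (-u * t) * g t‖ ≤ u * ε * Real.exp (-u * t) := by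
      intro s hs
      have := hc.norm_image_sub_le_of_norm_hasDerivWithin_le (C := u * ε * Real.exp (-u * t))
        (fun r hr => (hE hg r (ht0.trans hr.1)).hasDerivWithinAt) (fun r hr => by
          rw [norm_mul, norm_neg, norm_mul, Complex.norm_real, Complex.norm_real,
            Real.norm_of_nonneg hu.le, Real.norm_of_nonneg (Real.exp_pos _).le, mul_assoc]
          refine mul_le_mul_of_nonneg_left ?_ hu.le
          rw [mul_comm]
          exact mul_le_mul (hb r (ht.trans hr.1)) (hexp r hr) (Real.exp_pos _).le hε) hl hs
      refine this.trans (mul_le_of_le_one_right (by positivity) ?_)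
      rw [Real.norm_of_nonneg (by linarith [hs.1])]
      linarith [hs.2]
    -- A linear function is added to e^{-us} f(s) so that the derivative of the sum is -u times the
    -- deviation of e^{-us} g(s) from its value at t, which h1 bounds.
    have h2 := hc.norm_image_sub_le_of_norm_hasDerivWithin_le
      (f := fun s : ℝ => Real.exp (-u * s) * f s + s * (u * (Real.exp (-u * t) * g t)))
      (f' := fun s => -u * (Real.exp (-u * s) * g s) + 1 * (u * (Real.exp (-u * t) * g t)))
      (C := u * (u * ε * Real.exp (-u * t)))
      (fun r hr => ((hE hf r (ht0.trans hr.1)).add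
        ((hasDerivAt_id r).ofReal_comp.mul_const _)).hasDerivWithinAt) (fun r hr => by
          have : -(u : ℂ) * (Real.exp (-u * r) * g r) + 1 * (u * (Real.exp (-u * t) * g t)) =
            -u * (Real.exp (-u * r) * g r - Real.exp (-u * t) * g t) := by ring
          rw [this, norm_mul, norm_neg, Complex.norm_real, Real.norm_of_nonneg hu.le]
          exact mul_le_mul_of_nonneg_left (h1 r hr) hu.le) hl
      (y := t + 1) ⟨by linarith, le_refl _⟩
    rw [add_sub_cancel_left, norm_one, mul_one] at h2
    have h3 : u * (Real.exp (-u * t) * ‖g t‖) ≤ u * (u * ε * Real.exp (-u * t)) +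
        (Real.exp (-u * t) * ‖f (t + 1)‖ + Real.exp (-u * t) * ‖f t‖) := by
      have h4 : (u : ℂ) * (Real.exp (-u * t) * g t) =
          (Real.exp (-u * (t + 1)) * f (t + 1) + (t + 1 : ℝ) * (u * (Real.exp (-u * t) * g t)) -
          (Real.exp (-u * t) * f t + t * (u * (Real.exp (-u * t) * g t)))) -
          (Real.exp (-u * (t + 1)) * f (t + 1) - Real.exp (-u * t) * f t) := by
        push_cast
        ring
      have h5 := (norm_sub_le (Real.exp (-u * (t + 1)) * f (t + 1) +
        (t + 1 : ℝ) * (u * (Real.exp (-u * t) * g t)) -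
          (Real.exp (-u * t) * f t + t * (u * (Real.exp (-u * t) * g t))))
        (Real.exp (-u * (t + 1)) * f (t + 1) - Real.exp (-u * t) * f t)).trans
        (add_le_add h2 (norm_sub_le _ _))
      rw [← h4] at h5
      simp only [norm_mul, Complex.norm_real, Real.norm_of_nonneg hu.le,
        Real.norm_of_nonneg (Real.exp_pos _).le] at h5
      refine h5.trans (add_le_add le_rfl (add_le_add ?_ le_rfl))
      exact mul_le_mul_of_nonneg_right (hexp _ ⟨by linarith, le_refl _⟩) (norm_nonneg _)
    have h6 : u * ‖g t‖ ≤ u * (u * ε) + (‖f (t + 1)‖ + ‖f t‖) := by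
      refine le_of_mul_le_mul_left ?_ (Real.exp_pos (-u * t))
      linarith
    rw [← sub_le_iff_le_add', le_div_iff₀ hu]
    linarith
  rw [Metric.tendsto_atTop]
  intro ε hε
  obtain ⟨T₁, hT₁⟩ := Metric.tendsto_atTop.1 hh0 (ε / (3 * u)) (by positivity)
  obtain ⟨T₂, hT₂⟩ := Metric.tendsto_atTop.1 hf0 (ε * u / 3) (by positivity)
  refine ⟨max 0 (max T₁ T₂), fun t ht => ?_⟩
  have ht1 : T₁ ≤ max 0 (max T₁ T₂) := (le_max_left _ _).trans (le_max_right _ _)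
  have ht2 : T₂ ≤ t := ((le_max_right T₁ T₂).trans (le_max_right _ _)).trans ht
  have h1 := hkey (ε / (3 * u)) (max 0 (max T₁ T₂)) (by positivity) (le_max_left _ _)
    (fun s hs => by simpa using (hT₁ s (ht1.trans hs)).le) t ht
  have h2 := hT₂ t ht2
  have h3 := hT₂ (t + 1) (by linarith)
  rw [dist_zero_right] at h2 h3 ⊢
  have h4 : u * (ε / (3 * u)) = ε / 3 := by field_simp
  have h5 : (‖f (t + 1)‖ + ‖f t‖) / u < 2 * ε / 3 := by
    rw [div_lt_iff₀ hu]
    linarith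
  linarith

/-- A solution of a perturbed cyclic system that decays vanishes. -/
lemma eq_zero_of_cyclic {n : ℕ} (hn : 2 ≤ n) (hu : 0 < u)
    (hy : ∀ k < n, ∀ t, 0 ≤ t → HasDerivAt (y k) (u * (y k t - y (k + 1) t)) t)
    {β B : ℝ → ℝ} {b : ℝ} (hβ : ∀ t, 0 ≤ t → 0 ≤ β t ∧ β t ≤ b)
    (hB : ∀ t, 0 ≤ t → HasDerivAt B (β t) t) (hBb : ∀ t, 0 ≤ t → B t ≤ b)
    (hyn : ∀ t, 0 ≤ t → ‖y n t - y 0 t‖ ≤ β t * ∑ k ∈ Finset.range (n - 1), ‖y k t‖)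
    (h0 : ∀ k ≤ n - 2, Tendsto (y k) atTop (𝓝 0)) {t : ℝ} (ht : 0 ≤ t) : y 0 t = 0 := by
  have hs0 : Tendsto (fun t => ∑ k ∈ Finset.range (n - 1), ‖y k t‖) atTop (𝓝 0) := by
    have := tendsto_finsetSum (Finset.range (n - 1)) fun k hk => (h0 k (by
      rw [Finset.mem_range] at hk; omega)).norm
    simpa using this
  have hyn0 : Tendsto (y n) atTop (𝓝 0) := by
    have h1 : Tendsto (fun t => y n t - y 0 t) atTop (𝓝 0) := by
      refine squeeze_zero_norm' ?_ (by simpa using hs0.const_mul b)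
      filter_upwards [eventually_ge_atTop 0] with t ht
      exact (hyn t ht).trans (mul_le_mul_of_nonneg_right (hβ t ht).2
        (Finset.sum_nonneg fun _ _ => norm_nonneg _))
    simpa using h1.add (h0 0 (by omega))
  have hall : ∀ k < n, Tendsto (y k) atTop (𝓝 0) := by
    intro k hk
    rcases Nat.lt_or_ge k (n - 1) with h | h
    -- The hypotheses give decay up to index n - 2, and `hyn` gives it for y_n. The missing y_{n-1}
    -- lies between two components that decay.
    · exact h0 k (by omega)
    · obtain rfl : k = n - 2 + 1 := by omega
      refine tendsto_zero_of_hasDerivAt hu (hy (n - 2) (by omega)) (hy _ hk) (h0 _ le_rfl) ?_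
      rwa [show n - 2 + 1 + 1 = n by omega]
  set N : ℝ → ℝ := fun t => ∑ k ∈ Finset.range n, ‖y k t‖ ^ 2 with hN
  have hN0 : Tendsto N atTop (𝓝 0) := by
    have := tendsto_finsetSum (Finset.range n) fun k hk =>
      (hall k (Finset.mem_range.1 hk)).norm.pow 2
    simpa using this
  have hNn : ∀ t, 0 ≤ N t := fun t => Finset.sum_nonneg fun _ _ => by positivity
  set N' : ℝ → ℝ := fun t => ∑ k ∈ Finset.range n, 2 * inner ℝ (y k t) (u * (y k t - y (k + 1) t))
  have hN' : ∀ t, 0 ≤ t → HasDerivAt N (N' t) t := fun t ht =>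
    HasDerivAt.fun_sum fun k hk => (hy k (Finset.mem_range.1 hk) t ht).norm_sq
  -- Since 2⟨v, v - w⟩ ≥ |v|² - |w|², the derivative of the sum of squares would be nonnegative by
  -- telescoping if y_n were y_0. The mismatch y_n - y_0 costs at most a multiple of β N.
  have hlow : ∀ t, 0 ≤ t → -(2 * u * n * β t) * N t ≤ N' t := by
    intro t ht
    have hin : ∀ v w : ℂ, 2 * inner ℝ v ((u : ℂ) * (v - w)) ≥ u * (‖v‖ ^ 2 - ‖w‖ ^ 2) := by
      intro v w
      have h1 : inner ℝ v ((u : ℂ) * (v - w)) = u * (‖v‖ ^ 2 - inner ℝ v w) := by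
        rw [← Complex.real_smul, inner_smul_right, inner_sub_right, real_inner_self_eq_norm_sq]
      have h2 : inner ℝ v w ≤ ‖v‖ * ‖w‖ := real_inner_le_norm v w
      rw [h1]
      nlinarith [mul_nonneg hu.le (sq_nonneg (‖v‖ - ‖w‖)), mul_le_mul_of_nonneg_left h2 hu.le]
    have hlast : ∀ v w x : ℂ, 2 * inner ℝ v ((u : ℂ) * (v - w)) ≥
        u * (‖v‖ ^ 2 - ‖x‖ ^ 2) - 2 * u * (‖v‖ * ‖w - x‖) := by
      intro v w x
      have h1 : inner ℝ v ((u : ℂ) * (v - w)) = inner ℝ v ((u : ℂ) * (v - x)) -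
          u * inner ℝ v (w - x) := by
        rw [← Complex.real_smul, ← Complex.real_smul, inner_smul_right, inner_smul_right,
          ← mul_sub, ← inner_sub_right]
        congr 2
        ring
      have h2 : inner ℝ v (w - x) ≤ ‖v‖ * ‖w - x‖ := real_inner_le_norm v _
      rw [h1]
      nlinarith [hin v x, mul_le_mul_of_nonneg_left h2 hu.le]
    obtain ⟨m, rfl⟩ : ∃ m, n = m + 1 := ⟨n - 1, by omega⟩
    have htel : ∑ k ∈ Finset.range m, u * (‖y k t‖ ^ 2 - ‖y (k + 1) t‖ ^ 2) =
        u * (‖y 0 t‖ ^ 2 - ‖y m t‖ ^ 2) := by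
      rw [← Finset.mul_sum, Finset.sum_range_sub' (fun k => ‖y k t‖ ^ 2)]
    have h1 : u * (‖y 0 t‖ ^ 2 - ‖y m t‖ ^ 2) + (u * (‖y m t‖ ^ 2 - ‖y 0 t‖ ^ 2) -
        2 * u * (‖y m t‖ * ‖y (m + 1) t - y 0 t‖)) ≤ N' t := by
      change _ ≤ ∑ k ∈ Finset.range (m + 1), _
      rw [Finset.sum_range_succ, ← htel]
      exact add_le_add (Finset.sum_le_sum fun k _ => hin _ _) (hlast _ _ _)
    have hsq : ∀ k ∈ Finset.range (m + 1), ‖y k t‖ ^ 2 ≤ N t := fun k hk =>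
      Finset.single_le_sum (f := fun k => ‖y k t‖ ^ 2) (fun _ _ => by positivity) hk
    have h2 : ‖y m t‖ * ∑ k ∈ Finset.range m, ‖y k t‖ ≤ m * N t := by
      rw [Finset.mul_sum]
      have h3 : ∀ k ∈ Finset.range m, ‖y m t‖ * ‖y k t‖ ≤ N t := fun k hk => by
        have h4 := hsq m (by simp)
        have h5 := hsq k (Finset.mem_range.2 (by rw [Finset.mem_range] at hk; omega))
        nlinarith [sq_nonneg (‖y m t‖ - ‖y k t‖)]
      refine (Finset.sum_le_sum h3).trans (le_of_eq ?_)
      simp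
    have h6 : ‖y m t‖ * ‖y (m + 1) t - y 0 t‖ ≤ (m + 1) * β t * N t := by
      have h7 := mul_le_mul_of_nonneg_left (hyn t ht) (norm_nonneg (y m t))
      rw [Nat.add_sub_cancel] at h7
      have h8 := mul_le_mul_of_nonneg_left h2 (hβ t ht).1
      nlinarith [mul_nonneg (hβ t ht).1 (hNn t)]
    have h9 := mul_le_mul_of_nonneg_left h6 hu.le
    push_cast
    linarith
  set c : ℝ := 2 * u * n with hc
  have hc0 : 0 ≤ c := by positivity
  have hder : ∀ s, 0 ≤ s → HasDerivAt (fun s => N s * Real.exp (c * B s))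
      ((N' s + c * β s * N s) * Real.exp (c * B s)) s := fun s hs => by
    refine ((hN' s hs).mul ((hB s hs).const_mul c).exp).congr_deriv ?_
    ring
  -- With the integrating factor exp(cB) the nonnegative sum of squares is increasing; as it tends
  -- to zero, it vanishes.
  have hmono : MonotoneOn (fun s => N s * Real.exp (c * B s)) (Set.Ici 0) := by
    refine monotoneOn_of_hasDerivWithinAt_nonneg (convex_Ici 0)
      (fun s hs => (hder s hs).continuousAt.continuousWithinAt)
      (fun s hs => (hder s (interior_subset hs)).hasDerivWithinAt) (fun s hs => ?_)
    refine mul_nonneg ?_ (Real.exp_pos _).le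
    have := hlow s (interior_subset hs)
    rw [hc]
    linarith
  have hlim : Tendsto (fun s => N s * Real.exp (c * B s)) atTop (𝓝 0) := by
    refine squeeze_zero_norm' (a := fun s => N s * Real.exp (c * b)) ?_
      (by simpa using hN0.mul_const _)
    filter_upwards [eventually_ge_atTop 0] with s hs
    rw [Real.norm_of_nonneg (mul_nonneg (hNn s) (Real.exp_pos _).le)]
    exact mul_le_mul_of_nonneg_left (Real.exp_le_exp.2 (mul_le_mul_of_nonneg_left (hBb s hs) hc0))
      (hNn s)
  have hle : N t * Real.exp (c * B t) ≤ 0 := ge_of_tendsto hlim (by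
    filter_upwards [eventually_ge_atTop t] with s hs
    exact hmono ht (ht.trans hs) hs)
  have hNt : N t ≤ 0 := by
    by_contra h
    exact absurd hle (not_le.2 (mul_pos (not_le.1 h) (Real.exp_pos _)))
  have h1 : ‖y 0 t‖ ^ 2 ≤ N t := Finset.single_le_sum (f := fun k => ‖y k t‖ ^ 2)
    (fun _ _ => by positivity) (Finset.mem_range.2 (by omega))
  have h2 : ‖y 0 t‖ = 0 := by nlinarith [norm_nonneg (y 0 t)]
  exact norm_eq_zero.1 h2

end Uniqueness

end FactorialSeries
end

open Filter Topology Asymptotics MeasureTheory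
noncomputable section
namespace FactorialSeries

/-! ### Uniqueness of the solution along a ray -/

section RayUniqueness

lemma tendsto_iteratedDeriv_mul {ι : Type*} {l : Filter ι} {γ : ι → ℂ} {f h : ℂ → ℂ} {k : ℕ}
    (hf : ∀ᶠ i in l, AnalyticAt ℂ f (γ i)) (hh : ∀ᶠ i in l, AnalyticAt ℂ h (γ i))
    (hfb : ∀ r ≤ k, IsBoundedUnder (· ≤ ·) l (norm ∘ fun i => iteratedDeriv r f (γ i)))
    (hh0 : ∀ r ≤ k, Tendsto (fun i => iteratedDeriv r h (γ i)) l (𝓝 0)) :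
    Tendsto (fun i => iteratedDeriv k (fun w => f w * h w) (γ i)) l (𝓝 0) := by
  have h1 : Tendsto (fun i => ∑ r ∈ Finset.range (k + 1), (k.choose r : ℂ) *
      (iteratedDeriv r f (γ i) * iteratedDeriv (k - r) h (γ i))) l (𝓝 0) := by
    have := tendsto_finsetSum (Finset.range (k + 1)) fun r hr =>
      (Filter.isBoundedUnder_le_mul_tendsto_zero (hfb r (by rw [Finset.mem_range] at hr; omega))
        (hh0 (k - r) (by omega))).const_mul (k.choose r : ℂ)
    simpa using this
  refine h1.congr' ?_
  filter_upwards [hf, hh] with i hfi hhi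
  have := iteratedDeriv_mul (n := k) hfi.contDiffAt hhi.contDiffAt
  change _ = iteratedDeriv k (f * h) (γ i)
  rw [this]
  exact Finset.sum_congr rfl fun r _ => by ring

namespace Frame.Valid

variable {P : Frame} {σ c : ℝ} {Ψ : ℕ → ℂ × ℂ → ℂ} {u : ℝ} {z : ℂ} (hP : P.Valid)
include hP

lemma norm_lap_potential_le (hΨ : ∀ k < P.n - 1, P.Potential c σ (Ψ k)) {k : ℕ} (hk : k < P.n - 1)
    (hu : σ < u) {w : ℂ} (hw : w ∈ P.base) :
    ‖lap (fun t => Ψ k (t, w)) u‖ ≤ c / (u - σ) * wb P.ρ (P.prog w) := by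
  have hbox : ∀ t : ℝ, 0 ≤ t → ((t : ℂ), w) ∈ P.box := fun t ht => by
    refine ⟨?_, hw⟩
    have h0 : Metric.infDist w P.Q < P.d := hw
    have h1 : 0 ≤ Metric.infDist w P.Q := Metric.infDist_nonneg
    simpa [width_ofReal ht] using mul_pos hP.a_pos (lt_of_le_of_lt h1 h0)
  have h1 : LapBound (c * wb P.ρ (P.prog w)) σ (fun t => Ψ k (t, w)) := by
    refine ⟨fun t ht => ?_, fun t ht => ?_⟩
    · exact (ContinuousAt.comp (g := Ψ k) (f := fun t : ℝ => ((t, w) : ℂ × ℂ))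
        ((hΨ k hk).analytic _ (hbox t ht)).continuousAt (by fun_prop)).continuousWithinAt
    · have := (hΨ k hk).le _ (hbox t ht)
      rwa [rePos_ofReal ht, ← mul_assoc] at this
  refine (h1.norm_lap_le (u := u) (by simpa using hu)).trans (le_of_eq ?_)
  rw [Complex.ofReal_re]
  ring

/-- A solution that decays relative to `exp (ζ u z)` along the ray vanishes. -/
lemma eq_zero_of_decay (hc : 0 ≤ c) (hΨ : ∀ k < P.n - 1, P.Potential c σ (Ψ k)) (hσ : 0 ≤ σ)
    (hu : σ < u) (hz : z ∈ P.base) {g : ℂ → ℂ}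
    (hg : ∀ t : ℝ, 0 ≤ t → AnalyticAt ℂ g (z - t / P.ζ))
    (hode : ∀ t : ℝ, 0 ≤ t →
      -iteratedDeriv P.n (fun w => Complex.exp (P.ζ * u * w) * g w) (z - t / P.ζ) +
      ∑ k ∈ Finset.range (P.n - 1), (u : ℂ) ^ (P.n - k) *
        ((if k = 0 then 1 else 0) + lap (fun s => Ψ k (s, z - t / P.ζ)) u) *
        iteratedDeriv k (fun w => Complex.exp (P.ζ * u * w) * g w) (z - t / P.ζ) = 0)
    (hlim : ∀ s ≤ P.n - 2, Tendsto (fun t : ℝ => iteratedDeriv s g (z - t / P.ζ)) atTop (𝓝 0)) :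
    g z = 0 := by
  have hn := hP.two_le
  have hu0 : 0 < u := lt_of_le_of_lt hσ hu
  have huC : (u : ℂ) ≠ 0 := by exact_mod_cast hu0.ne'
  have hζ := hP.ζ_ne
  set α : ℂ := P.ζ * u with hα
  have hα0 : α ≠ 0 := mul_ne_zero hζ huC
  set f : ℂ → ℂ := fun w => Complex.exp (α * w) * g w with hf
  have hfa : ∀ t : ℝ, 0 ≤ t → AnalyticAt ℂ f (z - t / P.ζ) := fun t ht =>
    (analyticAt_const.mul analyticAt_id).cexp.mul (hg t ht)
  -- In the normalisation α = ζu, differentiation along t ↦ z - t/ζ gives y_k' = u(y_k - y_{k+1});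
  -- the equation of order n says that y_n differs from y_0 only by terms with the potentials.
  set y : ℕ → ℝ → ℂ := fun k t => (α ^ k)⁻¹ * (Complex.exp (-α * (z - t / P.ζ)) *
    iteratedDeriv k f (z - t / P.ζ)) with hy
  have hγ : ∀ t : ℝ, HasDerivAt (fun t : ℂ => z - t / P.ζ) (-(1 / P.ζ)) (t : ℂ) := fun t =>
    ((hasDerivAt_id (t : ℂ)).div_const _).const_sub z
  have hyd : ∀ k < P.n, ∀ t, 0 ≤ t → HasDerivAt (y k) (u * (y k t - y (k + 1) t)) t := by
    intro k _ t ht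
    have h1 := (analyticAt_iteratedDeriv (hfa t ht) k).differentiableAt.hasDerivAt
    rw [← iteratedDeriv_succ] at h1
    have h2 := (((hγ t).const_mul (-α)).cexp.mul (h1.comp (t : ℂ) (hγ t))).const_mul (α ^ k)⁻¹
    refine h2.comp_ofReal.congr_deriv ?_
    simp only [hy, Function.comp_apply]
    rw [pow_succ, hα]
    field_simp
    ring
  have hy0 : ∀ k ≤ P.n - 2, Tendsto (y k) atTop (𝓝 0) := by
    intro k hk
    have h1 : Tendsto (fun t : ℝ => (α ^ k)⁻¹ * ∑ r ∈ Finset.range (k + 1), (k.choose r : ℂ) *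
        α ^ r * iteratedDeriv (k - r) g (z - t / P.ζ)) atTop (𝓝 0) := by
      have := (tendsto_finsetSum (Finset.range (k + 1)) fun r _ =>
        (hlim (k - r) (by omega)).const_mul ((k.choose r : ℂ) * α ^ r)).const_mul (α ^ k)⁻¹
      simpa using this
    refine h1.congr' ?_
    filter_upwards [eventually_ge_atTop 0] with t ht
    have h2 := iteratedDeriv_mul (n := k) (f := fun w => Complex.exp (α * w)) (x := z - t / P.ζ)
      ((analyticAt_const.mul analyticAt_id).cexp : AnalyticAt ℂ (fun w => Complex.exp (α * w))
        (z - t / P.ζ)).contDiffAt (hg t ht).contDiffAt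
    change _ = (α ^ k)⁻¹ * (_ * iteratedDeriv k ((fun w => Complex.exp (α * w)) * g) _)
    rw [h2, Finset.mul_sum (Finset.range (k + 1)) _ (Complex.exp (-α * (z - t / P.ζ)))]
    congr 1
    refine Finset.sum_congr rfl fun r _ => ?_
    rw [iteratedDeriv_cexp_const_mul]
    have h3 : Complex.exp (-α * (z - t / P.ζ)) * Complex.exp (α * (z - t / P.ζ)) = 1 := by
      rw [← Complex.exp_add]
      simp
    linear_combination (-(k.choose r : ℂ) * α ^ r * iteratedDeriv (k - r) g (z - t / P.ζ)) * h3
  set C := c / (u - σ) with hC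
  have hC0 : 0 ≤ C := div_nonneg hc (by linarith)
  have hyn : ∀ t, 0 ≤ t → ‖y P.n t - y 0 t‖ ≤ C * wb P.ρ (P.prog z - t) *
      ∑ k ∈ Finset.range (P.n - 1), ‖y k t‖ := by
    intro t ht
    have hw := hP.ray_mem_base hz ht
    have h1 : y P.n t - y 0 t = ∑ k ∈ Finset.range (P.n - 1),
        P.ζ ^ k * lap (fun s => Ψ k (s, z - t / P.ζ)) u * y k t := by
      have hkey : ∀ k ∈ Finset.range (P.n - 1), (α ^ P.n)⁻¹ * Complex.exp (-α * (z - t / P.ζ)) *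
          ((u : ℂ) ^ (P.n - k) * ((if k = 0 then 1 else 0) +
            lap (fun s => Ψ k (s, z - t / P.ζ)) u) * iteratedDeriv k f (z - t / P.ζ)) =
          (if k = 0 then y k t else 0) +
            P.ζ ^ k * lap (fun s => Ψ k (s, z - t / P.ζ)) u * y k t := by
        intro k hk
        rw [Finset.mem_range] at hk
        have e1 : α ^ P.n = (u : ℂ) ^ (P.n - k) * u ^ k := by
          rw [hα, mul_pow, hP.root, one_mul, ← pow_add]
          congr 1
          omega
        simp only [hy, e1]
        have e2 : (α ^ k)⁻¹ = ((u : ℂ) ^ k)⁻¹ * (P.ζ ^ k)⁻¹ := by rw [hα, mul_pow, mul_inv, mul_comm]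
        rw [e2]
        split_ifs with h
        · subst h
          simp only [pow_zero, Nat.sub_zero]
          field_simp
        · field_simp
          ring
      have h2 := congrArg (fun w => (α ^ P.n)⁻¹ * Complex.exp (-α * (z - t / P.ζ)) * w) (hode t ht)
      simp only [mul_zero, mul_add] at h2
      rw [Finset.mul_sum] at h2
      simp only [← mul_add] at h2
      rw [Finset.sum_congr rfl hkey, Finset.sum_add_distrib, Finset.sum_ite_eq',
        if_pos (Finset.mem_range.2 (by omega))] at h2
      have h3 : y P.n t = (α ^ P.n)⁻¹ * Complex.exp (-α * (z - t / P.ζ)) *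
        iteratedDeriv P.n f (z - t / P.ζ) := by
        simp only [hy]
        ring
      rw [h3]
      linear_combination -h2
    rw [h1, Finset.mul_sum]
    refine (norm_sum_le _ _).trans (Finset.sum_le_sum fun k hk => ?_)
    rw [norm_mul, norm_mul, norm_pow, hP.norm_ζ, one_pow, one_mul, ← hP.prog_ray]
    exact mul_le_mul_of_nonneg_right
      (hP.norm_lap_potential_le hΨ (Finset.mem_range.1 hk) hu hw) (norm_nonneg _)
  -- `prog` falls at unit rate along the ray, so -C `wE` along it is a primitive of β. It is
  -- nonpositive, hence bounded above by C.
  have h := eq_zero_of_cyclic (y := y) hn hu0 hyd (β := fun t => C * wb P.ρ (P.prog z - t))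
    (B := fun t => C * -wE P.ρ (P.prog z - t)) (b := C)
    (fun t _ => ⟨mul_nonneg hC0 (wb_pos _).le, mul_le_of_le_one_right hC0 (wb_le_one hP.ρ_pos _)⟩)
    (fun t _ => by
      have h1 := (hasDerivAt_wE hP.ρ_pos (P.prog z - t)).comp t
        ((hasDerivAt_id t).const_sub (P.prog z))
      refine (h1.neg.const_mul C).congr_deriv ?_
      ring)
    (fun t _ => (mul_nonpos_of_nonneg_of_nonpos hC0
      (neg_nonpos.2 (wE_nonneg _))).trans hC0) hyn hy0 le_rfl
  simpa [hy, hf] using h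

/-- Two solutions of the form `exp (ζ u z + X) (1 + h)` with `h` decaying along the ray coincide. -/
lemma eq_of_decay (hc : 0 ≤ c) (hΨ : ∀ k < P.n - 1, P.Potential c σ (Ψ k)) (hσ : 0 ≤ σ)
    (hu : σ < u) (hz : z ∈ P.base) {h : Bool → ℂ → ℂ}
    (hh : ∀ b, ∀ t : ℝ, 0 ≤ t → AnalyticAt ℂ (h b) (z - t / P.ζ))
    (hode : ∀ b, ∀ t : ℝ, 0 ≤ t →
      -iteratedDeriv P.n (fun w => Complex.exp (P.ζ * u * w + P.expo Ψ w) * (1 + h b w))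
        (z - t / P.ζ) + ∑ k ∈ Finset.range (P.n - 1), (u : ℂ) ^ (P.n - k) *
        ((if k = 0 then 1 else 0) + lap (fun s => Ψ k (s, z - t / P.ζ)) u) *
        iteratedDeriv k (fun w => Complex.exp (P.ζ * u * w + P.expo Ψ w) * (1 + h b w))
          (z - t / P.ζ) = 0)
    (hlim : ∀ b, ∀ s ≤ P.n - 2,
      Tendsto (fun t : ℝ => iteratedDeriv s (h b) (z - t / P.ζ)) atTop (𝓝 0)) :
    h true z = h false z := by
  obtain ⟨hE, -⟩ := hP.lbdd_exp_expo hc hΨ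
  set E : ℂ → ℂ := fun w => Complex.exp (P.expo Ψ w) with hEdef
  have hEa : ∀ t : ℝ, 0 ≤ t → AnalyticAt ℂ E (z - t / P.ζ) := fun t ht =>
    hE.analytic _ (hP.ray_mem_base hz ht)
  set δ : ℂ → ℂ := fun w => h true w - h false w with hδ
  have hδa : ∀ t : ℝ, 0 ≤ t → AnalyticAt ℂ δ (z - t / P.ζ) := fun t ht =>
    (hh true t ht).sub (hh false t ht)
  have hδ0 : ∀ s ≤ P.n - 2, Tendsto (fun t : ℝ => iteratedDeriv s δ (z - t / P.ζ)) atTop (𝓝 0) := by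
    intro s hs
    have h1 := (hlim true s hs).sub (hlim false s hs)
    rw [sub_zero] at h1
    refine h1.congr' ?_
    filter_upwards [eventually_ge_atTop 0] with t ht
    exact (iteratedDeriv_sub (hh true t ht).contDiffAt (hh false t ht).contDiffAt).symm
  have h0 := hP.eq_zero_of_decay hc hΨ hσ hu hz (g := fun w => E w * δ w)
    (fun t ht => (hEa t ht).mul (hδa t ht)) (fun t ht => ?_) (fun s hs => ?_)
  · have : δ z = 0 := (mul_eq_zero.1 h0).resolve_left (Complex.exp_ne_zero _)
    exact sub_eq_zero.1 this
  · have e : (fun w => Complex.exp (P.ζ * u * w) * (E w * δ w)) =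
        (fun w => Complex.exp (P.ζ * u * w + P.expo Ψ w) * (1 + h true w)) -
        fun w => Complex.exp (P.ζ * u * w + P.expo Ψ w) * (1 + h false w) := by
      funext w
      simp only [Pi.sub_apply, hδ, hEdef, Complex.exp_add]
      ring
    have hWa : ∀ b, AnalyticAt ℂ (fun w => Complex.exp (P.ζ * u * w + P.expo Ψ w) * (1 + h b w))
        (z - t / P.ζ) := fun b => by
      simp only [Complex.exp_add]
      exact ((analyticAt_const.mul analyticAt_id).cexp.mul (hEa t ht)).mul
        (analyticAt_const.add (hh b t ht))
    have hsub : ∀ k, iteratedDeriv k (fun w => Complex.exp (P.ζ * u * w) * (E w * δ w))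
        (z - t / P.ζ) =
        iteratedDeriv k (fun w => Complex.exp (P.ζ * u * w + P.expo Ψ w) * (1 + h true w))
          (z - t / P.ζ) -
        iteratedDeriv k (fun w => Complex.exp (P.ζ * u * w + P.expo Ψ w) * (1 + h false w))
          (z - t / P.ζ) := fun k => by
      rw [e, iteratedDeriv_sub (hWa true).contDiffAt (hWa false).contDiffAt]
    simp only [hsub, mul_sub, Finset.sum_sub_distrib]
    linear_combination hode true t ht - hode false t ht
  · refine tendsto_iteratedDeriv_mul ?_ ?_ (fun r _ => ?_) fun r hr => hδ0 r (hr.trans hs)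
    · filter_upwards [eventually_ge_atTop 0] with t ht using hEa t ht
    · filter_upwards [eventually_ge_atTop 0] with t ht using hδa t ht
    · have hzb : Metric.infDist z P.Q < P.d := hz
      obtain ⟨A, -, hA⟩ := (hE.iteratedDeriv r).2 ((Metric.infDist z P.Q + P.d) / 2) (by linarith)
      refine ⟨A, ?_⟩
      rw [eventually_map]
      filter_upwards [eventually_ge_atTop 0] with t ht
      refine hA _ (lt_of_le_of_lt (b := Metric.infDist z P.Q) ?_ (by linarith))
      have := infDist_add_le_of_translate hP.nonempty (v := -(t / P.ζ))
        (fun w hw => by simpa [sub_eq_add_neg] using hP.ray_mem w hw t ht) z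
      rwa [← sub_eq_add_neg] at this

end Frame.Valid

end RayUniqueness

end FactorialSeries
end

open Filter Topology Asymptotics MeasureTheory
noncomputable section
namespace FactorialSeries

/-! ### Distances and directions between roots of unity -/

section RootsOfUnity

variable {n : ℕ} {ζ μ : ℂ}

/-- The primitive `n`-th root of unity `e^{2πi/n}`. -/
def omega (n : ℕ) : ℂ := Complex.exp (2 * Real.pi * Complex.I / n)

/-- The square root `e^{πi/n}` of `omega n`. -/
def halfOmega (n : ℕ) : ℂ := Complex.exp ((Real.pi / n : ℝ) * Complex.I)

lemma halfOmega_ne_zero : halfOmega n ≠ 0 := Complex.exp_ne_zero _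

lemma omega_eq : omega n = halfOmega n ^ 2 := by
  rw [omega, halfOmega, ← Complex.exp_nat_mul]
  push_cast
  ring_nf

lemma halfOmega_pow_sub (m : ℕ) : halfOmega n ^ m - (halfOmega n ^ m)⁻¹ =
    2 * Complex.I * (Real.sin (m * (Real.pi / n)) : ℝ) := by
  rw [halfOmega, ← Complex.exp_nat_mul, ← Complex.exp_neg, Complex.ofReal_sin, Complex.sin]
  push_cast
  have h : ∀ w : ℂ, -(w * Complex.I) * Complex.I = w := fun w => by
    linear_combination -w * Complex.I_mul_I
  have e1 : (m : ℂ) * (↑Real.pi / ↑n * Complex.I) = (m * (Real.pi / n)) * Complex.I := by ring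
  rw [e1, ← neg_mul]
  linear_combination (-(Complex.exp (-(m * (Real.pi / n)) * Complex.I) -
    Complex.exp ((m * (Real.pi / n)) * Complex.I))) * Complex.I_mul_I

lemma omega_pow_sub_one (m : ℕ) : omega n ^ m - 1 =
    halfOmega n ^ m * (2 * Complex.I * (Real.sin (m * (Real.pi / n)) : ℝ)) := by
  rw [← halfOmega_pow_sub, omega_eq, mul_sub, mul_inv_cancel₀ (pow_ne_zero _ halfOmega_ne_zero)]
  ring

lemma norm_halfOmega : ‖halfOmega n‖ = 1 := Complex.norm_exp_ofReal_mul_I _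

lemma sin_pi_div_pos (hn : 2 ≤ n) : 0 < Real.sin (Real.pi / n) := by
  have h2 : (2 : ℝ) ≤ n := by exact_mod_cast hn
  refine Real.sin_pos_of_pos_of_lt_pi (by positivity) ?_
  rw [div_lt_iff₀ (by linarith)]
  nlinarith [Real.pi_pos]

lemma sin_pi_div_le {m : ℕ} (hm : 0 < m) (hmn : m < n) :
    Real.sin (Real.pi / n) ≤ Real.sin (m * (Real.pi / n)) := by
  have hn0 : (0 : ℝ) < n := by exact_mod_cast (by omega : 0 < n)
  have hm1 : (1 : ℝ) ≤ m := by exact_mod_cast hm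
  have hm2 : (m : ℝ) + 1 ≤ n := by exact_mod_cast hmn
  have hp : 0 < Real.pi / n := by positivity
  have hnp : n * (Real.pi / n) = Real.pi := by field_simp
  rcases le_total (m * (Real.pi / n)) (Real.pi / 2) with h | h
  · exact Real.sin_le_sin_of_le_of_le_pi_div_two (by linarith [Real.pi_pos]) h (by nlinarith)
  · rw [← Real.sin_pi_sub (m * (Real.pi / n))]
    exact Real.sin_le_sin_of_le_of_le_pi_div_two (by linarith [Real.pi_pos]) (by linarith)
      (by nlinarith)

lemma norm_omega_sub_one (hn : 2 ≤ n) : ‖omega n - 1‖ = 2 * Real.sin (Real.pi / n) := by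
  have h := omega_pow_sub_one (n := n) 1
  rw [pow_one, pow_one, Nat.cast_one, one_mul] at h
  rw [h, norm_mul, norm_halfOmega, norm_mul, norm_mul, Complex.norm_I, Complex.norm_real,
    Real.norm_of_nonneg (sin_pi_div_pos hn).le]
  simp

lemma omega_pow_self (hn : 2 ≤ n) : omega n ^ n = 1 :=
  (Complex.isPrimitiveRoot_exp n (by omega)).pow_eq_one

lemma omega_ne_zero : omega n ≠ 0 := Complex.exp_ne_zero _

lemma omega_ne_one (hn : 2 ≤ n) : omega n ≠ 1 := fun h => by
  have := norm_omega_sub_one hn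
  rw [h, sub_self, norm_zero] at this
  linarith [sin_pi_div_pos hn]

lemma norm_omega : ‖omega n‖ = 1 := by
  rw [omega_eq, norm_pow, norm_halfOmega, one_pow]

lemma norm_of_pow_eq_one (hn : 2 ≤ n) (h : ζ ^ n = 1) : ‖ζ‖ = 1 :=
  Complex.norm_eq_one_of_pow_eq_one h (by omega)

lemma ne_zero_of_pow_eq_one (hn : 2 ≤ n) (h : ζ ^ n = 1) : ζ ≠ 0 :=
  norm_pos_iff.1 (by rw [norm_of_pow_eq_one hn h]; exact one_pos)

/-- All chords between n-th roots of unity have length 2 sin(mπ/n) with 0 < m < n, and m = 1 gives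
the least value. -/
lemma norm_omega_sub_one_le (hn : 2 ≤ n) (hζ : ζ ^ n = 1) (hμ : μ ^ n = 1) (hne : μ ≠ ζ) :
    ‖omega n - 1‖ ≤ ‖μ - ζ‖ := by
  have hζ0 := ne_zero_of_pow_eq_one hn hζ
  have : NeZero n := ⟨by omega⟩
  obtain ⟨m, hm, hmμ⟩ := (Complex.isPrimitiveRoot_exp n (by omega)).eq_pow_of_pow_eq_one
    (ξ := μ / ζ) (by rw [div_pow, hμ, hζ, div_one])
  change omega n ^ m = μ / ζ at hmμ
  have hm0 : 0 < m := Nat.pos_of_ne_zero fun h => hne (by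
    rw [h, pow_zero] at hmμ
    exact ((div_eq_one_iff_eq hζ0).1 hmμ.symm))
  have h1 : μ - ζ = ζ * (omega n ^ m - 1) := by rw [hmμ]; field_simp
  have h2 := sin_pi_div_le hm0 hm
  rw [norm_omega_sub_one hn, h1, norm_mul, norm_of_pow_eq_one hn hζ, one_mul, omega_pow_sub_one,
    norm_mul, norm_pow, norm_halfOmega, one_pow, one_mul, norm_mul, norm_mul, Complex.norm_I,
    Complex.norm_real, Real.norm_of_nonneg ((sin_pi_div_pos hn).le.trans h2)]
  simpa using h2

/-- The binomial expansion up to second order turns the equation for a into a(n-1) ≤ 2, hence an ≤ 4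
as n ≥ 2. Jordan's inequality gives 2 sin(π/n) ≥ 4/n for the shortest chord. -/
lemma le_norm_omega_sub_one (hn : 2 ≤ n) {a : ℝ} (ha : 0 < a)
    (ha_eq : (1 + a) ^ n = 1 + 2 * n * a) : a ≤ ‖omega n - 1‖ := by
  have h2 : (2 : ℝ) ≤ n := by exact_mod_cast hn
  have hlow : ∀ k : ℕ, 1 + k * a + k * (k - 1) / 2 * a ^ 2 ≤ (1 + a) ^ k := by
    intro k
    induction k with
    | zero => simp
    | succ k ih =>
      rw [pow_succ (1 + a)]
      have h3 := mul_le_mul_of_nonneg_right ih (by linarith : 0 ≤ 1 + a)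
      have h4 : 0 ≤ (k : ℝ) * (k - 1) / 2 * a ^ 3 := by
        rcases Nat.eq_zero_or_pos k with rfl | hk
        · simp
        · have : (1 : ℝ) ≤ k := by exact_mod_cast hk
          have h5 : 0 ≤ (k : ℝ) - 1 := by linarith
          positivity
      push_cast
      nlinarith
  have h3 := hlow n
  rw [ha_eq] at h3
  have h4 : a * (n - 1) ≤ 2 := by
    by_contra hcon
    have h5 : 0 < (n : ℝ) * a * (a * (n - 1) - 2) := by
      have : 0 < a * (n - 1) - 2 := by linarith
      positivity
    nlinarith
  have h5 : a * n ≤ 4 := by nlinarith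
  rw [norm_omega_sub_one hn]
  have h6 : 2 / Real.pi * (Real.pi / n) ≤ Real.sin (Real.pi / n) :=
    Real.mul_le_sin (by positivity)
      (div_le_div_of_nonneg_left Real.pi_pos.le (by norm_num) h2)
  have h7 : 2 / Real.pi * (Real.pi / n) = 2 / n := by
    have := Real.pi_pos.ne'
    field_simp
  have h8 : a ≤ 2 * (2 / n) := by
    rw [← mul_div_assoc, le_div_iff₀ (by linarith)]
    linarith
  linarith

/-- The ray direction -1/ζ is the sum of the two extreme characteristic directions. This makes the
cone Q stable along rays and identifies the middle angle θ_j. -/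
lemma inv_omega_add (hn : 2 ≤ n) (hζ : ζ ≠ 0) :
    1 / (ζ * omega n - ζ) + 1 / (ζ * (omega n)⁻¹ - ζ) = -1 / ζ := by
  have h1 := omega_ne_zero (n := n)
  have h2 : omega n - 1 ≠ 0 := sub_ne_zero.2 (omega_ne_one hn)
  have h3 : 1 - omega n ≠ 0 := sub_ne_zero.2 (omega_ne_one hn).symm
  have e1 : ζ * omega n - ζ = ζ * (omega n - 1) := by ring
  have e2 : ζ * (omega n)⁻¹ - ζ = -(ζ * (omega n - 1)) / omega n := by field_simp; ring
  rw [e1, e2]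
  field_simp
  ring

/-- The reciprocals of the differences of roots of unity lie in the cone spanned by those of
neighbouring roots. -/
lemma exists_cone_eq (hn : 2 ≤ n) (hζ : ζ ^ n = 1) (hμ : μ ^ n = 1) (hne : μ ≠ ζ) :
    ∃ p q : ℝ, 0 ≤ p ∧ 0 ≤ q ∧
      1 / (μ - ζ) = p * (1 / (ζ * omega n - ζ)) + q * (1 / (ζ * (omega n)⁻¹ - ζ)) := by
  have hζ0 := ne_zero_of_pow_eq_one hn hζ
  have hω0 := omega_ne_zero (n := n)
  have h2 : omega n - 1 ≠ 0 := sub_ne_zero.2 (omega_ne_one hn)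
  have hne' : ζ * omega n ≠ ζ := fun h => h2 (by
    have : ζ * (omega n - 1) = 0 := by linear_combination h
    exact (mul_eq_zero.1 this).resolve_left hζ0)
  have hsub : μ - ζ ≠ 0 := sub_ne_zero.2 hne
  set x := ζ / (μ - ζ) with hx
  set w := ζ / (ζ * omega n - ζ) with hw
  have hxre : x.re = -1 / 2 := re_div_sub (norm_of_pow_eq_one hn hζ) (norm_of_pow_eq_one hn hμ) hne
  have hwre : w.re = -1 / 2 := re_div_sub (norm_of_pow_eq_one hn hζ)
    (by rw [norm_mul, norm_of_pow_eq_one hn hζ, norm_omega, one_mul]) hne'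
  have hle : ‖x‖ ≤ ‖w‖ := by
    have e : ζ * omega n - ζ = ζ * (omega n - 1) := by ring
    rw [hx, hw, norm_div, norm_div, norm_of_pow_eq_one hn hζ, e, norm_mul,
      norm_of_pow_eq_one hn hζ, one_mul]
    exact one_div_le_one_div_of_le (norm_pos_iff.2 h2) (norm_omega_sub_one_le hn hζ hμ hne)
  -- Both numbers lie on the line Re = -1/2, where ordering by modulus is ordering by |Im|. So x
  -- lies on the segment between w and its conjugate -1 - w.
  have him : |x.im| ≤ |w.im| := by
    rw [← sq_le_sq]
    have := (sq_le_sq₀ (norm_nonneg _) (norm_nonneg _)).2 hle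
    rw [Complex.sq_norm, Complex.sq_norm, Complex.normSq_apply, Complex.normSq_apply, hxre,
      hwre] at this
    nlinarith
  have hmain : ∀ p q : ℝ, p + q = 1 → (p - q) * w.im = x.im →
      1 / (μ - ζ) = p * (1 / (ζ * omega n - ζ)) + q * (1 / (ζ * (omega n)⁻¹ - ζ)) := by
    intro p q hpq hi
    have h3 : x = p * w + q * (-1 - w) := by
      apply Complex.ext
      · simp [hxre, hwre]
        linear_combination (1 / 2 : ℝ) * hpq
      · simp
        linear_combination -hi
    have h4 : 1 / (ζ * (omega n)⁻¹ - ζ) = (-1 - w) / ζ := by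
      rw [eq_sub_of_add_eq' (inv_omega_add hn hζ0), sub_div, hw, div_div_cancel_left' hζ0, one_div]
    have h5 : 1 / (ζ * omega n - ζ) = w / ζ := by rw [hw, div_div_cancel_left' hζ0, one_div]
    have h6 : 1 / (μ - ζ) = x / ζ := by rw [hx, div_div_cancel_left' hζ0, one_div]
    rw [h4, h5, h6, h3]
    ring
  -- The segment degenerates to a point when the two extreme directions coincide, as for n = 2.
  rcases eq_or_ne w.im 0 with h | h
  · refine ⟨1, 0, zero_le_one, le_rfl, hmain 1 0 (by ring) ?_⟩
    rw [h, abs_zero] at him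
    rw [h, mul_zero, abs_nonpos_iff.1 him]
  · have h3 : |x.im / w.im| ≤ 1 := by
      rw [abs_div]
      exact div_le_one_of_le₀ him (abs_nonneg _)
    rw [abs_le] at h3
    exact ⟨(1 + x.im / w.im) / 2, (1 - x.im / w.im) / 2, by linarith, by linarith,
      hmain _ _ (by ring) (by field_simp; ring)⟩

end RootsOfUnity

/-! ### The angles θ_{j,ℓ} and their mean -/

section Angles

variable {n : ℕ}

lemma zeta_eq_pow (j q : ℕ) : zeta n j q = zeta n j 1 ^ q := by
  rw [zeta, zeta, ← Complex.exp_nat_mul]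
  push_cast
  ring_nf

lemma zeta_eq_omega_pow (j : ℕ) : zeta n j 1 = omega n ^ j := by
  rw [zeta, omega, ← Complex.exp_nat_mul]
  push_cast
  ring_nf

lemma zeta_pow_self (hn : 2 ≤ n) (j : ℕ) : zeta n j 1 ^ n = 1 := by
  rw [zeta_eq_omega_pow, ← pow_mul, mul_comm, pow_mul, omega_pow_self hn, one_pow]

/-- The direction `e^{iθ}` for a value `θ` of `-arg w`. -/
lemma exp_neg_arg (w : ℂ) (hw : w ≠ 0) {t : ℝ} {q : ℤ} (h : t = -Complex.arg w + 2 * Real.pi * q) :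
    Complex.exp (t * Complex.I) = ‖w‖ / w := by
  have h1 := Complex.norm_mul_exp_arg_mul_I w
  have h2 : Complex.exp (t * Complex.I) = (Complex.exp (Complex.arg w * Complex.I))⁻¹ := by
    rw [h, ← Complex.exp_neg, Complex.exp_eq_exp_iff_exists_int]
    refine ⟨q, ?_⟩
    push_cast
    ring
  have h3 := Complex.exp_ne_zero (Complex.arg w * Complex.I)
  rw [h2]
  nth_rewrite 3 [← h1]
  have h4 : (‖w‖ : ℂ) ≠ 0 := by exact_mod_cast (norm_pos_iff.2 hw).ne'
  field_simp

lemma exists_neighbours (hn : 2 ≤ n) (j : Fin n) :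
    ∃ k l : Fin n, k ≠ j ∧ l ≠ j ∧ zeta n k 1 = zeta n j 1 * omega n ∧
      zeta n l 1 = zeta n j 1 * (omega n)⁻¹ := by
  have hω := omega_pow_self hn
  have hω0 := omega_ne_zero (n := n)
  have hmod : ∀ i : ℕ, omega n ^ (i % n) = omega n ^ i := fun i => by
    conv_rhs => rw [← Nat.mod_add_div i n, pow_add, pow_mul, hω, one_pow, mul_one]
  have hζ0 : zeta n j 1 ≠ 0 := ne_zero_of_pow_eq_one hn (zeta_pow_self hn j)
  refine ⟨⟨(j + 1) % n, Nat.mod_lt _ (by omega)⟩, ⟨(j + (n - 1)) % n, Nat.mod_lt _ (by omega)⟩, ?_⟩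
  have h1 : zeta n ((j + 1) % n : ℕ) 1 = zeta n j 1 * omega n := by
    rw [zeta_eq_omega_pow, zeta_eq_omega_pow, hmod, pow_succ]
  have h2 : zeta n ((j + (n - 1)) % n : ℕ) 1 = zeta n j 1 * (omega n)⁻¹ := by
    rw [zeta_eq_omega_pow, zeta_eq_omega_pow, hmod, pow_add]
    congr 1
    refine eq_inv_of_mul_eq_one_left ?_
    rw [← pow_succ, show n - 1 + 1 = n by omega, hω]
  refine ⟨fun h => ?_, fun h => ?_, h1, h2⟩
  · have h3 := congrArg (fun i : Fin n => zeta n i 1) h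
    simp only at h3
    rw [h1] at h3
    exact omega_ne_one hn (mul_left_cancel₀ hζ0 (h3.trans (mul_one _).symm))
  · have h3 := congrArg (fun i : Fin n => zeta n i 1) h
    simp only at h3
    rw [h2] at h3
    exact omega_ne_one hn (inv_eq_one.1 (mul_left_cancel₀ hζ0 (h3.trans (mul_one _).symm)))

/-- The two extreme directions, and the direction halfway between them. -/
lemma exists_extreme_angles (hn : 2 ≤ n) {j : Fin n} {θ : Fin n → ℝ} (hθ : IsAngleChoice n j θ) :
    ∃ k l : Fin n, k ≠ j ∧ l ≠ j ∧
      Complex.exp (θ k * Complex.I) =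
        ‖omega n - 1‖ * (1 / (zeta n j 1 * omega n - zeta n j 1)) ∧
      Complex.exp (θ l * Complex.I) =
        ‖omega n - 1‖ * (1 / (zeta n j 1 * (omega n)⁻¹ - zeta n j 1)) ∧
      Complex.exp (midAngle j θ * Complex.I) = -1 / zeta n j 1 := by
  obtain ⟨k, l, hk, hl, hk1, hl1⟩ := exists_neighbours hn j
  set ζ := zeta n j 1 with hζ
  have hζn : ζ ^ n = 1 := zeta_pow_self hn j
  have hζ0 := ne_zero_of_pow_eq_one hn hζn
  have hω0 := omega_ne_zero (n := n)
  have hω1 : omega n - 1 ≠ 0 := sub_ne_zero.2 (omega_ne_one hn)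
  have hn2 : (2 : ℝ) ≤ n := by exact_mod_cast hn
  have hw1 : ζ * omega n - ζ = ζ * (omega n - 1) := by ring
  have hw2 : ζ * (omega n)⁻¹ - ζ = -(ζ * (omega n - 1)) / omega n := by field_simp; ring
  have hnk : ‖ζ * omega n - ζ‖ = ‖omega n - 1‖ := by
    rw [hw1, norm_mul, norm_of_pow_eq_one hn hζn, one_mul]
  have hnl : ‖ζ * (omega n)⁻¹ - ζ‖ = ‖omega n - 1‖ := by
    rw [hw2, norm_div, norm_neg, norm_mul, norm_of_pow_eq_one hn hζn, one_mul, norm_omega, div_one]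
  have hk0 : ζ * omega n - ζ ≠ 0 := by rw [hw1]; exact mul_ne_zero hζ0 hω1
  have hl0 : ζ * (omega n)⁻¹ - ζ ≠ 0 := by
    rw [hw2]
    exact div_ne_zero (neg_ne_zero.2 (mul_ne_zero hζ0 hω1)) hω0
  obtain ⟨q₁, hq₁⟩ := hθ.1 k hk
  obtain ⟨q₂, hq₂⟩ := hθ.1 l hl
  rw [hk1] at hq₁
  rw [hl1] at hq₂
  have hek := exp_neg_arg _ hk0 hq₁
  have hel := exp_neg_arg _ hl0 hq₂
  rw [hnk] at hek
  rw [hnl] at hel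
  refine ⟨k, l, hk, hl, by rw [hek]; ring, by rw [hel]; ring, ?_⟩
  have hr0 : (‖omega n - 1‖ : ℂ) ≠ 0 := by exact_mod_cast (norm_pos_iff.2 hω1).ne'
  -- Modulo 2π the angles of the two neighbours of ζ differ by (n-2)π/n, which is the prescribed
  -- spread of all angles.
  have hdiff : Complex.exp ((θ k - θ l : ℝ) * Complex.I) =
      Complex.exp (((n - 2) / n * Real.pi : ℝ) * Complex.I) := by
    have e1 : Complex.exp (((n - 2) / n * Real.pi : ℝ) * Complex.I) = -(omega n)⁻¹ := by
      rw [omega, ← Complex.exp_neg, ← neg_one_mul, ← Complex.exp_pi_mul_I, ← Complex.exp_add]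
      have : (n : ℂ) ≠ 0 := Nat.cast_ne_zero.2 (by omega)
      congr 1
      push_cast
      field_simp
      ring
    rw [e1]
    push_cast
    rw [sub_mul, Complex.exp_sub, hek, hel, hw1, hw2]
    field_simp
  obtain ⟨q, hq⟩ := Complex.exp_eq_exp_iff_exists_int.1 hdiff
  have hq' : θ k - θ l = (n - 2) / n * Real.pi + q * (2 * Real.pi) := by
    have h1 : ((θ k - θ l : ℝ) : ℂ) * Complex.I =
        (((n - 2) / n * Real.pi + q * (2 * Real.pi) : ℝ) : ℂ) * Complex.I := by
      rw [hq]
      push_cast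
      ring
    exact_mod_cast mul_right_cancel₀ Complex.I_ne_zero h1
  have hfin : (θ '' {ℓ | ℓ ≠ j}).Finite := Set.toFinite _
  have hsk := le_csSup hfin.bddAbove (Set.mem_image_of_mem θ (show k ∈ {ℓ | ℓ ≠ j} from hk))
  have hsl := le_csSup hfin.bddAbove (Set.mem_image_of_mem θ (show l ∈ {ℓ | ℓ ≠ j} from hl))
  have hik := csInf_le hfin.bddBelow (Set.mem_image_of_mem θ (show k ∈ {ℓ | ℓ ≠ j} from hk))
  have hil := csInf_le hfin.bddBelow (Set.mem_image_of_mem θ (show l ∈ {ℓ | ℓ ≠ j} from hl))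
  have hspread := hθ.2
  have hπ := Real.pi_pos
  have hfrac : ((n : ℝ) - 2) / n < 1 := by rw [div_lt_one (by linarith)]; linarith
  have hfp : ((n : ℝ) - 2) / n * Real.pi < Real.pi := by nlinarith
  -- The spread is below π, so no other multiple of 2π fits. The neighbours then realise the whole
  -- spread and must be the minimum and the maximum.
  have hq0 : q = 0 := by
    have h1 : (q : ℝ) * (2 * Real.pi) < 2 * Real.pi := by linarith
    have h2 : -(2 * Real.pi) < (q : ℝ) * (2 * Real.pi) := by linarith
    have h3 : (q : ℝ) < 1 := by nlinarith
    have h4 : (-1 : ℝ) < q := by nlinarith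
    have h5 : q < 1 := by exact_mod_cast h3
    have h6 : -1 < q := by exact_mod_cast h4
    omega
  rw [hq0, Int.cast_zero, zero_mul, add_zero] at hq'
  have hinf : sInf (θ '' {ℓ | ℓ ≠ j}) = θ l := by linarith
  have hsup : sSup (θ '' {ℓ | ℓ ≠ j}) = θ k := by linarith
  have hmid : midAngle j θ = θ l + (n - 2) / n * Real.pi / 2 := by
    unfold midAngle
    rw [hinf, hsup]
    linarith
  have hhalf : Complex.exp (((n - 2) / n * Real.pi / 2 : ℝ) * Complex.I) =
      Complex.I * (halfOmega n)⁻¹ := by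
    have : (n : ℂ) ≠ 0 := Nat.cast_ne_zero.2 (by omega)
    have e : Complex.exp (((n - 2) / n * Real.pi / 2 : ℝ) * Complex.I) =
        Complex.exp (Real.pi / 2 * Complex.I) * Complex.exp (-((Real.pi / n : ℝ) * Complex.I)) := by
      rw [← Complex.exp_add]
      congr 1
      push_cast
      field_simp
      ring
    rw [e, Complex.exp_pi_div_two_mul_I, Complex.exp_neg]
    rfl
  have hsub := omega_pow_sub_one (n := n) 1
  simp only [pow_one, Nat.cast_one, one_mul] at hsub
  have hnorm := norm_omega_sub_one hn
  have hsin : ((Real.sin (Real.pi / n) : ℝ) : ℂ) ≠ 0 := by exact_mod_cast (sin_pi_div_pos hn).ne'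
  have hhalf0 := halfOmega_ne_zero (n := n)
  rw [hmid]
  push_cast at hhalf ⊢
  rw [add_mul, Complex.exp_add, hel, hhalf, hw2, hnorm, hsub, omega_eq]
  push_cast at hsin ⊢
  field_simp

end Angles

end FactorialSeries
end

open Filter Topology Asymptotics MeasureTheory
noncomputable section
namespace FactorialSeries

/-! ### Sections of the surface over neighbourhoods of a cone -/

section Sections

variable {S : Type*} [TopologicalSpace S] [T2Space S] {pr : S → ℂ} (hpr : IsLocalHomeomorph pr)
include hpr

lemma lift_eqOn {A : Type*} [TopologicalSpace A] {T : Set A} (hT : IsPreconnected T)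
    {g₁ g₂ : A → S} (h₁ : ContinuousOn g₁ T) (h₂ : ContinuousOn g₂ T)
    (he : ∀ a ∈ T, pr (g₁ a) = pr (g₂ a)) {a₀ : A} (ha₀ : a₀ ∈ T) (h0 : g₁ a₀ = g₂ a₀) :
    Set.EqOn g₁ g₂ T :=
  (T2Space.isSeparatedMap pr).eqOn_of_comp_eqOn hpr.isLocallyInjective hT h₁ h₂ he ha₀ h0

omit [T2Space S] in
-- Any continuous section agrees locally with the chosen inverse branch of pr through its value.
-- Derivatives and analyticity on the surface can therefore be computed in the coordinate of any
-- sheet.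
lemma sec_eventuallyEq {s : ℂ → S} {z : ℂ} (hs : ContinuousAt s z)
    (hp : ∀ᶠ w in 𝓝 z, pr (s w) = w) : sec hpr (s z) =ᶠ[𝓝 z] s := by
  obtain ⟨hmem, heq⟩ := Classical.choose_spec (hpr (s z))
  have h1 : ∀ᶠ w in 𝓝 z, s w ∈ (Classical.choose (hpr (s z))).source :=
    hs.eventually_mem ((Classical.choose (hpr (s z))).open_source.mem_nhds hmem)
  filter_upwards [h1, hp] with w hw hpw
  have h2 := (Classical.choose (hpr (s z))).left_inv hw
  rw [← heq, hpw] at h2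
  exact h2

omit [T2Space S] in
lemma dXi_section {s : ℂ → S} {z : ℂ} (hs : ContinuousAt s z)
    (hp : ∀ᶠ w in 𝓝 z, pr (s w) = w) (k : ℕ) (f : S → ℂ) :
    dXi hpr k f (s z) = iteratedDeriv k (fun w => f (s w)) z := by
  have h := sec_eventuallyEq hpr hs hp
  unfold dXi
  rw [hp.self_of_nhds]
  exact Filter.EventuallyEq.iteratedDeriv_eq k (h.fun_comp f)

omit [T2Space S] in
lemma analyticAt_section {s : ℂ → S} {z : ℂ} (hs : ContinuousAt s z)
    (hp : ∀ᶠ w in 𝓝 z, pr (s w) = w) {f : ℂ → S → ℂ} {t : ℂ} :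
    AnalyticAt ℂ (fun p : ℂ × ℂ => f p.1 (sec hpr (s z) p.2)) (t, pr (s z)) ↔
      AnalyticAt ℂ (fun p : ℂ × ℂ => f p.1 (s p.2)) (t, z) := by
  rw [hp.self_of_nhds]
  refine analyticAt_congr ?_
  have h : Tendsto (fun p : ℂ × ℂ => p.2) (𝓝 (t, z)) (𝓝 z) := continuous_snd.tendsto _
  filter_upwards [h.eventually (sec_eventuallyEq hpr hs hp)] with p hp'
  rw [hp']

/-- Straight paths in a surface are determined by their initial point. -/
lemma ray_eq {x : S} {φ : ℝ} {γ : ℝ → S} (hγ : IsRay pr x φ γ) {t : ℝ} (ht : 0 ≤ t) :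
    ray pr x φ t = γ t := by
  have h : ∃ γ, IsRay pr x φ γ := ⟨γ, hγ⟩
  have h1 : IsRay pr x φ (ray pr x φ) := by
    unfold ray
    rw [dif_pos h]
    exact Classical.choose_spec h
  exact lift_eqOn hpr (convex_Ici (0 : ℝ)).isPreconnected h1.1 hγ.1
    (fun r hr => by rw [h1.2.2 r hr, hγ.2.2 r hr]) (Set.mem_Ici.2 le_rfl) (h1.2.1.trans hγ.2.1.symm) ht

/-- The translates of a point along two directions in which all points of `Γ` can be moved. -/
lemma exists_quadrant {Γ : Set S} {x : S} (hx : x ∈ Γ) {φ₁ φ₂ : ℝ}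
    (h₁ : ∀ y ∈ Γ, ∃ γ, IsRay pr y φ₁ γ ∧ ∀ t : ℝ, 0 ≤ t → γ t ∈ Γ)
    (h₂ : ∀ y ∈ Γ, ∃ γ, IsRay pr y φ₂ γ ∧ ∀ t : ℝ, 0 ≤ t → γ t ∈ Γ) :
    ∃ h : ℝ × ℝ → S, Continuous h ∧ h (0, 0) = x ∧ ∀ τ : ℝ × ℝ, 0 ≤ τ.1 → 0 ≤ τ.2 → h τ ∈ Γ ∧
      pr (h τ) = pr x + τ.1 * Complex.exp (φ₁ * Complex.I) + τ.2 * Complex.exp (φ₂ * Complex.I) := by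
  obtain ⟨γ, hγ, hγΓ⟩ := h₁ x hx
  choose R hR hRΓ using fun r : ℝ => h₂ (γ (max r 0)) (hγΓ _ (le_max_right _ _))
  -- The rays of the second leg are chosen separately for each endpoint of the first, so continuity
  -- in the first coordinate is not evident. The parameter in the unit interval scales the second
  -- leg, which makes g a candidate lift of a homotopy.
  set g : unitInterval × (ℝ × ℝ) → S := fun p => R p.2.1 (p.1 * max p.2.2 0) with hg
  have hγc : Continuous fun r : ℝ => γ (max r 0) :=
    hγ.1.comp_continuous (by fun_prop) fun r => Set.mem_Ici.2 (le_max_right _ _)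
  have hnn : ∀ p : unitInterval × (ℝ × ℝ), 0 ≤ (p.1 : ℝ) * max p.2.2 0 := fun p =>
    mul_nonneg p.1.2.1 (le_max_right _ _)
  have hlift : ∀ p, pr (g p) = pr x + (max p.2.1 0 : ℝ) * Complex.exp (φ₁ * Complex.I) +
      (p.1 * max p.2.2 0 : ℝ) * Complex.exp (φ₂ * Complex.I) := fun p => by
    rw [hg]
    simp only
    rw [(hR p.2.1).2.2 _ (hnn p), hγ.2.2 _ (le_max_right _ _)]
  have hcont : Continuous g := by
    -- Lifting of homotopies: continuity on the initial slice and along every single path gives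
    -- joint continuity.
    refine hpr.continuous_lift (T2Space.isSeparatedMap pr)
      ⟨fun p : unitInterval × (ℝ × ℝ) => pr x + (max p.2.1 0 : ℝ) * Complex.exp (φ₁ * Complex.I) +
        (p.1 * max p.2.2 0 : ℝ) * Complex.exp (φ₂ * Complex.I), by fun_prop⟩ (funext hlift) ?_ ?_
    · have : (fun τ : ℝ × ℝ => g (0, τ)) = fun τ => γ (max τ.1 0) := funext fun τ => by
        simp only [hg, Set.Icc.coe_zero, zero_mul]
        exact (hR τ.1).2.1
      rw [this]
      exact hγc.comp continuous_fst
    · intro τ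
      exact (hR τ.1).1.comp_continuous (f := fun t : unitInterval => (t : ℝ) * max τ.2 0)
        (by fun_prop) fun t => Set.mem_Ici.2 (hnn (t, τ))
  refine ⟨fun τ => g (1, τ), hcont.comp (by fun_prop), ?_, fun τ hτ₁ hτ₂ => ⟨?_, ?_⟩⟩
  · simp only [hg, Set.Icc.coe_one, one_mul, max_self]
    have h1 := (hR 0).2.1
    rw [max_self, hγ.2.1] at h1
    exact h1
  · exact hRΓ _ _ (hnn (1, τ))
  · rw [hlift]
    simp only [Set.Icc.coe_one, one_mul, max_eq_left hτ₁, max_eq_left hτ₂]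

/-- A continuous family of points of the surface with discs of fixed radius extends to a section
over a neighbourhood. -/
lemma exists_section {D : Set S} {d : ℝ} {A : Set (ℝ × ℝ)} (hA : Convex ℝ A) {τ₀ : ℝ × ℝ}
    (hτ₀ : τ₀ ∈ A) {h : ℝ × ℝ → S} (hh : Continuous h) {b e₁ e₂ : ℂ}
    (hpr' : ∀ τ ∈ A, pr (h τ) = b + τ.1 * e₁ + τ.2 * e₂) (hd : 0 < d)
    (hdisc : ∀ τ ∈ A, DiscIn pr D d (h τ)) :
    ∃ s : ℂ → S, ContinuousOn s {z | Metric.infDist z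
        ((fun τ : ℝ × ℝ => b + τ.1 * e₁ + τ.2 * e₂) '' A) < d} ∧
      (∀ z, Metric.infDist z ((fun τ : ℝ × ℝ => b + τ.1 * e₁ + τ.2 * e₂) '' A) < d →
        s z ∈ D ∧ pr (s z) = z) ∧ ∀ τ ∈ A, s (b + τ.1 * e₁ + τ.2 * e₂) = h τ := by
  set q : ℝ × ℝ → ℂ := fun τ => b + τ.1 * e₁ + τ.2 * e₂ with hq
  have hdisc' : ∀ τ, ∃ s : ℂ → S, τ ∈ A → ContinuousOn s (Metric.ball (q τ) d) ∧ s (q τ) = h τ ∧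
      ∀ z ∈ Metric.ball (q τ) d, s z ∈ D ∧ pr (s z) = z := fun τ => by
    by_cases hτ : τ ∈ A
    · obtain ⟨s, hs⟩ := hdisc τ hτ
      rw [hpr' τ hτ] at hs
      exact ⟨s, fun _ => hs⟩
    · exact ⟨fun _ => h τ₀, fun h => absurd h hτ⟩
  choose σ hσ using hdisc'
  have hqc : Continuous q := by fun_prop
  -- When each centre lies in the other's disc, h lifts the segment between the centres inside the
  -- first disc. So the two sections agree at the second centre, and then on the convex intersection
  -- of the discs.
  have hlink : ∀ τ ∈ A, ∀ τ' ∈ A, dist (q τ') (q τ) < d → ∀ z, dist z (q τ) < d →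
      dist z (q τ') < d → σ τ z = σ τ' z := by
    intro τ hτ τ' hτ' hdist z hz hz'
    have hseg : Set.EqOn (fun r : ℝ => h (AffineMap.lineMap τ τ' r))
        (fun r : ℝ => σ τ (q (AffineMap.lineMap τ τ' r))) (Set.Icc 0 1) := by
      have hin : ∀ r ∈ Set.Icc (0 : ℝ) 1, AffineMap.lineMap τ τ' r ∈ A := fun r hr =>
        hA.lineMap_mem hτ hτ' hr
      have hball : ∀ r ∈ Set.Icc (0 : ℝ) 1,
          q (AffineMap.lineMap τ τ' r) ∈ Metric.ball (q τ) d := fun r hr => by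
        have e : q (AffineMap.lineMap τ τ' r) - q τ = r * (q τ' - q τ) := by
          simp only [hq, AffineMap.lineMap_apply, vsub_eq_sub, vadd_eq_add, Prod.fst_add,
            Prod.snd_add, Prod.smul_fst, Prod.smul_snd, Prod.fst_sub, Prod.snd_sub, smul_eq_mul]
          push_cast
          ring
        rw [mem_ball_iff_norm, e, norm_mul, Complex.norm_real, Real.norm_of_nonneg hr.1]
        rw [dist_eq_norm] at hdist
        exact lt_of_le_of_lt (mul_le_of_le_one_left (norm_nonneg _) hr.2) hdist
      refine lift_eqOn hpr isPreconnected_Icc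
        (hh.comp AffineMap.lineMap_continuous).continuousOn
        ((hσ τ hτ).1.comp (hqc.comp AffineMap.lineMap_continuous).continuousOn hball)
        (fun r hr => ?_) (Set.left_mem_Icc.2 zero_le_one) ?_
      · rw [hpr' _ (hin r hr), ((hσ τ hτ).2.2 _ (hball r hr)).2]
      · simp only [AffineMap.lineMap_apply_zero]
        exact (hσ τ hτ).2.1.symm
    have h1 := hseg (Set.right_mem_Icc.2 zero_le_one)
    simp only [AffineMap.lineMap_apply_one] at h1
    rw [← (hσ τ' hτ').2.1] at h1
    refine lift_eqOn hpr (((convex_ball (q τ) d).inter (convex_ball (q τ') d)).isPreconnected)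
      ((hσ τ hτ).1.mono Set.inter_subset_left) ((hσ τ' hτ').1.mono Set.inter_subset_right)
      (fun w hw => ?_) (a₀ := q τ') ⟨hdist, Metric.mem_ball_self hd⟩ h1.symm ⟨hz, hz'⟩
    rw [((hσ τ hτ).2.2 w hw.1).2, ((hσ τ' hτ').2.2 w hw.2).2]
  have hagree : ∀ τ ∈ A, ∀ τ' ∈ A, ∀ z, dist z (q τ) < d → dist z (q τ') < d →
      σ τ z = σ τ' z := by
    intro τ hτ τ' hτ' z hz hz'
    -- Discs that meet may have centres up to 2d apart. The midpoint is within d of both centres and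
    -- of z, so two applications of `hlink` suffice.
    set m : ℝ × ℝ := AffineMap.lineMap τ τ' (1 / 2 : ℝ) with hm
    have hmA : m ∈ A := hA.lineMap_mem hτ hτ' (by norm_num)
    have hqm : q m = (q τ + q τ') / 2 := by
      simp only [hq, hm, AffineMap.lineMap_apply, vsub_eq_sub, vadd_eq_add, Prod.fst_add,
        Prod.snd_add, Prod.smul_fst, Prod.smul_snd, Prod.fst_sub, Prod.snd_sub, smul_eq_mul]
      push_cast
      ring
    rw [dist_eq_norm] at hz hz'
    have hhalf : ∀ w : ℂ, ‖w / 2‖ = ‖w‖ / 2 := fun w => by simp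
    have hqq : ‖q τ - q τ'‖ < 2 * d := by
      rw [show q τ - q τ' = (z - q τ') - (z - q τ) by ring]
      exact (norm_sub_le _ _).trans_lt (by linarith)
    have h1 : ‖q m - q τ‖ < d := by
      rw [hqm, show (q τ + q τ') / 2 - q τ = -((q τ - q τ') / 2) by ring, norm_neg, hhalf]
      linarith
    have h2 : ‖q m - q τ'‖ < d := by
      rw [hqm, show (q τ + q τ') / 2 - q τ' = (q τ - q τ') / 2 by ring, hhalf]
      linarith
    have h3 : ‖z - q m‖ < d := by
      rw [hqm, show z - (q τ + q τ') / 2 = ((z - q τ) + (z - q τ')) / 2 by ring, hhalf]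
      have := norm_add_le (z - q τ) (z - q τ')
      linarith
    rw [hlink τ hτ m hmA (by rwa [dist_eq_norm]) z (by rwa [dist_eq_norm]) (by rwa [dist_eq_norm]),
      hlink τ' hτ' m hmA (by rwa [dist_eq_norm]) z (by rwa [dist_eq_norm]) (by rwa [dist_eq_norm])]
  have hex : ∀ z, Metric.infDist z (q '' A) < d → ∃ τ ∈ A, dist z (q τ) < d := fun z hz => by
    obtain ⟨_, ⟨τ, hτ, rfl⟩, hlt⟩ := (Metric.infDist_lt_iff (Set.Nonempty.image q ⟨τ₀, hτ₀⟩)).1 hz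
    exact ⟨τ, hτ, hlt⟩
  classical
  set s : ℂ → S := fun z => if hz : ∃ τ ∈ A, dist z (q τ) < d then σ (Classical.choose hz) z
    else h τ₀ with hs
  have hs_eq : ∀ τ ∈ A, ∀ z, dist z (q τ) < d → s z = σ τ z := fun τ hτ z hz => by
    have hz' : ∃ τ ∈ A, dist z (q τ) < d := ⟨τ, hτ, hz⟩
    simp only [hs, dif_pos hz']
    exact hagree _ (Classical.choose_spec hz').1 τ hτ z (Classical.choose_spec hz').2 hz
  refine ⟨s, fun z hz => ?_, fun z hz => ?_, fun τ hτ => ?_⟩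
  · obtain ⟨τ, hτ, hlt⟩ := hex z hz
    have hball : Metric.ball (q τ) d ∈ 𝓝 z := Metric.isOpen_ball.mem_nhds hlt
    refine ContinuousAt.continuousWithinAt (((hσ τ hτ).1.continuousAt hball).congr ?_)
    filter_upwards [hball] with w hw
    exact (hs_eq τ hτ w hw).symm
  · obtain ⟨τ, hτ, hlt⟩ := hex z hz
    rw [hs_eq τ hτ z hlt]
    exact (hσ τ hτ).2.2 z hlt
  · change s (q τ) = h τ
    rw [hs_eq τ hτ (q τ) (by rwa [dist_self])]
    exact (hσ τ hτ).2.1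

end Sections

end FactorialSeries
end

open Filter Topology Asymptotics MeasureTheory
noncomputable section
namespace FactorialSeries

/-! ### The surface in the coordinate of a sheet -/

section Sheets

variable {S : Type*} [TopologicalSpace S] [T2Space S] {pr : S → ℂ}

/-- A section of the surface over the base of a frame. -/
structure Sheet (pr : S → ℂ) (P : Frame) (j : ℕ) (φ : ℝ) (Δ Γ : Set S) (s : ℂ → S) : Prop where
  valid : P.Valid
  ζ_eq : P.ζ = zeta P.n j 1
  exp_φ : Complex.exp (φ * Complex.I) = -1 / P.ζ
  cont : ContinuousOn s P.base
  mem : ∀ z ∈ P.base, s z ∈ Δ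
  pr_eq : ∀ z ∈ P.base, pr (s z) = z
  mem_Γ : ∀ z ∈ P.Q, s z ∈ Γ
  d_pos : 0 < P.d

/-- A sheet through a given point of an admissible domain. -/
lemma exists_sheet (hpr : IsLocalHomeomorph pr) {n : ℕ} (hn : 2 ≤ n) {a : ℝ} (ha : 0 < a)
    (ha_eq : (1 + a) ^ n = 1 + 2 * n * a) {d ρ : ℝ} (hd : 0 < d) (hρ : 0 < ρ) {j : Fin n}
    {θ : Fin n → ℝ} (hθ : IsAngleChoice n j θ) {Δ Γ : Set S} (hΓ : IsGamma pr j θ Δ d Γ) {x : S}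
    (hx : x ∈ Γ) :
    ∃ (Q : Set ℂ) (s : ℂ → S), Sheet pr ⟨n, zeta n j 1, a, d, ρ, Q⟩ j (midAngle j θ) Δ Γ s ∧
      pr x ∈ Q ∧ s (pr x) = x := by
  obtain ⟨k, l, hk, hl, hek, hel, hmid⟩ := exists_extreme_angles hn hθ
  set ζ := zeta n j 1 with hζ
  have hζn : ζ ^ n = 1 := zeta_pow_self hn j
  have hζ0 := ne_zero_of_pow_eq_one hn hζn
  -- Only the two extreme directions are followed; by `exists_cone_eq` the other characteristic
  -- directions lie in the cone they span.
  obtain ⟨h, hh, h0, hhτ⟩ := exists_quadrant hpr hx (fun y hy => hΓ.ray y hy k hk)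
    (fun y hy => hΓ.ray y hy l hl)
  set A : Set (ℝ × ℝ) := Set.Ici 0 ×ˢ Set.Ici 0 with hA
  set e₁ := Complex.exp (θ k * Complex.I) with he₁
  set e₂ := Complex.exp (θ l * Complex.I) with he₂
  have h0A : ((0 : ℝ), (0 : ℝ)) ∈ A := ⟨Set.mem_Ici.2 le_rfl, Set.mem_Ici.2 le_rfl⟩
  obtain ⟨s, hs, hs1, hs2⟩ := exists_section hpr (D := Δ) (d := d) (A := A)
    ((convex_Ici 0).prod (convex_Ici 0)) h0A hh (b := pr x) (e₁ := e₁) (e₂ := e₂)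
    (fun τ hτ => (hhτ τ hτ.1 hτ.2).2) hd (fun τ hτ => hΓ.disc _ (hhτ τ hτ.1 hτ.2).1)
  set Q := (fun τ : ℝ × ℝ => pr x + τ.1 * e₁ + τ.2 * e₂) '' A with hQ
  have hr : 0 < ‖omega n - 1‖ := norm_pos_iff.2 (sub_ne_zero.2 (omega_ne_one hn))
  have hrC : (‖omega n - 1‖ : ℂ) ≠ 0 := by exact_mod_cast hr.ne'
  have hmove : ∀ z ∈ Q, ∀ p q : ℝ, 0 ≤ p → 0 ≤ q → z + (p * (1 / (ζ * omega n - ζ)) +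
      q * (1 / (ζ * (omega n)⁻¹ - ζ))) ∈ Q := by
    rintro _ ⟨τ, hτ, rfl⟩ p q hp hq
    refine ⟨(τ.1 + p / ‖omega n - 1‖, τ.2 + q / ‖omega n - 1‖),
      ⟨Set.mem_Ici.2 (add_nonneg hτ.1 (by positivity)),
        Set.mem_Ici.2 (add_nonneg hτ.2 (by positivity))⟩, ?_⟩
    simp only
    rw [hek, hel]
    push_cast
    field_simp
    ring
  have hxQ : pr x ∈ Q := ⟨(0, 0), h0A, by simp⟩
  refine ⟨Q, s, ⟨⟨hn, hζn, ha, fun μ hμ hne => ?_, hρ, ⟨_, hxQ⟩, fun z hz μ hμ hne τ hτ => ?_,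
    fun z hz τ hτ => ?_⟩, hζ, hmid, hs, fun z hz => (hs1 z hz).1, fun z hz => (hs1 z hz).2,
    ?_, hd⟩, hxQ, ?_⟩
  · exact (le_norm_omega_sub_one hn ha ha_eq).trans (norm_omega_sub_one_le hn hζn hμ hne)
  · obtain ⟨p, q, hp, hq, hpq⟩ := exists_cone_eq hn hζn hμ hne
    have h1 := hmove z hz (τ * p) (τ * q) (mul_nonneg hτ hp) (mul_nonneg hτ hq)
    have h2 : (τ : ℂ) / (μ - ζ) = (τ * p : ℝ) * (1 / (ζ * omega n - ζ)) +
        (τ * q : ℝ) * (1 / (ζ * (omega n)⁻¹ - ζ)) := by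
      rw [← mul_one_div, hpq]
      push_cast
      ring
    exact h2 ▸ h1
  · have h1 := hmove z hz τ τ hτ hτ
    rw [← mul_add, inv_omega_add hn hζ0] at h1
    have h2 : z - τ / ζ = z + τ * (-1 / ζ) := by ring
    exact h2 ▸ h1
  · rintro _ ⟨τ, hτ, rfl⟩
    rw [hs2 τ hτ]
    exact (hhτ τ hτ.1 hτ.2).1
  · have := hs2 (0, 0) h0A
    simp only [Complex.ofReal_zero, zero_mul, add_zero] at this
    rw [this, h0]

/-- Functions on the surface in the coordinate of a sheet. -/
def pull (s : ℂ → S) (Ψ : ℕ → ℂ → S → ℂ) (k : ℕ) (p : ℂ × ℂ) : ℂ := Ψ k p.1 (s p.2)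

namespace Sheet

variable {P : Frame} {j : ℕ} {φ : ℝ} {Δ Γ : Set S} {s : ℂ → S} (hS : Sheet pr P j φ Δ Γ s)
  {z : ℂ}
include hS

omit [T2Space S] in
lemma continuousAt (hz : z ∈ P.base) : ContinuousAt s z :=
  hS.cont.continuousAt (Frame.isOpen_base.mem_nhds hz)

omit [T2Space S] in
lemma eventually_pr (hz : z ∈ P.base) : ∀ᶠ w in 𝓝 z, pr (s w) = w := by
  filter_upwards [Frame.isOpen_base.mem_nhds hz] with w hw using hS.pr_eq w hw

omit [T2Space S] in
lemma mem_base_of_mem (hz : z ∈ P.Q) : z ∈ P.base := by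
  change Metric.infDist z P.Q < P.d
  rw [Metric.infDist_zero_of_mem hz]
  exact hS.d_pos

omit [T2Space S] in
lemma dXi_eq (hpr : IsLocalHomeomorph pr) (hz : z ∈ P.base) (k : ℕ) (f : S → ℂ) :
    dXi hpr k f (s z) = iteratedDeriv k (fun w => f (s w)) z :=
  dXi_section hpr (hS.continuousAt hz) (hS.eventually_pr hz) k f

omit [T2Space S] in
lemma analyticAt_iff (hpr : IsLocalHomeomorph pr) (hz : z ∈ P.base) {f : ℂ → S → ℂ} {t : ℂ} :
    AnalyticAt ℂ (fun p : ℂ × ℂ => f p.1 (sec hpr (s z) p.2)) (t, pr (s z)) ↔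
      AnalyticAt ℂ (fun p : ℂ × ℂ => f p.1 (s p.2)) (t, z) :=
  analyticAt_section hpr (hS.continuousAt hz) (hS.eventually_pr hz)

lemma ray_eq (hpr : IsLocalHomeomorph pr) (hz : z ∈ P.base) {t : ℝ} (ht : 0 ≤ t) :
    ray pr (s z) φ t = s (z - t / P.ζ) := by
  refine FactorialSeries.ray_eq hpr (γ := fun t : ℝ => s (z - t / P.ζ)) ⟨?_, by simp, fun r hr => ?_⟩ ht
  · exact hS.cont.comp (Continuous.continuousOn (by fun_prop))
      fun r hr => hS.valid.ray_mem_base hz hr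
  · rw [hS.pr_eq _ (hS.valid.ray_mem_base hz hr), hS.pr_eq _ hz, hS.exp_φ]
    ring

lemma rayIntegral_eq (hpr : IsLocalHomeomorph pr) (hz : z ∈ P.base) {g : S → ℂ} {g' : ℂ → ℂ}
    (hg : ∀ w ∈ P.base, g (s w) = g' w) : rayIntegral pr (s z) φ g = P.rint g' z := by
  unfold rayIntegral Frame.rint
  refine setIntegral_congr_fun measurableSet_Ioi fun t ht => ?_
  rw [hS.ray_eq hpr hz (le_of_lt ht), hS.exp_φ, hg _ (hS.valid.ray_mem_base hz (le_of_lt ht))]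

variable {hpr : IsLocalHomeomorph pr} {d' c σ' : ℝ} {ψ Ψ : ℕ → ℂ → S → ℂ} {ψc : ℕ → ℕ → S → ℂ}
  (hcond : BorelCondition hpr P.n P.a d' c P.ρ σ' Δ ψ Ψ) {k : ℕ}
include hcond

omit [T2Space S] in
lemma analyticAt_pull (hk : k < P.n - 1) {t : ℂ} (ht : width t < P.a * d') (hz : z ∈ P.base) :
    AnalyticAt ℂ (pull s Ψ k) (t, z) :=
  (hS.analyticAt_iff hpr hz).1 (hcond.analytic k hk t (mem_U_iff.2 ht) _ (hS.mem z hz))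

omit [T2Space S] in
-- The decay in |ξ| is weakened to decay in `prog`, the coordinate that the characteristics control.
-- Since 1 + |prog z| ≤ 2 max(1, |z|), the loss is the factor 2^{1+ρ}.
lemma norm_pull_le (hk : k < P.n - 1) {t : ℂ} (ht : width t < P.a * d') (hz : z ∈ P.base) :
    ‖pull s Ψ k (t, z)‖ ≤
      c * 2 ^ (1 + P.ρ) * wb P.ρ (P.prog z) * Real.exp (σ' * rePos t) := by
  have hρ := hcond.ρ_pos
  refine (hcond.bound k hk t (mem_U_iff.2 ht) _ (hS.mem z hz)).trans ?_
  rw [hS.pr_eq z hz, mul_assoc, mul_assoc]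
  refine mul_le_mul_of_nonneg_left ?_ hcond.c_pos.le
  rw [← mul_assoc, div_eq_inv_mul]
  have h1 : (1 + ‖z‖ ^ (1 + P.ρ))⁻¹ ≤ 2 ^ (1 + P.ρ) * wb P.ρ (P.prog z) := by
    unfold wb
    rw [Real.rpow_neg (by positivity), ← div_eq_mul_inv, le_div_iff₀ (by positivity),
      ← div_eq_inv_mul, div_le_iff₀ (by positivity)]
    have h2 : 1 + |P.prog z| ≤ 2 * max 1 ‖z‖ := by
      have := hS.valid.abs_prog_le z
      have := le_max_left 1 ‖z‖
      have := le_max_right 1 ‖z‖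
      linarith
    refine (Real.rpow_le_rpow (by positivity) h2 (by linarith)).trans ?_
    rw [Real.mul_rpow (by norm_num) (by positivity)]
    refine mul_le_mul_of_nonneg_left ?_ (by positivity)
    rcases le_total 1 ‖z‖ with h | h
    · rw [max_eq_right h]
      linarith
    · rw [max_eq_left h, Real.one_rpow]
      have : 0 ≤ ‖z‖ ^ (1 + P.ρ) := by positivity
      linarith
  have h3 : Real.exp (σ' * t.re) ≤ Real.exp (σ' * rePos t) :=
    Real.exp_le_exp.2 (mul_le_mul_of_nonneg_left (le_max_left _ _) hcond.σ'_nonneg)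
  exact mul_le_mul h1 h3 (Real.exp_pos _).le (mul_nonneg (by positivity) (wb_pos _).le)

omit [T2Space S] in
lemma analyticOnNhd_slice (hk : k < P.n - 1) (hz : z ∈ P.base) :
    AnalyticOnNhd ℂ (fun t => Ψ k t (s z)) {t | width t < P.a * d'} := fun _ ht =>
  Frame.analyticAt_fst_of (hS.analyticAt_pull hcond hk ht hz)

omit [T2Space S] in
/-- The potentials and their derivatives, in the coordinate of a sheet. -/
lemma potential_pull (hd : P.d < d') (hk : k < P.n - 1) :
    P.Potential (c * 2 ^ (1 + P.ρ) * (1 + Real.exp (σ' * (P.a * (d' - P.d))) / (P.a * (d' - P.d))))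
      σ' (pull s Ψ k) ∧
    P.Potential (c * 2 ^ (1 + P.ρ) * (1 + Real.exp (σ' * (P.a * (d' - P.d))) / (P.a * (d' - P.d))))
      σ' (dFst (pull s Ψ k)) := by
  have ha := hS.valid.a_pos
  have hc := hcond.c_pos
  have hδ : 0 < P.a * (d' - P.d) := mul_pos ha (by linarith)
  set δ := P.a * (d' - P.d) with hδdef
  have hw : ∀ p ∈ P.box, width p.1 < P.a * d' := fun p hp =>
    lt_trans hp.1 (mul_lt_mul_of_pos_left hd ha)
  have hb0 : ∀ p : ℂ × ℂ, 0 ≤ c * 2 ^ (1 + P.ρ) * (wb P.ρ (P.prog p.2) * Real.exp (σ' * rePos p.1)) :=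
    fun p => mul_nonneg (by positivity) (mul_nonneg (wb_pos _).le (Real.exp_pos _).le)
  have he0 : 0 < Real.exp (σ' * δ) / δ := by positivity
  refine ⟨⟨fun p hp => hS.analyticAt_pull hcond hk (hw p hp) hp.2, fun p hp => ?_⟩,
    ⟨fun p hp => analyticAt_dFst (hS.analyticAt_pull hcond hk (hw p hp) hp.2), fun p hp => ?_⟩⟩
  · refine (hS.norm_pull_le hcond hk (hw p hp) hp.2).trans ?_
    have := mul_nonneg (hb0 p) he0.le
    linarith
  · have h1 := norm_iteratedDeriv_le_of_width (F := fun t => pull s Ψ k (t, p.2))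
      (r := P.a * d') (C := c * 2 ^ (1 + P.ρ) * wb P.ρ (P.prog p.2)) (σ := σ') (δ := δ)
      hcond.σ'_nonneg hδ (mul_nonneg (by positivity) (wb_pos _).le)
      (hS.analyticOnNhd_slice hcond hk hp.2) (fun t ht => hS.norm_pull_le hcond hk ht hp.2) 1
      (t := p.1) (by
        have : width p.1 < P.a * P.d := hp.1
        rw [hδdef]
        linarith)
    rw [iteratedDeriv_one, pow_one, Nat.factorial_one, Nat.cast_one, one_mul] at h1
    refine h1.trans ?_
    have e : c * 2 ^ (1 + P.ρ) * wb P.ρ (P.prog p.2) * Real.exp (σ' * δ) / δ *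
        Real.exp (σ' * rePos p.1) = c * 2 ^ (1 + P.ρ) *
        (wb P.ρ (P.prog p.2) * Real.exp (σ' * rePos p.1)) * (Real.exp (σ' * δ) / δ) := by ring
    rw [e]
    have := hb0 p
    linarith

variable (hexp : HasExpansion P.n Δ ψ ψc) (hd : P.d < d')
include hexp hd

omit [T2Space S] in
/-- The coefficients of the expansions of the potentials are the Taylor coefficients of their
Borel transforms. -/
lemma psiC_eq (hk : k < P.n - 1) {m : ℕ} (hm : 1 ≤ m) (hz : z ∈ P.base) :
    ψc k m (s z) = psiC (pull s Ψ) k m z := by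
  have ha := hS.valid.a_pos
  have hd0 := hS.d_pos
  have hc := hcond.c_pos
  have h1 := lap_isLittleO (F := fun t => Ψ k t (s z)) (r := P.a * d')
    (mul_pos ha (by linarith)) hcond.σ'_nonneg (mul_nonneg (by positivity) (wb_pos _).le)
    (hS.analyticOnNhd_slice hcond hk hz) (fun t ht => hS.norm_pull_le hcond hk ht hz)
  have h2 := coeff_unique (f := fun u : ℝ => ψ k u (s z)) (e := if k = 0 then 1 else 0)
    (α := fun m => ψc k m (s z))
    (β := fun m => iteratedDeriv (m - 1) (fun t => Ψ k t (s z)) 0)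
    (hexp k hk (s z) (hS.mem z hz)) (fun N => by
      refine (h1 N).congr' ?_ EventuallyEq.rfl
      filter_upwards [eventually_gt_atTop σ'] with u hu
      rw [hcond.laplace k hk u (by simpa using hu) _ (hS.mem z hz)]
      unfold lap
      ring) hm
  rw [h2, psiC, dFst_iterate]
  rfl

lemma X_eq (hz : z ∈ P.base) : X pr P.n j φ ψc (s z) = P.expo (pull s Ψ) z := by
  unfold X Frame.expo
  congr 1
  refine hS.rayIntegral_eq hpr hz fun w hw => Finset.sum_congr rfl fun k hk => ?_
  rw [hS.psiC_eq hcond hexp hd (Finset.mem_range.1 hk) le_rfl hw, zeta_eq_pow, ← hS.ζ_eq]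
  rfl

lemma bellX_eq (hz : z ∈ P.base) (p : ℕ) :
    bellX hpr P.n j φ ψc p (s z) = P.bell (pull s Ψ) p z := by
  unfold bellX Frame.bell
  rw [hS.X_eq hcond hexp hd hz, hS.dXi_eq hpr hz]
  congr 1
  refine Filter.EventuallyEq.iteratedDeriv_eq p ?_
  filter_upwards [Frame.isOpen_base.mem_nhds hz] with w hw
  rw [hS.X_eq hcond hexp hd hw]

omit hS hcond hexp hd in
omit [T2Space S] in
lemma _root_.FactorialSeries.recRHS_eq_recForm (hpr : IsLocalHomeomorph pr) (n j : ℕ) (φ : ℝ)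
    (ψc : ℕ → ℕ → S → ℂ) (A : ℕ → S → ℂ) (m : ℕ) (x : S) :
    recRHS hpr n j φ ψc A m x = recForm n (zeta n j 1) (bellX hpr n j φ ψc) ψc
      (fun r q => dXi hpr r (A q)) m (rayIntegral pr x φ) := by
  unfold recRHS recForm
  have h : ∀ q, zeta n j q = zeta n j 1 ^ q := zeta_eq_pow j
  generalize zeta n j 1 = ζ at h ⊢
  simp only [h]

/-- Both sequences satisfy the same recurrence from the same start. The induction runs over the
whole base because the recurrence differentiates the lower coefficients and integrates them along
rays. -/
lemma coeffA_eq {K l σ M : ℝ} {G : ℂ × ℂ → ℂ} {c' : ℝ}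
    (hs : P.Solution K l σ σ' c' M (pull s Ψ) G) (m : ℕ) :
    ∀ z ∈ P.base, coeffA hpr P.n j φ ψc m (s z) = P.ac (pull s Ψ) G m z := by
  induction m using Nat.strong_induction_on with
  | _ m ih =>
    intro z hz
    rcases Nat.eq_zero_or_pos m with rfl | hm
    · rw [coeffA_zero, hs.ac_zero hz]
    · rw [coeffA_rec hpr P.n j φ ψc m hm, hs.ac_rec hm hz, recRHS_eq_recForm, ← hS.ζ_eq]
      have hD : ∀ r, ∀ q < m, ∀ w ∈ P.base, dXi hpr r (coeffA hpr P.n j φ ψc q) (s w) =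
          iteratedDeriv r (P.ac (pull s Ψ) G q) w := fun r q hq w hw => by
        rw [hS.dXi_eq hpr hw]
        refine Filter.EventuallyEq.iteratedDeriv_eq r ?_
        filter_upwards [Frame.isOpen_base.mem_nhds hw] with v hv using ih q hq v hv
      refine recForm_congr P.n P.ζ (fun p r q hq => hS.rayIntegral_eq hpr hz fun w hw => ?_)
        (fun p r q hq k hk i hi => hS.rayIntegral_eq hpr hz fun w hw => ?_)
      · rw [hS.bellX_eq hcond hexp hd hw, hD r q hq w hw]
      · rw [hS.bellX_eq hcond hexp hd hw, hD r q hq w hw, hS.psiC_eq hcond hexp hd hk hi hw]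

end Sheet

end Sheets

end FactorialSeries
end

open Filter Topology Asymptotics MeasureTheory
noncomputable section
namespace FactorialSeries

/-! ### Construction and uniqueness of η on the surface -/

section Assembly

variable {S : Type*} [TopologicalSpace S] [T2Space S] {pr : S → ℂ}

namespace Sheet

variable {P : Frame} {j : ℕ} {φ : ℝ} {Δ Γ : Set S} {s : ℂ → S} (hS : Sheet pr P j φ Δ Γ s)
  {z : ℂ} {hpr : IsLocalHomeomorph pr} {d' c σ' : ℝ} {ψ Ψ : ℕ → ℂ → S → ℂ} {ψc : ℕ → ℕ → S → ℂ}
  (hcond : BorelCondition hpr P.n P.a d' c P.ρ σ' Δ ψ Ψ) (hexp : HasExpansion P.n Δ ψ ψc)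
  (hd : P.d < d')
include hS hcond hexp hd

lemma term_eq {K l σ M c' : ℝ} {G : ℂ × ℂ → ℂ} (hs : P.Solution K l σ σ' c' M (pull s Ψ) G)
    (hz : z ∈ P.base) (ω : ℝ) (u : ℂ) (m : ℕ) : term hpr P.n j φ ψc ω u (s z) m =
      facCoeff ω (fun t => P.borelEta (pull s Ψ) G (t, z)) m 0 /
        ∏ i ∈ Finset.range (m + 1), (u + i * ω) := by
  unfold term coeffB facCoeff
  congr 1
  refine Finset.sum_congr rfl fun r _ => ?_
  rw [hS.coeffA_eq hcond hexp hd hs (r + 1) z hz, Frame.ac_succ]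

lemma W_eventuallyEq (hz : z ∈ P.base) {η : ℂ → S → ℂ} {u : ℂ} {f : ℂ → ℂ}
    (hf : ∀ᶠ w in 𝓝 z, η u (s w) = f w) :
    (fun w => W pr P.n j φ ψc η u (s w)) =ᶠ[𝓝 z]
      fun w => Complex.exp (P.ζ * u * w + P.expo (pull s Ψ) w) * (1 + f w) := by
  filter_upwards [hf, Frame.isOpen_base.mem_nhds hz] with w hw hwb
  unfold W
  rw [hw, hS.pr_eq w hwb, hS.X_eq hcond hexp hd hwb, ← hS.ζ_eq]

omit [T2Space S] hexp hd in
lemma psi_eq {u : ℂ} (hu : σ' < u.re) {k : ℕ} (hk : k < P.n - 1) (hz : z ∈ P.base) :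
    ψ k u (s z) = (if k = 0 then 1 else 0) + lap (fun t => pull s Ψ k (t, z)) u :=
  hcond.laplace k hk u hu _ (hS.mem z hz)

/-- The differential equation in the coordinate of a sheet. -/
lemma ode_iff (hz : z ∈ P.base) {η : ℂ → S → ℂ} {u : ℂ} (hu : σ' < u.re) {f : ℂ → ℂ}
    (hf : ∀ᶠ w in 𝓝 z, η u (s w) = f w) :
    -dXi hpr P.n (W pr P.n j φ ψc η u) (s z) + ∑ k ∈ Finset.range (P.n - 1),
        u ^ (P.n - k) * ψ k u (s z) * dXi hpr k (W pr P.n j φ ψc η u) (s z) = 0 ↔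
    -iteratedDeriv P.n (fun w => Complex.exp (P.ζ * u * w + P.expo (pull s Ψ) w) * (1 + f w)) z +
      ∑ k ∈ Finset.range (P.n - 1), u ^ (P.n - k) *
        ((if k = 0 then 1 else 0) + lap (fun t => pull s Ψ k (t, z)) u) *
        iteratedDeriv k
          (fun w => Complex.exp (P.ζ * u * w + P.expo (pull s Ψ) w) * (1 + f w)) z = 0 := by
  have hW := hS.W_eventuallyEq hcond hexp hd hz hf
  have h1 : ∀ k, dXi hpr k (W pr P.n j φ ψc η u) (s z) = iteratedDeriv k
      (fun w => Complex.exp (P.ζ * u * w + P.expo (pull s Ψ) w) * (1 + f w)) z := fun k => by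
    rw [hS.dXi_eq hpr hz]
    exact Filter.EventuallyEq.iteratedDeriv_eq k hW
  have h2 : ∑ k ∈ Finset.range (P.n - 1),
        u ^ (P.n - k) * ψ k u (s z) * dXi hpr k (W pr P.n j φ ψc η u) (s z) =
      ∑ k ∈ Finset.range (P.n - 1), u ^ (P.n - k) *
        ((if k = 0 then 1 else 0) + lap (fun t => pull s Ψ k (t, z)) u) *
        iteratedDeriv k
          (fun w => Complex.exp (P.ζ * u * w + P.expo (pull s Ψ) w) * (1 + f w)) z :=
    Finset.sum_congr rfl fun k hk => by
      rw [hS.psi_eq hcond hu (Finset.mem_range.1 hk) hz, h1]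
  rw [h1, h2]

/-- For real u > σ' the two solutions agree by `eq_of_decay`; both are analytic in u on a
half-plane, so they agree for all u. The base point is taken in Q because η is only controlled on Γ,
which contains the lift of Q and of its rays. -/
lemma isEta_unique {η₁ η₂ : ℂ → S → ℂ} (h₁ : IsEta hpr P.n j φ σ' ψ ψc Γ η₁)
    (h₂ : IsEta hpr P.n j φ σ' ψ ψc Γ η₂) (hz : z ∈ P.Q) {u : ℂ} (hu : σ' < u.re) :
    η₁ u (s z) = η₂ u (s z) := by
  have hP := hS.valid
  have hc := hcond.c_pos
  have ha := hP.a_pos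
  have hzb := hS.mem_base_of_mem hz
  have hδ : 0 < P.a * (d' - P.d) := mul_pos ha (by linarith)
  set η : Bool → ℂ → S → ℂ := fun b => if b then η₁ else η₂ with hηdef
  have hη : ∀ b, IsEta hpr P.n j φ σ' ψ ψc Γ (η b) := fun b => by
    cases b
    · exact h₂
    · exact h₁
  have han : ∀ b, ∀ w ∈ P.Q, ∀ u : ℂ, σ' < u.re →
      AnalyticAt ℂ (fun p : ℂ × ℂ => η b p.1 (s p.2)) (u, w) := fun b w hw u hu =>
    (hS.analyticAt_iff hpr (hS.mem_base_of_mem hw)).1 ((hη b).analytic u hu _ (hS.mem_Γ w hw))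
  have hreal : ∀ v : ℝ, σ' < v → η₁ v (s z) = η₂ v (s z) := fun v hv => by
    refine hP.eq_of_decay (h := fun b w => η b v (s w))
      (mul_nonneg (by positivity) (by positivity))
      (fun k hk => (hS.potential_pull hcond hd hk).1) hcond.σ'_nonneg hv hzb (fun b t ht => ?_)
      (fun b t ht => ?_) (fun b r hr => ?_)
    · exact Frame.analyticAt_snd_of (han b _ (hP.ray_mem z hz t ht) v (by simpa using hv))
    · have hw := hP.ray_mem z hz t ht
      exact (hS.ode_iff hcond hexp hd (hS.mem_base_of_mem hw) (η := η b) (by simpa using hv)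
        (Eventually.of_forall fun _ => rfl)).1 ((hη b).ode v (by simpa using hv) _ (hS.mem_Γ _ hw))
    · refine ((hη b).limit v (by simpa using hv) _ (hS.mem_Γ z hz) r hr).congr' ?_
      filter_upwards [eventually_ge_atTop 0] with t ht
      rw [hS.ray_eq hpr hzb ht, hS.dXi_eq hpr (hP.ray_mem_base hzb ht)]
  have hanu : ∀ b, AnalyticOnNhd ℂ (fun v => η b v (s z)) {v : ℂ | σ' < v.re} := fun b v hv =>
    Frame.analyticAt_fst_of (han b z hz v hv)
  have hpre : IsPreconnected {v : ℂ | σ' < v.re} := (convex_halfSpace_re_gt σ').isPreconnected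
  have hx : ((σ' + 1 : ℝ) : ℂ) ∈ {v : ℂ | σ' < v.re} := by
    change σ' < (((σ' + 1 : ℝ) : ℂ)).re
    rw [Complex.ofReal_re]
    linarith
  refine (hanu true).eqOn_of_preconnected_of_frequently_eq (hanu false) hpre hx ?_ hu
  -- Agreement at real points that accumulate at σ' + 1 is all that the identity theorem needs.
  have hseq : Tendsto (fun i : ℕ => ((σ' + 1 + 1 / ((i : ℝ) + 1) : ℝ) : ℂ)) atTop
      (𝓝[≠] ((σ' + 1 : ℝ) : ℂ)) := by
    refine tendsto_nhdsWithin_iff.2 ⟨?_, Eventually.of_forall fun i => ?_⟩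
    · have h := (tendsto_one_div_add_atTop_nhds_zero_nat (𝕜 := ℝ)).const_add (σ' + 1)
      rw [add_zero] at h
      exact (Complex.continuous_ofReal.tendsto _).comp h
    · intro h
      have h' : (σ' + 1 + 1 / ((i : ℝ) + 1) : ℝ) = σ' + 1 :=
        Complex.ofReal_injective (Set.mem_singleton_iff.1 h)
      have : (0 : ℝ) < 1 / ((i : ℝ) + 1) := by positivity
      linarith
  refine hseq.frequently (Frequently.of_forall fun i => hreal _ ?_)
  have : (0 : ℝ) < 1 / ((i : ℝ) + 1) := by positivity
  linarith

end Sheet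

variable (hpr : IsLocalHomeomorph pr) {n : ℕ} (hn : 2 ≤ n) {a : ℝ} (ha : 0 < a)
  (ha_eq : (1 + a) ^ n = 1 + 2 * n * a) {d d' c ρ σ' : ℝ} {Δ : Set S} {ψ Ψ : ℕ → ℂ → S → ℂ}
  {ψc : ℕ → ℕ → S → ℂ} (hcond : BorelCondition hpr n a d' c ρ σ' Δ ψ Ψ)
  (hexp : HasExpansion n Δ ψ ψc) (hd : 0 < d) (hdd' : d < d') {ω : ℝ}
  (hω : Real.pi / (2 * a * d) < ω) {j : Fin n} {θ : Fin n → ℝ} (hθ : IsAngleChoice n j θ)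
  {Γ : Set S} (hΓ : IsGamma pr j θ Δ d Γ)
include hn ha ha_eq hcond hexp hd hdd' hω hθ hΓ

/-- Near every point of `Γ` the factorial series converges to the solution on a sheet, with bounds
that do not depend on the point. -/
lemma exists_local_solution {s₀ : ℝ} (hs₀ : σ' < s₀) :
    ∃ δ > 0, ∃ M : ℕ → ℝ, Summable M ∧ ∀ x ∈ Γ, ∃ (Q : Set ℂ) (s : ℂ → S) (K l σ c' M' : ℝ)
      (G : ℂ × ℂ → ℂ), Sheet pr ⟨n, zeta n j 1, a, d, ρ, Q⟩ j (midAngle j θ) Δ Γ s ∧ pr x ∈ Q ∧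
      s (pr x) = x ∧ σ < s₀ ∧
      Frame.Solution ⟨n, zeta n j 1, a, d, ρ, Q⟩ K l σ σ' c' M' (pull s Ψ) G ∧
      ∀ z, Metric.infDist z Q < δ → ∀ u : ℂ, s₀ ≤ u.re →
        (∀ m, ‖term hpr n j (midAngle j θ) ψc ω u (s z) m‖ ≤ M m) ∧
        HasSum (term hpr n j (midAngle j θ) ψc ω u (s z))
          (Frame.eta ⟨n, zeta n j 1, a, d, ρ, Q⟩ (pull s Ψ) G u z) := by
  have hσ' := hcond.σ'_nonneg
  have hc := hcond.c_pos
  have hω0 : 0 < ω := lt_trans (by have := Real.pi_pos; positivity) hω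
  have hr : Real.pi / (2 * ω) < a * d := by
    rw [div_lt_iff₀ (by positivity)] at hω ⊢
    linarith
  obtain ⟨r, hr1, hr2⟩ := exists_between hr
  obtain ⟨σ, hσ1, hσ2⟩ := exists_between hs₀
  set δ := (d - r / a) / 2 with hδ
  have hra : r / a < d := (div_lt_iff₀ ha).2 (by linarith)
  have hδ0 : 0 < δ := by linarith
  have hδd : δ < d := by
    have : 0 < r / a := div_pos (lt_trans (by have := Real.pi_pos; positivity) hr1) ha
    linarith
  have hε : 0 < a * (d' - d) := mul_pos ha (by linarith)
  set c' := c * 2 ^ (1 + ρ) * (1 + Real.exp (σ' * (a * (d' - d))) / (a * (d' - d))) with hc'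
  have hc'0 : 0 ≤ c' := by positivity
  -- K and l, and with them the majorant M, are fixed before the point x; this is the source of
  -- uniformity over Γ.
  obtain ⟨K, l, hK, hl, hsol⟩ := Frame.exists_isSource n ha hc'0 hσ' hσ1
  set M' := 2 * (n * c') with hM'
  set B := Real.exp (c' * ∫ y, wb ρ y) * ((2 / a + 1) / K * M' *
    Frame.wtBound ⟨n, zeta n j 1, a, d, ρ, ∅⟩ K l * Real.exp (σ * (a * δ)) / (a * δ)) with hB
  have hB0 : 0 ≤ B := by
    have := (Frame.wtBound_pos (P := ⟨n, zeta n j 1, a, d, ρ, ∅⟩) (K := K) (l := l)).le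
    positivity
  obtain ⟨M, hM, hfac⟩ := hasSum_factorialSeries hω0 hr1 (hσ'.trans hσ1.le) hσ2 hB0
  refine ⟨δ, hδ0, M, hM, fun x hx => ?_⟩
  obtain ⟨Q, s, hS, hxQ, hsx⟩ := exists_sheet hpr hn ha ha_eq hd hcond.ρ_pos hθ hΓ hx
  set P : Frame := ⟨n, zeta n j 1, a, d, ρ, Q⟩ with hP
  have hpot : ∀ k < P.n - 1, P.Potential c' σ' (pull s Ψ k) ∧
      P.Potential c' σ' (dFst (pull s Ψ k)) := fun k hk => hS.potential_pull hcond hdd' hk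
  obtain ⟨G, hG1, hG2⟩ := hsol P hS.valid rfl rfl (pull s Ψ) (fun k hk => (hpot k hk).1)
    (fun k hk => (hpot k hk).2)
  have hs : P.Solution K l σ σ' c' M' (pull s Ψ) G := ⟨hS.valid, hK, hl, hσ', hσ1, hc'0,
    by positivity, fun k hk => (hpot k hk).1, fun k hk => (hpot k hk).2, hG1, hG2⟩
  refine ⟨Q, s, K, l, σ, c', M', G, hS, hxQ, hsx, hσ2, hs, fun z hz u hu => ?_⟩
  have hzb : z ∈ P.base := lt_trans hz hδd
  have hsmall : ∀ t, width t < r → width t / a + Metric.infDist z Q + δ < d := fun t ht => by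
    have := div_lt_div_of_pos_right ht ha
    linarith
  obtain ⟨h1, h2⟩ := hfac (fun t => P.borelEta (pull s Ψ) G (t, z))
    (fun t ht => Frame.analyticAt_fst_of (hs.analytic_borelEta _ (by
      change width t / a + Metric.infDist z Q < d
      linarith [hsmall t ht])))
    (fun t ht => hs.norm_borelEta_le hδ0 (hsmall t ht)) u hu
  have hterm : term hpr n j (midAngle j θ) ψc ω u (s z) = fun m =>
      facCoeff ω (fun t => P.borelEta (pull s Ψ) G (t, z)) m 0 /
        ∏ i ∈ Finset.range (m + 1), (u + i * ω) :=
    funext fun m => hS.term_eq hcond hexp hdd' hs hzb ω u m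
  rw [hterm, ← hs.lap_borelEta hzb (lt_of_lt_of_le hσ2 hu)]
  exact ⟨h1, h2⟩

/-- The sum of the factorial series has the properties that characterize `η`. -/
lemma isEta_tsum : IsEta hpr n j (midAngle j θ) σ' ψ ψc Γ
    (fun u x => ∑' m, term hpr n j (midAngle j θ) ψc ω u x m) := by
  set η : ℂ → S → ℂ := fun u x => ∑' m, term hpr n j (midAngle j θ) ψc ω u x m with hη
  -- The solution on a sheet depends on x and on the auxiliary s₀ < Re u, but the sum of the series
  -- does not. So η is globally defined, and its properties can be checked on one sheet at a time.
  have hkey : ∀ u : ℂ, σ' < u.re → ∀ x ∈ Γ, ∃ δ > 0, ∃ s₀ < u.re, ∃ (Q : Set ℂ) (s : ℂ → S)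
      (K l σ c' M' : ℝ) (G : ℂ × ℂ → ℂ),
      Sheet pr ⟨n, zeta n j 1, a, d, ρ, Q⟩ j (midAngle j θ) Δ Γ s ∧ pr x ∈ Q ∧
      s (pr x) = x ∧ σ < s₀ ∧
      Frame.Solution ⟨n, zeta n j 1, a, d, ρ, Q⟩ K l σ σ' c' M' (pull s Ψ) G ∧
      ∀ z, Metric.infDist z Q < δ → ∀ v : ℂ, s₀ ≤ v.re →
        η v (s z) = Frame.eta ⟨n, zeta n j 1, a, d, ρ, Q⟩ (pull s Ψ) G v z := by
    intro u hu x hx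
    obtain ⟨s₀, h1, h2⟩ := exists_between hu
    obtain ⟨δ, hδ, M, -, hloc⟩ := exists_local_solution hpr hn ha ha_eq hcond hexp hd hdd' hω hθ hΓ h1
    obtain ⟨Q, s, K, l, σ, c', M', G, hS, hxQ, hsx, hσ, hs, hsum⟩ := hloc x hx
    exact ⟨δ, hδ, s₀, h2, Q, s, K, l, σ, c', M', G, hS, hxQ, hsx, hσ, hs,
      fun z hz v hv => (hsum z hz v hv).2.tsum_eq⟩
  refine ⟨fun u hu x hx => ?_, fun u hu x hx => ?_, fun u hu x hx r _ => ?_⟩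
  all_goals
    obtain ⟨δ, hδ, s₀, hs₀, Q, s, K, l, σ, c', M', G, hS, hxQ, hsx, hσ, hs, hsum⟩ := hkey u hu x hx
    have hopen : IsOpen {z | Metric.infDist z Q < δ} :=
      isOpen_lt (Metric.continuous_infDist_pt _) continuous_const
    have hin : ∀ w ∈ Q, {z | Metric.infDist z Q < δ} ∈ 𝓝 w := fun w hw => hopen.mem_nhds (by
      change Metric.infDist w Q < δ
      rwa [Metric.infDist_zero_of_mem hw])
    have hxb := hS.mem_base_of_mem hxQ
    have hση : σ < u.re := hσ.trans hs₀
  · rw [← hsx, hS.analyticAt_iff hpr hxb]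
    refine (hs.analyticOnNhd_eta (u, pr x) ⟨hση, hxb⟩).congr ?_
    have h1 : {v : ℂ | s₀ < v.re} ∈ 𝓝 u :=
      (isOpen_lt continuous_const Complex.continuous_re).mem_nhds hs₀
    filter_upwards [prod_mem_nhds h1 (hin _ hxQ)] with p hp
    exact (hsum p.2 hp.2 p.1 (le_of_lt hp.1)).symm
  · have hev : ∀ᶠ w in 𝓝 (pr x), η u (s w) =
        Frame.eta ⟨n, zeta n j 1, a, d, ρ, Q⟩ (pull s Ψ) G u w := by
      filter_upwards [hin _ hxQ] with w hw using hsum w hw u hs₀.le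
    have h1 := hS.ode_iff hcond hexp hdd' hxb hu hev
    rw [hsx] at h1
    refine h1.2 ?_
    have h2 := hs.ode_exp_mul_V hση hxb
    have h3 : (fun w => Complex.exp (zeta n j 1 * u * w) *
        Frame.V ⟨n, zeta n j 1, a, d, ρ, Q⟩ G 0 u w) = fun w =>
        Complex.exp (zeta n j 1 * u * w +
          Frame.expo ⟨n, zeta n j 1, a, d, ρ, Q⟩ (pull s Ψ) w) *
        (1 + Frame.eta ⟨n, zeta n j 1, a, d, ρ, Q⟩ (pull s Ψ) G u w) := funext fun w => by
      rw [Complex.exp_add, mul_assoc (Complex.exp _) (Complex.exp _), Frame.one_add_eta]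
    exact h3 ▸ h2
  · refine (hs.tendsto_iteratedDeriv_eta hση r hxb).congr' ?_
    filter_upwards [eventually_ge_atTop 0] with t ht
    have hr := hS.ray_eq hpr hxb ht
    rw [hsx] at hr
    rw [hr, hS.dXi_eq hpr (hS.valid.ray_mem_base hxb ht)]
    refine (Filter.EventuallyEq.iteratedDeriv_eq r ?_).symm
    filter_upwards [hin _ (hS.valid.ray_mem _ hxQ t ht)] with w hw using hsum w hw u hs₀.le

end Assembly

end FactorialSeries
end

/-! ### The main theorem -/

theorem theorem1p2 {S : Type*} [TopologicalSpace S] [T2Space S] {pr : S → ℂ}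
    (hpr : IsLocalHomeomorph pr) (n : ℕ) (hn : 2 ≤ n)
    (a : ℝ) (ha : 0 < a) (ha_eq : (1 + a) ^ n = 1 + 2 * n * a)
    (d d' c ρ σ' : ℝ) (Δ : Set S) (ψ Ψ : ℕ → ℂ → S → ℂ) (ψc : ℕ → ℕ → S → ℂ)
    (hcond : BorelCondition hpr n a d' c ρ σ' Δ ψ Ψ) (hexp : HasExpansion n Δ ψ ψc)
    (hd : 0 < d) (hdd' : d < d') (ω : ℝ) (hω : Real.pi / (2 * a * d) < ω)
    (j : Fin n) (θ : Fin n → ℝ) (hθ : IsAngleChoice n j θ)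
    (Γ : Set S) (hΓ : IsGamma pr j θ Δ d Γ) :
    (∃ η : ℂ → S → ℂ, IsEta hpr n j (midAngle j θ) σ' ψ ψc Γ η) ∧
    ∀ η : ℂ → S → ℂ, IsEta hpr n j (midAngle j θ) σ' ψ ψc Γ η →
      (∀ u : ℂ, σ' < u.re → ∀ x ∈ Γ,
        (Summable fun m => ‖term hpr n j (midAngle j θ) ψc ω u x m‖) ∧
        HasSum (term hpr n j (midAngle j θ) ψc ω u x) (η u x)) ∧
      ∀ σ : ℝ, σ' < σ →
        TendstoUniformlyOn
          (fun (N : ℕ) (p : ℂ × S) =>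
            ∑ m ∈ Finset.range N, ‖term hpr n j (midAngle j θ) ψc ω p.1 p.2 m‖)
          (fun p : ℂ × S => ∑' m, ‖term hpr n j (midAngle j θ) ψc ω p.1 p.2 m‖)
          atTop {p : ℂ × S | σ ≤ p.1.re ∧ p.2 ∈ Γ} := by
  have hu := isEta_tsum hpr hn ha ha_eq hcond hexp hd hdd' hω hθ hΓ
  refine ⟨⟨_, hu⟩, fun η hη => ?_⟩
  -- The sum of the series is itself an admissible η, so uniqueness identifies every other one with
  -- it.
  have heq : ∀ u : ℂ, σ' < u.re → ∀ x ∈ Γ,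
      η u x = ∑' m, term hpr n j (midAngle j θ) ψc ω u x m := fun u hu' x hx => by
    obtain ⟨Q, s, hS, hxQ, hsx⟩ := exists_sheet hpr hn ha ha_eq hd hcond.ρ_pos hθ hΓ hx
    have h := hS.isEta_unique hcond hexp hdd' hη hu hxQ hu'
    rwa [hsx] at h
  have hbound : ∀ σ : ℝ, σ' < σ → ∃ M : ℕ → ℝ, Summable M ∧ ∀ u : ℂ, σ ≤ u.re → ∀ x ∈ Γ, ∀ m,
      ‖term hpr n j (midAngle j θ) ψc ω u x m‖ ≤ M m := fun σ hσ => by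
    obtain ⟨δ, hδ, M, hM, hloc⟩ :=
      exists_local_solution hpr hn ha ha_eq hcond hexp hd hdd' hω hθ hΓ hσ
    refine ⟨M, hM, fun u hu' x hx => ?_⟩
    obtain ⟨Q, s, K, l, τ, c', M', G, hS, hxQ, hsx, -, -, hsum⟩ := hloc x hx
    have h := (hsum (pr x) (by rwa [Metric.infDist_zero_of_mem hxQ]) u hu').1
    rwa [hsx] at h
  refine ⟨fun u hu' x hx => ?_, fun σ hσ => ?_⟩
  · obtain ⟨M, hM, hle⟩ := hbound u.re hu'
    have hsum : Summable fun m => ‖term hpr n j (midAngle j θ) ψc ω u x m‖ :=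
      Summable.of_nonneg_of_le (fun _ => norm_nonneg _) (hle u le_rfl x hx) hM
    exact ⟨hsum, heq u hu' x hx ▸ hsum.of_norm.hasSum⟩
  · obtain ⟨M, hM, hle⟩ := hbound σ hσ
    refine tendstoUniformlyOn_tsum_nat hM fun m p hp => ?_
    rw [norm_norm]
    exact hle p.1 hp.1 p.2 hp.2 m
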